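/- Let $k$ be a perfect field of characteristic $p>0$ and let $A$ be an associative unital $k$-algebra. Write $A^{(1)}$ for the Frobenius twist of $A$ (the same ring, $c\in k$ acting as $c^{1/p}$ acts on $A$) and let $\mathbb Z/p$ act on $A^{\otimes p}$ by cyclic permutation $\sigma$ of the factors. A *quasi-Frobenius map* is a $k$-algebra map $F:A^{(1)}\to A^{\otimes p}$ that is $\mathbb Z/p$-equivariant ($\sigma F(a)=F(a)$) and induces on Tate homology $\check H_i(\mathbb Z/p,-)$, for both parities of $i$, the canonical isomorphism $A^{(1)}\to\check H_i(\mathbb Z/p,A^{\otimes p})$, $a\mapsto[a^{\otimes p}]$; that is, $F(a)-a^{\otimes p}$ lies in the image of $1+\sigma+\dots+\sigma^{p-1}$ and in the image of $1-\sigma$. For $q\ge 1$ let $\Lambda_q$ be the category with objects $[n]$, $n\ge1$, whose morphisms $[n]\to[m]$ are the non-decreasing maps $f:\mathbb Z\to\mathbb Z$ with $f(a+n)=f(a)+m$, modulo $f\sim f+qm$; put $\Lambda=\Lambda_1$, and let $\pi,i:\Lambda_p\to\Lambda$ be the functors $[n]\mapsto[n]$ and $[n]\mapsto[pn]$. For $E\in\operatorname{Fun}(\Lambda_q,k)$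 let $CP_\bullet(E)$ be the product total complex of the periodic cyclic bicomplex with entries $E([n])$, $n\ge1$ (columns indexed by $\mathbb Z$; vertical differentials $b$ in even and $-b'$ in odd columns; horizontal differentials alternately $1-\tau$ and $1+\tau+\dots+\tau^{qn-1}$), and let $HP_\bullet(E)$ be its homology. Let $A_\#\in\operatorname{Fun}(\Lambda,k)$ be $[n]\mapsto A^{\otimes n}$ (a morphism multiplies, in order, the factors in each fibre), $HP_\bullet(A)=HP_\bullet(A_\#)$, and let $HH_\bullet(A)$ be the Hochschild homology of $A$, computed by the Hochschild complex. $HH_\bullet(A)((u))$ denotes Laurent series in $u$ of cohomological degree $2$; its part of degree $n$ consists of the series $\sum_q h_q u^{(q-n)/2}$, $h_q\in HH_q(A)$, over $q\ge0$ with $n-q$ even. A *comparison map* is a chain map $CP_\bullet(i^*E)\to CP_\bullet(E)$, natural in $E\in\operatorname{Fun}(\Lambda,k)$, that commutes with the periodicity $u$ (shift by two columns), preserves the part in negative columns (so that it induces a map on cyclic homology), and induces on cyclic homology of degree $0$ the adjunction map $\operatorname{colim}_{\Lambda_p}i^*E\to\operatorname{colim}_\Lambda E$. **Proposition.** Assume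 that $A$ admits a quasi-Frobenius map $F$ and that the category of $A$-bimodules has finite homological dimension (for some $d$, every $A\otimes A^{op}$-module has projective dimension at most $d$). Then: 1. Comparison maps exist. 2. The maps $F^{\otimes n}:(A^{(1)})^{\otimes n}\to A^{\otimes pn}$ form a morphism $F_\#:\pi^*A^{(1)}_\#\to i^*A_\#$ in $\operatorname{Fun}(\Lambda_p,k)$. 3. There is a canonical isomorphism of graded groups $$\varphi:HH_\bullet(A)((u))\;\cong\;HP_\bullet(A),$$ Frobenius-semilinear, $\varphi(cx)=c^p\varphi(x)$ for $c\in k$ (that is, $k$-linear on $HH_\bullet(A)((u))^{(1)}$), induced by $F$ in the following sense. If $z_q$ are Hochschild cycles of degrees $q\ge 0$, $n-q$ even, then the chain of degree $n$ in $CP_\bullet(i^*A_\#)$ whose entry in row $q+1$ is $F_\#(z_q)$ for $n-q$ even and $0$ for $n-q$ odd is a cycle, and for every comparison map $c$, $\varphi$ sends the class of $\sum_q z_q u^{(q-n)/2}$ to the image under $HP_n(i^*A_\#)\xrightarrow{\,c\,}HP_n(A)$ of the class of this cycle. -/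

import Mathlib

open CategoryTheory TensorProduct

universe u

noncomputable section

namespace CyclicHomology

/-- Non-decreasing maps `f : ℤ → ℤ` with `f (a + n) = f a + m`, that is, the morphisms `[n] ⟶ [m]` of the
category `Λ_∞`. -/
@[ext]
structure PMap (n m : ℕ) where
  toFun : ℤ → ℤ
  mono : Monotone toFun
  shift : ∀ a, toFun (a + n) = toFun a + m

namespace PMap

variable {n m l : ℕ}

theorem shift_mul (f : PMap n m) (a k : ℤ) : f.toFun (a + k * n) = f.toFun a + k * m := by
  induction k using Int.induction_on with
  | zero => simp
  | succ i ih =>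
    have h := f.shift (a + i * n)
    rw [show a + ((i : ℤ) + 1) * n = a + i * n + n by ring, h, ih]; ring
  | pred i ih =>
    have h := f.shift (a + (-(i : ℤ) - 1) * n)
    rw [show a + (-(i : ℤ) - 1) * n + n = a + -(i : ℤ) * n by ring, ih] at h
    linarith

/-- The identity of `[n]`. -/
protected def id (n : ℕ) : PMap n n := ⟨fun a => a, fun _ _ h => h, fun _ => rfl⟩

/-- `f.comp g` is first `f`, then `g`. -/
def comp (f : PMap n m) (g : PMap m l) : PMap n l :=
  ⟨fun a => g.toFun (f.toFun a), fun _ _ h => g.mono (f.mono h), fun a => by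
    rw [f.shift, g.shift]⟩

/-- Two maps are identified in `Λ_p` if they differ by a power of `σ ^ p`, where `σ : [m] ⟶ [m]` is
`a ↦ a + m`. -/
def rel (p : ℕ) (f g : PMap n m) : Prop :=
  ∃ k : ℤ, ∀ a, g.toFun a = f.toFun a + k * (p * m : ℕ)

/-- The equivalence relation `rel`. -/
def setoid (p n m : ℕ) : Setoid (PMap n m) where
  r := rel p
  iseqv :=
    { refl := fun _ => ⟨0, fun _ => by simp⟩
      symm := fun {_ _} ⟨k, hk⟩ => ⟨-k, fun a => by rw [hk a]; ring⟩
      trans := fun {_ _ _} ⟨k, hk⟩ ⟨j, hj⟩ => ⟨k + j, fun a => by rw [hj a, hk a]; ring⟩ }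

theorem rel_comp {p : ℕ} {f f' : PMap n m} {g g' : PMap m l} (hf : rel p f f') (hg : rel p g g') :
    rel p (f.comp g) (f'.comp g') := by
  obtain ⟨k, hk⟩ := hf
  obtain ⟨j, hj⟩ := hg
  refine ⟨k + j, fun a => ?_⟩
  change g'.toFun (f'.toFun a) = g.toFun (f.toFun a) + _
  rw [hj, hk, show f.toFun a + k * ((p * m : ℕ) : ℤ) = f.toFun a + (k * p) * m by push_cast; ring,
    g.shift_mul]
  push_cast
  ring

/-- The rotation `a ↦ a + 1` of `[n]`. -/
def rot (n : ℕ) : PMap n n :=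
  ⟨fun a => a + 1, fun _ _ h => by simpa using h, fun a => by ring⟩

/-- The face map `[n + 1] ⟶ [n]`, `0 ≤ i ≤ n`, which is `a (n + 1) + b ↦ a n + b` for `0 ≤ b ≤ i` and
`a (n + 1) + b ↦ a n + b - 1` for `i < b ≤ n`. -/
def face (n i : ℕ) : PMap (n + 1) n where
  toFun x := x - (x + (n - i)) / (n + 1)
  mono := by
    refine monotone_int_of_le_succ fun x => ?_
    have hn : (0 : ℤ) < n + 1 := by positivity
    have h : (x + 1 + ((n : ℤ) - i)) / (n + 1) ≤ (x + ((n : ℤ) - i)) / (n + 1) + 1 := by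
      rw [← Int.add_mul_ediv_right _ 1 hn.ne']
      exact Int.ediv_le_ediv hn (by linarith)
    linarith
  shift x := by
    have hn : ((n : ℤ) + 1) ≠ 0 := by positivity
    have h : (x + ((n + 1 : ℕ) : ℤ) + ((n : ℤ) - i)) / (n + 1) = (x + ((n : ℤ) - i)) / (n + 1) + 1 := by
      rw [show x + ((n + 1 : ℕ) : ℤ) + ((n : ℤ) - i) = (x + ((n : ℤ) - i)) + 1 * (n + 1) by
        push_cast; ring, Int.add_mul_ediv_right _ _ hn]
    rw [h]; push_cast; ring

theorem face_apply (n i : ℕ) (hi : i ≤ n) (a b : ℤ) (hb : 0 ≤ b) (hb' : b ≤ n) :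
    (face n i).toFun (a * (n + 1) + b) = if b ≤ i then a * n + b else a * n + b - 1 := by
  have hn : ((n : ℤ) + 1) ≠ 0 := by positivity
  have hn' : (0 : ℤ) < (n : ℤ) + 1 := by positivity
  change a * (n + 1) + b - (a * (n + 1) + b + (n - i)) / (n + 1) = _
  rw [show a * (n + 1) + b + ((n : ℤ) - i) = (b + (n - i)) + a * (n + 1) by ring,
    Int.add_mul_ediv_right _ _ hn]
  split_ifs with h
  · rw [Int.ediv_eq_zero_of_lt (by omega) (by omega)]; ring
  · rw [show (b + ((n : ℤ) - i)) / (n + 1) = 1 by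
      rw [Int.ediv_eq_iff_of_pos hn']; constructor <;> linarith [show (i : ℤ) + 1 ≤ b by omega, show (0:ℤ) ≤ i by positivity]]
    ring

/-- Two maps agree if they agree on one period. -/
theorem ext_of_lt (hn : 0 < n) {f g : PMap n m} (h : ∀ b : ℤ, 0 ≤ b → b < n → f.toFun b = g.toFun b) :
    f = g := by
  ext a
  have hn' : (0 : ℤ) < n := by exact_mod_cast hn
  have e : a = a % n + a / n * n := by rw [mul_comm]; exact (Int.emod_add_mul_ediv a n).symm
  rw [e, f.shift_mul, g.shift_mul, h _ (Int.emod_nonneg _ hn'.ne') (Int.emod_lt_of_pos _ hn')]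

theorem face_of_le {n i : ℕ} (hi : i ≤ n) {b : ℤ} (hb : 0 ≤ b) (hb' : b ≤ i) :
    (face n i).toFun b = b := by
  have := face_apply n i hi 0 b hb (by omega)
  simpa [hb'] using this

theorem face_of_gt {n i : ℕ} (hi : i ≤ n) {b : ℤ} (hb : (i : ℤ) < b) (hb' : b ≤ n + 1) :
    (face n i).toFun b = b - 1 := by
  rcases eq_or_lt_of_le hb' with h | h
  · have := face_apply n i hi 1 0 le_rfl (by positivity)
    simp only [one_mul, add_zero, Nat.cast_nonneg, if_true] at this
    rw [h, this]; ring
  · have := face_apply n i hi 0 b (by omega) (by omega)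
    simpa [not_le.mpr hb] using this

theorem face_comp_face {n i j : ℕ} (hij : i < j) (hj : j ≤ n + 1) :
    (face (n + 1) j).comp (face n i) = (face (n + 1) i).comp (face n (j - 1)) := by
  refine ext_of_lt (by omega) fun b hb hb' => ?_
  change (face n i).toFun ((face (n + 1) j).toFun b) = (face n (j - 1)).toFun ((face (n + 1) i).toFun b)
  push_cast at hb'
  have h2 : ((j - 1 : ℕ) : ℤ) = j - 1 := by omega
  by_cases h : b ≤ j
  · rw [face_of_le hj hb h]
    by_cases h' : b ≤ i
    · rw [face_of_le (by omega) hb h', face_of_le (by omega) hb h', face_of_le (by omega) hb (by omega)]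
    · rw [face_of_gt (n := n) (i := i) (by omega) (by omega) (by omega),
        face_of_gt (n := n + 1) (i := i) (by omega) (by omega) (by push_cast; omega),
        face_of_le (n := n) (by omega) (by omega) (by omega)]
  · rw [face_of_gt (n := n + 1) (i := j) hj (by omega) (by push_cast; omega),
      face_of_gt (by omega) (by omega) (by omega),
      face_of_gt (n := n + 1) (i := i) (by omega) (by omega) (by push_cast; omega),
      face_of_gt (by omega) (by omega) (by omega)]

theorem rot_comp_face (n i : ℕ) :
    (rot (n + 1)).comp (face n (i + 1)) = (face n i).comp (rot n) := by
  refine PMap.ext (funext fun x => ?_)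
  change (x + 1) - (x + 1 + (n - (i + 1 : ℕ))) / (n + 1) = x - (x + (n - i)) / (n + 1) + 1
  rw [show x + 1 + ((n : ℤ) - (i + 1 : ℕ)) = x + (n - i) by push_cast; ring]
  ring

theorem rot_comp_face_zero (n : ℕ) : (rot (n + 1)).comp (face n 0) = face n n := by
  refine PMap.ext (funext fun x => ?_)
  have hn : ((n : ℤ) + 1) ≠ 0 := by positivity
  change (x + 1) - (x + 1 + (n - (0 : ℕ))) / (n + 1) = x - (x + (n - n)) / (n + 1)
  rw [show x + 1 + ((n : ℤ) - (0 : ℕ)) = (x + (n - n)) + 1 * (n + 1) by push_cast; ring,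
    Int.add_mul_ediv_right _ _ hn]
  ring

end PMap

/-- The category `Λ_p`. Its objects are `[n]` for `n ≥ 1`. -/
structure Lam (p : ℕ) where
  len : ℕ
  pos : 0 < len

instance {p : ℕ} (X : Lam p) : NeZero X.len := ⟨X.pos.ne'⟩

instance (p : ℕ) : Category.{0} (Lam p) where
  Hom X Y := Quotient (PMap.setoid p X.len Y.len)
  id X := Quotient.mk _ (PMap.id X.len)
  comp f g := Quotient.map₂ PMap.comp (fun _ _ hf _ _ hg => PMap.rel_comp hf hg) f g
  id_comp f := by induction f using Quotient.ind; rfl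
  comp_id f := by induction f using Quotient.ind; rfl
  assoc f g h := by
    induction f using Quotient.ind
    induction g using Quotient.ind
    induction h using Quotient.ind
    rfl

namespace Lam

variable {p : ℕ}

/-- The morphism of `Λ_p` represented by a morphism of `Λ_∞`. -/
def ofMap {X Y : Lam p} (f : PMap X.len Y.len) : X ⟶ Y := Quotient.mk (PMap.setoid p X.len Y.len) f

theorem ofMap_comp {X Y Z : Lam p} (f : PMap X.len Y.len) (g : PMap Y.len Z.len) :
    (ofMap f : X ⟶ Y) ≫ (ofMap g : Y ⟶ Z) = ofMap (f.comp g) := rfl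

/-- The object `[q + 1]`. -/
abbrev ob (p q : ℕ) : Lam p := ⟨q + 1, q.succ_pos⟩

/-- The projection `π : Λ_p ⥤ Λ = Λ_1`, identical on objects and on representatives. -/
def proj (p : ℕ) : Lam p ⥤ Lam 1 where
  obj X := ⟨X.len, X.pos⟩
  map {X Y} f := Quotient.map' (s₁ := PMap.setoid p X.len Y.len) (s₂ := PMap.setoid 1 X.len Y.len) id
    (fun _ _ ⟨k, hk⟩ => ⟨k * p, fun a => (hk a).trans (by push_cast; rw [one_mul, mul_assoc]; rfl)⟩) f
  map_id _ := rfl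
  map_comp f g := by
    induction f using Quotient.ind
    induction g using Quotient.ind
    rfl

/-- A map `f` with `f (a + n) = f a + m`, read as one with `f (a + p n) = f a + p m`. -/
def _root_.CyclicHomology.PMap.dilate (p : ℕ) {n m : ℕ} (f : PMap n m) : PMap (p * n) (p * m) :=
  ⟨f.toFun, f.mono, fun a => by push_cast; exact f.shift_mul a p⟩

/-- The functor `i : Λ_p ⥤ Λ = Λ_1`, `[n] ↦ [p n]`, identical on representatives. -/
def incl (p : ℕ) [NeZero p] : Lam p ⥤ Lam 1 where
  obj X := ⟨p * X.len, Nat.mul_pos (NeZero.pos p) X.pos⟩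
  map {X Y} f := Quotient.map' (s₁ := PMap.setoid p X.len Y.len)
    (s₂ := PMap.setoid 1 (p * X.len) (p * Y.len)) (PMap.dilate p)
    (fun _ _ ⟨k, hk⟩ => ⟨k, fun a => (hk a).trans (by push_cast; rw [one_mul]; rfl)⟩) f
  map_id _ := rfl
  map_comp f g := by
    induction f using Quotient.ind
    induction g using Quotient.ind
    rfl

end Lam

end CyclicHomology

namespace CyclicHomology

variable {k : Type u} [Field k] {p : ℕ} (E : Lam p ⥤ ModuleCat.{u} k)

/-- The face operators `m_i : E([q + 2]) → E([q + 1])`, `0 ≤ i ≤ q + 1`. -/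
def faceOp (q i : ℕ) : E.obj (Lam.ob p (q + 1)) →ₗ[k] E.obj (Lam.ob p q) :=
  (E.map (X := Lam.ob p (q + 1)) (Y := Lam.ob p q) (Lam.ofMap (PMap.face (q + 1) i))).hom

/-- The signed rotation `τ` on `E([q + 1])`. -/
def rotOp (q : ℕ) : Module.End k (E.obj (Lam.ob p q)) :=
  (-1 : k) ^ q • (E.map (X := Lam.ob p q) (Y := Lam.ob p q) (Lam.ofMap (PMap.rot (q + 1)))).hom

/-- The norm operator `id + τ + ⋯ + τ ^ (p (q + 1) - 1)` on `E([q + 1])`. -/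
def normOp (q : ℕ) : Module.End k (E.obj (Lam.ob p q)) :=
  ∑ j ∈ Finset.range (p * (q + 1)), rotOp E q ^ j

/-- The differential `b = ∑ (-1) ^ i m_i`, `0 ≤ i ≤ q + 1`. -/
def bOp (q : ℕ) : E.obj (Lam.ob p (q + 1)) →ₗ[k] E.obj (Lam.ob p q) :=
  ∑ i ∈ Finset.range (q + 2), (-1 : k) ^ i • faceOp E q i

/-- The differential `b' = ∑ (-1) ^ i m_i`, `0 ≤ i ≤ q`. -/
def bOp' (q : ℕ) : E.obj (Lam.ob p (q + 1)) →ₗ[k] E.obj (Lam.ob p q) :=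
  ∑ i ∈ Finset.range (q + 1), (-1 : k) ^ i • faceOp E q i

theorem faceOp_faceOp (q : ℕ) {i j : ℕ} (hij : i < j) (hj : j ≤ q + 2) :
    faceOp E q i ∘ₗ faceOp E (q + 1) j = faceOp E q (j - 1) ∘ₗ faceOp E (q + 1) i := by
  unfold faceOp
  rw [← ModuleCat.hom_comp, ← ModuleCat.hom_comp, ← E.map_comp, ← E.map_comp]
  have := PMap.face_comp_face (n := q + 1) hij hj
  congr 2
  exact congrArg (Quotient.mk _) this

theorem faceOp_succ_rotOp (q i : ℕ) :
    faceOp E q (i + 1) ∘ₗ rotOp E (q + 1) = -(rotOp E q ∘ₗ faceOp E q i) := by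
  have : (E.map (X := Lam.ob p (q + 1)) (Y := Lam.ob p (q + 1)) (Lam.ofMap (PMap.rot (q + 2)))) ≫
      (E.map (X := Lam.ob p (q + 1)) (Y := Lam.ob p q) (Lam.ofMap (PMap.face (q + 1) (i + 1)))) =
      (E.map (X := Lam.ob p (q + 1)) (Y := Lam.ob p q) (Lam.ofMap (PMap.face (q + 1) i))) ≫
      (E.map (X := Lam.ob p q) (Y := Lam.ob p q) (Lam.ofMap (PMap.rot (q + 1)))) := by
    rw [← E.map_comp, ← E.map_comp]
    exact congrArg _ (congrArg (Quotient.mk _) (PMap.rot_comp_face (q + 1) i))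
  have h2 := congrArg ModuleCat.Hom.hom this
  rw [ModuleCat.hom_comp, ModuleCat.hom_comp] at h2
  unfold faceOp rotOp
  rw [LinearMap.comp_smul, LinearMap.smul_comp]
  erw [h2]
  rw [pow_succ]
  simp

theorem faceOp_zero_rotOp (q : ℕ) :
    faceOp E q 0 ∘ₗ rotOp E (q + 1) = (-1 : k) ^ (q + 1) • faceOp E q (q + 1) := by
  have : (E.map (X := Lam.ob p (q + 1)) (Y := Lam.ob p (q + 1)) (Lam.ofMap (PMap.rot (q + 2)))) ≫
      (E.map (X := Lam.ob p (q + 1)) (Y := Lam.ob p q) (Lam.ofMap (PMap.face (q + 1) 0))) =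
      (E.map (X := Lam.ob p (q + 1)) (Y := Lam.ob p q) (Lam.ofMap (PMap.face (q + 1) (q + 1)))) := by
    rw [← E.map_comp]
    exact congrArg _ (congrArg (Quotient.mk _) (PMap.rot_comp_face_zero (q + 1)))
  have h2 := congrArg ModuleCat.Hom.hom this
  rw [ModuleCat.hom_comp] at h2
  unfold faceOp rotOp
  rw [LinearMap.comp_smul]
  erw [h2]

theorem rotOp_pow (q j : ℕ) : ∃ g : PMap (q + 1) (q + 1), (∀ a, g.toFun a = a + j) ∧
    rotOp E q ^ j = ((-1 : k) ^ q) ^ j •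
      (E.map (X := Lam.ob p q) (Y := Lam.ob p q) (Lam.ofMap g)).hom := by
  induction j with
  | zero =>
    refine ⟨PMap.id _, fun a => by simp [PMap.id], ?_⟩
    have : E.map (X := Lam.ob p q) (Y := Lam.ob p q) (Lam.ofMap (PMap.id (q + 1))) = 𝟙 _ :=
      E.map_id (Lam.ob p q)
    rw [this]
    simp
    rfl
  | succ j ih =>
    obtain ⟨g, hg, h⟩ := ih
    refine ⟨(PMap.rot (q + 1)).comp g, fun a => ?_, ?_⟩
    · change g.toFun (a + 1) = _
      rw [hg]; push_cast; ring
    · have e := E.map_comp (X := Lam.ob p q) (Y := Lam.ob p q) (Z := Lam.ob p q)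
        (Lam.ofMap (PMap.rot (q + 1))) (Lam.ofMap g)
      rw [Lam.ofMap_comp] at e
      rw [e]
      rw [pow_succ, h, ModuleCat.hom_comp, pow_succ]
      unfold rotOp
      rw [smul_mul_smul_comm]
      rfl

theorem rotOp_pow_card (q : ℕ) : rotOp E q ^ (p * (q + 1)) = 1 := by
  obtain ⟨g, hg, h⟩ := rotOp_pow E q (p * (q + 1))
  have e : (Lam.ofMap g : Lam.ob p q ⟶ Lam.ob p q) = 𝟙 _ :=
    Quotient.sound (s := PMap.setoid p (q + 1) (q + 1)) ⟨-1, fun a => by rw [hg]; simp [PMap.id]⟩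
  rw [h, e, E.map_id]
  have : (((-1 : k) ^ q) ^ (p * (q + 1))) = 1 := by
    rw [← pow_mul, show q * (p * (q + 1)) = (q * (q + 1)) * p by ring, pow_mul,
      (Nat.even_mul_succ_self q).neg_one_pow, one_pow]
  rw [this, one_smul]
  rfl

theorem sum_linComp {ι V₂ V₁ V₀ : Type*} [AddCommGroup V₂] [AddCommGroup V₁] [AddCommGroup V₀]
    [Module k V₂] [Module k V₁] [Module k V₀] (s : Finset ι) (g : ι → V₁ →ₗ[k] V₀)
    (f : V₂ →ₗ[k] V₁) : (∑ i ∈ s, g i) ∘ₗ f = ∑ i ∈ s, g i ∘ₗ f := by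
  ext x
  simp [LinearMap.sum_apply]

theorem linComp_sum {ι V₂ V₁ V₀ : Type*} [AddCommGroup V₂] [AddCommGroup V₁] [AddCommGroup V₀]
    [Module k V₂] [Module k V₁] [Module k V₀] (s : Finset ι) (f : ι → V₂ →ₗ[k] V₁)
    (g : V₁ →ₗ[k] V₀) : g ∘ₗ (∑ i ∈ s, f i) = ∑ i ∈ s, g ∘ₗ f i := by
  ext x
  simp [LinearMap.sum_apply]

/-- The alternating sum argument for `b ∘ b = 0` and `b' ∘ b' = 0`. -/
theorem alternating_comp {V₂ V₁ V₀ : Type*} [AddCommGroup V₂] [AddCommGroup V₁] [AddCommGroup V₀]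
    [Module k V₂] [Module k V₁] [Module k V₀] (f : ℕ → V₂ →ₗ[k] V₁) (g : ℕ → V₁ →ₗ[k] V₀) (n : ℕ)
    (h : ∀ i j, i < j → j ≤ n → g i ∘ₗ f j = g (j - 1) ∘ₗ f i) :
    (∑ i ∈ Finset.range n, (-1 : k) ^ i • g i) ∘ₗ
      (∑ j ∈ Finset.range (n + 1), (-1 : k) ^ j • f j) = 0 := by
  have key : (∑ i ∈ Finset.range n, (-1 : k) ^ i • g i) ∘ₗ
      (∑ j ∈ Finset.range (n + 1), (-1 : k) ^ j • f j) =
      ∑ s ∈ Finset.range n ×ˢ Finset.range (n + 1), (-1 : k) ^ (s.1 + s.2) • (g s.1 ∘ₗ f s.2) := by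
    rw [Finset.sum_product]
    ext x
    simp [LinearMap.sum_apply, map_sum, Finset.smul_sum, smul_smul, pow_add]
  rw [key]
  refine Finset.sum_involution
    (fun (s : ℕ × ℕ) _ => if s.1 < s.2 then (s.2 - 1, s.1) else (s.2, s.1 + 1)) ?_ ?_ ?_ ?_
  · rintro ⟨i, j⟩ hs
    simp only [Finset.mem_product, Finset.mem_range] at hs
    by_cases hij : i < j
    · obtain ⟨j, rfl⟩ : ∃ l, j = l + 1 := ⟨j - 1, by omega⟩
      simp only [hij, if_true]
      rw [h i (j + 1) hij (by omega), Nat.add_sub_cancel, ← add_smul]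
      rw [show i + (j + 1) = (j + i) + 1 by ring, pow_succ]
      simp
    · simp only [hij, if_false]
      rw [h j (i + 1) (by omega) (by omega), Nat.add_sub_cancel, ← add_smul]
      rw [show j + (i + 1) = (i + j) + 1 by ring, pow_succ]
      simp
  · rintro ⟨i, j⟩ hs - e
    by_cases hij : i < j
    · simp only [hij, if_true, Prod.mk.injEq] at e
      omega
    · simp only [hij, if_false, Prod.mk.injEq] at e
      omega
  · rintro ⟨i, j⟩ hs
    simp only [Finset.mem_product, Finset.mem_range] at hs ⊢
    split_ifs <;> constructor <;> dsimp only <;> omega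
  · rintro ⟨i, j⟩ hs
    by_cases hij : i < j
    · simp only [hij, if_true]
      rw [if_neg (by omega)]
      ext <;> dsimp only; omega
    · simp only [hij, if_false]
      rw [if_pos (by omega)]
      ext <;> dsimp only; omega

theorem bOp_bOp (q : ℕ) : bOp E q ∘ₗ bOp E (q + 1) = 0 :=
  alternating_comp (faceOp E (q + 1)) (faceOp E q) (q + 2)
    fun _ _ hij hj => faceOp_faceOp E q hij hj

theorem bOp'_bOp' (q : ℕ) : bOp' E q ∘ₗ bOp' E (q + 1) = 0 :=
  alternating_comp (faceOp E (q + 1)) (faceOp E q) (q + 1)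
    fun _ _ hij hj => faceOp_faceOp E q hij (by omega)

theorem bOp_eq (q : ℕ) : bOp E q = bOp' E q + (-1 : k) ^ (q + 1) • faceOp E q (q + 1) :=
  Finset.sum_range_succ _ _

theorem bOp_one_sub (q : ℕ) :
    bOp E q ∘ₗ (1 - rotOp E (q + 1)) = (1 - rotOp E q) ∘ₗ bOp' E q := by
  have h : bOp E q ∘ₗ rotOp E (q + 1) =
      rotOp E q ∘ₗ bOp' E q + (-1 : k) ^ (q + 1) • faceOp E q (q + 1) := by
    unfold bOp bOp'
    rw [Finset.sum_range_succ', LinearMap.add_comp, LinearMap.smul_comp, faceOp_zero_rotOp,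
      pow_zero, one_smul]
    congr 1
    rw [sum_linComp, linComp_sum]
    refine Finset.sum_congr rfl fun i _ => ?_
    rw [LinearMap.smul_comp, faceOp_succ_rotOp, LinearMap.comp_smul, pow_succ]
    simp
  rw [LinearMap.comp_sub, LinearMap.sub_comp, h, bOp_eq]
  change bOp' E q + _ - _ = bOp' E q - _
  abel

theorem faceOp_rotOp_pow (q i : ℕ) :
    ((-1 : k) ^ i • faceOp E q i) ∘ₗ (rotOp E (q + 1) ^ i) = (rotOp E q ^ i) ∘ₗ faceOp E q 0 := by
  induction i with
  | zero => simp [Module.End.one_eq_id]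
  | succ i ih =>
    have : ((-1 : k) ^ (i + 1) • faceOp E q (i + 1)) ∘ₗ (rotOp E (q + 1)) =
        rotOp E q ∘ₗ ((-1 : k) ^ i • faceOp E q i) := by
      rw [LinearMap.smul_comp, faceOp_succ_rotOp, LinearMap.comp_smul, pow_succ]
      simp
    rw [pow_succ' (rotOp E (q + 1)), Module.End.mul_eq_comp, ← LinearMap.comp_assoc, this,
      LinearMap.comp_assoc, ih, pow_succ' (rotOp E q), Module.End.mul_eq_comp, LinearMap.comp_assoc]

theorem faceOp_zero_period (q l : ℕ) :
    faceOp E q 0 ∘ₗ (rotOp E (q + 1) ^ ((q + 2) * l)) =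
      (rotOp E q ^ ((q + 1) * l)) ∘ₗ faceOp E q 0 := by
  induction l with
  | zero => simp [Module.End.one_eq_id]
  | succ l ih =>
    have h : faceOp E q 0 ∘ₗ (rotOp E (q + 1) ^ (q + 2)) =
        (rotOp E q ^ (q + 1)) ∘ₗ faceOp E q 0 := by
      rw [pow_succ', Module.End.mul_eq_comp, ← LinearMap.comp_assoc, faceOp_zero_rotOp,
        faceOp_rotOp_pow]
    rw [mul_add, mul_one, pow_add, Module.End.mul_eq_comp, ← LinearMap.comp_assoc, ih,
      LinearMap.comp_assoc, h, mul_add, mul_one, pow_add _ ((q + 1) * l), Module.End.mul_eq_comp,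
      LinearMap.comp_assoc]

theorem sum_range_mul_pow {R : Type*} [Semiring R] (t : R) (a c : ℕ) :
    ∑ j ∈ Finset.range (a * c), t ^ j =
      (∑ l ∈ Finset.range a, t ^ (c * l)) * ∑ i ∈ Finset.range c, t ^ i := by
  induction a with
  | zero => simp
  | succ a ih =>
    rw [add_mul, one_mul, Finset.sum_range_add, ih, Finset.sum_range_succ, add_mul,
      Finset.mul_sum (f := fun i => t ^ i) (a := t ^ (c * a))]
    congr 1
    exact Finset.sum_congr rfl fun i _ => by rw [← pow_add, mul_comm]

theorem rotOp_mul_normOp (q : ℕ) : rotOp E q * normOp E q = normOp E q := by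
  have h : normOp E q * (rotOp E q - 1) = 0 := by
    unfold normOp
    rw [geom_sum_mul, rotOp_pow_card, sub_self]
  have h2 : Commute (normOp E q) (rotOp E q) :=
    Commute.sum_left _ _ _ fun _ _ => Commute.pow_left (Commute.refl _) _
  rw [mul_sub, mul_one, sub_eq_zero, h2.eq] at h
  exact h

theorem normOp_mul_rotOp (q : ℕ) : normOp E q * rotOp E q = normOp E q := by
  have h : normOp E q * (rotOp E q - 1) = 0 := by
    unfold normOp
    rw [geom_sum_mul, rotOp_pow_card, sub_self]
  rwa [mul_sub, mul_one, sub_eq_zero] at h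

theorem rotOp_pow_mul_normOp (q i : ℕ) : rotOp E q ^ i * normOp E q = normOp E q := by
  induction i with
  | zero => simp
  | succ i ih => rw [pow_succ, mul_assoc, rotOp_mul_normOp, ih]

theorem normOp_mul_rotOp_pow (q i : ℕ) : normOp E q * rotOp E q ^ i = normOp E q := by
  induction i with
  | zero => simp
  | succ i ih => rw [pow_succ', ← mul_assoc, normOp_mul_rotOp, ih]

theorem bOp'_normOp [NeZero p] (q : ℕ) :
    bOp' E q ∘ₗ normOp E (q + 1) = normOp E q ∘ₗ bOp E q := by
  set S : Module.End k (E.obj (Lam.ob p (q + 1))) :=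
    ∑ i ∈ Finset.range (q + 2), rotOp E (q + 1) ^ i with hS
  have h1 : bOp' E q ∘ₗ normOp E (q + 1) =
      (∑ i ∈ Finset.range (q + 1), rotOp E q ^ i) ∘ₗ (faceOp E q 0 ∘ₗ normOp E (q + 1)) := by
    unfold bOp'
    rw [sum_linComp, sum_linComp]
    refine Finset.sum_congr rfl fun i _ => ?_
    conv_lhs => rw [← rotOp_pow_mul_normOp E (q + 1) i]
    rw [Module.End.mul_eq_comp, ← LinearMap.comp_assoc, faceOp_rotOp_pow, LinearMap.comp_assoc]
  have h2 : faceOp E q 0 ∘ₗ normOp E (q + 1) =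
      (∑ l ∈ Finset.range p, rotOp E q ^ ((q + 1) * l)) ∘ₗ (faceOp E q 0 ∘ₗ S) := by
    have hN : normOp E (q + 1) = (∑ l ∈ Finset.range p, rotOp E (q + 1) ^ ((q + 2) * l)) * S :=
      sum_range_mul_pow _ _ _
    rw [hN, Module.End.mul_eq_comp, ← LinearMap.comp_assoc, ← LinearMap.comp_assoc]
    congr 1
    rw [linComp_sum, sum_linComp]
    exact Finset.sum_congr rfl fun l _ => faceOp_zero_period E q l
  have h3 : bOp' E q ∘ₗ normOp E (q + 1) = normOp E q ∘ₗ (faceOp E q 0 ∘ₗ S) := by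
    rw [h1, h2, ← LinearMap.comp_assoc]
    congr 1
    have h2 : Commute (∑ i ∈ Finset.range (q + 1), rotOp E q ^ i)
        (∑ l ∈ Finset.range p, rotOp E q ^ ((q + 1) * l)) :=
      Commute.sum_left _ _ _ fun _ _ => Commute.sum_right _ _ _ fun _ _ =>
        (Commute.refl _).pow_pow _ _
    rw [← Module.End.mul_eq_comp, h2.eq]
    exact (sum_range_mul_pow _ _ _).symm
  have h4 : (normOp E q ∘ₗ bOp E q) ∘ₗ rotOp E (q + 1) ^ (q + 1) =
      normOp E q ∘ₗ (faceOp E q 0 ∘ₗ S) := by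
    have : ∀ i ∈ Finset.range (q + 2), (normOp E q ∘ₗ ((-1 : k) ^ i • faceOp E q i)) ∘ₗ
        rotOp E (q + 1) ^ (q + 1) =
        (normOp E q ∘ₗ faceOp E q 0) ∘ₗ rotOp E (q + 1) ^ (q + 2 - 1 - i) := by
      intro i hi
      rw [Finset.mem_range] at hi
      have e : rotOp E (q + 1) ^ (q + 1) =
          (rotOp E (q + 1) ^ i) ∘ₗ (rotOp E (q + 1) ^ (q + 2 - 1 - i)) := by
        rw [← Module.End.mul_eq_comp, ← pow_add, show i + (q + 2 - 1 - i) = q + 1 by omega]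
      rw [e, ← LinearMap.comp_assoc, LinearMap.comp_assoc _ _ (normOp E q), faceOp_rotOp_pow,
        ← LinearMap.comp_assoc _ _ (normOp E q), ← Module.End.mul_eq_comp (normOp E q),
        normOp_mul_rotOp_pow]
    unfold bOp
    rw [linComp_sum]
    rw [sum_linComp, Finset.sum_congr rfl this, hS, ← LinearMap.comp_assoc]
    rw [linComp_sum]
    exact Finset.sum_range_reflect
      (fun i => (normOp E q ∘ₗ faceOp E q 0) ∘ₗ (rotOp E (q + 1) ^ i)) (q + 2)
  have h5 : (bOp' E q ∘ₗ normOp E (q + 1)) ∘ₗ rotOp E (q + 1) ^ (q + 1) =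
      bOp' E q ∘ₗ normOp E (q + 1) := by
    rw [LinearMap.comp_assoc, ← Module.End.mul_eq_comp (normOp E (q + 1)), normOp_mul_rotOp_pow]
  have h6 := h5.trans (h3.trans h4.symm)
  have h7 : Function.Surjective (rotOp E (q + 1) ^ (q + 1)) := by
    intro x
    refine ⟨(rotOp E (q + 1) ^ (p * (q + 2) - (q + 1))) x, ?_⟩
    rw [← Module.End.mul_apply, ← pow_add]
    have hp := NeZero.pos p
    rw [Nat.add_sub_cancel' (by nlinarith), rotOp_pow_card]
    rfl
  exact LinearMap.ext fun x => by
    obtain ⟨y, rfl⟩ := h7 x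
    exact LinearMap.congr_fun h6 y

theorem one_sub_normOp (q : ℕ) : (1 - rotOp E q) ∘ₗ normOp E q = 0 := by
  rw [← Module.End.mul_eq_comp, sub_mul, one_mul, rotOp_mul_normOp, sub_self]

theorem normOp_one_sub (q : ℕ) : normOp E q ∘ₗ (1 - rotOp E q) = 0 := by
  rw [← Module.End.mul_eq_comp, mul_sub, mul_one, normOp_mul_rotOp, sub_self]

end CyclicHomology

namespace CyclicHomology

variable {k : Type u} [Field k] {p : ℕ}

section Complexes

variable (E : Lam p ⥤ ModuleCat.{u} k)

/-- The standard complex `C(E)`: `E([q + 1])` in degree `q`, with differential `b`. -/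
def stdComplex : ChainComplex (ModuleCat.{u} k) ℕ :=
  ChainComplex.of (fun q => E.obj (Lam.ob p q)) (fun q => ModuleCat.ofHom (bOp E q)) fun q => by
    rw [← ModuleCat.ofHom_comp, bOp_bOp]; rfl

/-- The differential from degree `n + 1` to degree `n` of the periodic complex. In degree `n` the entry in
row `q` (that is, `E([q + 1])`) lies in column `n - q`. The vertical differential is `b` in the even columns
and `-b'` in the odd ones; the horizontal differential is `id - τ` into the even columns and the norm
`id + τ + ⋯ + τ ^ (p (q + 1) - 1)` into the odd ones. -/
def perD (n : ℤ) : (∀ q : ℕ, E.obj (Lam.ob p q)) →ₗ[k] (∀ q : ℕ, E.obj (Lam.ob p q)) :=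
  LinearMap.pi fun q =>
    if Even (n - q) then
      bOp E q ∘ₗ LinearMap.proj (q + 1) + (1 - rotOp E q) ∘ₗ LinearMap.proj q
    else
      normOp E q ∘ₗ LinearMap.proj q - bOp' E q ∘ₗ LinearMap.proj (q + 1)

theorem perD_apply_even {n : ℤ} {q : ℕ} (h : Even (n - q)) (x : ∀ q : ℕ, E.obj (Lam.ob p q)) :
    perD E n x q = bOp E q (x (q + 1)) + (x q - rotOp E q (x q)) := by
  simp [perD, h]

theorem perD_apply_odd {n : ℤ} {q : ℕ} (h : ¬ Even (n - q)) (x : ∀ q : ℕ, E.obj (Lam.ob p q)) :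
    perD E n x q = normOp E q (x q) - bOp' E q (x (q + 1)) := by
  simp [perD, h]

theorem perD_perD [NeZero p] (n : ℤ) : perD E n ∘ₗ perD E (n + 1) = 0 := by
  refine LinearMap.ext fun x => funext fun q => ?_
  rw [LinearMap.comp_apply]
  have e : n + 1 - ((q + 1 : ℕ) : ℤ) = n - q := by push_cast; ring
  have e' : n + 1 - (q : ℤ) = (n - q) + 1 := by ring
  have hbb := LinearMap.congr_fun (bOp_bOp E q) (x (q + 1 + 1))
  have hbb' := LinearMap.congr_fun (bOp'_bOp' E q) (x (q + 1 + 1))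
  have hb1 := LinearMap.congr_fun (bOp_one_sub E q) (x (q + 1))
  have hbN := LinearMap.congr_fun (bOp'_normOp E q) (x (q + 1))
  have h1N := LinearMap.congr_fun (one_sub_normOp E q) (x q)
  have hN1 := LinearMap.congr_fun (normOp_one_sub E q) (x q)
  simp only [LinearMap.comp_apply, LinearMap.zero_apply, LinearMap.sub_apply,
    Module.End.one_apply, map_sub] at hbb hbb' hb1 hbN h1N hN1
  by_cases h : Even (n - q)
  · have h' : ¬ Even (n + 1 - (q : ℤ)) := by rw [e', Int.even_add_one]; exact not_not.mpr h
    rw [perD_apply_even E h, perD_apply_even E (q := q + 1) (by rw [e]; exact h), perD_apply_odd E h']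
    simp only [map_add, map_sub]
    rw [hbb, zero_add, hb1, sub_sub_sub_comm, h1N]
    simp
  · have h' : Even (n + 1 - (q : ℤ)) := by rw [e', Int.even_add_one]; exact h
    rw [perD_apply_odd E h, perD_apply_odd E (q := q + 1) (by rw [e]; exact h), perD_apply_even E h']
    simp only [map_add, map_sub]
    rw [hbb', hbN, hN1]
    simp

/-- The periodic cyclic complex of a `p`-cyclic vector space `E`: the product total complex of the bicomplex with
rows `E([q + 1])`, `q ≥ 0`, and columns indexed by all integers. -/
def perComplex [NeZero p] : ChainComplex (ModuleCat.{u} k) ℤ :=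
  ChainComplex.of (fun _ => ModuleCat.of k (∀ q : ℕ, E.obj (Lam.ob p q)))
    (fun n => ModuleCat.ofHom (perD E n)) fun n => by
      rw [← ModuleCat.ofHom_comp, perD_perD]; rfl

theorem perComplex_d [NeZero p] (n : ℤ) :
    (perComplex E).d (n + 1) n = ModuleCat.ofHom (perD E n) := by
  simp [perComplex]

variable {E} {E' : Lam p ⥤ ModuleCat.{u} k}

theorem faceOp_naturality (α : E ⟶ E') (q i : ℕ) :
    faceOp E' q i ∘ₗ (α.app (Lam.ob p (q + 1))).hom = (α.app (Lam.ob p q)).hom ∘ₗ faceOp E q i :=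
  congrArg ModuleCat.Hom.hom (α.naturality (X := Lam.ob p (q + 1)) (Y := Lam.ob p q)
    (Lam.ofMap (PMap.face (q + 1) i))).symm

theorem rotOp_naturality (α : E ⟶ E') (q : ℕ) :
    rotOp E' q ∘ₗ (α.app (Lam.ob p q)).hom = (α.app (Lam.ob p q)).hom ∘ₗ rotOp E q := by
  have := congrArg ModuleCat.Hom.hom (α.naturality (X := Lam.ob p q) (Y := Lam.ob p q)
    (Lam.ofMap (PMap.rot (q + 1)))).symm
  rw [ModuleCat.hom_comp, ModuleCat.hom_comp] at this
  unfold rotOp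
  rw [LinearMap.smul_comp, LinearMap.comp_smul, this]

theorem rotOp_pow_naturality (α : E ⟶ E') (q j : ℕ) :
    (rotOp E' q ^ j) ∘ₗ (α.app (Lam.ob p q)).hom = (α.app (Lam.ob p q)).hom ∘ₗ (rotOp E q ^ j) := by
  induction j with
  | zero => rfl
  | succ j ih =>
    rw [pow_succ, pow_succ, Module.End.mul_eq_comp, Module.End.mul_eq_comp, LinearMap.comp_assoc,
      rotOp_naturality, ← LinearMap.comp_assoc, ih, LinearMap.comp_assoc]

theorem normOp_naturality (α : E ⟶ E') (q : ℕ) :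
    normOp E' q ∘ₗ (α.app (Lam.ob p q)).hom = (α.app (Lam.ob p q)).hom ∘ₗ normOp E q := by
  unfold normOp
  rw [sum_linComp, linComp_sum]
  exact Finset.sum_congr rfl fun j _ => rotOp_pow_naturality α q j

theorem bOp_naturality (α : E ⟶ E') (q : ℕ) :
    bOp E' q ∘ₗ (α.app (Lam.ob p (q + 1))).hom = (α.app (Lam.ob p q)).hom ∘ₗ bOp E q := by
  unfold bOp
  rw [sum_linComp, linComp_sum]
  refine Finset.sum_congr rfl fun j _ => ?_
  rw [LinearMap.smul_comp, LinearMap.comp_smul, faceOp_naturality]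

theorem bOp'_naturality (α : E ⟶ E') (q : ℕ) :
    bOp' E' q ∘ₗ (α.app (Lam.ob p (q + 1))).hom = (α.app (Lam.ob p q)).hom ∘ₗ bOp' E q := by
  unfold bOp'
  rw [sum_linComp, linComp_sum]
  refine Finset.sum_congr rfl fun j _ => ?_
  rw [LinearMap.smul_comp, LinearMap.comp_smul, faceOp_naturality]

/-- The map on products induced by a morphism of `p`-cyclic vector spaces. -/
def perMap (α : E ⟶ E') : (∀ q : ℕ, E.obj (Lam.ob p q)) →ₗ[k] (∀ q : ℕ, E'.obj (Lam.ob p q)) :=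
  LinearMap.pi fun q => (α.app (Lam.ob p q)).hom ∘ₗ LinearMap.proj q

theorem perD_perMap (α : E ⟶ E') (n : ℤ) :
    perD E' n ∘ₗ perMap α = perMap α ∘ₗ perD E n := by
  refine LinearMap.ext fun x => funext fun q => ?_
  have hb := LinearMap.congr_fun (bOp_naturality α q) (x (q + 1))
  have hb' := LinearMap.congr_fun (bOp'_naturality α q) (x (q + 1))
  have hr := LinearMap.congr_fun (rotOp_naturality α q) (x q)
  have hn := LinearMap.congr_fun (normOp_naturality α q) (x q)
  simp only [LinearMap.comp_apply] at hb hb' hr hn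
  change perD E' n (perMap α x) q = (α.app (Lam.ob p q)).hom (perD E n x q)
  by_cases h : Even (n - q)
  · rw [perD_apply_even E h, perD_apply_even E' h]
    simp only [map_add, map_sub]
    rw [← hb, ← hr]
    rfl
  · rw [perD_apply_odd E h, perD_apply_odd E' h]
    simp only [map_sub]
    rw [← hb', ← hn]
    rfl

variable (k p)

/-- The periodic cyclic complex as a functor of the `p`-cyclic vector space. -/
def perFunctor [NeZero p] : (Lam p ⥤ ModuleCat.{u} k) ⥤ ChainComplex (ModuleCat.{u} k) ℤ where
  obj E := perComplex E
  map {E E'} α := ChainComplex.ofHom (X := perComplex E) (Y := perComplex E')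
    (fun _ => ModuleCat.ofHom (perMap α)) fun n => by
      rw [perComplex_d, perComplex_d]
      exact congrArg ModuleCat.ofHom (perD_perMap α n)
  map_id _ := rfl
  map_comp _ _ := rfl

end Complexes

/-- The component in degree `n` of a natural transformation between periodic complexes, as a linear map. -/
def perComponent [NeZero p] {k : Type u} [Field k]
    (c : (Functor.whiskeringLeft (Lam p) (Lam 1) (ModuleCat.{u} k)).obj (Lam.incl p) ⋙
      perFunctor k p ⟶ perFunctor k 1) (E : Lam 1 ⥤ ModuleCat.{u} k) (n : ℤ) :
    (∀ q : ℕ, (Lam.incl p ⋙ E).obj (Lam.ob p q)) →ₗ[k] (∀ q : ℕ, E.obj (Lam.ob 1 q)) :=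
  ((c.app E).f n).hom

/-- The canonical comparison between the periodic complexes of `i^* E` and of `E`, for `E` a cyclic vector space. -/
structure Comparison (k : Type u) [Field k] (p : ℕ) [NeZero p] where
  /-- It is a chain map, natural in `E`. -/
  toNat : (Functor.whiskeringLeft (Lam p) (Lam 1) (ModuleCat.{u} k)).obj (Lam.incl p) ⋙
      perFunctor k p ⟶ perFunctor k 1
  /-- It commutes with the periodicity (the shift of the bicomplex by two columns). -/
  periodic : ∀ (E : Lam 1 ⥤ ModuleCat.{u} k) (n : ℤ),
    perComponent toNat E (n - 2) = perComponent toNat E n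
  /-- It preserves the part in the columns `< 0`, hence descends to cyclic homology. -/
  filtered : ∀ (E : Lam 1 ⥤ ModuleCat.{u} k) (n : ℤ) (x : ∀ q : ℕ, (Lam.incl p ⋙ E).obj (Lam.ob p q)),
    (∀ q : ℕ, (q : ℤ) ≤ n → x q = 0) → ∀ q : ℕ, (q : ℤ) ≤ n → perComponent toNat E n x q = 0
  /-- On cyclic homology of degree zero, it is the adjunction map
  `colim_{Λ_p} i^* E → colim_Λ E`: the class of `x ∈ E([p])` goes to the class of `E(g)(x)`, for any
  morphism `g : [p] ⟶ [1]`. -/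
  augmented : ∀ (E : Lam 1 ⥤ ModuleCat.{u} k) (x : (Lam.incl p ⋙ E).obj (Lam.ob p 0))
    (g : (Lam.incl p).obj (Lam.ob p 0) ⟶ Lam.ob 1 0),
    perComponent toNat E 0 (Pi.single 0 x) 0 - (E.map g).hom x ∈ LinearMap.range (bOp E 0)

end CyclicHomology

namespace CyclicHomology

namespace PMap

variable {n m l : ℕ}

/-- The least `i` with `j ≤ f i`. The fibre `f ⁻¹ {j}` is the interval `lower f j ≤ i < lower f (j + 1)`. -/
def lower (f : PMap n m) (j : ℤ) : ℤ := sInf {i : ℤ | j ≤ f.toFun i}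

theorem lower_le_iff (hm : 0 < m) (f : PMap n m) (i j : ℤ) : f.lower j ≤ i ↔ j ≤ f.toFun i := by
  have hm' : (1 : ℤ) ≤ m := by exact_mod_cast hm
  have hne : {i : ℤ | j ≤ f.toFun i}.Nonempty := by
    refine ⟨0 + |j - f.toFun 0| * n, ?_⟩
    change j ≤ f.toFun _
    rw [f.shift_mul]
    have := le_abs_self (j - f.toFun 0)
    nlinarith [abs_nonneg (j - f.toFun 0)]
  have hbdd : BddBelow {i : ℤ | j ≤ f.toFun i} := by
    refine ⟨0 + (-(|j - f.toFun 0| + 1)) * n, fun i hi => ?_⟩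
    by_contra hlt
    have h1 := f.mono (not_le.mp hlt).le
    rw [f.shift_mul] at h1
    have h2 : j ≤ f.toFun i := hi
    have := neg_abs_le (j - f.toFun 0)
    nlinarith [abs_nonneg (j - f.toFun 0)]
  constructor
  · intro h
    exact le_trans (show j ≤ f.toFun (f.lower j) from Int.csInf_mem hne hbdd) (f.mono h)
  · exact fun h => csInf_le hbdd h

theorem mem_fibre_iff (hm : 0 < m) (f : PMap n m) (i j : ℤ) :
    (f.lower j ≤ i ∧ i < f.lower (j + 1)) ↔ f.toFun i = j := by
  rw [lower_le_iff hm, ← not_le, lower_le_iff hm]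
  omega

theorem lower_mono (hm : 0 < m) (f : PMap n m) : Monotone f.lower := fun i j h => by
  rw [lower_le_iff hm]
  exact h.trans ((lower_le_iff hm f _ _).mp le_rfl)

theorem lower_shift (hm : 0 < m) (f : PMap n m) (j c : ℤ) :
    f.lower (j + c * m) = f.lower j + c * n := by
  refine eq_of_forall_ge_iff fun i => ?_
  have h := f.lower_le_iff hm (i + (-c) * n) j
  rw [f.shift_mul] at h
  rw [lower_le_iff hm]
  constructor <;> intro h' <;> [have := h.mpr (by linarith); have := h.mp (by linarith)] <;> linarith

theorem lower_comp (hm : 0 < m) (hl : 0 < l) (f : PMap n m) (g : PMap m l) (j : ℤ) :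
    (f.comp g).lower j = f.lower (g.lower j) := by
  refine eq_of_forall_ge_iff fun i => ?_
  rw [lower_le_iff hl, lower_le_iff hm, lower_le_iff hl]
  rfl

theorem lower_id (hn : 0 < n) (j : ℤ) : (PMap.id n).lower j = j :=
  eq_of_forall_ge_iff fun i => by rw [lower_le_iff hn]; rfl

theorem lower_of_add (hm : 0 < m) {f f' : PMap n m} {c : ℤ} (h : ∀ a, f'.toFun a = f.toFun a + c) (j : ℤ) :
    f'.lower j = f.lower (j - c) :=
  eq_of_forall_ge_iff fun i => by
    rw [lower_le_iff hm, lower_le_iff hm, h]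
    constructor <;> intro h <;> linarith

end PMap

section IntervalProduct

variable {M : Type*} [Monoid M]

/-- The ordered product `a x * a (x + 1) * ⋯ * a (y - 1)`. -/
def iprod (a : ℤ → M) (x y : ℤ) : M := ((List.range (y - x).toNat).map fun l : ℕ => a (x + l)).prod

theorem iprod_self (a : ℤ → M) (x : ℤ) : iprod a x x = 1 := by simp [iprod]

theorem iprod_single (a : ℤ → M) (x : ℤ) : iprod a x (x + 1) = a x := by simp [iprod]

theorem iprod_mul (a : ℤ → M) {x y z : ℤ} (hxy : x ≤ y) (hyz : y ≤ z) :
    iprod a x y * iprod a y z = iprod a x z := by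
  obtain ⟨c, rfl⟩ : ∃ c : ℕ, y = x + c := ⟨(y - x).toNat, by omega⟩
  obtain ⟨d, rfl⟩ : ∃ d : ℕ, z = x + c + d := ⟨(z - (x + c)).toNat, by omega⟩
  unfold iprod
  rw [show (x + c - x).toNat = c by omega, show (x + c + d - (x + c)).toNat = d by omega,
    show (x + c + d - x).toNat = c + d by omega, List.range_add, List.map_append, List.prod_append,
    List.map_map]
  congr 3
  funext l
  simp [add_assoc]

theorem iprod_congr {a b : ℤ → M} {x y : ℤ} (h : ∀ i, x ≤ i → i < y → a i = b i) :
    iprod a x y = iprod b x y := by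
  unfold iprod
  congr 1
  refine List.map_congr_left fun l hl => h _ (by omega) ?_
  rw [List.mem_range] at hl
  omega

theorem iprod_shift (a : ℤ → M) (x y c : ℤ) :
    iprod a (x + c) (y + c) = iprod (fun i => a (i + c)) x y := by
  unfold iprod
  rw [show y + c - (x + c) = y - x by ring]
  congr 2
  funext l
  rw [show x + c + (l : ℤ) = x + l + c by ring]

theorem iprod_iprod (a : ℤ → M) {L : ℤ → ℤ} (hL : Monotone L) {x y : ℤ} (h : x ≤ y) :
    iprod (fun j => iprod a (L j) (L (j + 1))) x y = iprod a (L x) (L y) := by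
  obtain ⟨c, rfl⟩ : ∃ c : ℕ, y = x + c := ⟨(y - x).toNat, by omega⟩
  induction c with
  | zero => simp [iprod_self]
  | succ c ih =>
    rw [← iprod_mul _ (y := x + c) (by omega) (by push_cast; omega), ih (by omega),
      show x + ((c + 1 : ℕ) : ℤ) = x + c + 1 by push_cast; ring, iprod_single,
      iprod_mul _ (hL (by omega)) (hL (by omega))]

end IntervalProduct

section AlgebraObject

variable {n m l : ℕ} {A : Type*} [Monoid A]

/-- For a family `a` indexed by `ℤ/n` and `f : [n] ⟶ [m]`, the family indexed by `ℤ/m` whose `j`-th entry is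
the product of the `a i` over the fibre of `f` over `j`, in increasing order. -/
def fibreProd (f : PMap n m) (a : ZMod n → A) (j : ZMod m) : A :=
  iprod (fun i : ℤ => a (i : ZMod n)) (f.lower j.val) (f.lower (j.val + 1))

theorem fibreProd_intCast [NeZero m] (f : PMap n m) (a : ZMod n → A) (j : ℤ) :
    fibreProd f a (j : ZMod m) = iprod (fun i : ℤ => a (i : ZMod n)) (f.lower j) (f.lower (j + 1)) := by
  have hm := NeZero.pos m
  unfold fibreProd
  have e : (((j : ZMod m).val : ℕ) : ℤ) = j + (-(j / m)) * m := by
    rw [ZMod.val_intCast]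
    linarith [Int.emod_add_mul_ediv j m]
  rw [e, show j + (-(j / m)) * m + 1 = (j + 1) + (-(j / m)) * m by ring, PMap.lower_shift hm,
    PMap.lower_shift hm, iprod_shift]
  refine iprod_congr fun i _ _ => ?_
  simp

theorem fibreProd_id [NeZero n] (a : ZMod n → A) : fibreProd (PMap.id n) a = a := by
  funext j
  unfold fibreProd
  rw [PMap.lower_id (NeZero.pos n), PMap.lower_id (NeZero.pos n), iprod_single]
  simp

theorem fibreProd_comp [NeZero m] [NeZero l] (f : PMap n m) (g : PMap m l) (a : ZMod n → A) :
    fibreProd (f.comp g) a = fibreProd g (fibreProd f a) := by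
  funext j
  have hm := NeZero.pos m
  have hl := NeZero.pos l
  rw [fibreProd, fibreProd, PMap.lower_comp hm hl, PMap.lower_comp hm hl,
    ← iprod_iprod _ (f.lower_mono hm) (g.lower_mono hl (by omega))]
  exact iprod_congr fun i _ _ => (fibreProd_intCast f a i).symm

theorem fibreProd_rel [NeZero m] {f f' : PMap n m} (h : PMap.rel 1 f f') (a : ZMod n → A) :
    fibreProd f a = fibreProd f' a := by
  obtain ⟨c, hc⟩ := h
  funext j
  have hm := NeZero.pos m
  rw [fibreProd, fibreProd, PMap.lower_of_add hm hc, PMap.lower_of_add hm hc]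
  have e : ((j.val - c * (1 * m : ℕ) : ℤ) : ZMod m) = j := by
    push_cast
    simp
  have := fibreProd_intCast f a (j.val - c * (1 * m : ℕ))
  rw [e] at this
  rw [show (j.val : ℤ) + 1 - c * (1 * m : ℕ) = j.val - c * (1 * m : ℕ) + 1 by ring, ← this]
  rfl

theorem fibreProd_update [NeZero n] [NeZero m] [DecidableEq (ZMod n)] [DecidableEq (ZMod m)] (f : PMap n m) (a : ZMod n → A) (i₀ : ZMod n) :
    ∃ (j₀ : ZMod m) (x y : A), ∀ b : A,
      fibreProd f (Function.update a i₀ b) = Function.update (fibreProd f a) j₀ (x * b * y) := by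
  have hn := NeZero.pos n
  have hm := NeZero.pos m
  set s := f.lower 0 with hs
  have hsn : f.lower m = s + n := by
    have := f.lower_shift hm 0 1
    simpa using this
  set t : ℤ := s + ((i₀ - (s : ZMod n)).val : ℤ) with ht
  have htn : ((i₀ - (s : ZMod n)).val : ℤ) < n := by exact_mod_cast ZMod.val_lt _
  have hti : (t : ZMod n) = i₀ := by rw [ht]; push_cast; simp
  have huniq : ∀ i : ℤ, s ≤ i → i < s + n → (i : ZMod n) = i₀ → i = t := by
    intro i h1 h2 h3
    rw [← hti, ZMod.intCast_eq_intCast_iff, Int.modEq_iff_dvd] at h3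
    obtain ⟨c, hc⟩ := h3
    have hn' : (0 : ℤ) < n := by exact_mod_cast hn
    have : c = 0 := by
      have h5 : n * c < n * 1 := by omega
      have h6 : n * (-1) < n * c := by omega
      have := lt_of_mul_lt_mul_left h5 hn'.le
      have := lt_of_mul_lt_mul_left h6 hn'.le
      omega
    rw [this] at hc
    omega
  have hft0 : 0 ≤ f.toFun t := (f.lower_le_iff hm t 0).mp (by omega)
  have hftm : f.toFun t < m := by
    rw [← not_le, ← f.lower_le_iff hm, hsn]
    omega
  have hlow : ∀ j : ℤ, 0 ≤ j → s ≤ f.lower j := fun j hj => f.lower_mono hm hj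
  have hupp : ∀ j : ℤ, j < m → f.lower (j + 1) ≤ s + n := fun j hj => by
    rw [← hsn]; exact f.lower_mono hm (by omega)
  obtain ⟨h1, h2⟩ := (f.mem_fibre_iff hm t (f.toFun t)).mpr rfl
  refine ⟨(f.toFun t : ZMod m), iprod (fun i : ℤ => a (i : ZMod n)) (f.lower (f.toFun t)) t,
    iprod (fun i : ℤ => a (i : ZMod n)) (t + 1) (f.lower (f.toFun t + 1)), fun b => ?_⟩
  funext j
  by_cases hj : j = (f.toFun t : ZMod m)
  · subst hj
    rw [Function.update_self, fibreProd_intCast,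
      ← iprod_mul _ (y := t + 1) (by omega) (by omega), ← iprod_mul _ h1 (by omega : t ≤ t + 1),
      iprod_single, hti, Function.update_self]
    have l1 := hlow _ hft0
    have l2 := hupp _ hftm
    have e1 : iprod (fun i : ℤ => Function.update a i₀ b (i : ZMod n)) (f.lower (f.toFun t)) t =
        iprod (fun i : ℤ => a (i : ZMod n)) (f.lower (f.toFun t)) t := by
      refine iprod_congr fun i h3 h4 => Function.update_of_ne (fun e => ?_) _ _
      have := huniq i (by omega) (by omega) e
      omega
    have e2 : iprod (fun i : ℤ => Function.update a i₀ b (i : ZMod n)) (t + 1)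
        (f.lower (f.toFun t + 1)) =
        iprod (fun i : ℤ => a (i : ZMod n)) (t + 1) (f.lower (f.toFun t + 1)) := by
      refine iprod_congr fun i h3 h4 => Function.update_of_ne (fun e => ?_) _ _
      have := huniq i (by omega) (by omega) e
      omega
    rw [e1, e2]
  · rw [Function.update_of_ne hj]
    refine iprod_congr fun i h3 h4 => Function.update_of_ne (fun e => hj ?_) _ _
    have hjm : (j.val : ℤ) < m := by exact_mod_cast ZMod.val_lt j
    have l1 := hlow (j.val : ℤ) (by positivity)
    have l2 := hupp (j.val : ℤ) hjm
    have e2 := huniq i (by omega) (by omega) e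
    have := (f.mem_fibre_iff hm i j.val).mp ⟨h3, h4⟩
    rw [← e2, this]
    simp

end AlgebraObject

section AlgebraObjectLinear

variable (k : Type u) [Field k] (A : Type u) [Ring A] [Algebra k A]

/-- The map `A^{⊗ n} → A^{⊗ m}` induced by `f : [n] ⟶ [m]`. -/
def tensorMap {n m : ℕ} [NeZero n] [NeZero m] (f : PMap n m) :
    (⨂[k] _ : ZMod n, A) →ₗ[k] ⨂[k] _ : ZMod m, A :=
  PiTensorProduct.lift
    { toFun := fun a => PiTensorProduct.tprod k (fibreProd f a)
      map_update_add' := fun a i x y => by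
        obtain ⟨j, u, v, h⟩ := fibreProd_update f a i
        rw [h, h, h, mul_add, add_mul,
          MultilinearMap.map_update_add]
      map_update_smul' := fun a i c x => by
        obtain ⟨j, u, v, h⟩ := fibreProd_update f a i
        rw [h, h, mul_smul_comm, smul_mul_assoc,
          MultilinearMap.map_update_smul] }

theorem tensorMap_tprod {n m : ℕ} [NeZero n] [NeZero m] (f : PMap n m) (a : ZMod n → A) :
    tensorMap k A f (PiTensorProduct.tprod k a) = PiTensorProduct.tprod k (fibreProd f a) := by
  simp [tensorMap]

/-- The cyclic vector space `A_#`: `[n] ↦ A^{⊗ n}`, with factors numbered by `ℤ/n`; a morphism `f : [n] ⟶ [m]`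
sends `⊗ a_i` to the tensor whose `j`-th factor is the ordered product of the `a_i`, `i ∈ f ⁻¹ {j}`. -/
def cyclicObject : Lam 1 ⥤ ModuleCat.{u} k where
  obj X := ModuleCat.of k (⨂[k] _ : ZMod X.len, A)
  map {X Y} f := ModuleCat.ofHom (Quotient.lift (s := PMap.setoid 1 X.len Y.len) (tensorMap k A)
    (fun f g h => PiTensorProduct.ext (MultilinearMap.ext fun a => by
      simp only [LinearMap.compMultilinearMap_apply, tensorMap_tprod]
      rw [fibreProd_rel h])) f)
  map_id X := by
    refine ModuleCat.hom_ext (PiTensorProduct.ext (MultilinearMap.ext fun a => ?_))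
    change tensorMap k A (PMap.id X.len) (PiTensorProduct.tprod k a) = PiTensorProduct.tprod k a
    rw [tensorMap_tprod, fibreProd_id]
  map_comp {X Y Z} f g := by
    induction f using Quotient.ind with | _ f
    induction g using Quotient.ind with | _ g
    refine ModuleCat.hom_ext (PiTensorProduct.ext (MultilinearMap.ext fun a => ?_))
    change tensorMap k A (f.comp g) (PiTensorProduct.tprod k a) =
      tensorMap k A g (tensorMap k A f (PiTensorProduct.tprod k a))
    rw [tensorMap_tprod, tensorMap_tprod, tensorMap_tprod, fibreProd_comp]

end AlgebraObjectLinear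

end CyclicHomology

namespace CyclicHomology

/-- The Frobenius twist `A^{(1)}`: the ring `A`, on which `c ∈ k` acts as `c ^ (1 / p)` acts on `A`. -/
def FrobTwist (k : Type u) [Field k] (_p : ℕ) (A : Type u) : Type u := A

/-- The identity map `A → A^{(1)}`. -/
def toTwist (k : Type u) [Field k] (p : ℕ) {A : Type u} (a : A) : FrobTwist k p A := a

theorem toTwist_update (k : Type u) [Field k] (p : ℕ) {A : Type u} {ι : Type*} [DecidableEq ι] (a : ι → A) (i : ι) (z : A) :
    (fun j => toTwist k p (Function.update a i z j)) =
      Function.update (fun j => toTwist k p (a j)) i (toTwist k p z) := by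
  funext j
  by_cases hj : j = i
  · subst hj; simp
  · simp [hj]

section Twist

variable (k : Type u) [Field k] (p : ℕ) (A : Type u) [Ring A] [Algebra k A]

instance : Ring (FrobTwist k p A) := inferInstanceAs (Ring A)

instance [ExpChar k p] [PerfectRing k p] : Algebra k (FrobTwist k p A) :=
  Algebra.compHom A ((frobeniusEquiv k p).symm : k →+* k)

theorem toTwist_smul [ExpChar k p] [PerfectRing k p] (c : k) (a : A) :
    toTwist k p (c • a) = c ^ p • toTwist k p a := by
  have h : (frobeniusEquiv k p).symm (c ^ p) = c := frobeniusEquiv_symm_apply_frobenius k p c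
  have e : c ^ p • toTwist k p a = toTwist k p ((frobeniusEquiv k p).symm (c ^ p) • a) := by
    rw [Algebra.smul_def, Algebra.smul_def]
    rfl
  rw [e, h]

/-- The map `(a_i) ↦ ⊗ a_i` from `A^n` to `(A^{(1)})^{⊗ n}`. It is multilinear if `c ∈ k` acts on the target through
its `p`-th power. -/
def twistMultilinear [ExpChar k p] [PerfectRing k p] (n : ℕ) :
    MultilinearMap k (fun _ : ZMod n => A) ((ModuleCat.restrictScalars (frobenius k p)).obj
      (ModuleCat.of k (⨂[k] _ : ZMod n, FrobTwist k p A))) where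
  toFun a := (PiTensorProduct.tprod k fun i => toTwist k p (a i) : ⨂[k] _ : ZMod n, FrobTwist k p A)
  map_update_add' a i x y := by
    rw [toTwist_update, toTwist_update, toTwist_update]
    exact MultilinearMap.map_update_add (PiTensorProduct.tprod k) _ _ _ _
  map_update_smul' a i c x := by
    rw [toTwist_update, toTwist_update, toTwist_smul]
    exact MultilinearMap.map_update_smul (PiTensorProduct.tprod k) _ _ _ _

/-- The canonical additive bijection `A^{⊗ n} → (A^{(1)})^{⊗ n}`, the identity on pure tensors. It identifies
`(A^{⊗ n})^{(1)}` with `(A^{(1)})^{⊗ n}`. -/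
def twistTensor [ExpChar k p] [PerfectRing k p] (n : ℕ) :
    (⨂[k] _ : ZMod n, A) →+ ⨂[k] _ : ZMod n, FrobTwist k p A :=
  (PiTensorProduct.lift (twistMultilinear k p A n)).toAddMonoidHom

theorem twistTensor_tprod [ExpChar k p] [PerfectRing k p] (n : ℕ) (a : ZMod n → A) :
    twistTensor k p A n (PiTensorProduct.tprod k a) =
      PiTensorProduct.tprod k fun i => toTwist k p (a i) :=
  PiTensorProduct.lift.tprod (φ := twistMultilinear k p A n) a

theorem twistTensor_smul [ExpChar k p] [PerfectRing k p] (n : ℕ) (c : k) (x : ⨂[k] _ : ZMod n, A) :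
    twistTensor k p A n (c • x) = c ^ p • twistTensor k p A n x :=
  (PiTensorProduct.lift (twistMultilinear k p A n)).map_smul c x

end Twist

section QuasiFrobenius

variable {k : Type u} [Field k] {p : ℕ} {A : Type u} [Ring A] [Algebra k A]

variable (k p A) in
/-- The generator `σ` of `ℤ/p` acting on `A^{⊗ p}` by cyclic permutation of the factors. -/
def cyclicPerm : Module.End k (⨂[k] _ : ZMod p, A) :=
  (PiTensorProduct.reindex k (fun _ : ZMod p => A) (Equiv.addRight (1 : ZMod p))).toLinearMap

/-- Quasi-Frobenius maps `F : A^{(1)} → A^{⊗ p}`: algebra maps that are `ℤ/p`-equivariant for the trivial action on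
`A^{(1)}`, and such that the map `A^{(1)} = Ȟ_i(ℤ/p, A^{(1)}) → Ȟ_i(ℤ/p, A^{⊗ p})` on Tate homology is the canonical
isomorphism `a ↦ [a ⊗ ⋯ ⊗ a]`, for `i` of either parity. The Tate homology of `A^{⊗ p}` is
`ker (1 - σ) / im (1 + σ + ⋯ + σ ^ (p - 1))` in one parity and
`ker (1 + σ + ⋯ + σ ^ (p - 1)) / im (1 - σ)` in the other. -/
structure IsQuasiFrobenius [ExpChar k p] [PerfectRing k p]
    (F : FrobTwist k p A →ₐ[k] ⨂[k] _ : ZMod p, A) : Prop where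
  equivariant : ∀ a, cyclicPerm k p A (F a) = F a
  tate_norm : ∀ a : A, F (toTwist k p a) - PiTensorProduct.tprod k (fun _ : ZMod p => a) ∈
    LinearMap.range (∑ j ∈ Finset.range p, cyclicPerm k p A ^ j)
  tate_diff : ∀ a : A, F (toTwist k p a) - PiTensorProduct.tprod k (fun _ : ZMod p => a) ∈
    LinearMap.range (1 - cyclicPerm k p A)

/-- The map `ℤ → ℤ`, `a ↦ j + n a`, from period `p` to period `p n`. -/
def PMap.spread (p n : ℕ) (j : ℤ) : PMap p (p * n) :=
  ⟨fun a => j + n * a, fun _ _ h => by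
    have := mul_le_mul_of_nonneg_left h (Nat.cast_nonneg (α := ℤ) n)
    simpa using this, fun a => by push_cast; ring⟩

/-- The tensor `F(a_0) ⊗ ⋯ ⊗ F(a_{n-1})` in `(A^{⊗ p})^{⊗ n} = A^{⊗ pn}`, where the `l`-th factor of the `j`-th
copy of `A^{⊗ p}` is the factor number `j + n l` of `A^{⊗ pn}`. It is written as the product in the algebra `A^{⊗ pn}`
of the images of the `F(a_j)` under the embeddings `A^{⊗ p} → A^{⊗ pn}` onto the factors `j + n l`. -/
def tensorPower [NeZero p] [ExpChar k p] [PerfectRing k p]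
    (F : FrobTwist k p A →ₐ[k] ⨂[k] _ : ZMod p, A) (n : ℕ) [NeZero n] (a : ZMod n → FrobTwist k p A) :
    ⨂[k] _ : ZMod (p * n), A :=
  ((List.range n).map fun j => tensorMap k A (PMap.spread p n j) (F (a j))).prod

end QuasiFrobenius

section Homology

variable (k : Type u) [Field k] (A : Type u) [Ring A] [Algebra k A]

/-- The Hochschild complex of `A`: `A^{⊗ (q + 1)}` in degree `q`, with the Hochschild differential. -/
abbrev hochschildComplex : ChainComplex (ModuleCat.{u} k) ℕ := stdComplex (cyclicObject k A)

/-- Hochschild homology. -/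
abbrev HH (q : ℕ) : ModuleCat.{u} k := (hochschildComplex k A).homology q

/-- The part of degree `n` of `HH(A)((u))`, with `u` of homological degree `-2`. A Laurent series of degree `n` is
`∑ h_q u ^ ((q - n) / 2)` with `h_q ∈ HH_q(A)`, over all `q ≥ 0` with `n - q` even; such a series is automatically
bounded below in `u`, so that all families `(h_q)` occur. -/
abbrev HHLaurent (n : ℤ) : Type u := ∀ q : {q : ℕ // Even (n - q)}, HH k A q

/-- Periodic cyclic homology. -/
abbrev HP (n : ℤ) : ModuleCat.{u} k := (perComplex (cyclicObject k A)).homology n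

end Homology

section Cartier

variable {k : Type u} [Field k] {p : ℕ} [NeZero p] [ExpChar k p] [PerfectRing k p]
  {A : Type u} [Ring A] [Algebra k A]

/-- The chain of the periodic complex of `i^* A_#` in degree `n` that corresponds to the Laurent series
`∑ z_q u ^ ((q - n) / 2)` of Hochschild chains: its entry in row `q` is the image of `z_q` under `G = F_#` if the column
`n - q` is even, and `0` if it is odd. -/
def laurentChain (G : Lam.proj p ⋙ cyclicObject k (FrobTwist k p A) ⟶ Lam.incl p ⋙ cyclicObject k A)
    (n : ℤ) (z : ∀ q : {q : ℕ // Even (n - q)}, (hochschildComplex k A).X q) :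
    (perComplex (Lam.incl p ⋙ cyclicObject k A)).X n :=
  fun q : ℕ => if h : Even (n - q) then
    (G.app (Lam.ob p q)).hom (twistTensor k p A (q + 1) (z ⟨q, h⟩)) else 0

end Cartier

end CyclicHomology

open CyclicHomology

/-!
Write `F_# : π^* A^{(1)}_# ⟶ i^* A_#` for the morphism of `p`-cyclic vector spaces with components `F^{⊗ n}`. It
induces the isomorphism `φ` because it induces an isomorphism on periodic homology, and because the comparison maps
do.

*The cokernel of `F_#`.* Fix a basis of `A`. In `A^{⊗ pn}` the words fixed by `ℤ/p` are the `p`-th powers of words of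
length `n`, and the other words span a free `k[ℤ/p]`-module. The two conditions on `F(a) - a^{⊗ p}` say that `F^{⊗ n}`
identifies `(A^{(1)})^{⊗ n}` with the span of the fixed words up to the free part (`exists_fixed_projection`), so
`F_#` is injective and the terms of its cokernel have no Tate homology (`rowsExact_coker`). The rows of the Tate
bicomplex being exact, its product total complex is acyclic as soon as the quotient by the sum total complex, the
complex of germs at infinity, is (`GermAcyclicOn`, `prodAcyclic_of_germ`). Finally `σ` is homotopic to the identity
(`lapHtpy`) and `p = 0`, which forces the periodic homology to vanish when the Tate complex is acyclic
(`perD_exact_of_prodAcyclic`).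

*Germs.* They are controlled by the homological dimension. For a bimodule `M` over `A`, the tensor powers of the
square-zero extension `A ⊕ M` contain, as a direct summand, the words with exactly one letter from `M` in each of `r`
blocks. For a free bimodule, expanding each such letter gives a contraction (`bimodAcyclic_of_basis`). In a short
exact sequence `0 → L → N → M → 0` acyclicity passes from `L` and `N` to `M`, since words of `N` with letters from `L`
in some but not in all blocks are permuted freely by `ℤ/p` (`bimodAcyclic_of_exact`). Descending along a projective
resolution, every bimodule has acyclic germs, in particular the diagonal one (`germAcyclic_blockObject`): with `r = p`
for `i^* A_#`, with `r = 1` for the twist, and then also for the cokernel of `F_#`.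

*The source.* On `π^* A^{(1)}_#` the norm from `ℤ/p` is multiplication by `p = 0`, so Connes' operator vanishes and
the periodic homology is the product of the Hochschild homology groups, represented by the chains of the statement
(`laurentChain_eq`).

*Comparison maps.* The periodic complex is homotopy equivalent to the total complex of the mixed complex with `b` and
Connes' operator (`fromMixed`, `toMixed`, `mixHtpy`). Natural maps between the mixed complexes of the restrictions of
`E` along `[n] ↦ [rn]` and `[n] ↦ [sn]` are constructed on free objects `k[Λ(X, -)]`, by acyclic models. The
restriction of such an object has Hochschild homology only in degrees `0` and `1` (`exists_bOp_freeIncl`, by a prism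
homotopy), where it is detected by the augmentation and the winding number (`windCocycle`). Hence a natural map with
prescribed effect in degree `0` exists (`exists_mixedMap`) and is unique up to homotopy (`exists_mixedHtpy`), also
among all comparison maps (`Comparison.exists_homologous`). With `(r, s) = (p, 1)` and `(1, p)` this gives a
comparison map and an inverse on periodic homology.

*Conclusion.* Both `HH_•(A)((u))` and `HP_•(A)` are quotients of the group of families of Hochschild cycles, and by
the previous steps by the same subgroup (`IsShortExact.exists_laurentIso`).
-/

namespace CyclicHomology

/-! ### Extra degeneracies -/

instance {n m : ℕ} [NeZero n] [NeZero m] : NeZero (n * m) := ⟨(Nat.mul_pos (NeZero.pos n) (NeZero.pos m)).ne'⟩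

namespace PMap

/-- The extra degeneracy `[n + 1] ⟶ [n + 2]` that skips the points `a (n + 2)`. -/
def extra (n : ℕ) : PMap (n + 1) (n + 2) where
  toFun x := x + x / (n + 1) + 1
  mono x y h := by
    have := Int.ediv_le_ediv (a := x) (b := y) (c := (n : ℤ) + 1) (by positivity) h
    dsimp only
    linarith
  shift x := by
    have hn : ((n : ℤ) + 1) ≠ 0 := by positivity
    have h : (x + ((n + 1 : ℕ) : ℤ)) / (n + 1) = x / (n + 1) + 1 := by
      rw [show x + ((n + 1 : ℕ) : ℤ) = x + 1 * (n + 1) by push_cast; ring,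
        Int.add_mul_ediv_right _ _ hn]
    rw [h]; push_cast; ring

lemma extra_of_lt {n : ℕ} {b : ℤ} (hb : 0 ≤ b) (hb' : b < n + 1) : (extra n).toFun b = b + 1 := by
  change b + b / (n + 1) + 1 = _
  rw [Int.ediv_eq_zero_of_lt hb hb']; ring

lemma extra_comp_face_zero (n : ℕ) : (extra n).comp (face (n + 1) 0) = PMap.id (n + 1) := by
  refine ext_of_lt (by omega) fun b hb hb' => ?_
  push_cast at hb'
  change (face (n + 1) 0).toFun ((extra n).toFun b) = b
  rw [extra_of_lt hb hb', face_of_gt (by omega) (by push_cast; omega) (by push_cast; omega)]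
  ring

lemma extra_comp_face_succ {n i : ℕ} (hi : i ≤ n) :
    (extra (n + 1)).comp (face (n + 2) (i + 1)) = (face (n + 1) i).comp (extra n) := by
  refine ext_of_lt (by omega) fun b hb hb' => ?_
  push_cast at hb'
  change (face (n + 2) (i + 1)).toFun ((extra (n + 1)).toFun b) =
    (extra n).toFun ((face (n + 1) i).toFun b)
  rw [extra_of_lt hb (by push_cast; omega)]
  by_cases h : b ≤ i
  · rw [face_of_le (by omega) (by omega) (by push_cast; omega), face_of_le (by omega) hb h,
      extra_of_lt hb (by omega)]
  · rw [face_of_gt (by omega) (by push_cast; omega) (by push_cast; omega),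
      face_of_gt (by omega) (by omega) (by push_cast; omega), extra_of_lt (by omega) (by omega)]
    ring

end PMap

/-! ### The mixed complex and the periodic complex -/

section Mixed

variable {k : Type u} [Field k] {p : ℕ} (E : Lam p ⥤ ModuleCat.{u} k)

/-- The extra degeneracy `E([q + 1]) → E([q + 2])`, a contraction of the `b'`-complex. -/
def extraOp (q : ℕ) : E.obj (Lam.ob p q) →ₗ[k] E.obj (Lam.ob p (q + 1)) :=
  (E.map (X := Lam.ob p q) (Y := Lam.ob p (q + 1)) (Lam.ofMap (PMap.extra q))).hom

lemma faceOp_zero_extraOp (q : ℕ) : faceOp E q 0 ∘ₗ extraOp E q = LinearMap.id := by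
  unfold faceOp extraOp
  rw [← ModuleCat.hom_comp, ← E.map_comp]
  have : (Lam.ofMap (PMap.extra q) : Lam.ob p q ⟶ Lam.ob p (q + 1)) ≫
      (Lam.ofMap (PMap.face (q + 1) 0) : Lam.ob p (q + 1) ⟶ Lam.ob p q) = 𝟙 _ :=
    congrArg (Quotient.mk _) (PMap.extra_comp_face_zero q)
  rw [this, E.map_id, ModuleCat.hom_id]

lemma faceOp_succ_extraOp {q i : ℕ} (hi : i ≤ q) :
    faceOp E (q + 1) (i + 1) ∘ₗ extraOp E (q + 1) = extraOp E q ∘ₗ faceOp E q i := by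
  unfold faceOp extraOp
  rw [← ModuleCat.hom_comp, ← ModuleCat.hom_comp, ← E.map_comp, ← E.map_comp]
  congr 2
  exact congrArg (Quotient.mk _) (PMap.extra_comp_face_succ hi)

lemma bOp'_extraOp_zero (x : E.obj (Lam.ob p 0)) : bOp' E 0 (extraOp E 0 x) = x := by
  have := LinearMap.congr_fun (faceOp_zero_extraOp E 0) x
  simpa [bOp'] using this

lemma bOp'_extraOp (q : ℕ) (x : E.obj (Lam.ob p (q + 1))) :
    bOp' E (q + 1) (extraOp E (q + 1) x) + extraOp E q (bOp' E q x) = x := by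
  have h0 := LinearMap.congr_fun (faceOp_zero_extraOp E (q + 1)) x
  have h1 : ∀ i ∈ Finset.range (q + 1), faceOp E (q + 1) (i + 1) (extraOp E (q + 1) x) =
      extraOp E q (faceOp E q i x) := fun i hi =>
    LinearMap.congr_fun (faceOp_succ_extraOp E (by rw [Finset.mem_range] at hi; omega)) x
  unfold bOp'
  rw [Finset.sum_range_succ']
  simp only [LinearMap.add_apply, LinearMap.sum_apply, LinearMap.smul_apply, map_sum, map_smul]
  rw [Finset.sum_congr rfl fun i hi => by rw [h1 i hi, pow_succ]]
  simp only [LinearMap.comp_apply, LinearMap.id_apply] at h0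
  rw [h0]
  simp

/-- The Connes operator `B = (1 - τ) s N`. -/
def connesOp (q : ℕ) : E.obj (Lam.ob p q) →ₗ[k] E.obj (Lam.ob p (q + 1)) :=
  (1 - rotOp E (q + 1)) ∘ₗ extraOp E q ∘ₗ normOp E q

lemma normOp_sub_rotOp_apply (q : ℕ) (x : E.obj (Lam.ob p q)) :
    normOp E q (x - rotOp E q x) = 0 := LinearMap.congr_fun (normOp_one_sub E q) x

lemma sub_rotOp_normOp_apply (q : ℕ) (x : E.obj (Lam.ob p q)) :
    normOp E q x - rotOp E q (normOp E q x) = 0 := LinearMap.congr_fun (one_sub_normOp E q) x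

lemma bOp_sub_rotOp_apply (q : ℕ) (x : E.obj (Lam.ob p (q + 1))) :
    bOp E q (x - rotOp E (q + 1) x) = bOp' E q x - rotOp E q (bOp' E q x) :=
  LinearMap.congr_fun (bOp_one_sub E q) x

lemma bOp'_normOp_apply [NeZero p] (q : ℕ) (x : E.obj (Lam.ob p (q + 1))) :
    bOp' E q (normOp E (q + 1) x) = normOp E q (bOp E q x) :=
  LinearMap.congr_fun (bOp'_normOp E q) x

lemma bOp_bOp_apply (q : ℕ) (x : E.obj (Lam.ob p (q + 2))) :
    bOp E q (bOp E (q + 1) x) = 0 := LinearMap.congr_fun (bOp_bOp E q) x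

lemma connesOp_apply (q : ℕ) (x : E.obj (Lam.ob p q)) : connesOp E q x =
    extraOp E q (normOp E q x) - rotOp E (q + 1) (extraOp E q (normOp E q x)) := rfl

lemma normOp_connesOp (q : ℕ) (x : E.obj (Lam.ob p q)) :
    normOp E (q + 1) (connesOp E q x) = 0 := normOp_sub_rotOp_apply E (q + 1) _

lemma connesOp_connesOp (q : ℕ) (x : E.obj (Lam.ob p q)) :
    connesOp E (q + 1) (connesOp E q x) = 0 := by
  rw [connesOp_apply E (q + 1), normOp_connesOp]; simp

lemma connesOp_sub_rotOp (q : ℕ) (x : E.obj (Lam.ob p q)) :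
    connesOp E q (x - rotOp E q x) = 0 := by
  rw [connesOp_apply, normOp_sub_rotOp_apply]; simp

lemma bOp_connesOp_zero (x : E.obj (Lam.ob p 0)) : bOp E 0 (connesOp E 0 x) = 0 := by
  rw [connesOp_apply, bOp_sub_rotOp_apply, bOp'_extraOp_zero, sub_rotOp_normOp_apply]

lemma bOp_connesOp [NeZero p] (q : ℕ) (x : E.obj (Lam.ob p (q + 1))) :
    bOp E (q + 1) (connesOp E (q + 1) x) + connesOp E q (bOp E q x) = 0 := by
  have h := bOp'_extraOp E q (normOp E (q + 1) x)
  rw [bOp'_normOp_apply] at h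
  have h2 : bOp' E (q + 1) (extraOp E (q + 1) (normOp E (q + 1) x)) =
    normOp E (q + 1) x - extraOp E q (normOp E q (bOp E q x)) := eq_sub_of_add_eq h
  rw [connesOp_apply, connesOp_apply, bOp_sub_rotOp_apply, h2, map_sub, sub_sub_sub_comm,
    sub_rotOp_normOp_apply]
  simp

/-- A family of maps `V q → V (q + 1)`, applied to sequences. -/
def shiftUp {V : ℕ → Type*} [∀ q, AddCommGroup (V q)] [∀ q, Module k (V q)]
    (f : ∀ q, V q →ₗ[k] V (q + 1)) : (∀ q, V q) →ₗ[k] (∀ q, V q) :=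
  LinearMap.pi fun q => match q with
    | 0 => 0
    | q + 1 => f q ∘ₗ LinearMap.proj q

section ShiftUp

variable {V : ℕ → Type*} [∀ q, AddCommGroup (V q)] [∀ q, Module k (V q)]
    (f : ∀ q, V q →ₗ[k] V (q + 1)) (x : ∀ q, V q)

@[simp] theorem shiftUp_zero : shiftUp f x 0 = 0 := rfl

@[simp] theorem shiftUp_succ (q : ℕ) : shiftUp f x (q + 1) = f q (x q) := rfl

end ShiftUp

/-- The differential `b + B` of the mixed complex, on sequences. -/
def mixD : (∀ q : ℕ, E.obj (Lam.ob p q)) →ₗ[k] (∀ q : ℕ, E.obj (Lam.ob p q)) :=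
  LinearMap.pi (fun q => bOp E q ∘ₗ LinearMap.proj (q + 1)) + shiftUp (connesOp E)

lemma mixD_apply (x : ∀ q : ℕ, E.obj (Lam.ob p q)) (q : ℕ) :
    mixD E x q = bOp E q (x (q + 1)) + shiftUp (connesOp E) x q := rfl

lemma mixD_mixD [NeZero p] (x : ∀ q : ℕ, E.obj (Lam.ob p q)) : mixD E (mixD E x) = 0 := by
  funext q
  rw [mixD_apply, mixD_apply, map_add, bOp_bOp_apply, zero_add, shiftUp_succ]
  match q with
  | 0 => rw [shiftUp_zero, bOp_connesOp_zero]; simp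
  | q + 1 =>
    rw [shiftUp_succ, mixD_apply, map_add, ← add_assoc, bOp_connesOp, zero_add]
    match q with
    | 0 => simp
    | q + 1 => rw [shiftUp_succ, connesOp_connesOp]; rfl

/-- The inclusion `x ↦ x + s N x` of the mixed complex into the periodic complex. -/
def fromMixed (n : ℤ) : (∀ q : ℕ, E.obj (Lam.ob p q)) →ₗ[k] (∀ q : ℕ, E.obj (Lam.ob p q)) :=
  LinearMap.pi fun q => if Even (n - q) then LinearMap.proj q else
    LinearMap.proj q ∘ₗ shiftUp fun q => extraOp E q ∘ₗ normOp E q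

/-- The projection of the periodic complex to the mixed complex: `x + y ↦ x + (1 - τ) s y` for `x` in the
even and `y` in the odd columns. -/
def toMixed (n : ℤ) : (∀ q : ℕ, E.obj (Lam.ob p q)) →ₗ[k] (∀ q : ℕ, E.obj (Lam.ob p q)) :=
  LinearMap.pi fun q => if Even (n - q) then LinearMap.proj q +
    LinearMap.proj q ∘ₗ shiftUp (fun q => (1 - rotOp E (q + 1)) ∘ₗ extraOp E q) else 0

variable {n : ℤ} {q : ℕ} (x : ∀ q : ℕ, E.obj (Lam.ob p q))

lemma fromMixed_even (h : Even (n - q)) : fromMixed E n x q = x q := by simp [fromMixed, h]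

lemma fromMixed_odd (h : ¬ Even (n - q)) : fromMixed E n x q =
    shiftUp (fun q => extraOp E q ∘ₗ normOp E q) x q := by simp [fromMixed, h]

lemma toMixed_even (h : Even (n - q)) : toMixed E n x q =
    x q + shiftUp (fun q => (1 - rotOp E (q + 1)) ∘ₗ extraOp E q) x q := by simp [toMixed, h]

lemma toMixed_odd (h : ¬ Even (n - q)) : toMixed E n x q = 0 := by simp [toMixed, h]

lemma even_succ_sub_succ : Even (n + 1 - ((q + 1 : ℕ) : ℤ)) ↔ Even (n - q) := by
  rw [show n + 1 - ((q + 1 : ℕ) : ℤ) = n - q by push_cast; ring]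

lemma even_succ_sub : Even (n + 1 - (q : ℤ)) ↔ ¬ Even (n - q) := by
  rw [show n + 1 - (q : ℤ) = (n - q) + 1 by ring, Int.even_add_one]

lemma even_sub_succ : Even (n - ((q + 1 : ℕ) : ℤ)) ↔ ¬ Even (n - q) := by
  rw [show n - (q : ℤ) = (n - ((q + 1 : ℕ) : ℤ)) + 1 by push_cast; ring, Int.even_add_one, not_not]

variable [NeZero p]

/-- The inclusion commutes with the differentials of the total complexes. -/
theorem perD_fromMixed (n : ℤ) : perD E n (fromMixed E (n + 1) x) = fromMixed E n (mixD E x) := by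
  funext q
  by_cases h : Even (n - q)
  · rw [perD_apply_even E h, fromMixed_even E _ h, fromMixed_even E _ (even_succ_sub_succ.mpr h),
      fromMixed_odd E _ (by rw [even_succ_sub, not_not]; exact h), mixD_apply]
    match q with
    | 0 => simp
    | q + 1 => rfl
  · rw [perD_apply_odd E h, fromMixed_odd E _ h, fromMixed_even E _ (even_succ_sub.mpr h),
      fromMixed_odd E _ (fun h' => h (even_succ_sub_succ.mp h')), shiftUp_succ]
    match q with
    | 0 =>
      rw [LinearMap.comp_apply, bOp'_extraOp_zero]
      simp
    | q + 1 =>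
      have h1 := bOp'_extraOp E q (normOp E (q + 1) (x (q + 1)))
      rw [bOp'_normOp_apply] at h1
      rw [LinearMap.comp_apply, shiftUp_succ, mixD_apply, map_add, LinearMap.comp_apply,
        LinearMap.comp_apply]
      have h2 : normOp E q (shiftUp (connesOp E) x q) = 0 := by
        match q with
        | 0 => simp
        | q + 1 => rw [shiftUp_succ, normOp_connesOp]
      rw [h2, map_zero, add_zero]
      exact sub_eq_of_eq_add' h1.symm

/-- The projection commutes with the differentials of the total complexes. -/
theorem mixD_toMixed (n : ℤ) : mixD E (toMixed E (n + 1) x) = toMixed E n (perD E n x) := by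
  funext q
  rw [mixD_apply]
  by_cases h : Even (n - q)
  · rw [toMixed_even E _ h, toMixed_even E _ (even_succ_sub_succ.mpr h), shiftUp_succ,
      perD_apply_even E h, map_add]
    match q with
    | 0 =>
      have : bOp E 0 (((1 - rotOp E (0 + 1)) ∘ₗ extraOp E 0) (x 0)) = x 0 - rotOp E 0 (x 0) := by
        change bOp E 0 (extraOp E 0 (x 0) - rotOp E (0 + 1) (extraOp E 0 (x 0))) = _
        rw [bOp_sub_rotOp_apply, bOp'_extraOp_zero]
      rw [this]; simp
    | q + 1 =>
      have h1 : Even (n + 1 - (q : ℤ)) := by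
        rw [even_succ_sub]; exact even_sub_succ.mp h
      have h2 : ¬ Even (n - (q : ℤ)) := even_sub_succ.mp h
      have e1 : bOp E (q + 1) (((1 - rotOp E (q + 1 + 1)) ∘ₗ extraOp E (q + 1)) (x (q + 1))) =
          (x (q + 1) - extraOp E q (bOp' E q (x (q + 1)))) -
          rotOp E (q + 1) (x (q + 1) - extraOp E q (bOp' E q (x (q + 1)))) := by
        change bOp E (q + 1) (extraOp E (q + 1) (x (q + 1)) - rotOp E (q + 1 + 1)
          (extraOp E (q + 1) (x (q + 1)))) = _
        rw [bOp_sub_rotOp_apply, ← eq_sub_of_add_eq (bOp'_extraOp E q (x (q + 1)))]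
      rw [e1, shiftUp_succ, shiftUp_succ, perD_apply_odd E h2, toMixed_even E _ h1]
      have e2 : connesOp E q (x q + shiftUp (fun q => (1 - rotOp E (q + 1)) ∘ₗ extraOp E q) x q) =
          extraOp E q (normOp E q (x q)) - rotOp E (q + 1) (extraOp E q (normOp E q (x q))) := by
        rw [map_add]
        have : connesOp E q (shiftUp (fun q => (1 - rotOp E (q + 1)) ∘ₗ extraOp E q) x q) = 0 := by
          match q with
          | 0 => simp
          | q + 1 => exact connesOp_sub_rotOp E (q + 1) _
        rw [this, add_zero, connesOp_apply]
      rw [e2]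
      change _ = _ + ((extraOp E q (normOp E q (x q) - bOp' E q (x (q + 1)))) -
        rotOp E (q + 1) (extraOp E q (normOp E q (x q) - bOp' E q (x (q + 1)))))
      simp only [map_sub]
      abel
  · rw [toMixed_odd E _ h, toMixed_odd E _ (fun h' => h (even_succ_sub_succ.mp h'))]
    match q with
    | 0 => simp
    | q + 1 =>
      rw [shiftUp_succ, toMixed_odd E _ (fun h' => ?_)]
      · simp
      · rw [even_sub_succ, not_not] at h
        exact even_succ_sub.mp h' h

/-- The homotopy between the identity of the periodic complex and its composite endomorphism through the mixed
complex, `-s` on the odd columns. -/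
def mixHtpy (n : ℤ) : (∀ q : ℕ, E.obj (Lam.ob p q)) →ₗ[k] (∀ q : ℕ, E.obj (Lam.ob p q)) :=
  LinearMap.pi fun q => if Even (n - q) then LinearMap.proj q ∘ₗ shiftUp (fun q => -extraOp E q)
    else 0

lemma mixHtpy_even (h : Even (n - q)) :
    mixHtpy E n x q = shiftUp (fun q => -extraOp E q) x q := by simp [mixHtpy, h]

lemma mixHtpy_odd (h : ¬ Even (n - q)) : mixHtpy E n x q = 0 := by simp [mixHtpy, h]

/-- A chain of degree `n + 1` differs from its image under the composite endomorphism by the boundary terms of the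
homotopy. -/
theorem fromMixed_toMixed (n : ℤ) : x = fromMixed E (n + 1) (toMixed E (n + 1) x) +
    perD E (n + 1) (mixHtpy E (n + 1) x) + mixHtpy E n (perD E n x) := by
  funext q
  simp only [Pi.add_apply]
  by_cases h : Even (n - q)
  · -- row `q` lies in an odd column of degree `n + 1`
    have h1 : ¬ Even (n + 1 - (q : ℤ)) := by rw [even_succ_sub, not_not]; exact h
    rw [fromMixed_odd E _ h1, perD_apply_odd E h1, mixHtpy_odd E _ h1, mixHtpy_even E _ h,
      mixHtpy_even E _ (even_succ_sub_succ.mpr h), shiftUp_succ]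
    match q with
    | 0 =>
      have := bOp'_extraOp_zero E (x 0)
      simp [this]
    | q + 1 =>
      have h2 : ¬ Even (n - (q : ℤ)) := even_sub_succ.mp h
      rw [shiftUp_succ, shiftUp_succ, toMixed_even E _ (even_succ_sub.mpr h2), perD_apply_odd E h2,
        LinearMap.comp_apply, map_add (normOp E q)]
      have e : normOp E q (shiftUp (fun q => (1 - rotOp E (q + 1)) ∘ₗ extraOp E q) x q) = 0 := by
        match q with
        | 0 => simp
        | q + 1 => exact normOp_sub_rotOp_apply E (q + 1) _
      rw [e]
      have := bOp'_extraOp E q (x (q + 1))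
      simp only [LinearMap.neg_apply, map_neg, map_zero, map_sub, add_zero]
      nth_rewrite 1 [← this]
      abel
  · have h1 : Even (n + 1 - (q : ℤ)) := even_succ_sub.mpr h
    rw [fromMixed_even E _ h1, perD_apply_even E h1, mixHtpy_odd E _ h, toMixed_even E _ h1,
      mixHtpy_even E _ h1, mixHtpy_odd E _ (fun h' => h (even_succ_sub_succ.mp h')), map_zero]
    match q with
    | 0 => simp
    | q + 1 =>
      rw [shiftUp_succ, shiftUp_succ]
      change _ = x (q + 1) + (extraOp E q (x q) - rotOp E (q + 1) (extraOp E q (x q))) + _ + _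
      simp only [LinearMap.neg_apply, map_neg]
      abel

end Mixed

/-! ### Tate complexes -/

section Tate

variable {k : Type*} [Field k] (p : ℕ) {V : ℕ → Type*} [∀ q, AddCommGroup (V q)]
  [∀ q, Module k (V q)] (b : ∀ q, V (q + 1) →ₗ[k] V q) (s : ∀ q, Module.End k (V q))

/-- The norm `1 + σ + ⋯ + σ ^ (p - 1)`. -/
def tateNorm (q : ℕ) : Module.End k (V q) := ∑ j ∈ Finset.range p, s q ^ j

/-- The differential of the product total complex of the Tate bicomplex of a complex `(V, b)` with an action `σ` of
`ℤ/p`: the horizontal differentials are `1 - σ` into the even and the norm into the odd columns. -/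
def tateD (n : ℤ) : (∀ q, V q) →ₗ[k] (∀ q, V q) :=
  LinearMap.pi fun q =>
    if Even (n - q) then b q ∘ₗ LinearMap.proj (q + 1) + (1 - s q) ∘ₗ LinearMap.proj q
    else tateNorm p s q ∘ₗ LinearMap.proj q - b q ∘ₗ LinearMap.proj (q + 1)

variable {n : ℤ} {q : ℕ} (x : ∀ q, V q)

lemma tateD_even (h : Even (n - q)) :
    tateD p b s n x q = b q (x (q + 1)) + (x q - s q (x q)) := by simp [tateD, h]

lemma tateD_odd (h : ¬ Even (n - q)) :
    tateD p b s n x q = tateNorm p s q (x q) - b q (x (q + 1)) := by simp [tateD, h]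

/-- The value of the Tate differential in row `q` depends only on rows `q` and `q + 1`. -/
theorem tateD_congr {x y : ∀ q, V q} (h : x q = y q) (h' : x (q + 1) = y (q + 1)) :
    tateD p b s n x q = tateD p b s n y q := by
  by_cases e : Even (n - q)
  · rw [tateD_even p b s x e, tateD_even p b s y e, h, h']
  · rw [tateD_odd p b s x e, tateD_odd p b s y e, h, h']

/-- Exactness of the product total complex of the Tate bicomplex. -/
def ProdAcyclic : Prop :=
  ∀ (n : ℤ) (x : ∀ q, V q), tateD p b s n x = 0 → ∃ y, tateD p b s (n + 1) y = x

/-- Exactness of the quotient of the product by the sum total complex of the Tate bicomplex, for a family of subspaces: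
its elements are germs of sequences at infinity. -/
def GermAcyclicOn (Y : ∀ q, Submodule k (V q)) : Prop :=
  ∀ (n : ℤ) (x : ∀ q, V q), (∀ q, x q ∈ Y q) → (∀ᶠ q in Filter.atTop, tateD p b s n x q = 0) →
    ∃ y : ∀ q, V q, (∀ q, y q ∈ Y q) ∧ ∀ᶠ q in Filter.atTop, tateD p b s (n + 1) y q = x q

/-- Exactness of the rows of the Tate bicomplex. -/
def RowsExact : Prop :=
  (∀ q (x : V q), x - s q x = 0 → ∃ y, tateNorm p s q y = x) ∧
    ∀ q (x : V q), tateNorm p s q x = 0 → ∃ y, y - s q y = x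

lemma tateNorm_eq_one_sub_mul [CharP k p] (q : ℕ) :
    tateNorm p s q = (1 - s q) * (-∑ j ∈ Finset.range p, ∑ i ∈ Finset.range j, s q ^ i) := by
  have h : ∀ j, s q ^ j = 1 + (1 - s q) * (-∑ i ∈ Finset.range j, s q ^ i) := fun j => by
    rw [mul_neg, mul_neg_geom_sum]; abel
  unfold tateNorm
  rw [Finset.sum_congr rfl fun j _ => h j, Finset.sum_add_distrib, ← Finset.mul_sum,
    Finset.sum_neg_distrib, Finset.sum_const, Finset.card_range]
  have : p • (1 : Module.End k (V q)) = 0 := by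
    ext v
    rw [LinearMap.smul_apply, ← Nat.cast_smul_eq_nsmul k, CharP.cast_eq_zero]; simp
  rw [this, zero_add]

variable {p b s}

lemma tateD_tateD (hbb : ∀ q x, b q (b (q + 1) x) = 0)
    (hbs : ∀ q x, b q (s (q + 1) x) = s q (b q x)) (hs : ∀ q, s q ^ p = 1) (n : ℤ) :
    tateD p b s n (tateD p b s (n + 1) x) = 0 := by
  have hbN : ∀ q x, b q (tateNorm p s (q + 1) x) = tateNorm p s q (b q x) := by
    intro q x
    have : ∀ j, b q ((s (q + 1) ^ j) x) = (s q ^ j) (b q x) := by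
      intro j
      induction j with
      | zero => rfl
      | succ j ih => rw [pow_succ', pow_succ', Module.End.mul_apply, hbs, ih, Module.End.mul_apply]
    simp [tateNorm, LinearMap.sum_apply, map_sum, this]
  have h1N : ∀ q x, tateNorm p s q x - s q (tateNorm p s q x) = 0 := by
    intro q x
    have : (1 - s q) * tateNorm p s q = 0 := by
      unfold tateNorm; rw [mul_neg_geom_sum, hs, sub_self]
    exact LinearMap.congr_fun this x
  have hN1 : ∀ q x, tateNorm p s q (x - s q x) = 0 := by
    intro q x
    have : tateNorm p s q * (1 - s q) = 0 := by
      unfold tateNorm; rw [geom_sum_mul_neg, hs, sub_self]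
    exact LinearMap.congr_fun this x
  funext q
  by_cases h : Even (n - q)
  · rw [tateD_even _ _ _ _ h, tateD_even _ _ _ _ (even_succ_sub_succ.mpr h),
      tateD_odd _ _ _ _ (by rw [even_succ_sub, not_not]; exact h), map_add, hbb, map_sub, hbs,
      map_sub, sub_sub_sub_comm, h1N]
    simp
  · rw [tateD_odd _ _ _ _ h, tateD_odd _ _ _ _ (fun h' => h (even_succ_sub_succ.mp h')),
      tateD_even _ _ _ _ (even_succ_sub.mpr h), map_sub, hbb, map_add, hN1, hbN]
    simp

/-- If the rows are exact and the germs at infinity are acyclic, the product total complex is exact. -/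
theorem prodAcyclic_of_germ (hbb : ∀ q x, b q (b (q + 1) x) = 0)
    (hbs : ∀ q x, b q (s (q + 1) x) = s q (b q x)) (hs : ∀ q, s q ^ p = 1)
    (hrow : RowsExact p s) (hgerm : GermAcyclicOn p b s fun _ => ⊤) : ProdAcyclic p b s := by
  classical
  intro n x hx
  obtain ⟨y₀, -, hy₀⟩ := hgerm n x (fun _ => trivial) (Filter.Eventually.of_forall fun q => by
    rw [hx]; rfl)
  obtain ⟨m, hm⟩ := Filter.eventually_atTop.mp hy₀
  -- a cycle supported in the first `m` rows is killed from the top row downwards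
  have key : ∀ (m : ℕ) (z : ∀ q, V q), (∀ q, m ≤ q → z q = 0) → tateD p b s n z = 0 →
      ∃ y, tateD p b s (n + 1) y = z := by
    intro m
    induction m with
    | zero => exact fun z hz _ => ⟨0, by funext q; rw [map_zero, hz q (Nat.zero_le q)]; rfl⟩
    | succ m ih =>
      intro z hz hDz
      have h1 : z (m + 1) = 0 := hz _ le_rfl
      have h2 := congrFun hDz m
      obtain ⟨v, hv⟩ : ∃ v : V m, tateD p b s (n + 1) (Pi.single m v) m = z m := by
        by_cases h : Even (n - m)
        · rw [tateD_even _ _ _ _ h, h1, map_zero, zero_add] at h2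
          obtain ⟨v, hv⟩ := hrow.1 m _ h2
          refine ⟨v, ?_⟩
          rw [tateD_odd _ _ _ _ (by rw [even_succ_sub, not_not]; exact h), Pi.single_eq_same,
            Pi.single_eq_of_ne (by omega), map_zero, sub_zero, hv]
        · rw [tateD_odd _ _ _ _ h, h1, map_zero, sub_zero] at h2
          obtain ⟨v, hv⟩ := hrow.2 m _ h2
          refine ⟨v, ?_⟩
          rw [tateD_even _ _ _ _ (even_succ_sub.mpr h), Pi.single_eq_same,
            Pi.single_eq_of_ne (by omega), map_zero, zero_add, hv]
      obtain ⟨y, hy⟩ := ih (z - tateD p b s (n + 1) (Pi.single m v)) (fun q hq => by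
        rcases eq_or_lt_of_le hq with rfl | hq
        · rw [Pi.sub_apply, hv, sub_self]
        · rw [Pi.sub_apply, hz q hq, tateD_congr p b s (y := 0)
            (Pi.single_eq_of_ne (by omega) _) (Pi.single_eq_of_ne (by omega) _), map_zero]
          simp) (by rw [map_sub, hDz, tateD_tateD _ hbb hbs hs, sub_zero])
      exact ⟨y + Pi.single m v, by rw [map_add, hy, sub_add_cancel]⟩
  obtain ⟨y, hy⟩ := key m (x - tateD p b s (n + 1) y₀) (fun q hq => by
    rw [Pi.sub_apply, hm q hq, sub_self]) (by rw [map_sub, hx, tateD_tateD _ hbb hbs hs, sub_zero])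
  exact ⟨y + y₀, by rw [map_add, hy, sub_add_cancel]⟩

end Tate

/-! ### The action of `ℤ/p` on a `p`-cyclic vector space -/

section Lap

variable {k : Type u} [Field k] {p : ℕ} (E : Lam p ⥤ ModuleCat.{u} k)

/-- The generator `σ = τ ^ (q + 1)` of the action of `ℤ/p` on `E([q + 1])`. -/
def lapOp (q : ℕ) : Module.End k (E.obj (Lam.ob p q)) := rotOp E q ^ (q + 1)

lemma lapOp_pow (q : ℕ) : lapOp E q ^ p = 1 := by
  rw [lapOp, ← pow_mul, mul_comm, rotOp_pow_card]

/-- The full turn of `[n]`. -/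
def PMap.turn (n : ℕ) : PMap n n := ⟨fun a => a + n, fun _ _ h => by simpa using h, fun a => by ring⟩

lemma lapOp_eq (q : ℕ) : lapOp E q =
    (E.map (X := Lam.ob p q) (Y := Lam.ob p q) (Lam.ofMap (PMap.turn (q + 1)))).hom := by
  obtain ⟨g, hg, h⟩ := rotOp_pow E q (q + 1)
  have e : g = PMap.turn (q + 1) := PMap.ext (funext hg)
  rw [lapOp, h, ← pow_mul, (Nat.even_mul_succ_self q).neg_one_pow, one_smul, e]

lemma lapOp_map {a c : ℕ} (f : PMap (a + 1) (c + 1)) (x : E.obj (Lam.ob p a)) :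
    (E.map (X := Lam.ob p a) (Y := Lam.ob p c) (Lam.ofMap f)).hom (lapOp E a x) =
      lapOp E c ((E.map (X := Lam.ob p a) (Y := Lam.ob p c) (Lam.ofMap f)).hom x) := by
  have : (Lam.ofMap (PMap.turn (a + 1)) : Lam.ob p a ⟶ Lam.ob p a) ≫
      (Lam.ofMap f : Lam.ob p a ⟶ Lam.ob p c) = (Lam.ofMap f : Lam.ob p a ⟶ Lam.ob p c) ≫
      (Lam.ofMap (PMap.turn (c + 1)) : Lam.ob p c ⟶ Lam.ob p c) :=
    congrArg (Quotient.mk _) (PMap.ext (funext fun a => f.shift a))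
  have h := congrArg (fun g => (E.map g).hom x) this
  rw [lapOp_eq, lapOp_eq]
  simpa only [E.map_comp, ModuleCat.hom_comp, LinearMap.comp_apply] using h

lemma bOp_lapOp (q : ℕ) (x : E.obj (Lam.ob p (q + 1))) :
    bOp E q (lapOp E (q + 1) x) = lapOp E q (bOp E q x) := by
  have : ∀ i, faceOp E q i (lapOp E (q + 1) x) = lapOp E q (faceOp E q i x) := fun i =>
    lapOp_map E (PMap.face (q + 1) i) x
  simp [bOp, LinearMap.sum_apply, map_sum, this]

lemma extraOp_lapOp (q : ℕ) (x : E.obj (Lam.ob p q)) :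
    extraOp E q (lapOp E q x) = lapOp E (q + 1) (extraOp E q x) := lapOp_map E (PMap.extra q) x

lemma rotOp_lapOp (q : ℕ) (x : E.obj (Lam.ob p q)) :
    rotOp E q (lapOp E q x) = lapOp E q (rotOp E q x) :=
  LinearMap.congr_fun ((Commute.refl (rotOp E q)).pow_right (q + 1)).eq x

/-- The partial norm `1 + τ + ⋯ + τ ^ q` on `E([q + 1])`. -/
def partNorm (q : ℕ) : Module.End k (E.obj (Lam.ob p q)) :=
  ∑ j ∈ Finset.range (q + 1), rotOp E q ^ j

lemma normOp_eq_tateNorm_mul (q : ℕ) : normOp E q = tateNorm p (lapOp E) q * partNorm E q := by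
  rw [normOp, sum_range_mul_pow]
  simp [tateNorm, lapOp, partNorm, pow_mul]

lemma commute_partNorm_lapOp (q : ℕ) : Commute (partNorm E q) (lapOp E q) :=
  Commute.sum_left _ _ _ fun _ _ => (Commute.refl _).pow_pow _ _

lemma partNorm_lapOp (q : ℕ) (x : E.obj (Lam.ob p q)) :
    partNorm E q (lapOp E q x) = lapOp E q (partNorm E q x) :=
  LinearMap.congr_fun (commute_partNorm_lapOp E q).eq x

lemma partNorm_sub_rotOp (q : ℕ) (x : E.obj (Lam.ob p q)) :
    partNorm E q (x - rotOp E q x) = x - lapOp E q x :=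
  LinearMap.congr_fun (geom_sum_mul_neg (rotOp E q) (q + 1)) x

lemma sub_rotOp_partNorm (q : ℕ) (x : E.obj (Lam.ob p q)) :
    partNorm E q x - rotOp E q (partNorm E q x) = x - lapOp E q x :=
  LinearMap.congr_fun (mul_neg_geom_sum (rotOp E q) (q + 1)) x

variable [NeZero p]

lemma rotOp_pow_surjective (q j : ℕ) : Function.Surjective (rotOp E q ^ j) := by
  intro x
  refine ⟨(rotOp E q ^ (p * (q + 1) * j - j)) x, ?_⟩
  have hp : 1 ≤ p * (q + 1) := Nat.mul_pos (NeZero.pos p) (Nat.succ_pos q)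
  rw [← Module.End.mul_apply, ← pow_add, Nat.add_sub_cancel' (Nat.le_mul_of_pos_left _ hp), pow_mul,
    rotOp_pow_card, one_pow]
  rfl

/-- Both sides are sums of the operators `τ ^ i m₀ τ ^ j`, and a full turn moves through `m₀`. -/
theorem bOp'_partNorm (q : ℕ) : bOp' E q ∘ₗ partNorm E (q + 1) = partNorm E q ∘ₗ bOp E q := by
  have hface : ∀ i c, i ≤ c → ((-1 : k) ^ i • faceOp E q i) ∘ₗ (rotOp E (q + 1) ^ c) =
      (rotOp E q ^ i) ∘ₗ faceOp E q 0 ∘ₗ (rotOp E (q + 1) ^ (c - i)) := by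
    intro i c hic
    conv_lhs => rw [← Nat.add_sub_cancel' hic, pow_add, Module.End.mul_eq_comp]
    rw [← LinearMap.comp_assoc, faceOp_rotOp_pow, LinearMap.comp_assoc]
  have hturn : ∀ i c, (rotOp E q ^ i) ∘ₗ faceOp E q 0 ∘ₗ (rotOp E (q + 1) ^ (q + 2 + c)) =
      (rotOp E q ^ (i + (q + 1))) ∘ₗ faceOp E q 0 ∘ₗ (rotOp E (q + 1) ^ c) := by
    intro i c
    have h := faceOp_zero_period E q 1
    rw [mul_one, mul_one] at h
    rw [pow_add (rotOp E (q + 1)), Module.End.mul_eq_comp,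
      ← LinearMap.comp_assoc (rotOp E (q + 1) ^ c) (rotOp E (q + 1) ^ (q + 2)) (faceOp E q 0), h,
      pow_add (rotOp E q) i (q + 1), Module.End.mul_eq_comp]
    simp only [LinearMap.comp_assoc]
  have h1 : (bOp' E q ∘ₗ partNorm E (q + 1)) ∘ₗ rotOp E (q + 1) ^ (q + 1) =
      ∑ w ∈ Finset.range (q + 1) ×ˢ Finset.range (q + 2),
        (rotOp E q ^ w.1) ∘ₗ faceOp E q 0 ∘ₗ (rotOp E (q + 1) ^ (q + 1 + w.2 - w.1)) := by
    rw [Finset.sum_product, bOp', sum_linComp, sum_linComp]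
    refine Finset.sum_congr rfl fun i hi => ?_
    rw [partNorm, linComp_sum, sum_linComp]
    refine Finset.sum_congr rfl fun j _ => ?_
    rw [Finset.mem_range] at hi
    rw [LinearMap.comp_assoc, ← Module.End.mul_eq_comp, ← pow_add, hface i _ (by omega),
      add_comm j]
  have h2 : (partNorm E q ∘ₗ bOp E q) ∘ₗ rotOp E (q + 1) ^ (q + 1) =
      ∑ w ∈ Finset.range (q + 1) ×ˢ Finset.range (q + 2),
        (rotOp E q ^ (w.1 + w.2)) ∘ₗ faceOp E q 0 ∘ₗ (rotOp E (q + 1) ^ (q + 1 - w.2)) := by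
    rw [Finset.sum_product, partNorm, sum_linComp, sum_linComp]
    refine Finset.sum_congr rfl fun i _ => ?_
    rw [bOp, linComp_sum, sum_linComp]
    refine Finset.sum_congr rfl fun j hj => ?_
    rw [Finset.mem_range] at hj
    rw [LinearMap.comp_assoc, hface j _ (by omega), pow_add, Module.End.mul_eq_comp,
      LinearMap.comp_assoc]
  have h3 : (bOp' E q ∘ₗ partNorm E (q + 1)) ∘ₗ rotOp E (q + 1) ^ (q + 1) =
      (partNorm E q ∘ₗ bOp E q) ∘ₗ rotOp E (q + 1) ^ (q + 1) := by
    rw [h1, h2]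
    refine Finset.sum_nbij'
      (fun w => if w.2 ≤ w.1 then (w.2, w.1 - w.2) else (w.2 - 1, q + 2 - w.2 + w.1))
      (fun w => if w.1 + w.2 ≤ q then (w.1 + w.2, w.1) else (w.1 + w.2 - (q + 1), w.1 + 1))
      ?_ ?_ ?_ ?_ ?_
    · rintro ⟨i, j⟩ h
      simp only [Finset.mem_product, Finset.mem_range] at h ⊢
      split_ifs <;> dsimp only <;> omega
    · rintro ⟨i, j⟩ h
      simp only [Finset.mem_product, Finset.mem_range] at h ⊢
      split_ifs <;> dsimp only <;> omega
    · rintro ⟨i, j⟩ h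
      simp only [Finset.mem_product, Finset.mem_range] at h
      by_cases hij : j ≤ i
      · simp only [hij, if_true]
        rw [if_pos (by omega)]
        ext <;> dsimp only; omega
      · simp only [hij, if_false]
        rw [if_neg (by omega)]
        ext <;> dsimp only <;> omega
    · rintro ⟨i, j⟩ h
      simp only [Finset.mem_product, Finset.mem_range] at h
      by_cases hij : i + j ≤ q
      · simp only [hij, if_true]
        rw [if_pos (by omega)]
        ext <;> dsimp only; omega
      · simp only [hij, if_false]
        rw [if_neg (by omega)]
        ext <;> dsimp only <;> omega
    · rintro ⟨i, j⟩ h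
      simp only [Finset.mem_product, Finset.mem_range] at h
      by_cases hij : j ≤ i
      · simp only [hij, if_true]
        rw [show j + (i - j) = i by omega, show q + 1 - (i - j) = q + 1 + j - i by omega]
      · simp only [hij, if_false]
        rw [show q + 1 + j - i = q + 2 + (j - 1 - i) by omega, hturn,
          show j - 1 + (q + 2 - j + i) = i + (q + 1) by omega,
          show q + 1 - (q + 2 - j + i) = j - 1 - i by omega]
  exact LinearMap.ext fun x => by
    obtain ⟨y, rfl⟩ := rotOp_pow_surjective E (q + 1) (q + 1) x
    exact LinearMap.congr_fun h3 y

lemma bOp'_partNorm_apply (q : ℕ) (x : E.obj (Lam.ob p (q + 1))) :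
    bOp' E q (partNorm E (q + 1) x) = partNorm E q (bOp E q x) :=
  LinearMap.congr_fun (bOp'_partNorm E q) x

/-- The operator `β = (1 - τ) s (1 + τ + ⋯ + τ ^ q)`, a homotopy between the identity and `σ`. -/
def lapHtpy (q : ℕ) : E.obj (Lam.ob p q) →ₗ[k] E.obj (Lam.ob p (q + 1)) :=
  (1 - rotOp E (q + 1)) ∘ₗ extraOp E q ∘ₗ partNorm E q

lemma lapHtpy_apply (q : ℕ) (x : E.obj (Lam.ob p q)) : lapHtpy E q x =
    extraOp E q (partNorm E q x) - rotOp E (q + 1) (extraOp E q (partNorm E q x)) := rfl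

lemma bOp_lapHtpy_zero (x : E.obj (Lam.ob p 0)) :
    bOp E 0 (lapHtpy E 0 x) = x - lapOp E 0 x := by
  rw [lapHtpy_apply, bOp_sub_rotOp_apply, bOp'_extraOp_zero, sub_rotOp_partNorm]

/-- The relation `b β + β b = 1 - σ`. -/
theorem bOp_lapHtpy (q : ℕ) (x : E.obj (Lam.ob p (q + 1))) :
    bOp E (q + 1) (lapHtpy E (q + 1) x) =
      x - lapOp E (q + 1) x - lapHtpy E q (bOp E q x) := by
  have h := bOp'_extraOp E q (partNorm E (q + 1) x)
  rw [bOp'_partNorm_apply] at h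
  rw [lapHtpy_apply, lapHtpy_apply, bOp_sub_rotOp_apply, eq_sub_of_add_eq h, map_sub,
    sub_sub_sub_comm, sub_rotOp_partNorm]

lemma connesOp_lapHtpy (q : ℕ) (x : E.obj (Lam.ob p q)) :
    connesOp E (q + 1) (lapHtpy E q x) = 0 := connesOp_sub_rotOp E (q + 1) _

lemma lapHtpy_lapOp (q : ℕ) (x : E.obj (Lam.ob p q)) :
    lapHtpy E q (lapOp E q x) = lapOp E (q + 1) (lapHtpy E q x) := by
  rw [lapHtpy_apply, lapHtpy_apply, partNorm_lapOp, extraOp_lapOp, rotOp_lapOp, map_sub]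

lemma lapHtpy_lapOp_pow (q j : ℕ) (x : E.obj (Lam.ob p q)) :
    lapHtpy E q ((lapOp E q ^ j) x) = (lapOp E (q + 1) ^ j) (lapHtpy E q x) := by
  induction j with
  | zero => rfl
  | succ j ih => rw [pow_succ', pow_succ', Module.End.mul_apply, lapHtpy_lapOp, ih,
      Module.End.mul_apply]

lemma bOp_lapOp_pow (q j : ℕ) (x : E.obj (Lam.ob p (q + 1))) :
    bOp E q ((lapOp E (q + 1) ^ j) x) = (lapOp E q ^ j) (bOp E q x) := by
  induction j with
  | zero => rfl
  | succ j ih => rw [pow_succ', pow_succ', Module.End.mul_apply, bOp_lapOp, ih,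
      Module.End.mul_apply]

lemma lapHtpy_tateNorm (q : ℕ) (x : E.obj (Lam.ob p q)) :
    lapHtpy E q (tateNorm p (lapOp E) q x) = connesOp E q x := by
  have : partNorm E q (tateNorm p (lapOp E) q x) = normOp E q x := by
    rw [normOp_eq_tateNorm_mul]
    exact LinearMap.congr_fun (Commute.sum_right _ _ _ fun j _ =>
      (commute_partNorm_lapOp E q).pow_right j).eq x
  rw [lapHtpy_apply, this, connesOp_apply]

lemma tateNorm_lapHtpy (q : ℕ) (x : E.obj (Lam.ob p q)) :
    tateNorm p (lapOp E) (q + 1) (lapHtpy E q x) = connesOp E q x := by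
  rw [← lapHtpy_tateNorm]
  simp [tateNorm, LinearMap.sum_apply, map_sum, lapHtpy_lapOp_pow]

lemma lapHtpy_connesOp (q : ℕ) (x : E.obj (Lam.ob p q)) :
    lapHtpy E (q + 1) (connesOp E q x) = 0 := by
  have h1 : lapOp E q (normOp E q x) = normOp E q x :=
    LinearMap.congr_fun (rotOp_pow_mul_normOp E q (q + 1)) x
  have : partNorm E (q + 1) (connesOp E q x) = 0 := by
    rw [connesOp_apply, partNorm_sub_rotOp, ← extraOp_lapOp, h1, sub_self]
  rw [lapHtpy_apply, this]; simp

/-- The map `x + y ↦ x + β y` from the Tate complex to the mixed complex, for `x` in the even and `y` in the odd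
columns. -/
def tateToMixed (n : ℤ) : (∀ q : ℕ, E.obj (Lam.ob p q)) →ₗ[k] (∀ q : ℕ, E.obj (Lam.ob p q)) :=
  LinearMap.pi fun q => if Even (n - q) then LinearMap.proj q +
    LinearMap.proj q ∘ₗ shiftUp (lapHtpy E) else 0

variable {n : ℤ} {q : ℕ} (x : ∀ q : ℕ, E.obj (Lam.ob p q))

lemma tateToMixed_even (h : Even (n - q)) :
    tateToMixed E n x q = x q + shiftUp (lapHtpy E) x q := by simp [tateToMixed, h]

lemma tateToMixed_odd (h : ¬ Even (n - q)) : tateToMixed E n x q = 0 := by simp [tateToMixed, h]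

lemma mixD_tateToMixed (n : ℤ) : mixD E (tateToMixed E (n + 1) x) =
    tateToMixed E n (tateD p (bOp E) (lapOp E) n x) := by
  funext q
  rw [mixD_apply]
  by_cases h : Even (n - q)
  · rw [tateToMixed_even E _ h, tateToMixed_even E _ (even_succ_sub_succ.mpr h), shiftUp_succ,
      tateD_even _ _ _ _ h, map_add]
    match q with
    | 0 => rw [bOp_lapHtpy_zero]; simp
    | q + 1 =>
      have h2 : ¬ Even (n - (q : ℤ)) := even_sub_succ.mp h
      have e : connesOp E q (shiftUp (lapHtpy E) x q) = 0 := by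
        match q with
        | 0 => simp
        | q + 1 => exact connesOp_lapHtpy E q _
      rw [shiftUp_succ, shiftUp_succ, tateD_odd _ _ _ _ h2,
        tateToMixed_even E _ (even_succ_sub.mpr h2), map_add, e, map_sub, lapHtpy_tateNorm,
        bOp_lapHtpy]
      abel
  · rw [tateToMixed_odd E _ h, tateToMixed_odd E _ (fun h' => h (even_succ_sub_succ.mp h'))]
    match q with
    | 0 => simp
    | q + 1 =>
      rw [shiftUp_succ, tateToMixed_odd E _ (fun h' => ?_)]
      · simp
      · rw [even_sub_succ, not_not] at h
        exact even_succ_sub.mp h' h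

/-- If the Tate complex of the action of `ℤ/p` is exact, so is the periodic cyclic complex: the norm of `ℤ/p` is
both an isomorphism of periodic cyclic homology, as connecting map, and zero, as `σ` is homotopic to the identity
and `p = 0`. -/
theorem perD_exact_of_prodAcyclic [CharP k p] (hT : ProdAcyclic p (bOp E) (lapOp E)) (n : ℤ)
    (hx : perD E n x = 0) : ∃ y, perD E (n + 1) y = x := by
  set X := toMixed E (n + 1) x with hX
  have hXD : mixD E X = 0 := by rw [hX, mixD_toMixed, hx, map_zero]
  set g : ∀ q, Module.End k (E.obj (Lam.ob p q)) := fun q =>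
    -∑ j ∈ Finset.range p, ∑ i ∈ Finset.range j, lapOp E q ^ i with hg
  have hgN : ∀ q y, g q y - lapOp E q (g q y) = tateNorm p (lapOp E) q y := fun q y =>
    (LinearMap.congr_fun (tateNorm_eq_one_sub_mul p (lapOp E) q) y).symm
  have hgb : ∀ q y, bOp E q (g (q + 1) y) = g q (bOp E q y) := fun q y => by
    simp [hg, LinearMap.sum_apply, map_sum, bOp_lapOp_pow]
  have hgh : ∀ q y, lapHtpy E q (g q y) = g (q + 1) (lapHtpy E q y) := fun q y => by
    simp [hg, LinearMap.sum_apply, map_sum, lapHtpy_lapOp_pow]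
  set w : ∀ q, E.obj (Lam.ob p q) := shiftUp (fun q => lapHtpy E q ∘ₗ g q) X with hw
  have hwD : ∀ q, bOp E q (w (q + 1)) + shiftUp (connesOp E) w q = tateNorm p (lapOp E) q (X q) := by
    intro q
    rw [hw, shiftUp_succ, LinearMap.comp_apply]
    match q with
    | 0 => rw [bOp_lapHtpy_zero, hgN]; simp
    | q + 1 =>
      rw [bOp_lapHtpy, hgN, hgb, shiftUp_succ]
      have h1 : bOp E q (X (q + 1)) = -shiftUp (connesOp E) X q :=
        eq_neg_of_add_eq_zero_left (congrFun hXD q)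
      have h2 : lapHtpy E q (g q (bOp E q (X (q + 1)))) = 0 := by
        rw [h1]
        match q with
        | 0 => simp
        | q + 1 => rw [shiftUp_succ, map_neg, map_neg, hgh, lapHtpy_connesOp]; simp
      rw [h2]
      match q with
      | 0 => simp
      | q + 1 =>
        rw [shiftUp_succ, LinearMap.comp_apply, connesOp_lapHtpy]
        simp
  set Z : ∀ q, E.obj (Lam.ob p q) := fun q =>
    if Even (n + 1 - q) then X q - shiftUp (lapHtpy E) w q else w q with hZ
  have hZe : ∀ q : ℕ, Even (n + 1 - q) → Z q = X q - shiftUp (lapHtpy E) w q := fun q h => if_pos h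
  have hZo : ∀ q : ℕ, ¬ Even (n + 1 - q) → Z q = w q := fun q h => if_neg h
  have hZD : tateD p (bOp E) (lapOp E) n Z = 0 := by
    funext q
    by_cases h : Even (n - q)
    · rw [tateD_even _ _ _ _ h, hZe _ (even_succ_sub_succ.mpr h),
        hZo _ (by rw [even_succ_sub, not_not]; exact h), shiftUp_succ, map_sub]
      have hXq := congrFun hXD q
      rw [mixD_apply] at hXq
      match q with
      | 0 =>
        rw [bOp_lapHtpy_zero]
        simpa using hXq
      | q + 1 =>
        have h3 : lapHtpy E q (bOp E q (w (q + 1))) = connesOp E q (X q) := by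
          rw [eq_sub_of_add_eq (hwD q), map_sub, lapHtpy_tateNorm]
          match q with
          | 0 => simp
          | q + 1 => rw [shiftUp_succ, lapHtpy_connesOp, sub_zero]
        rw [bOp_lapHtpy, h3]
        rw [shiftUp_succ] at hXq
        simp only [Pi.zero_apply] at hXq ⊢
        rw [← hXq]; abel
    · rw [tateD_odd _ _ _ _ h, hZo _ (fun h' => h (even_succ_sub_succ.mp h')),
        hZe _ (even_succ_sub.mpr h), map_sub, ← hwD]
      match q with
      | 0 => simp
      | q + 1 => rw [shiftUp_succ, shiftUp_succ, tateNorm_lapHtpy]; simp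
  obtain ⟨y, hy⟩ := hT n Z hZD
  have hpsi : tateToMixed E (n + 1) Z = X := by
    funext q
    by_cases h : Even (n + 1 - q)
    · rw [tateToMixed_even E _ h, hZe q h]
      match q with
      | 0 => simp
      | q + 1 =>
        rw [shiftUp_succ, shiftUp_succ, hZo q (even_sub_succ.mp h)]; simp
    · rw [tateToMixed_odd E _ h, hX, toMixed_odd E _ h]
  refine ⟨fromMixed E (n + 1 + 1) (tateToMixed E (n + 1 + 1) y) + mixHtpy E (n + 1) x, ?_⟩
  rw [map_add, perD_fromMixed, mixD_tateToMixed, hy, hpsi]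
  conv_rhs => rw [fromMixed_toMixed E x n, hx, map_zero, add_zero]

end Lap

/-! ### Free actions of `ℤ/p` -/

/-- Every permutation of prime order has a set of representatives of its non-trivial orbits: each point that is not
fixed is moved into it by exactly one power. -/
theorem exists_orbit_transversal {W : Type*} {p : ℕ} (hp : p.Prime) (g : W → W) (hg : g^[p] = id) :
    ∃ I : Set W, (∀ w ∈ I, g w ≠ w) ∧ ∀ w, g w ≠ w → ∃! j, j < p ∧ g^[p - j] w ∈ I := by
  have hper : ∀ w, Function.IsPeriodicPt g p w := fun w => by
    rw [Function.IsPeriodicPt, hg]; rfl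
  let r : Setoid W :=
    { r := fun v w => ∃ j, g^[j] v = w
      iseqv :=
        { refl := fun v => ⟨0, rfl⟩
          symm := fun {v w} ⟨j, hj⟩ => ⟨p * j - j, by
            rw [← hj, ← Function.iterate_add_apply,
              Nat.sub_add_cancel (Nat.le_mul_of_pos_left j hp.pos), Function.iterate_mul, hg,
              Function.iterate_id]; rfl⟩
          trans := fun {u v w} ⟨i, hi⟩ ⟨j, hj⟩ => ⟨j + i, by
            rw [Function.iterate_add_apply, hi, hj]⟩ } }
  refine ⟨{w | g w ≠ w ∧ (Quotient.mk r w).out = w}, fun w h => h.1, fun w hw => ?_⟩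
  have hmin : Function.minimalPeriod g w = p := by
    rcases (Nat.dvd_prime hp).mp (hper w).minimalPeriod_dvd with h | h
    · exact absurd (Function.minimalPeriod_eq_one_iff_isFixedPt.mp h) hw
    · exact h
  have hinj : ∀ i j, i < p → j < p → g^[i] w = g^[j] w → i = j := fun i j hi hj h =>
    Function.iterate_injOn_Iio_minimalPeriod (f := g) (x := w) (by rw [hmin]; exact hi)
      (by rw [hmin]; exact hj) h
  have hfix : ∀ j, g (g^[j] w) ≠ g^[j] w := fun j h => hw <| by
    have h1 : g^[p * j - j] (g^[j] (g w)) = g^[p * j - j] (g^[j] w) := by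
      rw [← h, ← Function.iterate_succ_apply, Function.iterate_succ_apply']
    have h2 : ∀ v, g^[p * j - j] (g^[j] v) = v := fun v => by
      rw [← Function.iterate_add_apply, Nat.sub_add_cancel (Nat.le_mul_of_pos_left j hp.pos),
        Function.iterate_mul, hg, Function.iterate_id]; rfl
    rwa [h2, h2] at h1
  obtain ⟨c, hc⟩ : ∃ c, g^[c] w = (Quotient.mk r w).out :=
    (r.iseqv.symm (Quotient.exact (Quotient.out_eq (Quotient.mk r w))) :)
  have hcm : g^[c % p] w = (Quotient.mk r w).out := by
    rw [(hper w).iterate_mod_apply, hc]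
  have hcp := Nat.mod_lt c hp.pos
  have hmk : ∀ j, (Quotient.mk r (g^[j] w)) = Quotient.mk r w := fun j =>
    Quotient.sound (r.iseqv.symm ⟨j, rfl⟩)
  have hp0 : g^[p] w = w := hper w
  refine ⟨if c % p = 0 then 0 else p - c % p, ⟨?_, hfix _, ?_⟩, ?_⟩
  · have := hp.pos
    split_ifs <;> omega
  · rw [hmk, ← hcm]
    split_ifs with h
    · rw [h, Nat.sub_zero, hp0]; rfl
    · rw [Nat.sub_sub_self hcp.le]
  · rintro j ⟨hj, -, hj'⟩
    rw [hmk, ← hcm] at hj'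
    by_cases h0 : j = 0
    · rw [h0, Nat.sub_zero, hp0] at hj'
      rw [if_pos (hinj _ 0 hcp hp.pos hj'), h0]
    · have := hinj _ _ hcp (by omega) hj'
      rw [if_neg (by omega)]
      omega

section FreePart

variable {R : Type*} [Ring R] (p : ℕ) (s θ : R)

/-- The operator `∑ σ ^ j θ σ ^ (-j)`. If it is the identity, `θ` exhibits a free action of `ℤ/p`. -/
def orbitSum : R := ∑ j ∈ Finset.range p, s ^ j * θ * s ^ (p - j)

/-- A contraction of the Tate complex of a free action. -/
def orbitHtpy : R := -∑ j ∈ Finset.range p, (∑ i ∈ Finset.range j, s ^ i) * θ * s ^ (p - j)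

variable {p s}

lemma sum_pow_sub (hs : s ^ p = 1) :
    ∑ j ∈ Finset.range p, s ^ (p - j) = ∑ j ∈ Finset.range p, s ^ j := by
  rcases p with _ | p
  · simp
  · rw [Finset.sum_range_succ' (fun j => s ^ (p + 1 - j)), Finset.sum_range_succ' (fun j => s ^ j),
      Nat.sub_zero, hs, pow_zero]
    congr 1
    rw [← Finset.sum_range_reflect]
    refine Finset.sum_congr rfl fun j hj => ?_
    rw [Finset.mem_range] at hj
    congr 1
    omega

lemma mul_norm_add_orbitHtpy (hs : s ^ p = 1) :
    θ * (∑ j ∈ Finset.range p, s ^ j) + (1 - s) * orbitHtpy p s θ = orbitSum p s θ := by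
  rw [orbitHtpy, mul_neg, Finset.mul_sum (a := 1 - s)]
  have : ∀ j, (1 - s) * ((∑ i ∈ Finset.range j, s ^ i) * θ * s ^ (p - j)) =
      θ * s ^ (p - j) - s ^ j * θ * s ^ (p - j) := fun j => by
    rw [← mul_assoc, ← mul_assoc, mul_neg_geom_sum, sub_mul, sub_mul, one_mul]
  simp only [this]
  rw [Finset.sum_sub_distrib, ← Finset.mul_sum, sum_pow_sub hs, orbitSum]
  abel

lemma norm_mul_add_orbitHtpy (hp : 0 < p) (hs : s ^ p = 1) :
    (∑ j ∈ Finset.range p, s ^ j) * (θ * s) + orbitHtpy p s θ * (1 - s) = orbitSum p s θ := by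
  obtain ⟨m, rfl⟩ : ∃ m, p = m + 1 := ⟨p - 1, by omega⟩
  have h1 : orbitHtpy (m + 1) s θ * (1 - s) =
      (∑ j ∈ Finset.range (m + 1), (∑ i ∈ Finset.range j, s ^ i) * θ * s ^ (m + 2 - j)) -
      ∑ j ∈ Finset.range (m + 1), (∑ i ∈ Finset.range j, s ^ i) * θ * s ^ (m + 1 - j) := by
    rw [orbitHtpy, neg_mul, Finset.sum_mul, ← Finset.sum_neg_distrib, ← Finset.sum_sub_distrib]
    refine Finset.sum_congr rfl fun j hj => ?_
    rw [Finset.mem_range] at hj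
    rw [mul_sub, mul_one, mul_assoc _ _ s, ← pow_succ, show m + 1 - j + 1 = m + 2 - j by omega]
    abel
  have h2 : ∑ j ∈ Finset.range (m + 1), (∑ i ∈ Finset.range j, s ^ i) * θ * s ^ (m + 2 - j) =
      ∑ j ∈ Finset.range m, (∑ i ∈ Finset.range (j + 1), s ^ i) * θ * s ^ (m + 1 - j) := by
    rw [Finset.sum_range_succ', Finset.sum_range_zero]
    simp only [zero_mul, add_zero]
    exact Finset.sum_congr rfl fun j hj => by rw [show m + 2 - (j + 1) = m + 1 - j by omega]
  rw [h1, h2, Finset.sum_range_succ (fun j => (∑ i ∈ Finset.range j, s ^ i) * θ * s ^ (m + 1 - j)),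
    orbitSum, Finset.sum_range_succ (fun j => s ^ j * θ * s ^ (m + 1 - j)), Finset.sum_range_succ,
    show m + 1 - m = 1 by omega, pow_one]
  have : ∀ j, (∑ i ∈ Finset.range (j + 1), s ^ i) * θ * s ^ (m + 1 - j) =
      (∑ i ∈ Finset.range j, s ^ i) * θ * s ^ (m + 1 - j) + s ^ j * θ * s ^ (m + 1 - j) := fun j => by
    rw [Finset.sum_range_succ, add_mul, add_mul]
  simp only [this]
  rw [Finset.sum_add_distrib, add_mul]
  noncomm_ring

end FreePart

/-! ### Pure tensors -/

section Pure

variable {k : Type*} [Field k] {ι : Type*} [Fintype ι]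

/-- Pure tensors of elements of spans lie in the span of the pure tensors of generators. -/
theorem tprod_mem_span {M : ι → Type*} [∀ i, AddCommGroup (M i)] [∀ i, Module k (M i)]
    (G : ∀ i, Set (M i)) (x : ∀ i, M i) (hx : ∀ i, x i ∈ Submodule.span k (G i)) :
    PiTensorProduct.tprod k x ∈
      Submodule.span k (PiTensorProduct.tprod k '' {a | ∀ i, a i ∈ G i}) := by
  classical
  have key : ∀ (s : Finset ι) (x : ∀ i, M i), (∀ i ∈ s, x i ∈ Submodule.span k (G i)) →
      (∀ i ∉ s, x i ∈ G i) → PiTensorProduct.tprod k x ∈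
        Submodule.span k (PiTensorProduct.tprod k '' {a | ∀ i, a i ∈ G i}) := by
    intro s
    induction s using Finset.induction_on with
    | empty => exact fun x _ h => Submodule.subset_span ⟨x, fun i => h i (by simp), rfl⟩
    | insert i₀ s hi₀ ih =>
      intro x h1 h2
      rw [← Function.update_eq_self i₀ x]
      refine Submodule.span_induction (p := fun v _ => PiTensorProduct.tprod k (Function.update x i₀ v) ∈
        Submodule.span k (PiTensorProduct.tprod k '' {a | ∀ i, a i ∈ G i})) ?_ ?_ ?_ ?_
        (h1 i₀ (by simp))
      · intro v hv
        refine ih _ (fun i hi => ?_) fun i hi => ?_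
        · rw [Function.update_of_ne (by rintro rfl; exact hi₀ hi)]
          exact h1 i (by simp [hi])
        · by_cases e : i = i₀
          · subst e; rwa [Function.update_self]
          · rw [Function.update_of_ne e]
            exact h2 i (by simp [hi, e])
      · rw [(PiTensorProduct.tprod k).map_update_zero]; exact Submodule.zero_mem _
      · intro v w _ _ hv hw
        rw [(PiTensorProduct.tprod k).map_update_add]; exact Submodule.add_mem _ hv hw
      · intro c v _ hv
        rw [(PiTensorProduct.tprod k).map_update_smul]; exact Submodule.smul_mem _ _ hv
  exact key Finset.univ x (fun i _ => hx i) (fun i h => absurd (Finset.mem_univ i) h)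

end Pure

section Naturality

variable {k : Type u} [Field k] {A B : Type u} [Ring A] [Algebra k A] [Ring B] [Algebra k B]

lemma map_iprod {M N : Type*} [Monoid M] [Monoid N] (f : M →* N) (a : ℤ → M) (x y : ℤ) :
    f (iprod a x y) = iprod (fun i => f (a i)) x y := by
  unfold iprod
  rw [map_list_prod, List.map_map]
  rfl

lemma fibreProd_map {M N : Type*} [Monoid M] [Monoid N] {n m : ℕ} (f : M →* N) (g : PMap n m)
    (a : ZMod n → M) : fibreProd g (fun i => f (a i)) = fun j => f (fibreProd g a j) :=
  funext fun _ => (map_iprod f _ _ _).symm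

lemma tensorMap_map (f : A →ₐ[k] B) {n m : ℕ} [NeZero n] [NeZero m] (g : PMap n m)
    (x : ⨂[k] _ : ZMod n, A) : tensorMap k B g (PiTensorProduct.map (fun _ => f.toLinearMap) x) =
      PiTensorProduct.map (fun _ => f.toLinearMap) (tensorMap k A g x) := by
  have : tensorMap k B g ∘ₗ PiTensorProduct.map (fun _ => f.toLinearMap) =
      PiTensorProduct.map (fun _ => f.toLinearMap) ∘ₗ tensorMap k A g :=
    PiTensorProduct.ext (MultilinearMap.ext fun a => by
      simp only [LinearMap.compMultilinearMap_apply, LinearMap.comp_apply, PiTensorProduct.map_tprod,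
        tensorMap_tprod]
      exact congrArg _ (fibreProd_map (f : A →* B) g a))
  exact LinearMap.congr_fun this x

/-- The morphism of cyclic vector spaces induced by a homomorphism of algebras. -/
def cyclicObjectMap (f : A →ₐ[k] B) : cyclicObject k A ⟶ cyclicObject k B where
  app X := ModuleCat.ofHom (PiTensorProduct.map (R := k) (ι := ZMod X.len) (fun _ => f.toLinearMap))
  naturality X Y g := by
    induction g using Quotient.ind with | _ g
    exact ModuleCat.hom_ext (LinearMap.ext fun x => (tensorMap_map f g x).symm)

end Naturality

/-! ### Tate complexes with a free filtration -/

section Filtered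

variable {k : Type*} [Field k] {p : ℕ} {V : ℕ → Type*} [∀ q, AddCommGroup (V q)]
  [∀ q, Module k (V q)] {b : ∀ q, V (q + 1) →ₗ[k] V q} {s : ∀ q, Module.End k (V q)}

lemma pow_comm_of_comm {V W : Type*} [AddCommGroup V] [AddCommGroup W] [Module k V] [Module k W]
    {s : Module.End k V} {t : Module.End k W} {f : V →ₗ[k] W} (h : ∀ x, f (s x) = t (f x)) (j : ℕ)
    (x : V) : f ((s ^ j) x) = (t ^ j) (f x) := by
  induction j with
  | zero => rfl
  | succ j ih => rw [pow_succ', pow_succ', Module.End.mul_apply, h, ih, Module.End.mul_apply]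

variable (p b s) in
/-- A decomposition of a complex with an action `σ` of `ℤ/p` into pieces that are permuted by `σ`. The pieces have a
weight, `b` is triangular, and the pieces of weight strictly between `0` and `d` are permuted freely. -/
structure FreePieces (J : Type) [Fintype J] [DecidableEq J] (d : ℕ) where
  /-- The projections to the pieces. -/
  π : ∀ q, J → Module.End k (V q)
  /-- The weights. -/
  c : J → ℕ
  /-- The permutation of the pieces by `σ`. -/
  ρ : Equiv.Perm J
  orth : ∀ q I I' x, π q I (π q I' x) = if I = I' then π q I x else 0
  equivariant : ∀ q I x, s q (π q I x) = π q (ρ I) (s q x)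
  triangular : ∀ q I I' x, c I' ≤ c I → I ≠ I' → π q I (b q (π (q + 1) I' x)) = 0
  stable : ∀ q I x, ∑ I', π q I' (b q (π (q + 1) I x)) = b q (π (q + 1) I x)
  weight : ∀ I, c (ρ I) = c I
  iterate : ρ^[p] = id
  free : ∀ I, 0 < c I → c I < d → ρ I ≠ I

namespace FreePieces

variable {J : Type} [Fintype J] [DecidableEq J] {d : ℕ} (P : FreePieces p b s J d)

/-- The sum of the pieces of weight at most `j`. -/
def filt (j q : ℕ) : Submodule k (V q) :=
  (⨅ I : {I // j < P.c I}, LinearMap.ker (P.π q I)) ⊓ LinearMap.ker (∑ I, P.π q I - 1)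

lemma mem_filt {j q : ℕ} {x : V q} :
    x ∈ P.filt j q ↔ (∀ I, j < P.c I → P.π q I x = 0) ∧ ∑ I, P.π q I x = x := by
  simp [filt, sub_eq_zero, LinearMap.sum_apply]

lemma filt_mono {i j q : ℕ} (h : i ≤ j) : P.filt i q ≤ P.filt j q := fun x hx => by
  rw [mem_filt] at hx ⊢
  exact ⟨fun I hI => hx.1 I (by omega), hx.2⟩

lemma piece_mem_filt {j q : ℕ} {I : J} (hI : P.c I ≤ j) (x : V q) : P.π q I x ∈ P.filt j q := by
  rw [mem_filt]
  refine ⟨fun I' h => ?_, ?_⟩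
  · rw [P.orth, if_neg (by rintro rfl; omega)]
  · rw [Finset.sum_eq_single I (fun I' _ h => by rw [P.orth, if_neg h])
      (fun h => absurd (Finset.mem_univ _) h), P.orth, if_pos rfl]

lemma b_mem_filt {j q : ℕ} {x : V (q + 1)} (hx : x ∈ P.filt j (q + 1)) : b q x ∈ P.filt j q := by
  rw [mem_filt] at hx ⊢
  constructor
  · intro I hI
    rw [← hx.2, map_sum, map_sum]
    refine Finset.sum_eq_zero fun I' _ => ?_
    by_cases h : j < P.c I'
    · rw [hx.1 I' h, map_zero, map_zero]
    · exact P.triangular q I I' x (by omega) (by rintro rfl; omega)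
  · conv_rhs => rw [← hx.2]
    conv_lhs => rw [← hx.2]
    simp only [map_sum]
    rw [Finset.sum_comm]
    exact Finset.sum_congr rfl fun I _ => P.stable q I x

lemma piece_s (q : ℕ) (I : J) (x : V q) : P.π q I (s q x) = s q (P.π q (P.ρ.symm I) x) := by
  rw [P.equivariant, Equiv.apply_symm_apply]

lemma weight_symm (I : J) : P.c (P.ρ.symm I) = P.c I := by
  rw [← P.weight, Equiv.apply_symm_apply]

lemma s_mem_filt {j q : ℕ} {x : V q} (hx : x ∈ P.filt j q) : s q x ∈ P.filt j q := by
  rw [mem_filt] at hx ⊢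
  constructor
  · intro I hI
    rw [piece_s, hx.1 _ (by rwa [weight_symm]), map_zero]
  · simp only [piece_s]
    rw [Equiv.sum_comp P.ρ.symm (fun I => s q (P.π q I x)), ← map_sum, hx.2]

lemma pow_mem_filt {j q : ℕ} {x : V q} (hx : x ∈ P.filt j q) (i : ℕ) :
    (s q ^ i) x ∈ P.filt j q := by
  induction i with
  | zero => exact hx
  | succ i ih => rw [pow_succ', Module.End.mul_apply]; exact P.s_mem_filt ih

lemma tateD_mem_filt {j : ℕ} {x : ∀ q, V q} (hx : ∀ q, x q ∈ P.filt j q) (n : ℤ) (q : ℕ) :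
    tateD p b s n x q ∈ P.filt j q := by
  by_cases h : Even (n - q)
  · rw [tateD_even _ _ _ _ h]
    exact Submodule.add_mem _ (P.b_mem_filt (hx _))
      (Submodule.sub_mem _ (hx q) (P.s_mem_filt (hx q)))
  · rw [tateD_odd _ _ _ _ h, tateNorm, LinearMap.sum_apply]
    exact Submodule.sub_mem _ (Submodule.sum_mem _ fun i _ => P.pow_mem_filt (hx q) i)
      (P.b_mem_filt (hx _))

open scoped Classical in
/-- The projection to the pieces of weight `j` that lie in a set `T`. -/
def part (T : Set J) (j q : ℕ) : Module.End k (V q) :=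
  ∑ I, if I ∈ T ∧ P.c I = j then P.π q I else 0

open scoped Classical in
lemma part_apply (T : Set J) (j q : ℕ) (x : V q) :
    P.part T j q x = ∑ I, if I ∈ T ∧ P.c I = j then P.π q I x else 0 := by
  rw [part, LinearMap.sum_apply]
  exact Finset.sum_congr rfl fun I _ => by split_ifs <;> rfl

open scoped Classical in
lemma piece_part (T : Set J) (j q : ℕ) (I : J) (x : V q) :
    P.π q I (P.part T j q x) = if I ∈ T ∧ P.c I = j then P.π q I x else 0 := by
  rw [part_apply, map_sum, Finset.sum_eq_single I]
  · split_ifs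
    · rw [P.orth, if_pos rfl]
    · rw [map_zero]
  · intro I' _ h
    split_ifs
    · rw [P.orth, if_neg h.symm]
    · rw [map_zero]
  · exact fun h => absurd (Finset.mem_univ _) h

lemma part_mem_filt (T : Set J) (j q : ℕ) (x : V q) : P.part T j q x ∈ P.filt j q := by
  classical
  rw [part_apply]
  refine Submodule.sum_mem _ fun I _ => ?_
  split_ifs with h
  · exact P.piece_mem_filt h.2.le x
  · exact Submodule.zero_mem _

lemma part_univ_part (T : Set J) (j q : ℕ) (x : V q) :
    P.part Set.univ j q (P.part T j q x) = P.part T j q x := by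
  classical
  rw [part_apply, part_apply]
  refine Finset.sum_congr rfl fun I _ => ?_
  rw [← part_apply, piece_part]
  by_cases h : P.c I = j
  · rw [if_pos ⟨trivial, h⟩]
  · rw [if_neg (fun e => h e.2), if_neg (fun e => h e.2)]

lemma part_univ_s (j q : ℕ) (x : V q) :
    P.part Set.univ j q (s q x) = s q (P.part Set.univ j q x) := by
  classical
  rw [part_apply, part_apply, map_sum, ← Equiv.sum_comp P.ρ]
  refine Finset.sum_congr rfl fun I _ => ?_
  rw [P.weight, ← P.equivariant, apply_ite (s q), map_zero]
  rfl

/-- On the top graded piece, `b` is diagonal. -/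
theorem piece_b {j q : ℕ} {x : V (q + 1)} (hx : x ∈ P.filt j (q + 1)) {I : J} (hI : P.c I = j) :
    P.π q I (b q x) = P.π q I (b q (P.π (q + 1) I x)) := by
  rw [mem_filt] at hx
  have e : P.π q I (b q x) = ∑ I', P.π q I (b q (P.π (q + 1) I' x)) := by
    rw [← map_sum, ← map_sum, hx.2]
  rw [e]
  refine Finset.sum_eq_single I (fun I' _ h => ?_) fun h => absurd (Finset.mem_univ I) h
  by_cases h' : j < P.c I'
  · rw [hx.1 I' h', map_zero, map_zero]
  · exact P.triangular q I I' x (by omega) h.symm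

lemma part_univ_b_part (T : Set J) {j q : ℕ} {x : V (q + 1)} (hx : x ∈ P.filt j (q + 1)) :
    P.part Set.univ j q (b q (P.part T j (q + 1) x)) = P.part T j q (b q x) := by
  classical
  rw [part_apply P Set.univ, part_apply P T j q (b q x)]
  refine Finset.sum_congr rfl fun I _ => ?_
  by_cases h : P.c I = j
  · rw [if_pos ⟨trivial, h⟩, P.piece_b (P.part_mem_filt _ _ _ _) h, piece_part]
    by_cases h' : I ∈ T
    · rw [if_pos ⟨h', h⟩, if_pos ⟨h', h⟩, ← P.piece_b hx h]
    · rw [if_neg (fun e => h' e.1), if_neg (fun e => h' e.1), map_zero, map_zero]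
  · rw [if_neg (fun e => h e.2), if_neg (fun e => h e.2)]

lemma iterate_symm (i : ℕ) (hi : i ≤ p) (I : J) : P.ρ^[p - i] (P.ρ^[i] I) = I := by
  rw [← Function.iterate_add_apply, Nat.sub_add_cancel hi, P.iterate]; rfl

/-- Along a set of representatives of the orbits of pieces of weight `j`, the orbit sum is the projection to weight
`j`. -/
theorem exists_orbitSum (hp : p.Prime) (hs : ∀ q, s q ^ p = 1) :
    ∃ T : Set J, ∀ j, 0 < j → j < d → ∀ q,
      orbitSum p (s q) (P.part T j q) = P.part Set.univ j q := by
  classical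
  obtain ⟨T, -, hT⟩ := exists_orbit_transversal hp P.ρ P.iterate
  have hc : ∀ i I, P.c (P.ρ^[i] I) = P.c I := fun i I => by
    induction i with
    | zero => rfl
    | succ i ih => rw [Function.iterate_succ_apply', P.weight, ih]
  have heq : ∀ i q I x, (s q ^ i) (P.π q I x) = P.π q (P.ρ^[i] I) ((s q ^ i) x) := fun i q I x => by
    induction i with
    | zero => rfl
    | succ i ih => rw [pow_succ', Module.End.mul_apply, ih, P.equivariant,
        Function.iterate_succ_apply', Module.End.mul_apply]
  refine ⟨T, fun j hj hjd q => LinearMap.ext fun x => ?_⟩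
  have h1 : ∀ i ∈ Finset.range p, (s q ^ i * P.part T j q * s q ^ (p - i)) x =
      ∑ I, if P.ρ^[p - i] I ∈ T ∧ P.c I = j then P.π q I x else 0 := by
    intro i hi
    rw [Finset.mem_range] at hi
    rw [Module.End.mul_apply, Module.End.mul_apply, part_apply, map_sum,
      ← Equiv.sum_comp (P.ρ ^ i) (fun I => if P.ρ^[p - i] I ∈ T ∧ P.c I = j then P.π q I x else 0)]
    refine Finset.sum_congr rfl fun I _ => ?_
    rw [← Equiv.Perm.iterate_eq_pow, P.iterate_symm i hi.le, hc]
    split_ifs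
    · rw [heq, ← Module.End.mul_apply (s q ^ i), ← pow_add, Nat.add_sub_cancel' hi.le, hs]; rfl
    · rw [map_zero]
  rw [orbitSum, LinearMap.sum_apply, Finset.sum_congr rfl h1, Finset.sum_comm, part_apply]
  refine Finset.sum_congr rfl fun I _ => ?_
  by_cases h : P.c I = j
  · obtain ⟨i, ⟨hi, hiT⟩, huniq⟩ := hT I (P.free I (by omega) (by omega))
    rw [if_pos ⟨trivial, h⟩, Finset.sum_eq_single i]
    · rw [if_pos ⟨hiT, h⟩]
    · exact fun i' hi' hne => if_neg fun e => hne (huniq i' ⟨Finset.mem_range.mp hi', e.1⟩)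
    · exact fun h' => absurd (Finset.mem_range.mpr hi) h'
  · rw [if_neg (fun e => h e.2)]
    exact Finset.sum_eq_zero fun i _ => if_neg fun e => h e.2

lemma part_univ_pow (j q i : ℕ) (x : V q) :
    P.part Set.univ j q ((s q ^ i) x) = (s q ^ i) (P.part Set.univ j q x) :=
  pow_comm_of_comm (P.part_univ_s j q) i x

lemma part_univ_b_orbitHtpy (hbs : ∀ q x, b q (s (q + 1) x) = s q (b q x)) (T : Set J)
    {j q : ℕ} {x : V (q + 1)} (hx : x ∈ P.filt j (q + 1)) :
    P.part Set.univ j q (b q (orbitHtpy p (s (q + 1)) (P.part T j (q + 1)) x)) =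
      orbitHtpy p (s q) (P.part T j q) (b q x) := by
  simp only [orbitHtpy, LinearMap.neg_apply, LinearMap.sum_apply, Module.End.mul_apply, map_neg,
    map_sum, pow_comm_of_comm (hbs q), part_univ_pow, P.part_univ_b_part T (P.pow_mem_filt hx _)]

/-- Germs of cycles of weight less than `d` are homologous to germs of cycles of weight `0`: the graded pieces
in between are free over `ℤ/p`. -/
theorem exists_weight_zero (hp : p.Prime) (hs : ∀ q, s q ^ p = 1)
    (hbs : ∀ q x, b q (s (q + 1) x) = s q (b q x)) (hbb : ∀ q x, b q (b (q + 1) x) = 0)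
    (n : ℤ) (j : ℕ) (hj : j < d) (x : ∀ q, V q) (hx : ∀ q, x q ∈ P.filt j q)
    (hDx : ∀ᶠ q in Filter.atTop, tateD p b s n x q = 0) :
    ∃ y : ∀ q, V q, (∀ q, y q ∈ P.filt j q) ∧
      ∀ᶠ q in Filter.atTop, x q - tateD p b s (n + 1) y q ∈ P.filt 0 q := by
  classical
  obtain ⟨T, hT⟩ := P.exists_orbitSum hp hs
  induction j generalizing x with
  | zero => exact ⟨0, fun q => Submodule.zero_mem _, Filter.Eventually.of_forall fun q => by
      rw [map_zero]; simpa using hx q⟩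
  | succ j ih =>
    set θ := fun q => P.part T (j + 1) q with hθ
    set y₁ : ∀ q, V q := fun q => if Even (n - q) then θ q (s q (x q))
      else orbitHtpy p (s q) (θ q) (x q) with hy₁
    have hye : ∀ q : ℕ, Even (n - q) → y₁ q = θ q (s q (x q)) := fun q h => if_pos h
    have hyo : ∀ q : ℕ, ¬ Even (n - q) → y₁ q = orbitHtpy p (s q) (θ q) (x q) := fun q h => if_neg h
    have hy₁F : ∀ q, y₁ q ∈ P.filt (j + 1) q := by
      intro q
      by_cases h : Even (n - q)
      · rw [hye q h]; exact P.part_mem_filt _ _ _ _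
      · rw [hyo q h, orbitHtpy, LinearMap.neg_apply, LinearMap.sum_apply]
        refine Submodule.neg_mem _ (Submodule.sum_mem _ fun i _ => ?_)
        rw [Module.End.mul_apply, Module.End.mul_apply, LinearMap.sum_apply]
        exact Submodule.sum_mem _ fun l _ => P.pow_mem_filt (P.part_mem_filt _ _ _ _) _
    have hsum : ∀ q v, orbitSum p (s q) (θ q) v = P.part Set.univ (j + 1) q v := fun q v => by
      rw [hT (j + 1) (by omega) hj q]
    have e1 : ∀ q v, θ q (tateNorm p s q v) + (orbitHtpy p (s q) (θ q) v -
        s q (orbitHtpy p (s q) (θ q) v)) = P.part Set.univ (j + 1) q v := fun q v => by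
      rw [← hsum, ← mul_norm_add_orbitHtpy _ (hs q)]; rfl
    have e2 : ∀ q v, tateNorm p s q (θ q (s q v)) + orbitHtpy p (s q) (θ q) (v - s q v) =
        P.part Set.univ (j + 1) q v := fun q v => by
      rw [← hsum, ← norm_mul_add_orbitHtpy _ hp.pos (hs q)]; rfl
    have hNs : ∀ q v, s q (tateNorm p s q v) = tateNorm p s q v := fun q v => by
      have h : (1 - s q) * tateNorm p s q = 0 := by
        rw [tateNorm, mul_neg_geom_sum, hs, sub_self]
      exact (sub_eq_zero.mp (LinearMap.congr_fun h v)).symm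
    have hpN : ∀ q v, P.part Set.univ (j + 1) q (tateNorm p s q v) =
        tateNorm p s q (P.part Set.univ (j + 1) q v) := fun q v => by
      simp [tateNorm, LinearMap.sum_apply, map_sum, part_univ_pow]
    have hpS : ∀ q v, P.part Set.univ (j + 1) q (orbitHtpy p (s q) (θ q) v) =
        orbitHtpy p (s q) (θ q) v := fun q v => by
      simp [orbitHtpy, LinearMap.sum_apply, map_sum, part_univ_pow, hθ, part_univ_part]
    have key : ∀ q, tateD p b s n x q = 0 →
        P.part Set.univ (j + 1) q (tateD p b s (n + 1) y₁ q) = P.part Set.univ (j + 1) q (x q) := by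
      intro q h0
      by_cases h : Even (n - q)
      · rw [tateD_even _ _ _ _ h] at h0
        rw [tateD_odd _ _ _ _ (by rw [even_succ_sub, not_not]; exact h), hye q h,
          hyo (q + 1) (by rw [even_sub_succ, not_not]; exact h), map_sub,
          P.part_univ_b_orbitHtpy hbs T (hx _), hpN, hθ, part_univ_part,
          eq_neg_of_add_eq_zero_left h0, map_neg, sub_neg_eq_add, e2]
      · rw [tateD_odd _ _ _ _ h, sub_eq_zero] at h0
        rw [tateD_even _ _ _ _ (even_succ_sub.mpr h), hyo q h, hye (q + 1) (even_sub_succ.mpr h),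
          map_add, map_sub, part_univ_s, hpS, hθ,
          P.part_univ_b_part T (P.s_mem_filt (hx _)), hbs, ← h0, hNs, e1]
    obtain ⟨m, hm⟩ := Filter.eventually_atTop.mp hDx
    have hz : ∀ q, m ≤ q → x q - tateD p b s (n + 1) y₁ q ∈ P.filt j q := by
      intro q hq
      have h1 := Submodule.sub_mem _ (hx q) (P.tateD_mem_filt hy₁F (n + 1) q)
      have h2 := key q (hm q hq)
      rw [mem_filt] at h1 ⊢
      refine ⟨fun I hI => ?_, h1.2⟩
      rcases eq_or_lt_of_le (Nat.succ_le_of_lt hI) with h | h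
      · have h3 := P.piece_part Set.univ (j + 1) q I (x q - tateD p b s (n + 1) y₁ q)
        rw [map_sub (P.part Set.univ (j + 1) q), h2, sub_self, map_zero,
          if_pos ⟨trivial, h.symm⟩] at h3
        exact h3.symm
      · exact h1.1 I h
    obtain ⟨y, hyF, hy⟩ := ih (by omega)
      (fun q => if m ≤ q then x q - tateD p b s (n + 1) y₁ q else 0)
      (fun q => by
        split_ifs with h
        · exact hz q h
        · exact Submodule.zero_mem _)
      (by
        filter_upwards [hDx, Filter.eventually_ge_atTop m] with q h1 h2
        rw [tateD_congr p b s (y := x - tateD p b s (n + 1) y₁) (if_pos h2)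
          (if_pos (h2.trans q.le_succ)), map_sub, tateD_tateD _ hbb hbs hs, sub_zero, h1])
    refine ⟨y + y₁, fun q => Submodule.add_mem _ (P.filt_mono (Nat.le_succ j) (hyF q)) (hy₁F q), ?_⟩
    filter_upwards [hy, Filter.eventually_ge_atTop m] with q h1 h2
    rw [if_pos h2] at h1
    rw [map_add, Pi.add_apply, add_comm, ← sub_sub]
    exact h1

end FreePieces

end Filtered

/-! ### Square-zero extensions by bimodules -/

/-- The square-zero extension `A ⊕ M` of an algebra `A` by an `A`-bimodule `M`, given as a module over
`A ⊗ Aᵐᵒᵖ`. -/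
@[ext]
structure SqExt (k A M : Type u) where
  fst : A
  snd : M

namespace SqExt

variable {k : Type u} [Field k] {A : Type u} [Ring A] [Algebra k A] {M : Type u} [AddCommGroup M]
  [Module (A ⊗[k] Aᵐᵒᵖ) M]

variable (k A M) in
/-- The underlying set of a square-zero extension is a product. -/
def equivProd : SqExt k A M ≃ A × M := ⟨fun x => (x.1, x.2), fun x => ⟨x.1, x.2⟩, fun _ => rfl, fun _ => rfl⟩

instance : AddCommGroup (SqExt k A M) := (equivProd k A M).addCommGroup

lemma left_left_smul (a a' : A) (m : M) : (a ⊗ₜ[k] (1 : Aᵐᵒᵖ)) • (a' ⊗ₜ[k] (1 : Aᵐᵒᵖ)) • m =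
    ((a * a') ⊗ₜ[k] (1 : Aᵐᵒᵖ)) • m := by
  rw [← mul_smul, Algebra.TensorProduct.tmul_mul_tmul, one_mul]

lemma right_right_smul (a a' : A) (m : M) : ((1 : A) ⊗ₜ[k] MulOpposite.op a) •
    ((1 : A) ⊗ₜ[k] MulOpposite.op a') • m = ((1 : A) ⊗ₜ[k] MulOpposite.op (a' * a)) • m := by
  rw [← mul_smul, Algebra.TensorProduct.tmul_mul_tmul, one_mul, MulOpposite.op_mul]

lemma left_right_smul (a a' : A) (m : M) : (a ⊗ₜ[k] (1 : Aᵐᵒᵖ)) •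
    ((1 : A) ⊗ₜ[k] MulOpposite.op a') • m = (a ⊗ₜ[k] MulOpposite.op a') • m := by
  rw [← mul_smul, Algebra.TensorProduct.tmul_mul_tmul, one_mul, mul_one]

lemma right_left_smul (a a' : A) (m : M) : ((1 : A) ⊗ₜ[k] MulOpposite.op a') •
    (a ⊗ₜ[k] (1 : Aᵐᵒᵖ)) • m = (a ⊗ₜ[k] MulOpposite.op a') • m := by
  rw [← mul_smul, Algebra.TensorProduct.tmul_mul_tmul, one_mul, mul_one]

instance : Mul (SqExt k A M) := ⟨fun x y => ⟨x.1 * y.1,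
  (x.1 ⊗ₜ[k] (1 : Aᵐᵒᵖ)) • y.2 + ((1 : A) ⊗ₜ[k] MulOpposite.op y.1) • x.2⟩⟩

instance : One (SqExt k A M) := ⟨⟨1, 0⟩⟩

lemma mul_fst (x y : SqExt k A M) : (x * y).1 = x.1 * y.1 := rfl

lemma mul_snd (x y : SqExt k A M) : (x * y).2 =
    (x.1 ⊗ₜ[k] (1 : Aᵐᵒᵖ)) • y.2 + ((1 : A) ⊗ₜ[k] MulOpposite.op y.1) • x.2 := rfl

lemma one_fst : (1 : SqExt k A M).1 = 1 := rfl

lemma one_snd : (1 : SqExt k A M).2 = 0 := rfl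

instance : Ring (SqExt k A M) :=
  { (inferInstance : AddCommGroup (SqExt k A M)) with
    mul_assoc := fun x y z => by
      refine SqExt.ext (mul_assoc _ _ _) ?_
      simp only [mul_snd, mul_fst, smul_add, left_left_smul, right_right_smul, left_right_smul,
        right_left_smul, add_assoc]
    one_mul := fun x => by
      refine SqExt.ext (one_mul _) ?_
      rw [mul_snd, one_fst, one_snd, ← Algebra.TensorProduct.one_def, one_smul, smul_zero, add_zero]
    mul_one := fun x => by
      refine SqExt.ext (mul_one _) ?_
      rw [mul_snd, one_fst, one_snd, MulOpposite.op_one, ← Algebra.TensorProduct.one_def, one_smul,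
        smul_zero, zero_add]
    left_distrib := fun x y z => by
      refine SqExt.ext (mul_add _ _ _) ?_
      change _ • (y.2 + z.2) + (1 ⊗ₜ MulOpposite.op (y.1 + z.1)) • x.2 = _ + _ + (_ + _)
      rw [MulOpposite.op_add, TensorProduct.tmul_add, add_smul, smul_add]
      abel
    right_distrib := fun x y z => by
      refine SqExt.ext (add_mul _ _ _) ?_
      change ((x.1 + y.1) ⊗ₜ[k] (1 : Aᵐᵒᵖ)) • z.2 + _ • (x.2 + y.2) = _ + _ + (_ + _)
      rw [TensorProduct.add_tmul, add_smul, smul_add]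
      abel
    zero_mul := fun x => by
      refine SqExt.ext (zero_mul _) ?_
      change ((0 : A) ⊗ₜ[k] (1 : Aᵐᵒᵖ)) • x.2 + _ • (0 : M) = 0
      have h : ((0 : A) ⊗ₜ[k] (1 : Aᵐᵒᵖ)) • x.2 = 0 :=
        (congrArg (· • x.2) (TensorProduct.zero_tmul _ _)).trans (zero_smul (A ⊗[k] Aᵐᵒᵖ) x.2)
      rw [h, smul_zero, add_zero]
    mul_zero := fun x => by
      refine SqExt.ext (mul_zero _) ?_
      change _ • (0 : M) + (1 ⊗ₜ MulOpposite.op (0 : A)) • x.2 = 0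
      have h : ((1 : A) ⊗ₜ[k] (0 : Aᵐᵒᵖ)) • x.2 = 0 :=
        (congrArg (· • x.2) (TensorProduct.tmul_zero _ _)).trans (zero_smul (A ⊗[k] Aᵐᵒᵖ) x.2)
      rw [MulOpposite.op_zero, h, smul_zero, add_zero] }

variable [Module k M] [IsScalarTower k (A ⊗[k] Aᵐᵒᵖ) M]

instance : Module k (SqExt k A M) := (equivProd k A M).module k

lemma smul_fst (c : k) (x : SqExt k A M) : (c • x).1 = c • x.1 := rfl

lemma smul_snd (c : k) (x : SqExt k A M) : (c • x).2 = c • x.2 := rfl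

lemma smul_comm_env (c : k) (s : A ⊗[k] Aᵐᵒᵖ) (m : M) : s • c • m = c • s • m := by
  rw [← algebraMap_smul (A ⊗[k] Aᵐᵒᵖ) c m, ← algebraMap_smul (A ⊗[k] Aᵐᵒᵖ) c (s • m), ← mul_smul,
    ← mul_smul, Algebra.commutes]

instance : Algebra k (SqExt k A M) := Algebra.ofModule
  (fun c x y => SqExt.ext (smul_mul_assoc _ _ _) (by
    rw [mul_snd, smul_snd, smul_fst, smul_snd, mul_snd, smul_add, ← TensorProduct.smul_tmul',
      smul_assoc, smul_comm_env]))
  (fun c x y => SqExt.ext (mul_smul_comm _ _ _) (by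
    rw [mul_snd, smul_snd, smul_fst, smul_snd, mul_snd, smul_add, MulOpposite.op_smul,
      TensorProduct.tmul_smul, smul_assoc, smul_comm_env]))

/-- The inclusion of `A`. -/
def inl (a : A) : SqExt k A M := ⟨a, 0⟩

/-- The inclusion of `M`. -/
def inr (m : M) : SqExt k A M := ⟨0, m⟩

lemma inl_mul_inl (a a' : A) : (inl a * inl a' : SqExt k A M) = inl (a * a') :=
  SqExt.ext rfl (by rw [mul_snd]; change _ • (0 : M) + _ • (0 : M) = 0; simp)

lemma inl_mul_inr (a : A) (m : M) :
    (inl a * inr m : SqExt k A M) = inr ((a ⊗ₜ[k] (1 : Aᵐᵒᵖ)) • m) :=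
  SqExt.ext (mul_zero a) (by rw [mul_snd]; change _ + _ • (0 : M) = _; rw [smul_zero, add_zero]; rfl)

lemma inr_mul_inl (a : A) (m : M) :
    (inr m * inl a : SqExt k A M) = inr (((1 : A) ⊗ₜ[k] MulOpposite.op a) • m) :=
  SqExt.ext (zero_mul a) (by rw [mul_snd]; change _ • (0 : M) + _ = _; rw [smul_zero, zero_add]; rfl)

variable {N : Type u} [AddCommGroup N] [Module (A ⊗[k] Aᵐᵒᵖ) N] [Module k N]
  [IsScalarTower k (A ⊗[k] Aᵐᵒᵖ) N]

/-- Square-zero extensions are functorial in the bimodule. -/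
def map (g : M →ₗ[A ⊗[k] Aᵐᵒᵖ] N) : SqExt k A M →ₐ[k] SqExt k A N :=
  AlgHom.ofLinearMap
    { toFun := fun x => ⟨x.1, g x.2⟩
      map_add' := fun x y => SqExt.ext rfl (map_add g _ _)
      map_smul' := fun c x => SqExt.ext rfl ((g.restrictScalars k).map_smul c x.2) }
    (SqExt.ext rfl (map_zero g)) fun x y => SqExt.ext rfl (by
      change g _ = _
      rw [mul_snd, map_add, map_smul, map_smul]
      rfl)

lemma map_inl (g : M →ₗ[A ⊗[k] Aᵐᵒᵖ] N) (a : A) : map g (inl a) = inl a :=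
  SqExt.ext rfl (map_zero g)

lemma map_inr (g : M →ₗ[A ⊗[k] Aᵐᵒᵖ] N) (m : M) : map g (inr m) = inr (g m) := rfl

end SqExt

/-! ### Words with one letter from a bimodule in each block -/

section Slot

variable {r : ℕ} [NeZero r]

/-- The positions in `ℤ/r(q + 1)` are divided into `r` blocks of length `q + 1`. The first position of the block number
`t` is its slot; `slot i` is `t` if `i` is this position, and `none` if `i` is not a slot. -/
def slot (r q : ℕ) (i : ZMod (r * (q + 1))) : Option (ZMod r) :=
  if (q + 1) ∣ i.val then some ((i.val / (q + 1) : ℕ) : ZMod r) else none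

lemma slot_mul (q : ℕ) (t : ℤ) :
    slot r q ((((q + 1 : ℕ) : ℤ) * t : ℤ) : ZMod (r * (q + 1))) = some (t : ZMod r) := by
  have hr := NeZero.pos r
  set z : ℤ := ((q + 1 : ℕ) : ℤ) * t with hz
  have hv : ((z : ZMod (r * (q + 1))).val : ℤ) = ((q + 1 : ℕ) : ℤ) * (t % r) := by
    rw [ZMod.val_intCast, hz]
    push_cast
    rw [mul_comm (r : ℤ), Int.mul_emod_mul_of_pos _ _ (by positivity)]
  obtain ⟨v, hv'⟩ : ∃ v : ℕ, (v : ℤ) = t % r :=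
    ⟨(t % r).toNat, Int.toNat_of_nonneg (Int.emod_nonneg _ (by exact_mod_cast hr.ne'))⟩
  have hv2 : (z : ZMod (r * (q + 1))).val = (q + 1) * v := by
    rw [← hv'] at hv; exact_mod_cast hv
  rw [slot, hv2, if_pos (dvd_mul_right _ _), Nat.mul_div_cancel_left _ q.succ_pos]
  congr 1
  rw [← Int.cast_natCast, hv', ZMod.intCast_mod]

lemma slot_of_not_dvd {q : ℕ} {z : ℤ} (h : ¬ ((q + 1 : ℕ) : ℤ) ∣ z) :
    slot r q (z : ZMod (r * (q + 1))) = none := by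
  refine if_neg fun h' => h ?_
  have h1 := Int.natCast_dvd_natCast.mpr h'
  rw [ZMod.val_intCast, Int.dvd_iff_emod_eq_zero, Int.emod_emod_of_dvd _ (by simp)] at h1
  exact Int.dvd_iff_emod_eq_zero.mpr h1

lemma slot_sub (q : ℕ) (i : ZMod (r * (q + 1))) :
    slot r q (i - ((q + 1 : ℕ) : ZMod (r * (q + 1)))) = (slot r q i).map fun t => t - 1 := by
  obtain ⟨z, rfl⟩ := ZMod.intCast_surjective i
  by_cases h : ((q + 1 : ℕ) : ℤ) ∣ z
  · obtain ⟨t, rfl⟩ := h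
    have := slot_mul (r := r) q (t - 1)
    rw [slot_mul, Option.map_some]
    rw [mul_sub, mul_one] at this
    push_cast at this ⊢
    exact this
  · rw [slot_of_not_dvd h, Option.map_none]
    have := slot_of_not_dvd (r := r) (q := q) (z := z - ((q + 1 : ℕ) : ℤ))
      (fun h' => h ((dvd_sub_self_right).mp h'))
    push_cast at this ⊢
    exact this

lemma exists_slot (q : ℕ) (t : ZMod r) : ∃ i, slot r q i = some t := by
  obtain ⟨z, rfl⟩ := ZMod.intCast_surjective t
  exact ⟨_, slot_mul q z⟩

lemma slot_injective {q : ℕ} {i j : ZMod (r * (q + 1))} {t : ZMod r} (hi : slot r q i = some t)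
    (hj : slot r q j = some t) : i = j := by
  have key : ∀ i : ZMod (r * (q + 1)), slot r q i = some t →
      ∃ z : ℤ, i = ((((q + 1 : ℕ) : ℤ) * z : ℤ) : ZMod (r * (q + 1))) ∧ (z : ZMod r) = t := by
    intro i hi
    obtain ⟨z, rfl⟩ := ZMod.intCast_surjective i
    by_cases h : ((q + 1 : ℕ) : ℤ) ∣ z
    · obtain ⟨z, rfl⟩ := h
      rw [slot_mul] at hi
      exact ⟨z, rfl, Option.some.inj hi⟩
    · rw [slot_of_not_dvd h] at hi
      exact absurd hi (by simp)
  obtain ⟨z, rfl, hz⟩ := key i hi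
  obtain ⟨z', rfl, hz'⟩ := key j hj
  rw [ZMod.intCast_eq_intCast_iff_dvd_sub]
  rw [← hz', ZMod.intCast_eq_intCast_iff_dvd_sub] at hz
  obtain ⟨c, hc⟩ := hz
  exact ⟨c, by rw [← mul_sub, hc]; push_cast; ring⟩

end Slot

section Blocks

variable (r : ℕ) [NeZero r] (k : Type u) [Field k] (B : Type u) [Ring B] [Algebra k B]

/-- The `r`-cyclic vector space `[n] ↦ B^{⊗ rn}`. -/
abbrev blockObject : Lam r ⥤ ModuleCat.{u} k := Lam.incl r ⋙ cyclicObject k B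

/-- The pure tensors in `B^{⊗ r(q + 1)}`. -/
def word (q : ℕ) : MultilinearMap k (fun _ : ZMod (r * (q + 1)) => B)
    ((blockObject r k B).obj (Lam.ob r q)) := PiTensorProduct.tprod k

variable {r k B}

lemma map_word {a c : ℕ} (f : PMap (a + 1) (c + 1)) (w : ZMod (r * (a + 1)) → B) :
    ((blockObject r k B).map (X := Lam.ob r a) (Y := Lam.ob r c) (Lam.ofMap f)).hom
      (word r k B a w) = word r k B c (fibreProd (f.dilate r) w) :=
  tensorMap_tprod k B (f.dilate r) w

lemma fibreProd_of_add {M : Type*} [Monoid M] {n : ℕ} [NeZero n] (f : PMap n n) (c : ℤ)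
    (h : ∀ x, f.toFun x = x + c) (w : ZMod n → M) :
    fibreProd f w = fun j => w (j - (c : ZMod n)) := by
  funext j
  have hl : ∀ j, f.lower j = j - c := fun j => eq_of_forall_ge_iff fun i => by
    rw [f.lower_le_iff (NeZero.pos n), h]; constructor <;> intro h <;> linarith
  rw [fibreProd, hl, hl, show ((j.val : ℤ) + 1 - c) = j.val - c + 1 by ring, iprod_single]
  push_cast
  simp

lemma lapOp_word (q : ℕ) (w : ZMod (r * (q + 1)) → B) :
    lapOp (blockObject r k B) q (word r k B q w) =
      word r k B q fun j => w (j - ((q + 1 : ℕ) : ZMod (r * (q + 1)))) := by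
  rw [lapOp_eq, map_word, fibreProd_of_add _ ((q + 1 : ℕ) : ℤ) fun x => rfl]
  simp

end Blocks

section NaturalTate

variable {k : Type u} [Field k] {p : ℕ}

lemma tateD_map {V V' : ℕ → Type*} [∀ q, AddCommGroup (V q)] [∀ q, Module k (V q)]
    [∀ q, AddCommGroup (V' q)] [∀ q, Module k (V' q)] {b : ∀ q, V (q + 1) →ₗ[k] V q}
    {s : ∀ q, Module.End k (V q)} {b' : ∀ q, V' (q + 1) →ₗ[k] V' q} {s' : ∀ q, Module.End k (V' q)}
    (f : ∀ q, V q →ₗ[k] V' q) (hb : ∀ q x, b' q (f (q + 1) x) = f q (b q x))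
    (hs : ∀ q x, s' q (f q x) = f q (s q x)) (n : ℤ) (x : ∀ q, V q) (q : ℕ) :
    tateD p b' s' n (fun q => f q (x q)) q = f q (tateD p b s n x q) := by
  by_cases h : Even (n - q)
  · rw [tateD_even _ _ _ _ h, tateD_even _ _ _ _ h, hb, hs, map_add, map_sub]
  · have hN : tateNorm p s' q (f q (x q)) = f q (tateNorm p s q (x q)) := by
      simp only [tateNorm, LinearMap.sum_apply, map_sum]
      exact Finset.sum_congr rfl fun j _ => (pow_comm_of_comm (fun x => (hs q x).symm) j _).symm
    rw [tateD_odd _ _ _ _ h, tateD_odd _ _ _ _ h, hb, hN, map_sub]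

variable {r : ℕ} {E E' : Lam r ⥤ ModuleCat.{u} k} (α : E ⟶ E')

lemma bOp_app (q : ℕ) (x : E.obj (Lam.ob r (q + 1))) :
    bOp E' q ((α.app (Lam.ob r (q + 1))).hom x) = (α.app (Lam.ob r q)).hom (bOp E q x) :=
  LinearMap.congr_fun (bOp_naturality α q) x

lemma lapOp_app (q : ℕ) (x : E.obj (Lam.ob r q)) :
    lapOp E' q ((α.app (Lam.ob r q)).hom x) = (α.app (Lam.ob r q)).hom (lapOp E q x) :=
  LinearMap.congr_fun (rotOp_pow_naturality α q (q + 1)) x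

end NaturalTate

section WordMaps

variable (r : ℕ) [NeZero r] (k : Type u) [Field k] (B : Type u) [Ring B] [Algebra k B]

variable {r k B} {B' : Type u} [Ring B'] [Algebra k B']

/-- Linear maps that agree on words are equal. -/
theorem word_ext {q : ℕ} {W : Type*} [AddCommGroup W] [Module k W]
    {f g : (blockObject r k B).obj (Lam.ob r q) →ₗ[k] W}
    (h : ∀ w, f (word r k B q w) = g (word r k B q w)) (x : (blockObject r k B).obj (Lam.ob r q)) :
    f x = g x :=
  LinearMap.congr_fun (PiTensorProduct.ext (MultilinearMap.ext h) : f = g) x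

/-- The tensor product of linear maps, one for each position. -/
def wordMap {q : ℕ} (f : ZMod (r * (q + 1)) → B →ₗ[k] B') :
    (blockObject r k B).obj (Lam.ob r q) →ₗ[k] (blockObject r k B').obj (Lam.ob r q) :=
  PiTensorProduct.map (R := k) f

lemma wordMap_word {q : ℕ} (f : ZMod (r * (q + 1)) → B →ₗ[k] B') (w : ZMod (r * (q + 1)) → B) :
    wordMap f (word r k B q w) = word r k B' q fun i => f i (w i) := PiTensorProduct.map_tprod f w

/-- The morphism of `r`-cyclic vector spaces induced by a homomorphism of algebras. -/
def blockMap (r : ℕ) [NeZero r] (f : B →ₐ[k] B') : blockObject r k B ⟶ blockObject r k B' :=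
  Functor.whiskerLeft (Lam.incl r) (cyclicObjectMap f)

lemma blockMap_word (f : B →ₐ[k] B') (q : ℕ) (w : ZMod (r * (q + 1)) → B) :
    ((blockMap r f).app (Lam.ob r q)).hom (word r k B q w) = word r k B' q fun i => f (w i) :=
  PiTensorProduct.map_tprod (fun _ => f.toLinearMap) w

end WordMaps

section GoodWords

variable {r : ℕ} [NeZero r] {k : Type u} [Field k] {A : Type u} [Ring A] [Algebra k A]
  {M : Type u} [AddCommGroup M] [Module (A ⊗[k] Aᵐᵒᵖ) M]

/-- The letters that are allowed at a position: elements of `A` outside the slots, elements of the submodule `T t` of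
`M` in the slot of the block number `t`. -/
def letters (T : ZMod r → Submodule (A ⊗[k] Aᵐᵒᵖ) M) : Option (ZMod r) → Set (SqExt k A M)
  | none => Set.range SqExt.inl
  | some t => SqExt.inr '' (T t : Set M)

lemma iprod_mem_letters_none [Module k M] [IsScalarTower k (A ⊗[k] Aᵐᵒᵖ) M] (T : ZMod r → Submodule (A ⊗[k] Aᵐᵒᵖ) M) (w : ℤ → SqExt k A M)
    {x y : ℤ} (hxy : x ≤ y) (h : ∀ z, x ≤ z → z < y → w z ∈ letters T none) :
    iprod w x y ∈ letters T none := by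
  obtain ⟨c, rfl⟩ : ∃ c : ℕ, y = x + c := ⟨(y - x).toNat, by omega⟩
  induction c with
  | zero => exact ⟨1, by simp [iprod_self]; rfl⟩
  | succ c ih =>
    obtain ⟨a, ha⟩ := ih (by omega) fun z h1 h2 => h z h1 (by push_cast; omega)
    obtain ⟨a', ha'⟩ := h (x + c) (by omega) (by push_cast; omega)
    refine ⟨a * a', ?_⟩
    rw [← iprod_mul _ (y := x + c) (by omega) (by push_cast; omega),
      show x + ((c + 1 : ℕ) : ℤ) = x + c + 1 by push_cast; ring, iprod_single, ← ha, ← ha',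
      SqExt.inl_mul_inl]

lemma iprod_mem_letters_some [Module k M] [IsScalarTower k (A ⊗[k] Aᵐᵒᵖ) M]
    (T : ZMod r → Submodule (A ⊗[k] Aᵐᵒᵖ) M) (w : ℤ → SqExt k A M)
    {x y z₀ : ℤ} (h1 : x ≤ z₀) (h2 : z₀ < y) {t : ZMod r} (h0 : w z₀ ∈ letters T (some t))
    (h : ∀ z, x ≤ z → z < y → z ≠ z₀ → w z ∈ letters T none) :
    iprod w x y ∈ letters T (some t) := by
  obtain ⟨a, ha⟩ := iprod_mem_letters_none T w h1 fun z h3 h4 => h z h3 (by omega) (by omega)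
  obtain ⟨a', ha'⟩ := iprod_mem_letters_none T w (x := z₀ + 1) (y := y) (by omega)
    fun z h3 h4 => h z (by omega) (by omega) (by omega)
  obtain ⟨m, hm, hm'⟩ := h0
  rw [← iprod_mul w (y := z₀ + 1) (by omega) (by omega), ← iprod_mul w h1 (by omega), iprod_single,
    ← ha, ← ha', ← hm', SqExt.inl_mul_inr, SqExt.inr_mul_inl]
  exact ⟨_, (T t).smul_mem _ ((T t).smul_mem _ hm), rfl⟩

variable [Module k M] [IsScalarTower k (A ⊗[k] Aᵐᵒᵖ) M]

/-- Words with allowed letters. -/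
def goodWords (T : ZMod r → Submodule (A ⊗[k] Aᵐᵒᵖ) M) (q : ℕ) :
    Set (ZMod (r * (q + 1)) → SqExt k A M) := {w | ∀ i, w i ∈ letters T (slot r q i)}

lemma fibreProd_mem_goodWords {T : ZMod r → Submodule (A ⊗[k] Aᵐᵒᵖ) M} {a c : ℕ}
    (f : PMap (a + 1) (c + 1)) (hf : f.toFun 0 = 0) {w : ZMod (r * (a + 1)) → SqExt k A M}
    (hw : w ∈ goodWords T a) : fibreProd (f.dilate r) w ∈ goodWords T c := by
  intro j
  have hm : 0 < r * (c + 1) := NeZero.pos _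
  obtain ⟨J, rfl⟩ := ZMod.intCast_surjective j
  have hft : ∀ t : ℤ, f.toFun (((a + 1 : ℕ) : ℤ) * t) = ((c + 1 : ℕ) : ℤ) * t := fun t => by
    have := f.shift_mul 0 t
    rw [hf, zero_add, zero_add] at this
    rw [mul_comm, this, mul_comm]
  rw [fibreProd_intCast]
  have hmem := fun z => PMap.mem_fibre_iff hm (f.dilate r) z J
  have hle : (f.dilate r).lower J ≤ (f.dilate r).lower (J + 1) := PMap.lower_mono hm _ (by omega)
  by_cases h : ((c + 1 : ℕ) : ℤ) ∣ J
  · obtain ⟨t, rfl⟩ := h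
    obtain ⟨h1, h2⟩ := (hmem (((a + 1 : ℕ) : ℤ) * t)).mpr (hft t)
    rw [slot_mul]
    refine iprod_mem_letters_some T _ h1 h2 ?_ fun z h3 h4 h5 => ?_
    · have := hw ((((a + 1 : ℕ) : ℤ) * t : ℤ) : ZMod (r * (a + 1)))
      rwa [slot_mul] at this
    · have := hw (z : ZMod (r * (a + 1)))
      rwa [slot_of_not_dvd] at this
      rintro ⟨t', rfl⟩
      have h6 := (hmem _).mp ⟨h3, h4⟩
      change f.toFun _ = _ at h6
      rw [hft] at h6
      exact h5 (by rw [mul_left_cancel₀ (by positivity) h6])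
  · rw [slot_of_not_dvd h]
    refine iprod_mem_letters_none T _ hle fun z h3 h4 => ?_
    have := hw (z : ZMod (r * (a + 1)))
    rwa [slot_of_not_dvd] at this
    rintro ⟨t', rfl⟩
    have h6 := (hmem _).mp ⟨h3, h4⟩
    change f.toFun _ = _ at h6
    rw [hft] at h6
    exact h ⟨t', h6.symm⟩

/-- The span of the words with allowed letters. -/
def goodSpan (T : ZMod r → Submodule (A ⊗[k] Aᵐᵒᵖ) M) (q : ℕ) :
    Submodule k ((blockObject r k (SqExt k A M)).obj (Lam.ob r q)) :=
  Submodule.span k (word r k (SqExt k A M) q '' goodWords T q)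

lemma word_mem_goodSpan {T : ZMod r → Submodule (A ⊗[k] Aᵐᵒᵖ) M} {q : ℕ}
    {w : ZMod (r * (q + 1)) → SqExt k A M} (hw : w ∈ goodWords T q) :
    word r k (SqExt k A M) q w ∈ goodSpan T q := Submodule.subset_span ⟨w, hw, rfl⟩

lemma goodSpan_le {T : ZMod r → Submodule (A ⊗[k] Aᵐᵒᵖ) M} {q : ℕ}
    {Y : Submodule k ((blockObject r k (SqExt k A M)).obj (Lam.ob r q))}
    (h : ∀ w ∈ goodWords T q, word r k (SqExt k A M) q w ∈ Y) : goodSpan T q ≤ Y :=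
  Submodule.span_le.mpr (by rintro _ ⟨w, hw, rfl⟩; exact h w hw)

lemma bOp_mem_goodSpan {T : ZMod r → Submodule (A ⊗[k] Aᵐᵒᵖ) M} {q : ℕ}
    {x : (blockObject r k (SqExt k A M)).obj (Lam.ob r (q + 1))} (hx : x ∈ goodSpan T (q + 1)) :
    bOp (blockObject r k (SqExt k A M)) q x ∈ goodSpan T q := by
  refine goodSpan_le (Y := (goodSpan T q).comap (bOp (blockObject r k (SqExt k A M)) q))
    (fun w hw => ?_) hx
  rw [Submodule.mem_comap, bOp, LinearMap.sum_apply]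
  refine Submodule.sum_mem _ fun i hi => ?_
  rw [LinearMap.smul_apply, faceOp, map_word]
  refine Submodule.smul_mem _ _ ?_
  rw [Finset.mem_range] at hi
  exact word_mem_goodSpan (fibreProd_mem_goodWords _
    (PMap.face_of_le (by omega) le_rfl (by positivity)) hw)

lemma lapOp_mem_goodSpan {q : ℕ}
    {x : (blockObject r k (SqExt k A M)).obj (Lam.ob r q)}
    (hx : x ∈ goodSpan (M := M) (fun _ => ⊤) q) :
    lapOp (blockObject r k (SqExt k A M)) q x ∈ goodSpan (M := M) (fun _ => ⊤) q := by
  refine goodSpan_le (Y := (goodSpan (M := M) (fun _ => ⊤) q).comap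
    (lapOp (blockObject r k (SqExt k A M)) q)) (fun w hw => ?_) hx
  rw [Submodule.mem_comap, lapOp_word]
  refine word_mem_goodSpan fun j => ?_
  have := hw (j - ((q + 1 : ℕ) : ZMod (r * (q + 1))))
  rw [slot_sub] at this
  revert this
  cases slot r q j <;> exact id

lemma tateD_mem_goodSpan (p : ℕ) {x : ∀ q, (blockObject r k (SqExt k A M)).obj (Lam.ob r q)}
    (hx : ∀ q, x q ∈ goodSpan (M := M) (fun _ => ⊤) q) (n : ℤ) (q : ℕ) :
    tateD p (bOp (blockObject r k (SqExt k A M))) (lapOp (blockObject r k (SqExt k A M))) n x q ∈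
      goodSpan (M := M) (fun _ => ⊤) q := by
  have hpow : ∀ j, (lapOp (blockObject r k (SqExt k A M)) q ^ j) (x q) ∈
      goodSpan (M := M) (fun _ => ⊤) q := fun j => by
    induction j with
    | zero => exact hx q
    | succ j ih => rw [pow_succ', Module.End.mul_apply]; exact lapOp_mem_goodSpan ih
  by_cases h : Even (n - q)
  · rw [tateD_even _ _ _ _ h]
    exact Submodule.add_mem _ (bOp_mem_goodSpan (hx _))
      (Submodule.sub_mem _ (hx q) (lapOp_mem_goodSpan (hx q)))
  · rw [tateD_odd _ _ _ _ h, tateNorm, LinearMap.sum_apply]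
    exact Submodule.sub_mem _ (Submodule.sum_mem _ fun i _ => hpow i) (bOp_mem_goodSpan (hx _))

end GoodWords

/-- Acyclicity of the germs at infinity of the Tate complex of `M ⊗_A ⋯ ⊗_A M` (`r` factors, cyclically), computed by
the words with letters from `M` in the slots and letters from `A` elsewhere. -/
def BimodAcyclic (p r : ℕ) [NeZero r] (k A M : Type u) [Field k] [Ring A] [Algebra k A]
    [AddCommGroup M] [Module (A ⊗[k] Aᵐᵒᵖ) M] [Module k M] [IsScalarTower k (A ⊗[k] Aᵐᵒᵖ) M] :
    Prop :=
  GermAcyclicOn p (bOp (blockObject r k (SqExt k A M))) (lapOp (blockObject r k (SqExt k A M)))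
    (goodSpan (M := M) (fun _ => ⊤))

/-! ### Dévissage along a short exact sequence of bimodules -/

section Devissage

variable {r : ℕ} [NeZero r] {k : Type u} [Field k] {A : Type u} [Ring A] [Algebra k A]
  {M : Type u} [AddCommGroup M] [Module (A ⊗[k] Aᵐᵒᵖ) M] [Module k M]
  [IsScalarTower k (A ⊗[k] Aᵐᵒᵖ) M]
  {N : Type u} [AddCommGroup N] [Module (A ⊗[k] Aᵐᵒᵖ) N] [Module k N]
  [IsScalarTower k (A ⊗[k] Aᵐᵒᵖ) N]

/-- The linear map that forgets the `M`-part and applies `0` to it, or keeps only the `M`-part and applies a linear map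
to it. -/
def letterMap (h : ZMod r → M →ₗ[k] N) : Option (ZMod r) → SqExt k A M →ₗ[k] SqExt k A N
  | none =>
    { toFun := fun x => SqExt.inl x.1
      map_add' := fun _ _ => SqExt.ext rfl (add_zero (0 : N)).symm
      map_smul' := fun c _ => SqExt.ext rfl (smul_zero c).symm }
  | some t =>
    { toFun := fun x => SqExt.inr (h t x.2)
      map_add' := fun x y => SqExt.ext (add_zero (0 : A)).symm (map_add (h t) x.2 y.2)
      map_smul' := fun c x => SqExt.ext (smul_zero c).symm (map_smul (h t) c x.2) }

lemma letterMap_some (h : ZMod r → M →ₗ[k] N) (t : ZMod r) (x : SqExt k A M) :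
    letterMap h (some t) x = SqExt.inr (h t x.2) := rfl

/-- On words: the letters in the slots are projected to `M` and mapped by linear maps, the other letters are projected
to `A`. -/
def slotMap (h : ZMod r → M →ₗ[k] N) (q : ℕ) :
    (blockObject r k (SqExt k A M)).obj (Lam.ob r q) →ₗ[k]
      (blockObject r k (SqExt k A N)).obj (Lam.ob r q) :=
  wordMap fun i => letterMap h (slot r q i)

lemma slotMap_word (h : ZMod r → M →ₗ[k] N) (q : ℕ) (w : ZMod (r * (q + 1)) → SqExt k A M) :
    slotMap h q (word r k (SqExt k A M) q w) =
      word r k (SqExt k A N) q fun i => letterMap h (slot r q i) (w i) := wordMap_word _ w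

lemma slotMap_mem (h : ZMod r → M →ₗ[k] N) {T : ZMod r → Submodule (A ⊗[k] Aᵐᵒᵖ) N}
    (hT : ∀ t m, h t m ∈ T t) (q : ℕ) (x) : slotMap (A := A) h q x ∈ goodSpan T q := by
  have : ⊤ ≤ (goodSpan T q).comap (slotMap (A := A) h q) := by
    have e : Submodule.span k (Set.range (word r k (SqExt k A M) q)) = ⊤ :=
      PiTensorProduct.span_tprod_eq_top
    rw [← e, Submodule.span_le]
    rintro _ ⟨w, rfl⟩
    change slotMap h q _ ∈ goodSpan T q
    rw [slotMap_word]
    refine word_mem_goodSpan fun i => ?_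
    rcases slot r q i with _ | t
    · exact ⟨_, rfl⟩
    · exact ⟨_, hT t _, rfl⟩
  exact this trivial

lemma slotMap_slotMap {L : Type u} [AddCommGroup L] [Module (A ⊗[k] Aᵐᵒᵖ) L] [Module k L]
    [IsScalarTower k (A ⊗[k] Aᵐᵒᵖ) L] (h : ZMod r → M →ₗ[k] N) (h' : ZMod r → N →ₗ[k] L) (q : ℕ)
    (x) : slotMap h' q (slotMap (A := A) h q x) = slotMap (fun t => h' t ∘ₗ h t) q x := by
  refine word_ext (f := slotMap h' q ∘ₗ slotMap (A := A) h q) (fun w => ?_) x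
  rw [LinearMap.comp_apply, slotMap_word, slotMap_word, slotMap_word]
  congr 1
  funext i
  rcases slot r q i with _ | t <;> rfl

lemma slotMap_eq_zero (h : ZMod r → M →ₗ[k] N) {t : ZMod r} (ht : h t = 0) (q : ℕ) (x) :
    slotMap (A := A) h q x = 0 := by
  refine word_ext (g := 0) (fun w => ?_) x
  obtain ⟨i, hi⟩ := exists_slot (r := r) q t
  rw [slotMap_word, LinearMap.zero_apply]
  refine MultilinearMap.map_coord_zero _ i ?_
  rw [hi, letterMap_some, ht]
  rfl

/-- On words with allowed letters, only the values on the allowed letters matter. -/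
theorem slotMap_congr {h h' : ZMod r → M →ₗ[k] N} {T : ZMod r → Submodule (A ⊗[k] Aᵐᵒᵖ) M}
    (hh : ∀ t, ∀ m ∈ T t, h t m = h' t m) {q : ℕ} {x} (hx : x ∈ goodSpan T q) :
    slotMap (A := A) h q x = slotMap h' q x := by
  refine goodSpan_le (Y := LinearMap.eqLocus (slotMap (A := A) h q) (slotMap h' q)) (fun w hw => ?_) hx
  change slotMap h q _ = slotMap h' q _
  rw [slotMap_word, slotMap_word]
  congr 1
  funext i
  have := hw i
  revert this
  rcases slot r q i with _ | t
  · exact fun _ => rfl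
  · rintro ⟨m, hm, e⟩
    rw [letterMap_some, letterMap_some, ← e]
    exact congrArg SqExt.inr (hh t m hm)

lemma slotMap_id {T : ZMod r → Submodule (A ⊗[k] Aᵐᵒᵖ) M} {q : ℕ} {x} (hx : x ∈ goodSpan T q) :
    slotMap (A := A) (fun _ => LinearMap.id) q x = x := by
  refine goodSpan_le (Y := LinearMap.eqLocus (slotMap (A := A) (fun _ => LinearMap.id) q)
    LinearMap.id) (fun w hw => ?_) hx
  change slotMap (fun _ => LinearMap.id) q _ = word r k _ q w
  rw [slotMap_word]
  congr 1
  funext i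
  have := hw i
  revert this
  rcases slot r q i with _ | t
  · rintro ⟨a, e⟩
    rw [← e]; rfl
  · rintro ⟨m, hm, e⟩
    rw [← e]; rfl

/-- The morphism of `r`-cyclic vector spaces induced by a map of bimodules, on words with allowed letters. -/
theorem blockMap_eq_slotMap (g : M →ₗ[A ⊗[k] Aᵐᵒᵖ] N) {T : ZMod r → Submodule (A ⊗[k] Aᵐᵒᵖ) M}
    {q : ℕ} {x} (hx : x ∈ goodSpan T q) : ((blockMap r (SqExt.map g)).app (Lam.ob r q)).hom x =
      slotMap (A := A) (fun _ => g.restrictScalars k) q x := by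
  refine goodSpan_le (Y := LinearMap.eqLocus ((blockMap r (SqExt.map g)).app (Lam.ob r q)).hom
    (slotMap (A := A) (fun _ => g.restrictScalars k) q)) (fun w hw => ?_) hx
  change ((blockMap r (SqExt.map g)).app (Lam.ob r q)).hom _ = _
  rw [blockMap_word, slotMap_word]
  congr 1
  funext i
  have := hw i
  revert this
  rcases slot r q i with _ | t
  · rintro ⟨a, e⟩
    rw [← e, SqExt.map_inl]; rfl
  · rintro ⟨m, hm, e⟩
    rw [← e]; rfl

lemma lapOp_slotMap (h : ZMod r → M →ₗ[k] N) (q : ℕ) (x) :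
    lapOp (blockObject r k (SqExt k A N)) q (slotMap (A := A) h q x) =
      slotMap (fun t => h (t - 1)) q (lapOp (blockObject r k (SqExt k A M)) q x) := by
  refine word_ext (f := lapOp (blockObject r k (SqExt k A N)) q ∘ₗ slotMap (A := A) h q)
    (g := slotMap (fun t => h (t - 1)) q ∘ₗ lapOp (blockObject r k (SqExt k A M)) q) (fun w => ?_) x
  rw [LinearMap.comp_apply, LinearMap.comp_apply, slotMap_word, lapOp_word, lapOp_word,
    slotMap_word]
  congr 1
  funext i
  rw [slot_sub]
  rcases slot r q i with _ | t <;> rfl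

lemma lapOp_pow_eq_one {p : ℕ} (hrp : r ∣ p) {E : Lam r ⥤ ModuleCat.{u} k} (q : ℕ) :
    lapOp E q ^ p = 1 := by
  obtain ⟨c, rfl⟩ := hrp
  rw [pow_mul, lapOp_pow, one_pow]

section Pieces

variable (g : M →ₗ[A ⊗[k] Aᵐᵒᵖ] N) (s : N →ₗ[k] M)

/-- For a linear section `s` of a surjection `g` of bimodules, the projection of `M` to the image of `s` or to the kernel
of `g`. -/
def sectionProj (v : Bool) : M →ₗ[k] M :=
  if v then s ∘ₗ g.restrictScalars k else LinearMap.id - s ∘ₗ g.restrictScalars k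

variable {g s}

lemma sectionProj_comp (hs : ∀ n, g (s n) = n) (v v' : Bool) :
    sectionProj g s v ∘ₗ sectionProj g s v' = if v = v' then sectionProj g s v else 0 := by
  ext m
  cases v <;> cases v' <;> simp [sectionProj, hs]

variable (r) in
/-- The rotation of the set of subsets of the set of blocks. -/
def labelRot : Equiv.Perm (ZMod r → Bool) :=
  Equiv.arrowCongr (Equiv.addRight (1 : ZMod r)) (Equiv.refl Bool)

lemma labelRot_apply (I : ZMod r → Bool) (t : ZMod r) : labelRot r I t = I (t - 1) := by
  simp [labelRot, Equiv.arrowCongr, sub_eq_add_neg]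

lemma labelRot_iterate (j : ℕ) (I : ZMod r → Bool) (t : ZMod r) :
    (labelRot r)^[j] I t = I (t - j) := by
  induction j generalizing I with
  | zero => simp
  | succ j ih =>
    rw [Function.iterate_succ_apply, ih, labelRot_apply]
    congr 1; push_cast; ring

/-- The number of elements of a subset of the set of blocks. -/
def labelCard (I : ZMod r → Bool) : ℕ := (Finset.univ.filter fun t => I t = true).card

lemma exists_of_labelCard_le {I I' : ZMod r → Bool} (h : labelCard I' ≤ labelCard I) (hne : I ≠ I') :
    ∃ t, I t = true ∧ I' t = false := by
  by_contra! H
  have hsub : (Finset.univ.filter fun t => I t = true) ⊆ Finset.univ.filter fun t => I' t = true := by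
    intro t ht
    simp only [Finset.mem_filter, Finset.mem_univ, true_and] at ht ⊢
    simpa using H t ht
  have heq := Finset.eq_of_subset_of_card_le hsub h
  refine hne (funext fun t => ?_)
  have := congrArg (t ∈ ·) heq
  simp only [Finset.mem_filter, Finset.mem_univ, true_and, eq_iff_iff] at this
  rw [Bool.eq_iff_iff]
  exact this

lemma eq_const_of_labelRot_eq {I : ZMod r → Bool} (h : labelRot r I = I) (t : ZMod r) : I t = I 0 := by
  obtain ⟨n, rfl⟩ : ∃ n : ℕ, (n : ZMod r) = t := ⟨t.val, ZMod.natCast_zmod_val t⟩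
  have h1 : (labelRot r)^[n] I = I := Function.iterate_fixed h n
  have h2 := labelRot_iterate n I n
  rw [h1, sub_self] at h2
  exact h2

variable (g s) in
/-- The projection to the words with letters from the image of the section `s` in the slots of the blocks in `I`, and
letters from the kernel of `g` in the other slots. -/
def piece (q : ℕ) (I : ZMod r → Bool) :
    Module.End k ((blockObject r k (SqExt k A M)).obj (Lam.ob r q)) :=
  slotMap (A := A) (fun t => sectionProj g s (I t)) q

lemma piece_piece (hs : ∀ n, g (s n) = n) (q : ℕ) (I I' : ZMod r → Bool) (x) :
    piece g s q I (piece g s q I' x) = if I = I' then piece g s q I x else 0 := by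
  rw [piece, piece, slotMap_slotMap]
  split_ifs with h
  · subst h
    simp only [sectionProj_comp hs, if_true]
  · obtain ⟨t, ht⟩ := Function.ne_iff.mp h
    exact slotMap_eq_zero _ (t := t) (by rw [sectionProj_comp hs, if_neg ht]) q x

lemma sum_piece (hs : ∀ n, g (s n) = n) {q : ℕ}
    {x} (hx : x ∈ goodSpan (r := r) (k := k) (A := A) (M := M) (fun _ => ⊤) q) :
    ∑ I, piece g s q I x = x := by
  classical
  set G : ∀ i : ZMod (r * (q + 1)), Set (SqExt k A M) := fun i => match slot r q i with
    | none => Set.range SqExt.inl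
    | some _ => SqExt.inr '' (Set.range (sectionProj g s true) ∪ Set.range (sectionProj g s false))
    with hG
  have hfin : Finite (ZMod (r * (q + 1))) := by
    infer_instance
  have := Fintype.ofFinite (ZMod (r * (q + 1)))
  have hle : goodSpan (r := r) (k := k) (A := A) (M := M) (fun _ => ⊤) q ≤
      Submodule.span k (word r k (SqExt k A M) q '' {a | ∀ i, a i ∈ G i}) := by
    refine goodSpan_le fun w hw => tprod_mem_span G w fun i => ?_
    have := hw i
    revert this
    simp only [hG]
    rcases slot r q i with _ | t
    · exact fun h => Submodule.subset_span h
    · rintro ⟨m, -, e⟩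
      have e1 : w i = SqExt.inr (sectionProj g s true m) + SqExt.inr (sectionProj g s false m) := by
        rw [← e]
        refine SqExt.ext (add_zero (0 : A)).symm ?_
        change m = s (g m) + (m - s (g m))
        abel
      rw [e1]
      exact Submodule.add_mem _ (Submodule.subset_span ⟨_, Or.inl ⟨m, rfl⟩, rfl⟩)
        (Submodule.subset_span ⟨_, Or.inr ⟨m, rfl⟩, rfl⟩)
  have hword : ∀ w, (∀ i, w i ∈ G i) →
      ∑ I, piece g s q I (word r k (SqExt k A M) q w) = word r k (SqExt k A M) q w := by
    intro w hw
    have hletter : ∀ t : ZMod r, ∃ v : Bool, ∀ i, slot r q i = some t →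
        ∃ m, w i = SqExt.inr (sectionProj g s v m) := by
      intro t
      obtain ⟨i, hi⟩ := exists_slot (r := r) q t
      have huniq : ∀ i', slot r q i' = some t → i' = i := by
        intro i' hi'
        exact slot_injective hi' hi
      have h1 := hw i
      simp only [hG, hi] at h1
      obtain ⟨m, hm, e⟩ := h1
      rcases hm with ⟨m', rfl⟩ | ⟨m', rfl⟩
      · exact ⟨true, fun i' hi' => ⟨m', by rw [huniq i' hi', e]⟩⟩
      · exact ⟨false, fun i' hi' => ⟨m', by rw [huniq i' hi', e]⟩⟩
    choose I hI using hletter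
    have e : word r k (SqExt k A M) q w = piece g s q I (word r k (SqExt k A M) q w) := by
      rw [piece, slotMap_word]
      congr 1
      funext i
      rcases hsl : slot r q i with _ | t
      · have := hw i
        simp only [hG, hsl] at this
        obtain ⟨a, e⟩ := this
        rw [← e]; rfl
      · obtain ⟨m, hm⟩ := hI t i hsl
        have := LinearMap.congr_fun (sectionProj_comp hs (I t) (I t)) m
        rw [if_pos rfl] at this
        rw [hm, letterMap_some]
        exact congrArg SqExt.inr this.symm
    rw [Finset.sum_eq_single I (fun I' _ h => by rw [e, piece_piece hs, if_neg h])
      (fun h => absurd (Finset.mem_univ _) h), ← e]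
  have hx' := hle hx
  refine Submodule.span_induction (p := fun x _ => ∑ I, piece g s q I x = x) ?_ ?_ ?_ ?_ hx'
  · rintro _ ⟨w, hw, rfl⟩
    exact hword w hw
  · simp
  · intro x y _ _ h1 h2
    simp only [map_add, Finset.sum_add_distrib, h1, h2]
  · intro c x _ h
    simp only [map_smul, ← Finset.smul_sum, h]

lemma sectionProj_mem (hs : ∀ n, g (s n) = n) (v : Bool) (m : M) :
    sectionProj g s v m ∈ (if v then ⊤ else LinearMap.ker g : Submodule (A ⊗[k] Aᵐᵒᵖ) M) := by
  cases v
  · simp [sectionProj, hs]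
  · simp

lemma piece_mem (hs : ∀ n, g (s n) = n) (q : ℕ) (I : ZMod r → Bool) (x) : piece g s q I x ∈
    goodSpan (r := r) (k := k) (A := A) (fun t => if I t then ⊤ else LinearMap.ker g) q :=
  slotMap_mem _ (fun t => sectionProj_mem hs (I t)) q x

lemma goodSpan_le_top (T : ZMod r → Submodule (A ⊗[k] Aᵐᵒᵖ) M) (q : ℕ) :
    goodSpan T q ≤ goodSpan (r := r) (k := k) (fun _ => ⊤) q :=
  goodSpan_le fun w hw => word_mem_goodSpan fun i => by
    have := hw i
    revert this
    rcases slot r q i with _ | t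
    · exact id
    · rintro ⟨m, -, e⟩
      exact ⟨m, trivial, e⟩

variable (g s) in
/-- The decomposition of the complex of words for the middle term of a short exact sequence, by the set of slots with
letters outside the kernel. -/
def sectionPieces {p : ℕ} (hrp : r ∣ p) (hs : ∀ n, g (s n) = n) :
    FreePieces p (bOp (blockObject r k (SqExt k A M))) (lapOp (blockObject r k (SqExt k A M)))
      (ZMod r → Bool) r where
  π := piece g s
  c := labelCard
  ρ := labelRot r
  orth := piece_piece hs
  equivariant q I x := by
    rw [piece, piece, lapOp_slotMap]
    simp only [labelRot_apply]
  triangular q I I' x hc hne := by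
    obtain ⟨t, h1, h2⟩ := exists_of_labelCard_le hc hne
    rw [piece, slotMap_congr (h' := fun t' => if t' = t then 0 else sectionProj g s (I t'))
      (T := fun t => if I' t then ⊤ else LinearMap.ker g) (fun t' m hm => ?_)
      (bOp_mem_goodSpan (piece_mem hs _ _ _))]
    · exact slotMap_eq_zero _ (t := t) (by simp) q _
    · split_ifs with h
      · subst h
        rw [h2] at hm
        simp only [Bool.false_eq_true, if_false, LinearMap.mem_ker] at hm
        rw [h1]
        simp [sectionProj, hm]
      · rfl
  stable q I x := sum_piece hs (bOp_mem_goodSpan (goodSpan_le_top _ _ (piece_mem hs _ _ _)))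
  weight I := by
    unfold labelCard
    refine Finset.card_bij' (fun t _ => t - 1) (fun t _ => t + 1) ?_ ?_ ?_ ?_ <;>
      simp [labelRot_apply]
  iterate := funext fun I => funext fun t => by
    rw [labelRot_iterate, (ZMod.natCast_eq_zero_iff p r).mpr hrp, sub_zero]; rfl
  free I h0 h1 h := by
    have hI := eq_const_of_labelRot_eq h
    have : labelCard I = 0 ∨ labelCard I = r := by
      unfold labelCard
      simp only [hI]
      cases I 0
      · left; simp
      · right; simp [ZMod.card]
    omega

end Pieces

end Devissage

section Exact

variable {r : ℕ} [NeZero r] {k : Type u} [Field k] {A : Type u} [Ring A] [Algebra k A]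
  {M : Type u} [AddCommGroup M] [Module (A ⊗[k] Aᵐᵒᵖ) M] [Module k M]
  [IsScalarTower k (A ⊗[k] Aᵐᵒᵖ) M]
  {N : Type u} [AddCommGroup N] [Module (A ⊗[k] Aᵐᵒᵖ) N] [Module k N]
  [IsScalarTower k (A ⊗[k] Aᵐᵒᵖ) N]

lemma tateD_blockMap (p : ℕ) {B B' : Type u} [Ring B] [Algebra k B] [Ring B'] [Algebra k B']
    (f : B →ₐ[k] B') (n : ℤ) (x : ∀ q, (blockObject r k B).obj (Lam.ob r q)) (q : ℕ) :
    tateD p (bOp (blockObject r k B')) (lapOp (blockObject r k B')) n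
        (fun q => ((blockMap r f).app (Lam.ob r q)).hom (x q)) q =
      ((blockMap r f).app (Lam.ob r q)).hom
        (tateD p (bOp (blockObject r k B)) (lapOp (blockObject r k B)) n x q) :=
  tateD_map (fun q => ((blockMap r f).app (Lam.ob r q)).hom) (bOp_app (blockMap r f))
    (lapOp_app (blockMap r f)) n x q

lemma exists_lift_goodSpan (g : M →ₗ[A ⊗[k] Aᵐᵒᵖ] N) (hg : Function.Surjective g) {q : ℕ}
    {x : (blockObject r k (SqExt k A N)).obj (Lam.ob r q)}
    (hx : x ∈ goodSpan (r := r) (M := N) (fun _ => ⊤) q) :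
    ∃ y ∈ goodSpan (r := r) (k := k) (A := A) (M := M) (fun _ => ⊤) q,
      ((blockMap r (SqExt.map g)).app (Lam.ob r q)).hom y = x := by
  refine goodSpan_le (Y := (goodSpan (r := r) (k := k) (A := A) (M := M) (fun _ => ⊤) q).map
    ((blockMap r (SqExt.map g)).app (Lam.ob r q)).hom) (fun w hw => ?_) hx
  have : ∀ i, ∃ y ∈ letters (k := k) (A := A) (M := M) (fun _ => ⊤) (slot r q i),
      SqExt.map g y = w i := by
    intro i
    have := hw i
    revert this
    rcases slot r q i with _ | t
    · rintro ⟨a, e⟩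
      exact ⟨SqExt.inl a, ⟨a, rfl⟩, by rw [SqExt.map_inl, e]⟩
    · rintro ⟨m, -, e⟩
      obtain ⟨m, rfl⟩ := hg m
      exact ⟨SqExt.inr m, ⟨m, trivial, rfl⟩, by rw [SqExt.map_inr, e]⟩
  choose v hv hvw using this
  refine ⟨word r k _ q v, word_mem_goodSpan hv, ?_⟩
  rw [blockMap_word]
  simp only [hvw]

lemma blockMap_mem_goodSpan (g : M →ₗ[A ⊗[k] Aᵐᵒᵖ] N) {q : ℕ}
    {x : (blockObject r k (SqExt k A M)).obj (Lam.ob r q)}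
    (hx : x ∈ goodSpan (r := r) (M := M) (fun _ => ⊤) q) :
    ((blockMap r (SqExt.map g)).app (Lam.ob r q)).hom x ∈
      goodSpan (r := r) (k := k) (A := A) (M := N) (fun _ => ⊤) q := by
  rw [blockMap_eq_slotMap g hx]
  exact slotMap_mem (T := fun _ => ⊤) _ (fun _ _ => trivial) q x

/-- If the germs are acyclic for the middle term and for the kernel of a short exact sequence of bimodules, they are
acyclic for the quotient: the words of the middle term with letters from the kernel in some, but not in all slots
do not contribute, as `ℤ/p` permutes them freely. -/
theorem bimodAcyclic_of_exact {p : ℕ} (hp : p.Prime) (hrp : r ∣ p) (g : M →ₗ[A ⊗[k] Aᵐᵒᵖ] N)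
    (s : N →ₗ[k] M) (hs : ∀ n, g (s n) = n) (hM : BimodAcyclic p r k A M)
    (hK : BimodAcyclic p r k A (LinearMap.ker g)) : BimodAcyclic p r k A N := by
  classical
  intro n x hx hDx
  obtain ⟨n, rfl⟩ : ∃ n', n = n' + 1 := ⟨n - 1, by ring⟩
  set P := sectionPieces (r := r) (k := k) (A := A) g s hrp hs
  have hr := NeZero.pos r
  set gE := fun q => ((blockMap r (SqExt.map g)).app (Lam.ob r q)).hom with hgE
  set DM := tateD p (bOp (blockObject r k (SqExt k A M))) (lapOp (blockObject r k (SqExt k A M)))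
  have hDD : ∀ n y, DM n (DM (n + 1) y) = 0 := fun n y =>
    tateD_tateD y (bOp_bOp_apply _) (bOp_lapOp _) (lapOp_pow_eq_one hrp) n
  choose x' hx' hgx' using fun q => exists_lift_goodSpan g (fun n => ⟨s n, hs n⟩) (hx q)
  obtain ⟨m, hm⟩ := Filter.eventually_atTop.mp hDx
  -- the sum of all pieces but the top one is the kernel of `gE`
  have hker : ∀ q y, y ∈ goodSpan (r := r) (k := k) (A := A) (M := M) (fun _ => ⊤) q →
      gE q y = 0 → y ∈ P.filt (r - 1) q := by
    intro q y hy h0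
    rw [P.mem_filt]
    refine ⟨fun I hI => ?_, sum_piece hs hy⟩
    have hI' : ∀ t, I t = true := by
      by_contra! H
      obtain ⟨t, ht⟩ := H
      have : labelCard I < r := by
        rw [labelCard]
        calc _ < (Finset.univ : Finset (ZMod r)).card :=
              Finset.card_lt_card (Finset.filter_ssubset.mpr ⟨t, Finset.mem_univ _, ht⟩)
          _ = r := by rw [Finset.card_univ, ZMod.card]
      have : labelCard I > r - 1 := hI
      omega
    change piece g s q I y = 0
    have e : piece g s q I y = slotMap (A := A) (fun _ => s) q (gE q y) := by
      rw [hgE, blockMap_eq_slotMap g hy, slotMap_slotMap, piece]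
      simp only [hI', sectionProj, if_true]
    rw [e, h0, map_zero]
  have hker' : ∀ q y, y ∈ P.filt (r - 1) q → y ∈ goodSpan (r := r) (k := k) (A := A) (M := M)
      (fun _ => ⊤) q ∧ gE q y = 0 := by
    intro q y hy
    rw [P.mem_filt] at hy
    have hmem : ∀ I, piece g s q I y ∈ goodSpan (r := r) (k := k) (A := A) (M := M) (fun _ => ⊤) q :=
      fun I => goodSpan_le_top _ _ (piece_mem hs q I y)
    rw [← hy.2]
    refine ⟨Submodule.sum_mem _ fun I _ => hmem I, ?_⟩
    rw [map_sum]
    refine Finset.sum_eq_zero fun I _ => ?_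
    by_cases hI : r - 1 < labelCard I
    · rw [hy.1 I hI, map_zero]
    · have : ∃ t, I t = false := by
        by_contra! H
        apply hI
        have : labelCard I = r := by
          rw [labelCard, Finset.filter_true_of_mem fun t _ => by simpa using H t, Finset.card_univ,
            ZMod.card]
        omega
      obtain ⟨t, ht⟩ := this
      change gE q (piece g s q I y) = 0
      rw [hgE, blockMap_eq_slotMap g (hmem I), piece, slotMap_slotMap]
      refine slotMap_eq_zero _ (t := t) ?_ q y
      ext v
      simp [ht, sectionProj, hs]
  obtain ⟨y, hy, hy0⟩ := P.exists_weight_zero hp (lapOp_pow_eq_one hrp) (bOp_lapOp _)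
    (bOp_bOp_apply _) n (r - 1) (by omega) (fun q => if m ≤ q then DM (n + 1) x' q else 0)
    (fun q => by
      split_ifs with h
      · refine hker q _ (tateD_mem_goodSpan p hx' _ q) ?_
        have := tateD_blockMap (r := r) p (SqExt.map g) (n + 1) x' q
        simp only [hgx'] at this
        rw [← this]
        exact hm q h
      · exact Submodule.zero_mem _)
    (by
      filter_upwards [Filter.eventually_ge_atTop m] with q h2
      rw [tateD_congr p _ _ (y := DM (n + 1) x') (if_pos h2) (if_pos (h2.trans q.le_succ))]
      exact congrFun (hDD n x') q)
  obtain ⟨m', hm'⟩ := Filter.eventually_atTop.mp hy0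
  -- the cycle of weight zero comes from the kernel of `g`
  set K := LinearMap.ker g
  set jE := fun q => ((blockMap r (SqExt.map (k := k) (A := A) (M := ↥K) (N := M) K.subtype)).app (Lam.ob r q)).hom with hjE
  set e : M →ₗ[k] K := LinearMap.codRestrict (K.restrictScalars k) (sectionProj g s false)
    (fun m => LinearMap.mem_ker.mpr (by simpa using sectionProj_mem hs false m)) with he
  have heval : ∀ m, (e m : M) = m - s (g m) := fun m => rfl
  set v : ∀ q, (blockObject r k (SqExt k A M)).obj (Lam.ob r q) := fun q =>
    if max m m' ≤ q then DM (n + 1) (x' - y) q else 0 with hv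
  have hvF : ∀ q, v q ∈ P.filt 0 q := by
    intro q
    simp only [hv]
    split_ifs with h
    · have := hm' q ((le_max_right _ _).trans h)
      rw [if_pos ((le_max_left _ _).trans h)] at this
      rwa [map_sub]
    · exact Submodule.zero_mem _
  have hv0 : ∀ q, v q = piece g s q (fun _ => false) (v q) := by
    intro q
    have h1 := (P.mem_filt.mp (hvF q))
    have h2 : ∑ I, piece g s q I (v q) = v q := h1.2
    rw [Finset.sum_eq_single (fun _ => false) (fun I _ hI => ?_)
      (fun h => absurd (Finset.mem_univ _) h)] at h2
    · exact h2.symm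
    · refine h1.1 I (Nat.pos_of_ne_zero fun h0 => hI (funext fun t => ?_))
      have : (Finset.univ.filter fun t => I t = true) = ∅ := Finset.card_eq_zero.mp h0
      have ht := Finset.filter_eq_empty_iff.mp this (Finset.mem_univ t)
      simpa using ht
  have hvgood : ∀ q, v q ∈ goodSpan (r := r) (k := k) (A := A) (fun _ => K) q := by
    intro q
    rw [hv0 q]
    simpa using piece_mem hs q (fun _ => false) (v q)
  set v' : ∀ q, (blockObject r k (SqExt k A K)).obj (Lam.ob r q) := fun q =>
    slotMap (A := A) (M := M) (N := ↥K) (fun _ => e) q (v q) with hv'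
  have hv'good : ∀ q, v' q ∈ goodSpan (r := r) (k := k) (A := A) (M := K) (fun _ => ⊤) q := fun q =>
    slotMap_mem (T := fun _ => ⊤) _ (fun _ _ => trivial) q _
  have hjv : ∀ q, jE q (v' q) = v q := by
    intro q
    rw [hjE]
    dsimp only
    rw [blockMap_eq_slotMap _ (hv'good q), hv']
    dsimp only
    rw [slotMap_slotMap]
    conv_rhs => rw [hv0 q]
    rfl
  have hinj : ∀ q z, z ∈ goodSpan (r := r) (k := k) (A := A) (M := K) (fun _ => ⊤) q → jE q z = 0 →
      z = 0 := by
    intro q z hz h0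
    rw [hjE] at h0
    dsimp only at h0
    rw [blockMap_eq_slotMap _ hz] at h0
    have h1 := congrArg (slotMap (A := A) (M := M) (N := ↥K) (fun _ => e) q) h0
    rw [slotMap_slotMap, map_zero] at h1
    rw [← slotMap_id hz, ← h1]
    congr 2
    funext t
    ext ⟨m, hm⟩
    simp [heval, LinearMap.mem_ker.mp hm]
  obtain ⟨w', hw'good, hw'⟩ := hK n v' hv'good (by
    filter_upwards [Filter.eventually_ge_atTop (max m m')] with q hq
    refine hinj q _ (tateD_mem_goodSpan p hv'good n q) ?_
    have h1 := tateD_blockMap (r := r) p (SqExt.map (k := k) (A := A) (M := ↥K) (N := M) K.subtype) n v' q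
    have h2 : ∀ q, ((blockMap r (SqExt.map (k := k) (A := A) (M := ↥K) (N := M) K.subtype)).app (Lam.ob r q)).hom (v' q) = v q := hjv
    simp only [h2] at h1
    rw [hjE]
    dsimp only
    rw [← h1, tateD_congr p _ _ (y := DM (n + 1) (x' - y)) (if_pos hq) (if_pos (hq.trans q.le_succ))]
    exact congrFun (hDD n _) q)
  set w := fun q => jE q (w' q) with hw
  have hwgood : ∀ q, w q ∈ goodSpan (r := r) (k := k) (A := A) (M := M) (fun _ => ⊤) q := fun q =>
    blockMap_mem_goodSpan _ (hw'good q)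
  have hgw : ∀ q, gE q (w q) = 0 := by
    intro q
    have h := blockMap_eq_slotMap (r := r) K.subtype (hw'good q)
    simp only [hw, hjE, hgE]
    rw [blockMap_eq_slotMap g (hwgood q)]
    simp only [hw, hjE]
    rw [h, slotMap_slotMap]
    refine slotMap_eq_zero _ (t := 0) ?_ q _
    ext ⟨m, hm⟩
    exact LinearMap.mem_ker.mp hm
  have hDw : ∀ᶠ q in Filter.atTop, DM (n + 1) w q = DM (n + 1) (x' - y) q := by
    filter_upwards [hw', Filter.eventually_ge_atTop (max m m')] with q h1 h2
    have h3 := tateD_blockMap (r := r) p (SqExt.map (k := k) (A := A) (M := ↥K) (N := M) K.subtype) (n + 1) w' q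
    rw [h1] at h3
    refine h3.trans ((hjv q).trans ?_)
    exact if_pos h2
  obtain ⟨z, hz, hDz⟩ := hM (n + 1) (x' - y - w) (fun q => Submodule.sub_mem _
    (Submodule.sub_mem _ (hx' q) (hker' q _ (hy q)).1) (hwgood q)) (by
      filter_upwards [hDw] with q h
      have : DM (n + 1) (x' - y - w) q = 0 := by rw [map_sub, Pi.sub_apply, h, sub_self]
      exact this)
  refine ⟨fun q => gE q (z q), fun q => blockMap_mem_goodSpan g (hz q), ?_⟩
  filter_upwards [hDz] with q h
  have h1 := tateD_blockMap (r := r) p (SqExt.map g) (n + 1 + 1) z q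
  rw [h] at h1
  refine h1.trans ?_
  change gE q (x' q - y q - w q) = x q
  rw [map_sub, map_sub, hgw, (hker' q _ (hy q)).2, sub_zero, sub_zero]
  exact hgx' q

end Exact

/-! ### Free bimodules -/

namespace PMap

lemma lower_eq {n m : ℕ} (hm : 0 < m) (f : PMap n m) {J z : ℤ} (h1 : J ≤ f.toFun z)
    (h2 : f.toFun (z - 1) < J) : f.lower J = z := by
  refine le_antisymm ((f.lower_le_iff hm _ _).mpr h1) ?_
  by_contra! h
  have := (f.lower_le_iff hm (z - 1) J).mp (by omega)
  omega

/-- The map `[q + 3] ⟶ [q + 1]` that contracts the first three positions to one. -/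
def fold (q : ℕ) : PMap (q + 3) (q + 1) := (face (q + 2) 0).comp (face (q + 1) 0)

lemma fold_apply (q : ℕ) (t o : ℤ) (h0 : 0 ≤ o) (h1 : o ≤ q + 3) :
    (fold q).toFun (((q + 3 : ℕ) : ℤ) * t + o) = ((q + 1 : ℕ) : ℤ) * t + max (o - 2) 0 := by
  suffices h : (fold q).toFun o = max (o - 2) 0 by
    rw [show ((q + 3 : ℕ) : ℤ) * t + o = o + t * ((q + 3 : ℕ) : ℤ) by ring, (fold q).shift_mul, h]
    ring
  change (face (q + 1) 0).toFun ((face (q + 2) 0).toFun o) = _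
  rcases le_or_gt o 0 with h | h
  · rw [face_of_le (by omega) h0 (by simpa using h), face_of_le (by omega) h0 (by simpa using h)]
    omega
  · rw [face_of_gt (n := q + 2) (by omega) (by simpa using h) (by push_cast; omega)]
    rcases le_or_gt o 1 with h' | h'
    · rw [face_of_le (by omega) (by omega) (by simpa using h')]; omega
    · rw [face_of_gt (n := q + 1) (by omega) (by push_cast; omega) (by push_cast; omega)]; omega

end PMap

section Fold

variable {r : ℕ} [NeZero r] {B : Type*} [Monoid B] {q : ℕ} (W : ZMod (r * (q + 3)) → B)

lemma fibreProd_fold_slot (t : ℤ) :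
    fibreProd ((PMap.fold q).dilate r) W ((((q + 1 : ℕ) : ℤ) * t : ℤ) : ZMod (r * (q + 1))) =
      W ((((q + 3 : ℕ) : ℤ) * t : ℤ) : ZMod (r * (q + 3))) *
        W ((((q + 3 : ℕ) : ℤ) * t + 1 : ℤ) : ZMod (r * (q + 3))) *
        W ((((q + 3 : ℕ) : ℤ) * t + 2 : ℤ) : ZMod (r * (q + 3))) := by
  have hm : 0 < r * (q + 1) := NeZero.pos _
  have h1 : ((PMap.fold q).dilate r).lower (((q + 1 : ℕ) : ℤ) * t) = ((q + 3 : ℕ) : ℤ) * t := by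
    refine PMap.lower_eq hm _ ?_ ?_
    · have := PMap.fold_apply q t 0 le_rfl (by positivity)
      rw [add_zero] at this
      exact le_of_le_of_eq (by simp) this.symm
    · have := PMap.fold_apply q (t - 1) (q + 2) (by positivity) (by omega)
      refine lt_of_eq_of_lt (b := ((q + 1 : ℕ) : ℤ) * (t - 1) + max ((q : ℤ) + 2 - 2) 0) ?_ ?_
      · rw [← this]; change (PMap.fold q).toFun _ = _; congr 1; push_cast; ring
      · push_cast; rw [max_eq_left (by omega)]; linarith
  have h2 : ((PMap.fold q).dilate r).lower (((q + 1 : ℕ) : ℤ) * t + 1) =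
      ((q + 3 : ℕ) : ℤ) * t + 3 := by
    refine PMap.lower_eq hm _ ?_ ?_
    · exact le_of_le_of_eq (by norm_num) (PMap.fold_apply q t 3 (by norm_num) (by omega)).symm
    · have := PMap.fold_apply q t 2 (by norm_num) (by omega)
      rw [show ((q + 3 : ℕ) : ℤ) * t + 3 - 1 = ((q + 3 : ℕ) : ℤ) * t + 2 by ring]
      exact lt_of_eq_of_lt this (by norm_num)
  rw [fibreProd_intCast, h1, h2, ← iprod_mul _ (y := ((q + 3 : ℕ) : ℤ) * t + 2) (by omega) (by omega),
    ← iprod_mul _ (y := ((q + 3 : ℕ) : ℤ) * t + 1) (by omega) (by omega), iprod_single,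
    show ((q + 3 : ℕ) : ℤ) * t + 2 = ((q + 3 : ℕ) : ℤ) * t + 1 + 1 by ring, iprod_single,
    show ((q + 3 : ℕ) : ℤ) * t + 3 = ((q + 3 : ℕ) : ℤ) * t + 1 + 1 + 1 by ring, iprod_single]

lemma fibreProd_fold_of_pos (t o : ℤ) (h0 : 0 < o) (h1 : o ≤ q) :
    fibreProd ((PMap.fold q).dilate r) W ((((q + 1 : ℕ) : ℤ) * t + o : ℤ) : ZMod (r * (q + 1))) =
      W ((((q + 3 : ℕ) : ℤ) * t + (o + 2) : ℤ) : ZMod (r * (q + 3))) := by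
  have hm : 0 < r * (q + 1) := NeZero.pos _
  have h : ∀ o : ℤ, 0 < o → o ≤ q + 1 → ((PMap.fold q).dilate r).lower (((q + 1 : ℕ) : ℤ) * t + o) =
      ((q + 3 : ℕ) : ℤ) * t + (o + 2) := by
    intro o h0 h1
    refine PMap.lower_eq hm _ ?_ ?_
    · refine le_of_le_of_eq ?_ (PMap.fold_apply q t (o + 2) (by omega) (by omega)).symm
      rw [max_eq_left (by omega)]; omega
    · rw [show ((q + 3 : ℕ) : ℤ) * t + (o + 2) - 1 = ((q + 3 : ℕ) : ℤ) * t + (o + 1) by ring]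
      refine lt_of_eq_of_lt (PMap.fold_apply q t (o + 1) (by omega) (by omega)) ?_
      rw [max_eq_left (by omega)]; omega
  rw [fibreProd_intCast, h o h0 (by omega), add_assoc, h (o + 1) (by omega) (by omega),
    show ((q + 3 : ℕ) : ℤ) * t + (o + 1 + 2) = ((q + 3 : ℕ) : ℤ) * t + (o + 2) + 1 by ring,
    iprod_single]

end Fold

section OpenWords

variable {r : ℕ} [NeZero r] {k : Type u} [Field k] {A : Type u} [Ring A] [Algebra k A]
  {L : Type u} [AddCommGroup L] [Module (A ⊗[k] Aᵐᵒᵖ) L] [Module k L]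
  [IsScalarTower k (A ⊗[k] Aᵐᵒᵖ) L] {κ : Type u} (v : κ → L) (G : Set A)

/-- Words with an element of the family `v` in the second position of each block, and letters from a subset `G` of `A`
elsewhere. -/
def openWords (q : ℕ) : Set (ZMod (r * (q + 1)) → SqExt k A L) :=
  {W | ∀ z : ℤ, (((q + 1 : ℕ) : ℤ) ∣ z - 1 → W z ∈ Set.range fun j => SqExt.inr (v j)) ∧
    (¬ ((q + 1 : ℕ) : ℤ) ∣ z - 1 → W z ∈ SqExt.inl '' G)}

variable {v}

lemma fibreProd_mem_openWords {a c : ℕ} (f : PMap (a + 1) (c + 1))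
    (h1 : ∀ z, f.toFun z = 1 ↔ z = 1) {W : ZMod (r * (a + 1)) → SqExt k A L}
    (hW : W ∈ openWords v Set.univ a) :
    fibreProd (f.dilate r) W ∈ openWords v Set.univ c := by
  have hm : 0 < r * (c + 1) := NeZero.pos _
  have hft : ∀ z t : ℤ, f.toFun z = 1 + t * ((c + 1 : ℕ) : ℤ) ↔ z = 1 + t * ((a + 1 : ℕ) : ℤ) := by
    intro z t
    have h2 := h1 (z + (-t) * ((a + 1 : ℕ) : ℤ))
    rw [f.shift_mul] at h2
    constructor
    · intro h
      have := h2.mp (by rw [h]; ring)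
      linarith
    · intro h
      have := h2.mpr (by rw [h]; ring)
      linarith
  intro J
  rw [fibreProd_intCast]
  have hmem := fun z => PMap.mem_fibre_iff hm (f.dilate r) z J
  have hle : (f.dilate r).lower J ≤ (f.dilate r).lower (J + 1) := PMap.lower_mono hm _ (by omega)
  refine ⟨fun h => ?_, fun h => ?_⟩
  · obtain ⟨t, ht⟩ := h
    obtain rfl : J = 1 + t * ((c + 1 : ℕ) : ℤ) := by linarith
    have h3 := fun z => (hmem z).trans (hft z t)
    have h4 := (h3 _).mpr rfl
    have h5 : (f.dilate r).lower (1 + t * ((c + 1 : ℕ) : ℤ)) = 1 + t * ((a + 1 : ℕ) : ℤ) :=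
      (h3 _).mp ⟨le_rfl, by omega⟩
    have h6 : (f.dilate r).lower (1 + t * ((c + 1 : ℕ) : ℤ) + 1) = 1 + t * ((a + 1 : ℕ) : ℤ) + 1 := by
      have := (h3 ((f.dilate r).lower (1 + t * ((c + 1 : ℕ) : ℤ) + 1) - 1)).mp ⟨by omega, by omega⟩
      linarith
    rw [h5, h6, iprod_single]
    exact (hW _).1 ⟨t, by ring⟩
  · have h7 := iprod_mem_letters_none (r := r) (fun _ => (⊤ : Submodule (A ⊗[k] Aᵐᵒᵖ) L))
      (fun i : ℤ => W (i : ZMod (r * (a + 1)))) hle fun z h3 h4 => by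
        obtain ⟨a', -, e⟩ := (hW z).2 (by
          rintro ⟨t, ht⟩
          have h5 : f.toFun z = J := (hmem z).mp ⟨h3, h4⟩
          have h6 := (hft z t).mpr (by linarith)
          exact h ⟨t, by rw [← h5, h6]; ring⟩)
        exact ⟨a', e⟩
    obtain ⟨a', e⟩ := h7
    exact ⟨a', trivial, e⟩

lemma fibreProd_face_zero_mem_goodWords {q : ℕ} {W : ZMod (r * (q + 2 + 1)) → SqExt k A L}
    (hW : W ∈ openWords v Set.univ (q + 2)) :
    fibreProd ((PMap.face (q + 2) 0).dilate r) W ∈ goodWords (fun _ => ⊤) (q + 1) := by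
  have hm : 0 < r * (q + 2) := NeZero.pos _
  set f := PMap.face (q + 2) 0
  have hf0 : ∀ t : ℤ, f.toFun (1 + t * ((q + 3 : ℕ) : ℤ)) = t * ((q + 2 : ℕ) : ℤ) := fun t => by
    rw [f.shift_mul]
    simp only [f]
    rw [PMap.face_of_gt (by omega) (by norm_num) (by push_cast; omega)]; ring
  intro j
  obtain ⟨J, rfl⟩ := ZMod.intCast_surjective j
  have e := fibreProd_intCast (f.dilate r) W J
  have hmem := fun z => PMap.mem_fibre_iff hm (f.dilate r) z J
  have hle : (f.dilate r).lower J ≤ (f.dilate r).lower (J + 1) := PMap.lower_mono hm _ (by omega)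
  refine Set.mem_of_eq_of_mem e ?_
  have hinl : ∀ z : ℤ, ¬ ((q + 3 : ℕ) : ℤ) ∣ z - 1 → W z ∈ letters (k := k) (A := A)
      (fun _ : ZMod r => (⊤ : Submodule (A ⊗[k] Aᵐᵒᵖ) L)) none := fun z h => by
    obtain ⟨a', -, e⟩ := (hW z).2 h
    exact ⟨a', e⟩
  by_cases h : ((q + 2 : ℕ) : ℤ) ∣ J
  · obtain ⟨t, rfl⟩ := h
    have hs := slot_mul (r := r) (q + 1) t
    have h4 := (hmem (1 + t * ((q + 3 : ℕ) : ℤ))).mpr ((hf0 t).trans (mul_comm _ _))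
    refine Set.mem_of_mem_of_subset (s := letters (fun _ => ⊤) (some (t : ZMod r))) ?_ (by rw [← hs])
    refine iprod_mem_letters_some _ _ h4.1 h4.2 ?_ fun z h5 h6 h7 => hinl z ?_
    · obtain ⟨j, hj⟩ := (hW (1 + t * ((q + 3 : ℕ) : ℤ))).1 ⟨t, by push_cast; ring⟩
      exact ⟨v j, trivial, hj⟩
    · rintro ⟨t', ht'⟩
      obtain rfl : z = 1 + t' * ((q + 3 : ℕ) : ℤ) := by linarith
      have h8 : f.toFun _ = _ := (hmem _).mp ⟨h5, h6⟩
      rw [hf0, mul_comm] at h8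
      exact h7 (by rw [mul_left_cancel₀ (by positivity) h8])
  · have hs := slot_of_not_dvd (r := r) (q := q + 1) h
    refine Set.mem_of_mem_of_subset (s := letters (fun _ => ⊤) none) ?_ (by rw [← hs])
    refine iprod_mem_letters_none _ _ hle fun z h5 h6 => hinl z ?_
    rintro ⟨t', ht'⟩
    obtain rfl : z = 1 + t' * ((q + 3 : ℕ) : ℤ) := by linarith
    have h8 : f.toFun _ = _ := (hmem _).mp ⟨h5, h6⟩
    rw [hf0] at h8
    exact h ⟨t', by rw [← h8, mul_comm]⟩

variable (v) in
/-- The span of the open words. -/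
def openSpan (q : ℕ) : Submodule k ((blockObject r k (SqExt k A L)).obj (Lam.ob r q)) :=
  Submodule.span k (word r k (SqExt k A L) q '' openWords v Set.univ q)

lemma openSpan_induction {q : ℕ} {Y : Submodule k ((blockObject r k (SqExt k A L)).obj (Lam.ob r q))}
    (h : ∀ W ∈ openWords v Set.univ q, word r k (SqExt k A L) q W ∈ Y) :
    openSpan (r := r) (k := k) (A := A) v q ≤ Y :=
  Submodule.span_le.mpr (by rintro _ ⟨w, hw, rfl⟩; exact h w hw)

lemma map_mem_openSpan {a c : ℕ} (f : PMap (a + 1) (c + 1)) (h1 : ∀ z, f.toFun z = 1 ↔ z = 1) {x}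
    (hx : x ∈ openSpan (r := r) (k := k) (A := A) v a) :
    ((blockObject r k (SqExt k A L)).map (X := Lam.ob r a) (Y := Lam.ob r c) (Lam.ofMap f)).hom x ∈
      openSpan (r := r) (k := k) (A := A) v c := by
  refine openSpan_induction (Y := (openSpan v c).comap ((blockObject r k (SqExt k A L)).map
    (X := Lam.ob r a) (Y := Lam.ob r c) (Lam.ofMap f)).hom) (fun W hW => ?_) hx
  rw [Submodule.mem_comap, map_word]
  exact Submodule.subset_span ⟨_, fibreProd_mem_openWords f h1 hW, rfl⟩

lemma lapOp_mem_openSpan {q : ℕ} {x} (hx : x ∈ openSpan (r := r) (k := k) (A := A) v q) :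
    lapOp (blockObject r k (SqExt k A L)) q x ∈ openSpan (r := r) (k := k) (A := A) v q := by
  refine openSpan_induction (Y := (openSpan v q).comap (lapOp (blockObject r k (SqExt k A L)) q))
    (fun W hW => ?_) hx
  rw [Submodule.mem_comap, lapOp_word]
  refine Submodule.subset_span ⟨_, fun z => ?_, rfl⟩
  have h := hW (z - ((q + 1 : ℕ) : ℤ))
  have e : ((q + 1 : ℕ) : ℤ) ∣ z - ((q + 1 : ℕ) : ℤ) - 1 ↔ ((q + 1 : ℕ) : ℤ) ∣ z - 1 := by
    rw [show z - ((q + 1 : ℕ) : ℤ) - 1 = z - 1 - ((q + 1 : ℕ) : ℤ) by ring]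
    exact dvd_sub_self_right
  rw [e] at h
  push_cast at h ⊢
  exact h

lemma faceOp_zero_mem_goodSpan {q : ℕ} {x}
    (hx : x ∈ openSpan (r := r) (k := k) (A := A) v (q + 2)) :
    faceOp (blockObject r k (SqExt k A L)) (q + 1) 0 x ∈
      goodSpan (r := r) (k := k) (A := A) (M := L) (fun _ => ⊤) (q + 1) := by
  refine openSpan_induction (Y := (goodSpan (fun _ => ⊤) (q + 1)).comap
    (faceOp (blockObject r k (SqExt k A L)) (q + 1) 0)) (fun W hW => ?_) hx
  rw [Submodule.mem_comap, faceOp, map_word]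
  exact word_mem_goodSpan (fibreProd_face_zero_mem_goodWords hW)

end OpenWords

lemma exists_of_periodic {B : Type*} {n : ℕ} [NeZero n] (f : ℤ → B) (hf : ∀ z, f (z + n) = f z) :
    ∃ W : ZMod n → B, ∀ z : ℤ, W z = f z := by
  refine ⟨fun i => f i.val, fun z => ?_⟩
  change f (((z : ZMod n).val : ℕ) : ℤ) = f z
  rw [ZMod.val_intCast]
  have h := (Function.Periodic.int_mul hf (z / n)) (z % n)
  rw [← h, Int.cast_id, mul_comm, Int.emod_add_mul_ediv]

section Basis

variable {r : ℕ} [NeZero r] {k : Type u} [Field k] {A : Type u} [Ring A] [Algebra k A]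
  {L : Type u} [AddCommGroup L] [Module (A ⊗[k] Aᵐᵒᵖ) L] [Module k L]
  [IsScalarTower k (A ⊗[k] Aᵐᵒᵖ) L] {κ ι : Type u} {v : κ → L} {e : Module.Basis ι k A}
  {bL : Module.Basis (κ × ι × ι) k L}

namespace SqExt

variable (k A L) in
/-- The inclusion of the algebra into a square-zero extension, as a linear map. -/
def inlLinear : A →ₗ[k] SqExt k A L where
  toFun := inl
  map_add' _ _ := SqExt.ext rfl (add_zero (0 : L)).symm
  map_smul' c _ := SqExt.ext rfl (smul_zero c).symm

variable (k A L) in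
/-- The inclusion of the bimodule into a square-zero extension, as a linear map. -/
def inrLinear : L →ₗ[k] SqExt k A L where
  toFun := inr
  map_add' _ _ := SqExt.ext (add_zero (0 : A)).symm rfl
  map_smul' c _ := SqExt.ext (smul_zero c).symm rfl

/-- A basis of a square-zero extension. -/
def basis (e : Module.Basis ι k A) (bL : Module.Basis (κ × ι × ι) k L) :
    Module.Basis (ι ⊕ κ × ι × ι) k (SqExt k A L) :=
  (e.prod bL).map
    ({ toFun := fun x => ⟨x.1, x.2⟩
       invFun := fun x => (x.1, x.2)
       map_add' := fun _ _ => rfl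
       map_smul' := fun _ _ => rfl
       left_inv := fun _ => rfl
       right_inv := fun _ => rfl } : (A × L) ≃ₗ[k] SqExt k A L)

lemma basis_inl (c : ι) : basis e bL (Sum.inl c) = inl (e c) := by
  simp [basis, inl]
  rfl

lemma basis_inr (i : κ × ι × ι) : basis e bL (Sum.inr i) = inr (bL i) := by
  simp [basis, inr]
  rfl

lemma inl_mul_inr_mul_inl (hbL : ∀ j c d, bL (j, c, d) = (e c ⊗ₜ[k] MulOpposite.op (e d)) • v j)
    (j : κ) (c d : ι) :
    (inl (e c) * inr (v j) * inl (e d) : SqExt k A L) = basis e bL (Sum.inr (j, c, d)) := by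
  rw [inl_mul_inr, inr_mul_inl, right_left_smul, basis_inr, hbL]

end SqExt

lemma exists_div_mod (n : ℕ) (z : ℤ) : ∃ t o : ℤ, 0 ≤ o ∧ o < (n + 1 : ℕ) ∧
    z = ((n + 1 : ℕ) : ℤ) * t + o :=
  ⟨z / (n + 1 : ℕ), z % (n + 1 : ℕ), Int.emod_nonneg _ (by positivity),
    Int.emod_lt_of_pos _ (by positivity), (Int.mul_ediv_add_emod _ _).symm⟩

lemma not_dvd_sub_one {n : ℕ} (hn : 1 ≤ n) {o : ℤ} (h0 : 0 ≤ o) (h1 : o < (n + 1 : ℕ)) (h2 : o ≠ 1) :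
    ¬ ((n + 1 : ℕ) : ℤ) ∣ o - 1 := by
  intro h3
  rcases lt_or_ge o 1 with h | h
  · obtain rfl : o = 0 := by omega
    have := Int.le_of_dvd (a := ((n + 1 : ℕ) : ℤ)) (b := 1) (by norm_num) (by simpa using h3)
    push_cast at this
    omega
  · have := Int.le_of_dvd (by omega) h3
    omega

lemma openWords_letters {G : Set A} {q : ℕ} {W : ZMod (r * (q + 2 + 1)) → SqExt k A L}
    (hW : W ∈ openWords v G (q + 2)) :
    (∀ t : ℤ, W ((((q + 3 : ℕ) : ℤ) * t + 1 : ℤ) : ZMod (r * (q + 3))) ∈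
      Set.range fun j => SqExt.inr (v j)) ∧
    ∀ t o : ℤ, 0 ≤ o → o < (q + 3 : ℕ) → o ≠ 1 →
      W ((((q + 3 : ℕ) : ℤ) * t + o : ℤ) : ZMod (r * (q + 3))) ∈ SqExt.inl '' G := by
  refine ⟨fun t => (hW _).1 ⟨t, by push_cast; ring⟩, fun t o h0 h1 h2 => (hW _).2 ?_⟩
  rintro ⟨t', ht'⟩
  have h3 : ((q + 3 : ℕ) : ℤ) ∣ o - 1 := ⟨t' - t, by push_cast at ht' ⊢; linarith⟩
  exact not_dvd_sub_one (n := q + 2) (by omega) h0 h1 h2 h3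

lemma exists_fold_eq_basis
    (hbL : ∀ j c d, bL (j, c, d) = (e c ⊗ₜ[k] MulOpposite.op (e d)) • v j) {q : ℕ}
    {W : ZMod (r * (q + 2 + 1)) → SqExt k A L} (hW : W ∈ openWords v (Set.range e) (q + 2))
    (i : ZMod (r * (q + 1))) :
    ∃ l, SqExt.basis e bL l = fibreProd ((PMap.fold q).dilate r) W i := by
  obtain ⟨z, rfl⟩ := ZMod.intCast_surjective i
  obtain ⟨t, o, h0, h1, rfl⟩ := exists_div_mod q z
  obtain ⟨h2, h3⟩ := openWords_letters hW
  rcases h0.eq_or_lt with rfl | h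
  · rw [add_zero, fibreProd_fold_slot]
    obtain ⟨j, hj⟩ := h2 t
    obtain ⟨_, ⟨c, rfl⟩, hc⟩ := h3 t 0 le_rfl (by omega) (by norm_num)
    obtain ⟨_, ⟨d, rfl⟩, hd⟩ := h3 t 2 (by norm_num) (by omega) (by norm_num)
    rw [add_zero] at hc
    rw [← hj, ← hc, ← hd]
    exact ⟨_, (SqExt.inl_mul_inr_mul_inl hbL j c d).symm⟩
  · rw [fibreProd_fold_of_pos _ t o h (by omega)]
    obtain ⟨_, ⟨c, rfl⟩, hc⟩ := h3 t (o + 2) (by omega) (by omega) (by omega)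
    rw [← hc]
    exact ⟨_, SqExt.basis_inl c⟩

lemma eq_of_fold_eq (hbL : ∀ j c d, bL (j, c, d) = (e c ⊗ₜ[k] MulOpposite.op (e d)) • v j) {q : ℕ}
    {W W' : ZMod (r * (q + 2 + 1)) → SqExt k A L} (hW : W ∈ openWords v (Set.range e) (q + 2))
    (hW' : W' ∈ openWords v (Set.range e) (q + 2))
    (h : fibreProd ((PMap.fold q).dilate r) W = fibreProd ((PMap.fold q).dilate r) W') :
    W = W' := by
  funext i
  obtain ⟨z, rfl⟩ := ZMod.intCast_surjective i
  obtain ⟨t, o, h0, h1, rfl⟩ := exists_div_mod (q + 2) z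
  obtain ⟨h2, h3⟩ := openWords_letters hW
  obtain ⟨h2', h3'⟩ := openWords_letters hW'
  rcases lt_or_ge o 3 with ho | ho
  · have hs := congrFun h ((((q + 1 : ℕ) : ℤ) * t : ℤ) : ZMod (r * (q + 1)))
    rw [fibreProd_fold_slot, fibreProd_fold_slot] at hs
    obtain ⟨j, hj⟩ := h2 t
    obtain ⟨_, ⟨c, rfl⟩, hc⟩ := h3 t 0 le_rfl (by omega) (by norm_num)
    obtain ⟨_, ⟨d, rfl⟩, hd⟩ := h3 t 2 (by norm_num) (by omega) (by norm_num)
    obtain ⟨j', hj'⟩ := h2' t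
    obtain ⟨_, ⟨c', rfl⟩, hc'⟩ := h3' t 0 le_rfl (by omega) (by norm_num)
    obtain ⟨_, ⟨d', rfl⟩, hd'⟩ := h3' t 2 (by norm_num) (by omega) (by norm_num)
    have hc0 := hc
    have hc0' := hc'
    rw [add_zero] at hc hc'
    rw [← hj, ← hc, ← hd, ← hj', ← hc', ← hd'] at hs
    dsimp only at hs
    rw [SqExt.inl_mul_inr_mul_inl hbL, SqExt.inl_mul_inr_mul_inl hbL] at hs
    have hi := (SqExt.basis e bL).injective hs
    simp only [Sum.inr.injEq, Prod.mk.injEq] at hi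
    obtain ⟨rfl, rfl, rfl⟩ := hi
    obtain rfl | rfl | rfl : o = 0 ∨ o = 1 ∨ o = 2 := by omega
    · exact hc0.symm.trans hc0'
    · exact hj.symm.trans hj'
    · exact hd.symm.trans hd'
  · have hs := congrFun h ((((q + 1 : ℕ) : ℤ) * t + (o - 2) : ℤ) : ZMod (r * (q + 1)))
    rw [fibreProd_fold_of_pos _ t _ (by omega) (by omega),
      fibreProd_fold_of_pos _ t _ (by omega) (by omega), sub_add_cancel] at hs
    exact hs

lemma map_fold_eq_zero (hbL : ∀ j c d, bL (j, c, d) = (e c ⊗ₜ[k] MulOpposite.op (e d)) • v j)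
    {q : ℕ} {x} (hx : x ∈ openSpan (r := r) (k := k) (A := A) v (q + 2))
    (h0 : ((blockObject r k (SqExt k A L)).map (X := Lam.ob r (q + 2)) (Y := Lam.ob r q)
      (Lam.ofMap (PMap.fold q))).hom x = 0) : x = 0 := by
  set f := ((blockObject r k (SqExt k A L)).map (X := Lam.ob r (q + 2)) (Y := Lam.ob r q)
      (Lam.ofMap (PMap.fold q))).hom
  set Ω := openWords (r := r) (k := k) v (Set.range e) (q + 2)
  set w : Ω → (blockObject r k (SqExt k A L)).obj (Lam.ob r (q + 2)) := fun W => word r k _ _ W.1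
  have hx' : x ∈ Submodule.span k (Set.range w) := by
    refine openSpan_induction (fun W hW => ?_) hx
    have hmem := tprod_mem_span (k := k) (M := fun _ => SqExt k A L)
      (fun i : ZMod (r * (q + 2 + 1)) =>
      {y : SqExt k A L | ∃ z : ℤ, (z : ZMod (r * (q + 2 + 1))) = i ∧
        ((((q + 2 + 1 : ℕ) : ℤ) ∣ z - 1 → y ∈ Set.range fun j => SqExt.inr (v j)) ∧
        (¬ ((q + 2 + 1 : ℕ) : ℤ) ∣ z - 1 → y ∈ SqExt.inl '' Set.range e))}) W (fun i => by
        obtain ⟨z, rfl⟩ := ZMod.intCast_surjective i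
        by_cases h : ((q + 2 + 1 : ℕ) : ℤ) ∣ z - 1
        · exact Submodule.subset_span ⟨z, rfl, fun _ => (hW z).1 h, fun h' => absurd h h'⟩
        · obtain ⟨a, -, ha⟩ := (hW z).2 h
          rw [← ha]
          have h1 := Submodule.mem_map_of_mem (f := SqExt.inlLinear k A L) (e.mem_span a)
          rw [Submodule.map_span] at h1
          refine Submodule.span_mono ?_ h1
          rintro _ ⟨_, ⟨c, rfl⟩, rfl⟩
          exact ⟨z, rfl, fun h' => absurd h' h, fun _ => ⟨_, ⟨c, rfl⟩, rfl⟩⟩)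
    refine Submodule.span_mono ?_ hmem
    rintro _ ⟨W', hW', rfl⟩
    refine ⟨⟨W', fun z => ?_⟩, rfl⟩
    obtain ⟨z', hz', h1, h2⟩ := hW' z
    have : ((q + 2 + 1 : ℕ) : ℤ) ∣ z' - 1 ↔ ((q + 2 + 1 : ℕ) : ℤ) ∣ z - 1 := by
      rw [ZMod.intCast_eq_intCast_iff_dvd_sub] at hz'
      have h3 : ((q + 2 + 1 : ℕ) : ℤ) ∣ z - z' := (by push_cast; exact dvd_mul_left _ _ :
        ((q + 2 + 1 : ℕ) : ℤ) ∣ ((r * (q + 2 + 1) : ℕ) : ℤ)).trans hz'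
      constructor <;> intro h
      · have := dvd_add h h3
        rwa [show z' - 1 + (z - z') = z - 1 by ring] at this
      · have := dvd_sub h h3
        rwa [show z - 1 - (z - z') = z' - 1 by ring] at this
    exact ⟨fun h => h1 (this.mpr h), fun h => h2 (fun h' => h (this.mp h'))⟩
  choose g hg using fun W : Ω => exists_fold_eq_basis hbL W.2
  have hgi : Function.Injective g := fun W W' h => by
    refine Subtype.ext (eq_of_fold_eq hbL W.2 W'.2 (funext fun i => ?_))
    rw [← hg W, ← hg W', h]
  have hli : LinearIndependent k (f ∘ w) := by
    have := (Basis.piTensorProduct (R := k) fun _ : ZMod (r * (q + 1)) =>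
      SqExt.basis e bL).linearIndependent.comp g hgi
    have e2 : (f ∘ w : Ω → ⨂[k] _ : ZMod (r * (q + 1)), SqExt k A L) =
        (Basis.piTensorProduct (R := k) fun _ : ZMod (r * (q + 1)) => SqExt.basis e bL) ∘ g := by
      funext W
      have h2 := map_word (r := r) (k := k) (B := SqExt k A L) (a := q + 2) (c := q) (PMap.fold q) W.1
      refine h2.trans ?_
      rw [Function.comp_apply, Basis.piTensorProduct_apply, word]
      congr 1
      exact funext fun i => (hg W i).symm
    rw [← e2] at this
    exact this
  exact Submodule.disjoint_def.mp (Submodule.range_ker_disjoint hli) x hx' h0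

end Basis

section Contraction

variable {r : ℕ} [NeZero r] {k : Type u} [Field k] {A : Type u} [Ring A] [Algebra k A]
  {L : Type u} [AddCommGroup L] [Module (A ⊗[k] Aᵐᵒᵖ) L] [Module k L]
  [IsScalarTower k (A ⊗[k] Aᵐᵒᵖ) L] {κ ι : Type u} {v : κ → L} {e : Module.Basis ι k A}
  {bL : Module.Basis (κ × ι × ι) k L}

lemma exists_openWord (hbL : ∀ j c d, bL (j, c, d) = (e c ⊗ₜ[k] MulOpposite.op (e d)) • v j) {q : ℕ}
    {w : ZMod (r * (q + 1)) → SqExt k A L}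
    (h1 : ∀ t : ℤ, ∃ l, w ((((q + 1 : ℕ) : ℤ) * t : ℤ) : ZMod (r * (q + 1))) = SqExt.inr (bL l))
    (h2 : ∀ z : ℤ, ¬ ((q + 1 : ℕ) : ℤ) ∣ z → w z ∈ Set.range SqExt.inl) :
    ∃ W ∈ openWords (r := r) (k := k) v Set.univ (q + 2),
      fibreProd ((PMap.fold q).dilate r) W = w := by
  have h1' : ∀ i : ZMod (r * (q + 1)), ∃ l : Option (κ × ι × ι), ∀ l', w i = SqExt.inr (bL l') →
      l = some l' := by
    intro i
    by_cases h : ∃ l, w i = SqExt.inr (bL l)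
    · obtain ⟨l, hl⟩ := h
      refine ⟨some l, fun l' h' => congrArg some (bL.injective ?_)⟩
      rw [hl] at h'
      exact congrArg SqExt.snd h'
    · exact ⟨none, fun l' h' => absurd ⟨l', h'⟩ h⟩
  choose idx hidx using h1'
  set letter : ℤ → ℤ → SqExt k A L := fun t o =>
    if o < 3 then
      match idx ((((q + 1 : ℕ) : ℤ) * t : ℤ) : ZMod (r * (q + 1))) with
      | none => 0
      | some l => if o = 0 then SqExt.inl (e l.2.1) else if o = 1 then SqExt.inr (v l.1) else
          SqExt.inl (e l.2.2)
    else w ((((q + 1 : ℕ) : ℤ) * t + (o - 2) : ℤ) : ZMod (r * (q + 1))) with hletter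
  have hper : ∀ t o, letter (t + r) o = letter t o := by
    intro t o
    have : ∀ c : ℤ, ((((q + 1 : ℕ) : ℤ) * (t + r) + c : ℤ) : ZMod (r * (q + 1))) =
        ((((q + 1 : ℕ) : ℤ) * t + c : ℤ) : ZMod (r * (q + 1))) := by
      intro c
      rw [ZMod.intCast_eq_intCast_iff_dvd_sub]
      exact ⟨-1, by push_cast; ring⟩
    have h0 := this 0
    rw [add_zero, add_zero] at h0
    simp only [hletter]
    rw [h0, this]
  obtain ⟨W, hW⟩ := exists_of_periodic (n := r * (q + 2 + 1))
    (fun z => letter (z / (q + 3 : ℕ)) (z % (q + 3 : ℕ))) (fun z => by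
      have e : z + ((r * (q + 2 + 1) : ℕ) : ℤ) = z + ((q + 3 : ℕ) : ℤ) * r := by push_cast; ring
      rw [e, Int.add_mul_emod_self_left, Int.add_mul_ediv_left _ _ (by positivity), hper])
  have hW' : ∀ t o : ℤ, 0 ≤ o → o < (q + 3 : ℕ) →
      W ((((q + 3 : ℕ) : ℤ) * t + o : ℤ) : ZMod (r * (q + 2 + 1))) = letter t o := by
    intro t o h0 h1
    rw [hW, add_comm, Int.add_mul_emod_self_left, Int.add_mul_ediv_left _ _ (by positivity),
      Int.emod_eq_of_lt h0 h1, Int.ediv_eq_zero_of_lt h0 h1, zero_add]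
  have hlet : ∀ t o l, w ((((q + 1 : ℕ) : ℤ) * t : ℤ) : ZMod (r * (q + 1))) = SqExt.inr (bL l) →
      o < 3 → letter t o = if o = 0 then SqExt.inl (e l.2.1) else if o = 1 then SqExt.inr (v l.1) else
          SqExt.inl (e l.2.2) := by
    intro t o l hl ho
    simp only [hletter, if_pos ho, hidx _ l hl]
  refine ⟨W, fun z => ?_, ?_⟩
  · obtain ⟨t, o, h0, h3, rfl⟩ := exists_div_mod (q + 2) z
    have hWz := hW' t o h0 h3
    obtain ⟨l, hl⟩ := h1 t
    have hr : (o = 1 ∧ W ((((q + 2 + 1 : ℕ) : ℤ) * t + o : ℤ) : ZMod (r * (q + 2 + 1))) =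
        SqExt.inr (v l.1)) ∨ (o ≠ 1 ∧
        W ((((q + 2 + 1 : ℕ) : ℤ) * t + o : ℤ) : ZMod (r * (q + 2 + 1))) ∈
          SqExt.inl '' Set.univ) := by
      rw [hWz]
      rcases lt_or_ge o 3 with ho | ho
      · rw [hlet t o l hl ho]
        obtain rfl | rfl | rfl : o = 0 ∨ o = 1 ∨ o = 2 := by omega
        · exact Or.inr ⟨by norm_num, by simp⟩
        · exact Or.inl ⟨rfl, by simp⟩
        · exact Or.inr ⟨by norm_num, by simp⟩
      · refine Or.inr ⟨by omega, ?_⟩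
        simp only [hletter, if_neg (not_lt.mpr ho)]
        obtain ⟨a, ha⟩ := h2 (((q + 1 : ℕ) : ℤ) * t + (o - 2)) (by
          rw [Int.dvd_add_right (dvd_mul_right _ _)]
          intro hd
          have := Int.le_of_dvd (by omega) hd
          push_cast at this h3
          omega)
        exact ⟨a, trivial, ha⟩
    refine ⟨fun hd => ?_, fun hd => ?_⟩
    · rcases hr with h | h
      · exact ⟨_, h.2.symm⟩
      · refine absurd hd ?_
        rw [add_sub_assoc, Int.dvd_add_right (dvd_mul_right _ _)]
        exact not_dvd_sub_one (by omega) h0 h3 h.1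
    · rcases hr with h | h
      · refine absurd ?_ hd
        rw [h.1, add_sub_cancel_right]
        exact dvd_mul_right _ _
      · exact h.2
  · funext i
    obtain ⟨z, rfl⟩ := ZMod.intCast_surjective i
    obtain ⟨t, o, h0, h3, rfl⟩ := exists_div_mod q z
    rcases h0.eq_or_lt with rfl | h
    · obtain ⟨⟨j, c, d⟩, hl⟩ := h1 t
      have e0 := hW' t 0 le_rfl (by omega)
      have e1 := hW' t 1 (by norm_num) (by omega)
      have e2 := hW' t 2 (by norm_num) (by omega)
      rw [hlet t _ _ hl (by norm_num)] at e0 e1 e2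
      rw [add_zero] at e0
      rw [add_zero, fibreProd_fold_slot, hl, ← SqExt.basis_inr (e := e),
        ← SqExt.inl_mul_inr_mul_inl hbL]
      refine congrArg₂ _ (congrArg₂ _ (e0.trans ?_) (e1.trans ?_)) (e2.trans ?_) <;> simp
    · rw [fibreProd_fold_of_pos _ t o h (by omega)]
      refine (hW' t (o + 2) (by omega) (by push_cast; omega)).trans ?_
      simp only [hletter]
      rw [if_neg (by omega), add_sub_cancel_right]

lemma goodSpan_le_map_fold (hbL : ∀ j c d, bL (j, c, d) = (e c ⊗ₜ[k] MulOpposite.op (e d)) • v j)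
    {q : ℕ} {y} (hy : y ∈ goodSpan (r := r) (k := k) (A := A) (M := L) (fun _ => ⊤) q) :
    ∃ x ∈ openSpan (r := r) (k := k) (A := A) v (q + 2),
      ((blockObject r k (SqExt k A L)).map (X := Lam.ob r (q + 2)) (Y := Lam.ob r q)
        (Lam.ofMap (PMap.fold q))).hom x = y := by
  refine goodSpan_le (Y := (openSpan v (q + 2)).map ((blockObject r k (SqExt k A L)).map
    (X := Lam.ob r (q + 2)) (Y := Lam.ob r q) (Lam.ofMap (PMap.fold q))).hom) (fun w hw => ?_) hy
  have hmem := tprod_mem_span (k := k) (M := fun _ => SqExt k A L)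
    (fun i : ZMod (r * (q + 1)) => {y | (slot r q i = none → y ∈ Set.range SqExt.inl) ∧
      (slot r q i ≠ none → ∃ l, y = SqExt.inr (bL l))}) w (fun i => by
      have := hw i
      revert this
      rcases hs : slot r q i with _ | t
      · rintro h
        exact Submodule.subset_span ⟨fun _ => h, fun h' => absurd rfl h'⟩
      · rintro ⟨m, -, hm⟩
        rw [← hm]
        have h1 := Submodule.mem_map_of_mem (f := SqExt.inrLinear k A L) (bL.mem_span m)
        rw [Submodule.map_span] at h1
        refine Submodule.span_mono ?_ h1
        rintro _ ⟨_, ⟨c, rfl⟩, rfl⟩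
        exact ⟨fun h => absurd h (by simp), fun _ => ⟨c, rfl⟩⟩)
  refine Submodule.span_le.mpr ?_ hmem
  rintro _ ⟨w', hw', rfl⟩
  obtain ⟨W, hW, hWw⟩ := exists_openWord (r := r) hbL (w := w')
    (fun t => (hw' _).2 (by rw [slot_mul]; simp)) (fun z h => (hw' _).1 (slot_of_not_dvd h))
  refine ⟨word r k _ _ W, Submodule.subset_span ⟨W, hW, rfl⟩, ?_⟩
  refine (map_word (r := r) (k := k) (B := SqExt k A L) (a := q + 2) (c := q) (PMap.fold q) W).trans ?_
  rw [hWw]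
  rfl

/-- The standard contraction of the words over a free bimodule: it splits the right coefficient of the letter in
each slot off, as a new letter. -/
theorem exists_contraction (hbL : ∀ j c d, bL (j, c, d) = (e c ⊗ₜ[k] MulOpposite.op (e d)) • v j) :
    ∃ h : ∀ q, (blockObject r k (SqExt k A L)).obj (Lam.ob r q) →ₗ[k]
        (blockObject r k (SqExt k A L)).obj (Lam.ob r (q + 1)),
      (∀ q, ∀ x ∈ goodSpan (r := r) (k := k) (A := A) (M := L) (fun _ => ⊤) q,
        h q x ∈ goodSpan (r := r) (k := k) (A := A) (M := L) (fun _ => ⊤) (q + 1)) ∧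
      (∀ q, ∀ x ∈ goodSpan (r := r) (k := k) (A := A) (M := L) (fun _ => ⊤) q,
        h q (lapOp _ q x) = lapOp _ (q + 1) (h q x)) ∧
      ∀ q, ∀ x ∈ goodSpan (r := r) (k := k) (A := A) (M := L) (fun _ => ⊤) (q + 1),
        bOp _ (q + 1) (h (q + 1) x) = x - h q (bOp _ q x) := by
  set E := blockObject r k (SqExt k A L)
  set f : ∀ q, E.obj (Lam.ob r (q + 2)) →ₗ[k] E.obj (Lam.ob r q) := fun q =>
    (E.map (X := Lam.ob r (q + 2)) (Y := Lam.ob r q) (Lam.ofMap (PMap.fold q))).hom with hf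
  have hff : ∀ q x, f q x = faceOp E q 0 (faceOp E (q + 1) 0 x) := fun q x => by
    have := E.map_comp (X := Lam.ob r (q + 2)) (Y := Lam.ob r (q + 1)) (Z := Lam.ob r q)
      (Lam.ofMap (PMap.face (q + 2) 0)) (Lam.ofMap (PMap.face (q + 1) 0))
    exact congrArg (fun g => g.hom x) this
  have hinv : ∀ q, ∃ g : E.obj (Lam.ob r q) →ₗ[k] openSpan (r := r) (k := k) (A := A) v (q + 2),
      g ∘ₗ (f q).domRestrict (openSpan v (q + 2)) = LinearMap.id := fun q =>
    LinearMap.exists_leftInverse_of_injective _ (LinearMap.ker_eq_bot'.mpr fun x hx =>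
      Subtype.ext (map_fold_eq_zero hbL x.2 hx))
  choose g hg using hinv
  set h : ∀ q, E.obj (Lam.ob r q) →ₗ[k] E.obj (Lam.ob r (q + 1)) := fun q =>
    faceOp E (q + 1) 0 ∘ₗ Submodule.subtype _ ∘ₗ g q with hh
  have key : ∀ q, ∀ x ∈ openSpan (r := r) (k := k) (A := A) v (q + 2),
      h q (f q x) = faceOp E (q + 1) 0 x := by
    intro q x hx
    have := LinearMap.congr_fun (hg q) ⟨x, hx⟩
    simp only [hh, LinearMap.comp_apply]
    exact congrArg (fun z => faceOp E (q + 1) 0 (Submodule.subtype _ z)) this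
  have hcomm : ∀ (q : ℕ) {i j : ℕ}, i < j → j ≤ q + 2 → ∀ x,
      faceOp E q i (faceOp E (q + 1) j x) = faceOp E q (j - 1) (faceOp E (q + 1) i x) :=
    fun q i j hij hj x => LinearMap.congr_fun (faceOp_faceOp E q hij hj) x
  refine ⟨h, fun q x _ => ?_, fun q x hx => ?_, fun q x hx => ?_⟩
  · exact faceOp_zero_mem_goodSpan (g q x).2
  · obtain ⟨y, hy, rfl⟩ := goodSpan_le_map_fold hbL hx
    have e1 := lapOp_map E (PMap.fold q) y
    have e2 := lapOp_map E (PMap.face (q + 2) 0) y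
    refine (congrArg (h q) e1.symm).trans ((key q _ (lapOp_mem_openSpan hy)).trans (e2.trans ?_))
    exact congrArg _ (key q y hy).symm
  · obtain ⟨y, hy, rfl⟩ := goodSpan_le_map_fold hbL hx
    have h0 : h (q + 1) (f (q + 1) y) = faceOp E (q + 2) 0 y := key (q + 1) y hy
    have hface : ∀ i ≤ q + 1, h q (faceOp E q i (f (q + 1) y)) =
        faceOp E (q + 1) (i + 1) (faceOp E (q + 2) 0 y) := by
      intro i hi
      have e1 : faceOp E q i (f (q + 1) y) = f q (faceOp E (q + 2) (i + 2) y) := by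
        rw [hff, hff, hcomm (q + 1) (i := 0) (j := i + 2) (by omega) (by omega),
          hcomm q (i := 0) (j := i + 2 - 1) (by omega) (by omega)]
        rfl
      have hmem : faceOp E (q + 2) (i + 2) y ∈ openSpan (r := r) (k := k) (A := A) v (q + 2) := by
        refine map_mem_openSpan (a := q + 3) (c := q + 2) (PMap.face (q + 3) (i + 2)) (fun z => ?_) hy
        set g := PMap.face (q + 3) (i + 2)
        have g0 : g.toFun 0 = 0 := PMap.face_of_le (by omega) le_rfl (by positivity)
        have g1 : g.toFun 1 = 1 := PMap.face_of_le (by omega) (by norm_num) (by push_cast; omega)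
        have g2 : g.toFun 2 = 2 := PMap.face_of_le (by omega) (by norm_num) (by push_cast; omega)
        refine ⟨fun hz => ?_, fun hz => hz ▸ g1⟩
        rcases lt_trichotomy z 1 with h | h | h
        · have := g.mono (show z ≤ 0 by omega)
          omega
        · exact h
        · have := g.mono (show 2 ≤ z by omega)
          omega
      rw [e1, key q _ hmem, hcomm (q + 1) (i := 0) (j := i + 2) (by omega) (by omega)]
      rfl
    change bOp E (q + 1) (h (q + 1) (f (q + 1) y)) = f (q + 1) y - h q (bOp E q (f (q + 1) y))
    rw [h0, bOp, Finset.sum_range_succ', LinearMap.add_apply, LinearMap.sum_apply, bOp,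
      LinearMap.sum_apply, map_sum]
    refine (add_comm _ _).trans (Eq.trans ?_ (sub_eq_add_neg _ _).symm)
    rw [← Finset.sum_neg_distrib]
    congr 1
    · rw [pow_zero, one_smul]
      exact (hff _ _).symm
    · refine Finset.sum_congr rfl fun i hi => ?_
      rw [Finset.mem_range] at hi
      rw [LinearMap.smul_apply, LinearMap.smul_apply, map_smul, hface i (by omega), pow_succ]
      simp

/-- Germs are acyclic for free bimodules. -/
theorem bimodAcyclic_of_basis (p : ℕ)
    (hbL : ∀ j c d, bL (j, c, d) = (e c ⊗ₜ[k] MulOpposite.op (e d)) • v j) :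
    BimodAcyclic p r k A L := by
  obtain ⟨h, hmem, hlap, hb⟩ := exists_contraction (r := r) hbL
  intro n x hx hD
  have hpow : ∀ q j, (lapOp (blockObject r k (SqExt k A L)) q ^ j) (x q) ∈
      goodSpan (r := r) (k := k) (A := A) (M := L) (fun _ => ⊤) q ∧
      h q ((lapOp (blockObject r k (SqExt k A L)) q ^ j) (x q)) = (lapOp (blockObject r k (SqExt k A L)) (q + 1) ^ j) (h q (x q)) := by
    intro q j
    induction j with
    | zero => exact ⟨hx q, rfl⟩
    | succ j ih =>
      rw [pow_succ', Module.End.mul_apply, pow_succ', Module.End.mul_apply, ← ih.2]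
      exact ⟨lapOp_mem_goodSpan ih.1, hlap q _ ih.1⟩
  set y : ∀ q, (blockObject r k (SqExt k A L)).obj (Lam.ob r q) := fun q =>
    match q with
    | 0 => 0
    | q + 1 => if Even (n - q) then -h q (x q) else h q (x q) with hy
  refine ⟨y, fun q => ?_, ?_⟩
  · rcases q with _ | q
    · exact Submodule.zero_mem _
    · simp only [hy]
      split_ifs
      · exact Submodule.neg_mem _ (hmem q _ (hx q))
      · exact hmem q _ (hx q)
  obtain ⟨m, hm⟩ := Filter.eventually_atTop.mp hD
  filter_upwards [Filter.eventually_ge_atTop (m + 1)] with q hq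
  obtain ⟨q, rfl⟩ : ∃ q', q = q' + 1 := ⟨q - 1, by omega⟩
  have hc := hm q (by omega)
  have hbx := hb q (x (q + 1)) (hx _)
  by_cases he : Even (n - q)
  · have h1 : Even (n + 1 - ((q + 1 : ℕ) : ℤ)) := even_succ_sub_succ.mpr he
    have h2 : ¬ Even (n - ((q + 1 : ℕ) : ℤ)) := by rw [even_sub_succ]; exact not_not.mpr he
    rw [tateD_even _ _ _ _ he] at hc
    rw [tateD_even _ _ _ _ h1]
    simp only [hy, if_pos he, if_neg h2]
    rw [hbx, eq_neg_of_add_eq_zero_left hc, map_neg, map_sub, hlap q _ (hx q), map_neg]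
    abel
  · have h1 : ¬ Even (n + 1 - ((q + 1 : ℕ) : ℤ)) := even_succ_sub_succ.not.mpr he
    have h2 : Even (n - ((q + 1 : ℕ) : ℤ)) := by rw [even_sub_succ]; exact he
    rw [tateD_odd _ _ _ _ he, sub_eq_zero] at hc
    rw [tateD_odd _ _ _ _ h1]
    simp only [hy, if_neg he, if_pos h2]
    rw [map_neg, hbx, ← hc, tateNorm, tateNorm, LinearMap.sum_apply, LinearMap.sum_apply, map_sum,
      Finset.sum_congr rfl fun j _ => (hpow q j).2]
    abel

end Contraction

/-! ### Bimodules of finite projective dimension -/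

section ProjectiveDimension

variable {r : ℕ} [NeZero r] {k : Type u} [Field k] {A : Type u} [Ring A] [Algebra k A]

lemma bimodAcyclic_finsupp (p : ℕ) (κ : Type u) :
    BimodAcyclic p r k A (κ →₀ A ⊗[k] Aᵐᵒᵖ) := by
  set e := Module.Basis.ofVectorSpace k A
  set bS := e.tensorProduct (e.map (MulOpposite.opLinearEquiv k))
  exact bimodAcyclic_of_basis (e := e) (v := fun j => Finsupp.single j (1 : A ⊗[k] Aᵐᵒᵖ))
    (bL := bS.smulTower' (Finsupp.basisSingleOne (R := A ⊗[k] Aᵐᵒᵖ) (ι := κ))) p (fun j c d => by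
      rw [Module.Basis.smulTower'_apply]
      simp [bS])

lemma BimodAcyclic.of_retract {p : ℕ} {M L : Type u} [AddCommGroup M] [Module (A ⊗[k] Aᵐᵒᵖ) M]
    [Module k M] [IsScalarTower k (A ⊗[k] Aᵐᵒᵖ) M] [AddCommGroup L] [Module (A ⊗[k] Aᵐᵒᵖ) L]
    [Module k L] [IsScalarTower k (A ⊗[k] Aᵐᵒᵖ) L] (hL : BimodAcyclic p r k A L)
    (s : M →ₗ[A ⊗[k] Aᵐᵒᵖ] L) (g : L →ₗ[A ⊗[k] Aᵐᵒᵖ] M) (hs : ∀ m, g (s m) = m) :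
    BimodAcyclic p r k A M := by
  intro n x hx hD
  obtain ⟨y, hy, hDy⟩ := hL n (fun q => ((blockMap r (SqExt.map s)).app (Lam.ob r q)).hom (x q))
    (fun q => blockMap_mem_goodSpan s (hx q)) (by
      filter_upwards [hD] with q hq
      rw [tateD_blockMap, hq, map_zero])
  refine ⟨fun q => ((blockMap r (SqExt.map g)).app (Lam.ob r q)).hom (y q),
    fun q => blockMap_mem_goodSpan g (hy q), ?_⟩
  filter_upwards [hDy] with q hq
  rw [tateD_blockMap, hq]
  have h1 : ∀ w, ((blockMap r (SqExt.map g)).app (Lam.ob r q)).hom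
      (((blockMap r (SqExt.map s)).app (Lam.ob r q)).hom (word r k (SqExt k A M) q w)) =
      word r k (SqExt k A M) q w := by
    intro w
    rw [blockMap_word, blockMap_word]
    congr 1
    exact funext fun i => SqExt.ext rfl (hs _)
  exact word_ext (f := ((blockMap r (SqExt.map g)).app (Lam.ob r q)).hom ∘ₗ
    ((blockMap r (SqExt.map s)).app (Lam.ob r q)).hom) (g := LinearMap.id) h1 (x q)

lemma bimodAcyclic_of_surjective {p : ℕ} (hp : p.Prime) (hrp : r ∣ p) {d : ℕ} {L M : Type u}
    [AddCommGroup M] [Module (A ⊗[k] Aᵐᵒᵖ) M] [Module k M] [IsScalarTower k (A ⊗[k] Aᵐᵒᵖ) M]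
    [AddCommGroup L] [Module (A ⊗[k] Aᵐᵒᵖ) L] [Module k L] [IsScalarTower k (A ⊗[k] Aᵐᵒᵖ) L]
    (hL : BimodAcyclic p r k A L) (hX : Projective (ModuleCat.of (A ⊗[k] Aᵐᵒᵖ) L))
    (g : L →ₗ[A ⊗[k] Aᵐᵒᵖ] M) (hg : Function.Surjective g)
    (ih : ∀ (K : Type u) [AddCommGroup K] [Module (A ⊗[k] Aᵐᵒᵖ) K] [Module k K]
      [IsScalarTower k (A ⊗[k] Aᵐᵒᵖ) K],
      HasProjectiveDimensionLE (ModuleCat.of (A ⊗[k] Aᵐᵒᵖ) K) d → BimodAcyclic p r k A K)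
    (h : HasProjectiveDimensionLE (ModuleCat.of (A ⊗[k] Aᵐᵒᵖ) M) (d + 1)) :
    BimodAcyclic p r k A M := by
  obtain ⟨s, hs⟩ := (g.restrictScalars k).exists_rightInverse_of_surjective
    (LinearMap.range_eq_top.mpr hg)
  set S : ShortComplex (ModuleCat.{u} (A ⊗[k] Aᵐᵒᵖ)) :=
    ShortComplex.mk (ModuleCat.ofHom (X := LinearMap.ker g) (Y := L) (LinearMap.ker g).subtype) (ModuleCat.ofHom g)
      (ModuleCat.hom_ext (LinearMap.ext fun x => x.2))
  have hS : S.ShortExact := ModuleCat.shortComplex_shortExact S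
    (LinearMap.exact_subtype_ker_map g) Subtype.val_injective hg
  have h1 : HasProjectiveDimensionLT S.X₁ (d + 1) := (hS.hasProjectiveDimensionLT_X₃_iff d hX).mp h
  exact bimodAcyclic_of_exact hp hrp g s (fun m => LinearMap.congr_fun hs m) hL (ih _ h1)

/-- Dimension shifting along free covers. -/
theorem bimodAcyclic_of_hasProjectiveDimensionLE {p : ℕ} (hp : p.Prime) (hrp : r ∣ p) (d : ℕ) :
    ∀ (M : Type u) [AddCommGroup M] [Module (A ⊗[k] Aᵐᵒᵖ) M] [Module k M]
      [IsScalarTower k (A ⊗[k] Aᵐᵒᵖ) M],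
      HasProjectiveDimensionLE (ModuleCat.of (A ⊗[k] Aᵐᵒᵖ) M) d → BimodAcyclic p r k A M := by
  induction d with
  | zero =>
    intro M _ _ _ _ h
    have h1 : Projective (ModuleCat.of (A ⊗[k] Aᵐᵒᵖ) M) :=
      (projective_iff_hasProjectiveDimensionLE_zero _).mpr h
    obtain ⟨s, hs⟩ := Module.projective_def'.mp ((IsProjective.iff_projective M).mpr h1)
    exact (bimodAcyclic_finsupp p M).of_retract s (Finsupp.linearCombination _ id)
      (fun m => LinearMap.congr_fun hs m)
  | succ d ih =>
    intro M _ _ _ _ h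
    exact bimodAcyclic_of_surjective hp hrp (bimodAcyclic_finsupp p M)
      (ModuleCat.projective_of_free (Finsupp.basisSingleOne (R := A ⊗[k] Aᵐᵒᵖ) (ι := M)))
      (Finsupp.linearCombination _ id) (Finsupp.linearCombination_id_surjective _ _) ih h

end ProjectiveDimension

section Diagonal

variable {r : ℕ} [NeZero r] {k : Type u} [Field k] {A : Type u} [Ring A] [Algebra k A]

variable (k A) in
/-- An algebra is a bimodule over itself. -/
abbrev envModule : Module (A ⊗[k] Aᵐᵒᵖ) A := TensorProduct.Algebra.module

attribute [local instance] envModule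

lemma env_left_smul (a m : A) : (a ⊗ₜ[k] (1 : Aᵐᵒᵖ)) • m = a * m := by
  rw [TensorProduct.Algebra.smul_def, one_smul, smul_eq_mul]

lemma env_right_smul (a m : A) : ((1 : A) ⊗ₜ[k] MulOpposite.op a) • m = m * a := by
  rw [TensorProduct.Algebra.smul_def, one_smul, MulOpposite.smul_eq_mul_unop, MulOpposite.unop_op]

lemma env_isScalarTower : IsScalarTower k (A ⊗[k] Aᵐᵒᵖ) A := by
  refine ⟨fun c s m => ?_⟩
  induction s with
  | zero =>
    have h : (0 : A ⊗[k] Aᵐᵒᵖ) • m = 0 := zero_smul (A ⊗[k] Aᵐᵒᵖ) m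
    rw [smul_zero, h, smul_zero]
  | add s t hs ht => rw [smul_add, add_smul, add_smul, hs, ht, smul_add]
  | tmul a a' =>
    rw [TensorProduct.smul_tmul', TensorProduct.Algebra.smul_def, TensorProduct.Algebra.smul_def,
      smul_assoc]

attribute [local instance] env_isScalarTower

/-- The two coordinates of an element of `A ⊕ A`, added. -/
def addCoord : SqExt k A A →ₗ[k] A where
  toFun x := x.1 + x.2
  map_add' _ _ := add_add_add_comm _ _ _ _
  map_smul' c x := (smul_add c x.1 x.2).symm

lemma addCoord_mul {x y : SqExt k A A} (h : x.2 = 0 ∨ y.2 = 0) :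
    addCoord (x * y) = addCoord x * addCoord y := by
  change (x * y).1 + (x * y).2 = (x.1 + x.2) * (y.1 + y.2)
  rw [SqExt.mul_fst, SqExt.mul_snd, env_left_smul, env_right_smul]
  rcases h with h | h <;> rw [h] <;> noncomm_ring

lemma addCoord_iprod_none (w : ℤ → SqExt k A A) {x y : ℤ} (hxy : x ≤ y)
    (h : ∀ z, x ≤ z → z < y → (w z).2 = 0) :
    (iprod w x y).2 = 0 ∧ addCoord (iprod w x y) = iprod (fun z => addCoord (w z)) x y := by
  obtain ⟨c, rfl⟩ : ∃ c : ℕ, y = x + c := ⟨(y - x).toNat, by omega⟩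
  induction c with
  | zero =>
    simp only [Nat.cast_zero, add_zero, iprod_self]
    exact ⟨rfl, add_zero (1 : A)⟩
  | succ c ih =>
    obtain ⟨h1, h2⟩ := ih (by omega) fun z h1 h2 => h z h1 (by push_cast; omega)
    have h3 := h (x + c) (by omega) (by push_cast; omega)
    rw [← iprod_mul w (x := x) (y := x + c) (by omega) (by push_cast; omega),
      ← iprod_mul (fun z => addCoord (w z)) (x := x) (y := x + c) (by omega) (by push_cast; omega),
      show x + ((c + 1 : ℕ) : ℤ) = x + c + 1 by push_cast; ring, iprod_single, iprod_single]
    refine ⟨?_, by rw [addCoord_mul (Or.inl h1), h2]⟩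
    rw [SqExt.mul_snd, h1, h3, smul_zero, smul_zero, add_zero]

lemma addCoord_iprod (w : ℤ → SqExt k A A) {x y z₀ : ℤ} (hxy : x ≤ y)
    (h : ∀ z, x ≤ z → z < y → z ≠ z₀ → (w z).2 = 0) :
    addCoord (iprod w x y) = iprod (fun z => addCoord (w z)) x y := by
  by_cases hz : x ≤ z₀ ∧ z₀ < y
  · obtain ⟨h1, h2⟩ := hz
    have e1 := addCoord_iprod_none w h1 fun z h3 h4 => h z h3 (by omega) (by omega)
    have e2 := addCoord_iprod_none w (x := z₀ + 1) (y := y) (by omega)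
      fun z h3 h4 => h z (by omega) (by omega) (by omega)
    rw [← iprod_mul w (x := x) (y := z₀ + 1) (by omega) (by omega), ← iprod_mul w h1 (by omega), iprod_single,
      addCoord_mul (Or.inr e2.1), addCoord_mul (Or.inl e1.1), e1.2, e2.2,
      ← iprod_mul (fun z => addCoord (w z)) (x := x) (y := z₀ + 1) (z := y) (by omega) (by omega),
      ← iprod_mul (fun z => addCoord (w z)) (z := z₀ + 1) h1 (by omega), iprod_single]
  · exact (addCoord_iprod_none w hxy fun z h3 h4 => h z h3 h4 (by rintro rfl; exact hz ⟨h3, h4⟩)).2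

lemma addCoord_fibreProd {a c : ℕ} (f : PMap (a + 1) (c + 1)) (hf : f.toFun 0 = 0)
    {w : ZMod (r * (a + 1)) → SqExt k A A} (hw : w ∈ goodWords (fun _ => ⊤) a)
    (j : ZMod (r * (c + 1))) :
    addCoord (fibreProd (f.dilate r) w j) = fibreProd (f.dilate r) (fun i => addCoord (w i)) j := by
  have hm : 0 < r * (c + 1) := NeZero.pos _
  obtain ⟨J, rfl⟩ := ZMod.intCast_surjective j
  have hft : ∀ t : ℤ, f.toFun (((a + 1 : ℕ) : ℤ) * t) = ((c + 1 : ℕ) : ℤ) * t := fun t => by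
    have := f.shift_mul 0 t
    rw [hf, zero_add, zero_add] at this
    rw [mul_comm, this, mul_comm]
  rw [fibreProd_intCast, fibreProd_intCast]
  refine addCoord_iprod (z₀ := ((a + 1 : ℕ) : ℤ) * (J / (c + 1 : ℕ))) _
    (PMap.lower_mono hm _ (by omega)) fun z h3 h4 h5 => ?_
  have := hw (z : ZMod (r * (a + 1)))
  rw [slot_of_not_dvd] at this
  · obtain ⟨a', ha'⟩ := this
    rw [← ha']
    rfl
  · rintro ⟨t, rfl⟩
    have h6 := (PMap.mem_fibre_iff hm (f.dilate r) _ J).mp ⟨h3, h4⟩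
    change f.toFun _ = _ at h6
    rw [hft] at h6
    rw [← h6, Int.mul_ediv_cancel_left _ (by positivity)] at h5
    exact h5 rfl

/-- The germs of the Tate complex of `A ⊗ ⋯ ⊗ A` with `r` blocks are acyclic: it is the case of the diagonal bimodule,
up to the identification of the letters of `A` in the slots with letters from the bimodule `A`. -/
theorem germAcyclic_blockObject {p : ℕ} (hp : p.Prime) (hrp : r ∣ p)
    (hA : ∃ d : ℕ, ∀ M : ModuleCat.{u} (A ⊗[k] Aᵐᵒᵖ), HasProjectiveDimensionLE M d) :
    GermAcyclicOn p (bOp (blockObject r k A)) (lapOp (blockObject r k A)) fun _ => ⊤ := by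
  obtain ⟨d, hd⟩ := hA
  have hac := bimodAcyclic_of_hasProjectiveDimensionLE (k := k) hp hrp d A (hd _)
  set Φ : ∀ q, (blockObject r k (SqExt k A A)).obj (Lam.ob r q) →ₗ[k]
      (blockObject r k A).obj (Lam.ob r q) := fun q => wordMap fun _ => addCoord with hΦ
  set Ψ : ∀ q, (blockObject r k A).obj (Lam.ob r q) →ₗ[k]
      (blockObject r k (SqExt k A A)).obj (Lam.ob r q) := fun q => wordMap fun i =>
        if slot r q i = none then SqExt.inlLinear k A A else SqExt.inrLinear k A A with hΨ
  have hword : ∀ q w, Φ q (word r k _ q w) = word r k A q fun i => addCoord (w i) :=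
    fun q w => wordMap_word _ w
  have hΨword : ∀ q w, Ψ q (word r k _ q w) = word r k _ q fun i =>
      (if slot r q i = none then SqExt.inlLinear k A A else SqExt.inrLinear k A A) (w i) :=
    fun q w => wordMap_word _ w
  have hΨmem : ∀ q x, Ψ q x ∈ goodSpan (r := r) (k := k) (A := A) (M := A) (fun _ => ⊤) q := by
    intro q x
    have := PiTensorProduct.span_tprod_eq_top (R := k) (s := fun _ : ZMod (r * (q + 1)) => A)
    have hx : x ∈ Submodule.span k (Set.range (word r k A q)) := this ▸ trivial
    rw [← Submodule.mem_comap]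
    refine Submodule.span_le.mpr ?_ hx
    rintro _ ⟨w, rfl⟩
    refine Submodule.mem_comap.mpr ?_
    rw [hΨword]
    refine word_mem_goodSpan fun i => ?_
    rcases h : slot r q i with _ | t
    · rw [if_pos rfl]
      exact ⟨w i, rfl⟩
    · rw [if_neg (by simp)]
      exact ⟨w i, trivial, rfl⟩
  have hΦΨ : ∀ q x, Φ q (Ψ q x) = x := by
    intro q
    refine word_ext (f := Φ q ∘ₗ Ψ q) (g := LinearMap.id) fun w => ?_
    rw [LinearMap.comp_apply, hΨword, hword]
    refine congrArg (word r k A q) (funext fun i => ?_)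
    split_ifs
    · exact add_zero (w i)
    · exact zero_add (w i)
  have hΨΦ : ∀ q, ∀ x ∈ goodSpan (r := r) (k := k) (A := A) (M := A) (fun _ => ⊤) q,
      Ψ q (Φ q x) = x := by
    intro q x hx
    refine goodSpan_le (Y := LinearMap.eqLocus (Ψ q ∘ₗ Φ q) LinearMap.id) (fun w hw => ?_) hx
    rw [LinearMap.mem_eqLocus, LinearMap.comp_apply, hword, hΨword]
    refine congrArg (word r k _ q) (funext fun i => ?_)
    have := hw i
    revert this
    rcases h : slot r q i with _ | t
    · rintro ⟨a, ha⟩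
      rw [if_pos rfl, ← ha]
      exact congrArg SqExt.inl (add_zero a)
    · rintro ⟨a, -, ha⟩
      rw [if_neg (by simp), ← ha]
      exact congrArg SqExt.inr (zero_add a)
  have hb : ∀ q, ∀ x ∈ goodSpan (r := r) (k := k) (A := A) (M := A) (fun _ => ⊤) (q + 1),
      Φ q (bOp _ q x) = bOp _ q (Φ (q + 1) x) := by
    intro q x hx
    refine goodSpan_le (Y := LinearMap.eqLocus (Φ q ∘ₗ bOp _ q) (bOp _ q ∘ₗ Φ (q + 1)))
      (fun w hw => ?_) hx
    rw [LinearMap.mem_eqLocus, LinearMap.comp_apply, LinearMap.comp_apply, hword, bOp, bOp,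
      LinearMap.sum_apply, LinearMap.sum_apply, map_sum]
    refine Finset.sum_congr rfl fun i hi => ?_
    rw [Finset.mem_range] at hi
    rw [LinearMap.smul_apply, LinearMap.smul_apply, map_smul, faceOp, faceOp, map_word, map_word,
      hword]
    congr 2
    exact funext fun j => addCoord_fibreProd _ (PMap.face_of_le (by omega) le_rfl (by positivity)) hw j
  have hs : ∀ q x, Φ q (lapOp _ q x) = lapOp _ q (Φ q x) := by
    intro q
    refine word_ext (f := Φ q ∘ₗ lapOp _ q) (g := lapOp _ q ∘ₗ Φ q) fun w => ?_
    rw [LinearMap.comp_apply, LinearMap.comp_apply, lapOp_word, hword, hword, lapOp_word]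
  have hpow : ∀ q x j, Φ q ((lapOp _ q ^ j) x) = (lapOp _ q ^ j) (Φ q x) := by
    intro q x j
    induction j with
    | zero => rfl
    | succ j ih => rw [pow_succ', Module.End.mul_apply, hs, ih, pow_succ', Module.End.mul_apply]
  have hD : ∀ n x, (∀ q, x q ∈ goodSpan (r := r) (k := k) (A := A) (M := A) (fun _ => ⊤) q) → ∀ q,
      Φ q (tateD p (bOp (blockObject r k (SqExt k A A))) (lapOp _) n x q) =
        tateD p (bOp (blockObject r k A)) (lapOp _) n (fun q => Φ q (x q)) q := by
    intro n x hx q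
    by_cases h : Even (n - q)
    · rw [tateD_even _ _ _ _ h, tateD_even _ _ _ _ h, map_add, map_sub, hb q _ (hx _), hs]
    · rw [tateD_odd _ _ _ _ h, tateD_odd _ _ _ _ h, map_sub, hb q _ (hx _), tateNorm, tateNorm,
        LinearMap.sum_apply, LinearMap.sum_apply, map_sum]
      simp only [hpow]
  intro n x _ hx
  have hD1 := hD n (fun q => Ψ q (x q)) fun q => hΨmem q _
  simp only [hΦΨ] at hD1
  obtain ⟨y, hy, hDy⟩ := hac n (fun q => Ψ q (x q)) (fun q => hΨmem q _) (by
    filter_upwards [hx] with q hq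
    rw [← hΨΦ q _ (tateD_mem_goodSpan p (fun q => hΨmem q _) n q), hD1, hq, map_zero])
  refine ⟨fun q => Φ q (y q), fun _ => trivial, ?_⟩
  filter_upwards [hDy] with q hq
  rw [← hD (n + 1) y hy, hq, hΦΨ]

end Diagonal

/-! ### Trivial actions of `ℤ/p` -/

section Trivial

variable {k : Type*} [Field k] {p : ℕ} [CharP k p] {V : ℕ → Type*} [∀ q, AddCommGroup (V q)]
  [∀ q, Module k (V q)] {b : ∀ q, V (q + 1) →ₗ[k] V q} {s : ∀ q, Module.End k (V q)}

lemma tateNorm_eq_zero (hs : ∀ q, s q = 1) (q : ℕ) : tateNorm p s q = 0 := by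
  rw [tateNorm_eq_one_sub_mul, hs, sub_self, zero_mul]

/-- If `ℤ/p` acts trivially, acyclicity of germs depends only on the complex of abelian groups. -/
theorem GermAcyclicOn.of_addEquiv {W : ℕ → Type*} [∀ q, AddCommGroup (W q)] [∀ q, Module k (W q)]
    {b' : ∀ q, W (q + 1) →ₗ[k] W q} {s' : ∀ q, Module.End k (W q)} (h : GermAcyclicOn p b s fun _ => ⊤)
    (hs : ∀ q, s q = 1) (hs' : ∀ q, s' q = 1) (e : ∀ q, V q ≃+ W q) (hb : ∀ q x, b' q (e (q + 1) x) = e q (b q x)) :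
    GermAcyclicOn p b' s' fun _ => ⊤ := by
  have hD : ∀ n x q, tateD p b' s' n (fun q => e q (x q)) q = e q (tateD p b s n x q) := fun n x q => by
    by_cases h : Even (n - q)
    · rw [tateD_even _ _ _ _ h, tateD_even _ _ _ _ h, hs, hs', hb, map_add]
      simp
    · rw [tateD_odd _ _ _ _ h, tateD_odd _ _ _ _ h, tateNorm_eq_zero hs, tateNorm_eq_zero hs', hb, map_sub]
      simp
  intro n x _ hx
  obtain ⟨y, -, hy⟩ := h n (fun q => (e q).symm (x q)) (fun _ => trivial) (hx.mono fun q hq =>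
    (e q).injective (by rw [← hD, map_zero, ← hq]; simp))
  exact ⟨fun q => e q (y q), fun _ => trivial, hy.mono fun q hq => by rw [hD, hq, AddEquiv.apply_symm_apply]⟩

end Trivial

/-- The functor `[n] ↦ [1 n]` is the identity. -/
def inclOneIso : Lam.incl 1 ≅ 𝟭 (Lam 1) :=
  NatIso.ofComponents (fun X =>
    { hom := Lam.ofMap (X := (Lam.incl 1).obj X) (Y := X) ⟨fun a => a, fun _ _ h => h, fun a => by
        change a + ((1 * X.len : ℕ) : ℤ) = _; rw [one_mul]⟩
      inv := Lam.ofMap (X := X) (Y := (Lam.incl 1).obj X) ⟨fun a => a, fun _ _ h => h, fun a => by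
        change _ = a + ((1 * X.len : ℕ) : ℤ); rw [one_mul]⟩
      hom_inv_id := rfl
      inv_hom_id := rfl }) (fun {X Y} f => by
    induction f using Quotient.ind
    rfl)

/-- The restriction of a cyclic vector space along `[n] ↦ [1 n]` is the cyclic vector space itself. -/
def inclOne {k : Type u} [Field k] (E : Lam 1 ⥤ ModuleCat.{u} k) : Lam.incl 1 ⋙ E ≅ E :=
  Functor.isoWhiskerRight inclOneIso E

lemma lapOp_one {k : Type u} [Field k] (E : Lam 1 ⥤ ModuleCat.{u} k) (q : ℕ) : lapOp E q = 1 := by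
  have := lapOp_pow E q
  rwa [pow_one] at this

/-! ### The Frobenius twist of the cyclic object of an algebra -/

section Twist

variable {k : Type u} [Field k] {p : ℕ} [ExpChar k p] [PerfectRing k p] {A : Type u} [Ring A]
  [Algebra k A]

/-- The map inverse to the passage to the twist is multilinear if `c ∈ k` acts on the target through its `p`-th
root. -/
def untwistMultilinear (n : ℕ) : MultilinearMap k (fun _ : ZMod n => FrobTwist k p A)
    ((ModuleCat.restrictScalars ((frobeniusEquiv k p).symm : k →+* k)).obj
      (ModuleCat.of k (⨂[k] _ : ZMod n, A))) where
  toFun a := (PiTensorProduct.tprod k (fun i => (a i : A)) : ⨂[k] _ : ZMod n, A)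
  map_update_add' a i x y := MultilinearMap.map_update_add
    (PiTensorProduct.tprod k (s := fun _ : ZMod n => A)) a i x y
  map_update_smul' a i c x := MultilinearMap.map_update_smul
    (PiTensorProduct.tprod k (s := fun _ : ZMod n => A)) a i ((frobeniusEquiv k p).symm c) x

variable (k p A) in
/-- The inverse of `twistTensor`. -/
def untwistTensor (n : ℕ) : (⨂[k] _ : ZMod n, FrobTwist k p A) →+ ⨂[k] _ : ZMod n, A :=
  (PiTensorProduct.lift (untwistMultilinear n)).toAddMonoidHom

lemma untwistTensor_tprod (n : ℕ) (a : ZMod n → A) :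
    untwistTensor k p A n (PiTensorProduct.tprod k fun i => toTwist k p (a i)) =
      PiTensorProduct.tprod k a :=
  PiTensorProduct.lift.tprod (φ := untwistMultilinear (k := k) (p := p) (A := A) n) _

lemma untwistTensor_smul (n : ℕ) (c : k) (x : ⨂[k] _ : ZMod n, FrobTwist k p A) :
    untwistTensor k p A n (c • x) = (frobeniusEquiv k p).symm c • untwistTensor k p A n x :=
  (PiTensorProduct.lift (untwistMultilinear (k := k) (p := p) (A := A) n)).map_smul c x

lemma twistTensor_bijective (n : ℕ) : Function.Bijective (twistTensor k p A n) := by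
  refine Function.bijective_iff_has_inverse.mpr ⟨untwistTensor k p A n, fun x => ?_, fun x => ?_⟩
  · induction x using PiTensorProduct.induction_on with
    | smul_tprod c a =>
      rw [twistTensor_smul, twistTensor_tprod, untwistTensor_smul, untwistTensor_tprod]
      congr 1
      exact frobeniusEquiv_symm_apply_frobenius k p c
    | add x y hx hy => rw [map_add, map_add, hx, hy]
  · induction x using PiTensorProduct.induction_on with
    | smul_tprod c a =>
      let a' : ZMod n → A := a
      have h' : untwistTensor k p A n (PiTensorProduct.tprod k a) = PiTensorProduct.tprod k a' :=
        untwistTensor_tprod n a'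
      rw [untwistTensor_smul, twistTensor_smul, h', twistTensor_tprod]
      congr 1
      exact frobenius_apply_frobeniusEquiv_symm k p c
    | add x y hx hy => rw [map_add, map_add, hx, hy]

lemma twistTensor_tensorMap {n m : ℕ} [NeZero n] [NeZero m] (f : PMap n m) (x : ⨂[k] _ : ZMod n, A) :
    twistTensor k p A m (tensorMap k A f x) =
      tensorMap k (FrobTwist k p A) f (twistTensor k p A n x) := by
  induction x using PiTensorProduct.induction_on with
  | smul_tprod c a =>
    rw [map_smul, twistTensor_smul, twistTensor_smul, map_smul, twistTensor_tprod, tensorMap_tprod,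
      tensorMap_tprod, twistTensor_tprod]
    rfl
  | add x y hx hy => simp only [map_add, hx, hy]

lemma twistTensor_neg_one_pow (n i : ℕ) (x : ⨂[k] _ : ZMod n, A) :
    twistTensor k p A n ((-1 : k) ^ i • x) = (-1 : k) ^ i • twistTensor k p A n x := by
  rw [twistTensor_smul, ← frobenius_def, map_pow, map_neg, map_one]

lemma twistTensor_bOp (q : ℕ) (x : (cyclicObject k A).obj (Lam.ob 1 (q + 1))) :
    (twistTensor k p A (q + 1) (bOp (cyclicObject k A) q x) :
      (cyclicObject k (FrobTwist k p A)).obj (Lam.ob 1 q)) =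
      bOp (cyclicObject k (FrobTwist k p A)) q (twistTensor k p A (q + 2) x) := by
  refine (congrArg (twistTensor k p A (q + 1)) (LinearMap.sum_apply _ _ _)).trans ?_
  refine ((map_sum (twistTensor k p A (q + 1)) _ _).trans (Finset.sum_congr rfl fun i _ => ?_)).trans
    (LinearMap.sum_apply _ _ _).symm
  refine (twistTensor_neg_one_pow (q + 1) i _).trans ?_
  exact congrArg _ (twistTensor_tensorMap (PMap.face (q + 1) i) x)

lemma lapOp_proj (E : Lam 1 ⥤ ModuleCat.{u} k) (q : ℕ) : lapOp (Lam.proj p ⋙ E) q = 1 := by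
  have h := lapOp_one E q
  rw [lapOp_eq] at h ⊢
  exact h

/-- The canonical bijection `A^{⊗ (q + 1)} → (A^{(1)})^{⊗ (q + 1)}` between levels of cyclic objects. -/
def twistEquiv (q : ℕ) : (cyclicObject k A).obj (Lam.ob 1 q) ≃+
    (Lam.proj p ⋙ cyclicObject k (FrobTwist k p A)).obj (Lam.ob p q) :=
  AddEquiv.ofBijective (twistTensor k p A (q + 1)) (twistTensor_bijective (q + 1))

lemma bOp_twistEquiv (q : ℕ) (x : (cyclicObject k A).obj (Lam.ob 1 (q + 1))) :
    bOp (Lam.proj p ⋙ cyclicObject k (FrobTwist k p A)) q (twistEquiv (q + 1) x) =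
      twistEquiv q (bOp (cyclicObject k A) q x) :=
  (twistTensor_bOp q x).symm

/-- The source of `F_#` differs from `A_#`, the case of one block, only in the action of `k`. -/
theorem germAcyclic_twist (hp : p.Prime) [CharP k p]
    (hA : ∃ d : ℕ, ∀ M : ModuleCat.{u} (A ⊗[k] Aᵐᵒᵖ), HasProjectiveDimensionLE M d) :
    GermAcyclicOn p (bOp (Lam.proj p ⋙ cyclicObject k (FrobTwist k p A)))
      (lapOp (Lam.proj p ⋙ cyclicObject k (FrobTwist k p A))) fun _ => ⊤ :=
  (germAcyclic_blockObject (r := 1) hp (one_dvd p) hA).of_addEquiv (lapOp_one _) (lapOp_proj _)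
    (fun q => ((inclOne (cyclicObject k A)).app (Lam.ob 1 q)).toLinearEquiv.toAddEquiv.trans (twistEquiv q))
    fun q x => (bOp_twistEquiv q _).trans (congrArg (twistEquiv q) (bOp_app (inclOne (cyclicObject k A)).hom q x))

end Twist

/-! ### Naturality of the tensor powers of a quasi-Frobenius map -/

lemma iprod_one {M : Type*} [Monoid M] (x y : ℤ) : iprod (fun _ => (1 : M)) x y = 1 := by
  simp [iprod]

/-- A product over all of `ℤ/m`-periods in which only the factors over `j` are non-trivial. -/
theorem iprod_ite_toFun {M : Type*} [Monoid M] {n m : ℕ} (hm : 0 < m) (f : PMap n m) (g : ℤ → M)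
    {x y j : ℤ} (hx : x ≤ j) (hy : j < y) :
    iprod (fun z => if f.toFun z = j then g z else 1) (f.lower x) (f.lower y) =
      iprod g (f.lower j) (f.lower (j + 1)) := by
  have h1 := f.lower_mono hm hx
  have h2 := f.lower_mono hm (show j ≤ j + 1 by omega)
  have h3 := f.lower_mono hm (show j + 1 ≤ y by omega)
  rw [← iprod_mul _ h1 (h2.trans h3), ← iprod_mul _ h2 h3]
  have e1 : iprod (fun z => if f.toFun z = j then g z else 1) (f.lower x) (f.lower j) = 1 := by
    refine Eq.trans ?_ (iprod_one (f.lower x) (f.lower j))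
    refine iprod_congr fun z _ hz => if_neg fun h => ?_
    have := (f.mem_fibre_iff hm z j).mpr h
    omega
  have e2 : iprod (fun z => if f.toFun z = j then g z else 1) (f.lower (j + 1)) (f.lower y) = 1 := by
    refine Eq.trans ?_ (iprod_one (f.lower (j + 1)) (f.lower y))
    refine iprod_congr fun z hz _ => if_neg fun h => ?_
    have := (f.mem_fibre_iff hm z j).mpr h
    omega
  rw [e1, e2, one_mul, mul_one]
  refine iprod_congr fun z h4 h5 => if_pos ?_
  exact (f.mem_fibre_iff hm z j).mp ⟨h4, h5⟩

section Spread

variable {A : Type*} [Monoid A] {p m : ℕ} [NeZero p] [NeZero m]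

lemma PMap.lower_spread (J K : ℤ) : (PMap.spread p m J).lower K = -((J - K) / m) := by
  have hm : (0 : ℤ) < m := by exact_mod_cast NeZero.pos m
  refine eq_of_forall_ge_iff fun i => ?_
  rw [PMap.lower_le_iff (Nat.mul_pos (NeZero.pos p) (NeZero.pos m))]
  rw [neg_le, Int.le_ediv_iff_mul_le hm]
  change K ≤ J + m * i ↔ _
  constructor <;> intro h <;> linarith

lemma fibreProd_spread (J c s : ℤ) (hc : c < m) (hc' : -m < c) (u : ZMod p → A) :
    fibreProd (PMap.spread p m J) u ((J + c + m * s : ℤ) : ZMod (p * m)) =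
      if c = 0 then u (s : ZMod p) else 1 := by
  have hm : (0 : ℤ) < m := by exact_mod_cast NeZero.pos m
  rw [fibreProd_intCast, PMap.lower_spread, PMap.lower_spread,
    show J - (J + c + m * s) = -c + (-s) * m by ring,
    show J - (J + c + m * s + 1) = -c - 1 + (-s) * m by ring, Int.add_mul_ediv_right _ _ hm.ne',
    Int.add_mul_ediv_right _ _ hm.ne']
  split_ifs with h
  · subst h
    have : (-0 - 1 : ℤ) / m = -1 := by
      rw [Int.ediv_eq_iff_of_pos hm]; constructor <;> linarith
    rw [this, neg_zero, Int.zero_ediv, show -((0 : ℤ) + -s) = s by ring,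
      show -((-1 : ℤ) + -s) = s + 1 by ring, iprod_single]
  · have : (-c - 1) / (m : ℤ) = (-c) / m := by
      rcases lt_or_gt_of_ne h with h | h
      · rw [Int.ediv_eq_zero_of_lt (by omega) (by omega), Int.ediv_eq_zero_of_lt (by omega) (by omega)]
      · have e : ∀ y : ℤ, -m ≤ y → y < 0 → y / (m : ℤ) = -1 := fun y h1 h2 => by
          rw [Int.ediv_eq_iff_of_pos hm]; constructor <;> linarith
        rw [e _ (by omega) (by omega), e _ (by omega) (by omega)]
    rw [this, iprod_self]

lemma exists_spread_index (J K : ℤ) :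
    ∃ c s : ℤ, 0 ≤ c ∧ c < m ∧ K = J + c + m * s := by
  have hm : (0 : ℤ) < m := by exact_mod_cast NeZero.pos m
  exact ⟨(K - J) % m, (K - J) / m, Int.emod_nonneg _ hm.ne', Int.emod_lt_of_pos _ hm, by
    have := Int.emod_add_mul_ediv (K - J) m
    linarith⟩

lemma fibreProd_spread_mul (J : ℤ) (u v : ZMod p → A) :
    fibreProd (PMap.spread p m J) (u * v) =
      fibreProd (PMap.spread p m J) u * fibreProd (PMap.spread p m J) v := by
  funext K
  obtain ⟨K, rfl⟩ := ZMod.intCast_surjective K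
  obtain ⟨c, s, h1, h2, rfl⟩ := exists_spread_index (m := m) J K
  rw [Pi.mul_apply, fibreProd_spread _ _ _ h2 (by omega), fibreProd_spread _ _ _ h2 (by omega),
    fibreProd_spread _ _ _ h2 (by omega)]
  split_ifs <;> simp

lemma fibreProd_spread_one (J : ℤ) :
    fibreProd (PMap.spread p m J) (1 : ZMod p → A) = 1 := by
  funext K
  obtain ⟨K, rfl⟩ := ZMod.intCast_surjective K
  obtain ⟨c, s, h1, h2, rfl⟩ := exists_spread_index (m := m) J K
  rw [fibreProd_spread _ _ _ h2 (by omega)]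
  split_ifs <;> simp

lemma fibreProd_spread_add (J : ℤ) (u : ZMod p → A) :
    fibreProd (PMap.spread p m (J + m)) u = fibreProd (PMap.spread p m J) fun i => u (i - 1) := by
  funext K
  obtain ⟨K, rfl⟩ := ZMod.intCast_surjective K
  obtain ⟨c, s, h1, h2, rfl⟩ := exists_spread_index (m := m) J K
  rw [fibreProd_spread _ _ _ h2 (by omega), show J + c + m * s = (J + m) + c + m * (s - 1) by ring,
    fibreProd_spread _ _ _ h2 (by omega)]
  push_cast
  rfl

end Spread

section

variable {k : Type u} [Field k] {A : Type u} [Ring A] [Algebra k A] {p n m : ℕ} [NeZero p]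
  [NeZero n] [NeZero m]

variable (k A) in
/-- The embedding of `A^{⊗ p}` into `A^{⊗ pm}` onto the factors number `J + m l`, as a homomorphism. -/
def spreadHom (J : ℤ) : (⨂[k] _ : ZMod p, A) →* ⨂[k] _ : ZMod (p * m), A where
  toFun := tensorMap k A (PMap.spread p m J)
  map_one' := by
    rw [PiTensorProduct.one_def, tensorMap_tprod, fibreProd_spread_one, PiTensorProduct.one_def]
  map_mul' x y := by
    induction x using PiTensorProduct.induction_on with
    | smul_tprod c a =>
      induction y using PiTensorProduct.induction_on with
      | smul_tprod d b =>
        simp only [smul_mul_smul_comm, map_smul, PiTensorProduct.tprod_mul_tprod, tensorMap_tprod,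
          fibreProd_spread_mul]
      | add x y hx hy => rw [mul_add, map_add, map_add, hx, hy, mul_add]
    | add x y hx hy => rw [add_mul, map_add, map_add, hx, hy, add_mul]

lemma tensorMap_spread_add (J : ℤ) (x : ⨂[k] _ : ZMod p, A) (hx : cyclicPerm k p A x = x) :
    tensorMap k A (PMap.spread p m (J + m)) x = tensorMap k A (PMap.spread p m J) x := by
  have : tensorMap k A (PMap.spread p m (J + m)) =
      tensorMap k A (PMap.spread p m J) ∘ₗ cyclicPerm k p A :=
    PiTensorProduct.ext (MultilinearMap.ext fun a => by
      simp only [LinearMap.compMultilinearMap_apply, LinearMap.comp_apply, tensorMap_tprod,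
        fibreProd_spread_add]
      refine Eq.symm ((congrArg _ (PiTensorProduct.reindex_tprod _ _)).trans ?_)
      rw [tensorMap_tprod]
      simp only [Equiv.addRight_symm, Equiv.coe_addRight, sub_eq_add_neg])
  rw [this, LinearMap.comp_apply, hx]

lemma tensorMap_spread_add_mul (J s : ℤ) (x : ⨂[k] _ : ZMod p, A) (hx : cyclicPerm k p A x = x) :
    tensorMap k A (PMap.spread p m (J + m * s)) x = tensorMap k A (PMap.spread p m J) x := by
  induction s using Int.induction_on with
  | zero => simp
  | succ i ih =>
    rw [show J + (m : ℤ) * ((i : ℤ) + 1) = J + m * i + m by ring, tensorMap_spread_add _ _ hx, ih]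
  | pred i ih =>
    rw [← tensorMap_spread_add _ _ hx, ← ih,
      show J + (m : ℤ) * (-(i : ℤ) - 1) + m = J + m * -i by ring]

/-- A period of the integers, numbered by `Fin n`. -/
def periodEquiv (n : ℕ) [NeZero n] (x : ℤ) : Fin n ≃ ZMod n :=
  Equiv.ofBijective (fun l => ((x + (l : ℕ) : ℤ) : ZMod n)) <| by
    have : Fintype (ZMod n) := ZMod.fintype n
    rw [Fintype.bijective_iff_injective_and_card]
    refine ⟨fun i j h => ?_, by simp⟩
    simp only [Int.cast_add, Int.cast_natCast, add_right_inj] at h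
    have := congrArg ZMod.val h
    rw [ZMod.val_natCast_of_lt i.2, ZMod.val_natCast_of_lt j.2] at this
    exact Fin.ext this

/-- The ordered product of `L_z (c_z)` over a period of integers `z`, as a multilinear map in `c`. -/
def iprodMultilinear {V B : Type*} [AddCommGroup V] [Module k V] [Ring B] [Algebra k B]
    (L : ℤ → V →ₗ[k] B) (n : ℕ) [NeZero n] (x : ℤ) : MultilinearMap k (fun _ : ZMod n => V) B :=
  ((MultilinearMap.mkPiAlgebraFin k n B).compLinearMap fun l => L (x + (l : ℕ))).domDomCongr
    (periodEquiv n x)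

lemma iprodMultilinear_apply {V B : Type*} [AddCommGroup V] [Module k V] [Ring B] [Algebra k B]
    (L : ℤ → V →ₗ[k] B) (x : ℤ) (c : ZMod n → V) :
    iprodMultilinear L n x c = iprod (fun z => L z (c z)) x (x + n) := by
  unfold iprodMultilinear iprod
  rw [MultilinearMap.domDomCongr_apply, MultilinearMap.compLinearMap_apply,
    MultilinearMap.mkPiAlgebraFin_apply, show (x + n - x).toNat = n by omega, List.ofFn_eq_map,
    ← List.map_coe_finRange_eq_range, List.map_map]
  rfl

/-- The product of the images of pure tensors, spread over the fibres of `f`, is the pure tensor of the fibrewise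
products. -/
theorem iprod_spread_tprod (f : PMap n m) (W : ZMod (p * n) → A) :
    iprod (fun z => tensorMap k A (PMap.spread p m (f.toFun (z % n)))
      (PiTensorProduct.tprod k fun l : ZMod p => W ((z % n + n * (l.val : ℤ) : ℤ) : ZMod (p * n))))
      (f.lower 0) (f.lower 0 + n) = PiTensorProduct.tprod k (fibreProd (f.dilate p) W) := by
  have hm : 0 < m := NeZero.pos m
  have hn : (0 : ℤ) < n := by exact_mod_cast NeZero.pos n
  have hm' : (0 : ℤ) < m := by exact_mod_cast NeZero.pos m
  have hW : ∀ z s : ℤ, W ((z + n * (((s : ZMod p).val : ℕ) : ℤ) : ℤ) : ZMod (p * n)) =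
      W ((z + n * s : ℤ) : ZMod (p * n)) := fun z s => by
    congr 1
    rw [ZMod.intCast_eq_intCast_iff, Int.modEq_iff_dvd, ZMod.val_intCast]
    refine ⟨s / p, ?_⟩
    have := Int.emod_add_mul_ediv s p
    push_cast
    linear_combination (-(n : ℤ)) * this
  simp only [tensorMap_tprod]
  refine (map_iprod (PiTensorProduct.tprodMonoidHom k) (fun z => fibreProd
    (PMap.spread p m (f.toFun (z % n))) fun l : ZMod p =>
      W ((z % n + n * (l.val : ℤ) : ℤ) : ZMod (p * n))) _ _).symm.trans ?_
  refine congrArg (PiTensorProduct.tprod k) (funext fun K => ?_)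
  obtain ⟨K, rfl⟩ := ZMod.intCast_surjective K
  obtain ⟨j, s, hj0, hjm, rfl⟩ := exists_spread_index (m := m) 0 K
  rw [zero_add]
  have hlm : f.lower 0 + n = f.lower m := by
    have := f.lower_shift hm 0 1
    simpa using this.symm
  rw [hlm]
  refine (map_iprod (Pi.evalMonoidHom (fun _ => A) ((j + m * s : ℤ) : ZMod (p * m)))
    (fun z => fibreProd (PMap.spread p m (f.toFun (z % n))) fun l : ZMod p =>
      W ((z % n + n * (l.val : ℤ) : ℤ) : ZMod (p * n))) _ _).trans ?_
  have h1 : ∀ z, f.lower 0 ≤ z → z < f.lower m → Pi.evalMonoidHom (fun _ => A) ((j + m * s : ℤ) : ZMod (p * m))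
      (fibreProd (PMap.spread p m (f.toFun (z % n))) fun l : ZMod p =>
        W ((z % n + n * (l.val : ℤ) : ℤ) : ZMod (p * n))) =
      if f.toFun z = j then W ((z + n * s : ℤ) : ZMod (p * n)) else 1 := fun z h2 h3 => by
    have hz := Int.emod_add_mul_ediv z n
    have hfz : f.toFun (z % n) = f.toFun z - m * (z / n) := by
      have := f.shift_mul (z % n) (z / n)
      rw [show z % n + z / n * n = z by linarith] at this
      rw [this]; ring
    have h4 : 0 ≤ f.toFun z := (f.lower_le_iff hm _ _).mp h2
    have h5 : f.toFun z < m := by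
      rw [← not_le, ← f.lower_le_iff hm]; omega
    change fibreProd (PMap.spread p m (f.toFun (z % n))) (fun l : ZMod p =>
      W ((z % n + n * (l.val : ℤ) : ℤ) : ZMod (p * n))) _ = _
    rw [hfz, show j + m * s = f.toFun z - m * (z / n) + (j - f.toFun z) + m * (s + z / n) by ring,
      fibreProd_spread _ _ _ (by omega) (by omega), hW,
      show z % n + n * (s + z / n) = z + n * s by linear_combination hz]
    exact if_congr (by omega) rfl rfl
  rw [iprod_congr h1, iprod_ite_toFun hm f (fun z => W ((z + n * s : ℤ) : ZMod (p * n))) hj0 hjm,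
    fibreProd_intCast]
  have hl : ∀ i, (f.dilate p).lower i = f.lower i := fun i => rfl
  rw [hl, hl, show j + (m : ℤ) * s + 1 = j + 1 + s * m by ring, show j + (m : ℤ) * s = j + s * m by ring,
    f.lower_shift hm, f.lower_shift hm, iprod_shift]
  exact iprod_congr fun i _ _ => by rw [show i + (n : ℤ) * s = i + s * n by ring]

/-- The tensor product of maps followed by a morphism `f`, in terms of the factors. -/
theorem tensorMap_dilate_iprod (f : PMap n m) (c : ZMod n → ⨂[k] _ : ZMod p, A) :
    tensorMap k A (f.dilate p) (iprod (fun z => tensorMap k A (PMap.spread p n z) (c z)) 0 n) =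
      iprod (fun z => tensorMap k A (PMap.spread p m (f.toFun (z % n))) (c z))
        (f.lower 0) (f.lower 0 + n) := by
  have key : (tensorMap k A (f.dilate p)).compMultilinearMap
      (iprodMultilinear (fun z => tensorMap k A (PMap.spread p n z)) n 0) =
      iprodMultilinear (fun z => tensorMap k A (PMap.spread p m (f.toFun (z % n)))) n (f.lower 0) := by
    refine Module.Basis.ext_multilinear (fun _ => Basis.piTensorProduct fun _ : ZMod p =>
      Module.Basis.ofVectorSpace k A) fun v => ?_
    have hn : (0 : ℤ) < n := by exact_mod_cast NeZero.pos n
    obtain ⟨W, hW⟩ := exists_of_periodic (n := p * n)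
      (fun z => Module.Basis.ofVectorSpace k A (v (z : ZMod n) ((z / n : ℤ) : ZMod p))) (fun z => by
        push_cast
        rw [Int.add_mul_ediv_right _ _ hn.ne']
        simp)
    have hv : ∀ z : ℤ, (PiTensorProduct.tprod k fun l : ZMod p =>
        W ((z % n + n * (l.val : ℤ) : ℤ) : ZMod (p * n))) = Basis.piTensorProduct (fun _ : ZMod p =>
      Module.Basis.ofVectorSpace k A) (v z) := fun z => by
      rw [Basis.piTensorProduct_apply]
      congr 1
      funext l
      rw [hW, Int.add_mul_ediv_left _ _ hn.ne', Int.ediv_eq_zero_of_lt (Int.emod_nonneg _ hn.ne')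
        (Int.emod_lt_of_pos _ hn)]
      simp
    rw [LinearMap.compMultilinearMap_apply, iprodMultilinear_apply, iprodMultilinear_apply]
    simp only [← hv]
    rw [iprod_spread_tprod f W, zero_add]
    have h0 := iprod_spread_tprod (k := k) (PMap.id n) W
    rw [PMap.lower_id (NeZero.pos n), zero_add] at h0
    have h1 : iprod (fun z => tensorMap k A (PMap.spread p n z) (PiTensorProduct.tprod k fun l : ZMod p =>
        W ((z % n + n * (l.val : ℤ) : ℤ) : ZMod (p * n)))) 0 n =
        PiTensorProduct.tprod k W := by
      refine Eq.trans ?_ (h0.trans ?_)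
      · refine iprod_congr fun z h1 h2 => ?_
        change _ = tensorMap k A (PMap.spread p n (z % n)) _
        rw [Int.emod_eq_of_lt h1 h2]
      · exact congrArg _ (fibreProd_id W)
    rw [h1, tensorMap_tprod]
  have := MultilinearMap.congr_fun key c
  rwa [LinearMap.compMultilinearMap_apply, iprodMultilinear_apply, iprodMultilinear_apply,
    zero_add] at this

variable [ExpChar k p] [PerfectRing k p] (F : FrobTwist k p A →ₐ[k] ⨂[k] _ : ZMod p, A)

lemma tensorPower_eq (a : ZMod n → FrobTwist k p A) :
    tensorPower F n a = iprod (fun z => tensorMap k A (PMap.spread p n z) (F (a z))) 0 n := by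
  unfold tensorPower iprod
  rw [sub_zero, Int.toNat_natCast]
  simp only [List.map_map, bind_pure_comp, List.map_eq_map, zero_add]
  rfl

lemma tensorMap_tensorPower (hF : ∀ a, cyclicPerm k p A (F a) = F a) (f : PMap n m)
    (a : ZMod n → FrobTwist k p A) :
    tensorMap k A (f.dilate p) (tensorPower F n a) = tensorPower F m (fibreProd f a) := by
  have hm := NeZero.pos m
  rw [tensorPower_eq, tensorPower_eq, tensorMap_dilate_iprod f fun z => F (a z)]
  have hlm : f.lower 0 + n = f.lower m := by
    have := f.lower_shift hm 0 1
    simpa using this.symm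
  rw [hlm, ← iprod_iprod _ (f.lower_mono hm) (by positivity)]
  refine iprod_congr fun j _ _ => ?_
  rw [fibreProd_intCast]
  refine Eq.trans ?_ (map_iprod ((spreadHom k A (p := p) (m := m) j).comp
    (F : FrobTwist k p A →* ⨂[k] _ : ZMod p, A)) (fun i => a i) _ _).symm
  refine iprod_congr fun z h1 h2 => ?_
  change _ = tensorMap k A (PMap.spread p m j) (F (a z))
  have hz := Int.emod_add_mul_ediv z n
  have hfz := f.shift_mul (z % n) (z / n)
  rw [show z % n + z / n * n = z by linarith, (f.mem_fibre_iff hm z j).mp ⟨h1, h2⟩] at hfz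
  rw [hfz, show f.toFun (z % n) + z / n * m = f.toFun (z % n) + m * (z / n) by ring,
    tensorMap_spread_add_mul _ _ _ (hF _)]

/-- The linear extension of the tensor powers of `F`. -/
def tensorPowerMap (n : ℕ) [NeZero n] :
    (⨂[k] _ : ZMod n, FrobTwist k p A) →ₗ[k] ⨂[k] _ : ZMod (p * n), A :=
  PiTensorProduct.lift (iprodMultilinear
    (fun z => tensorMap k A (PMap.spread p n z) ∘ₗ F.toLinearMap) n 0)

lemma tensorPowerMap_tprod (a : ZMod n → FrobTwist k p A) :
    tensorPowerMap F n (PiTensorProduct.tprod k a) = tensorPower F n a := by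
  unfold tensorPowerMap
  rw [PiTensorProduct.lift.tprod, iprodMultilinear_apply, zero_add, tensorPower_eq]
  rfl

variable {F}

/-- The morphism `F_#` of `p`-cyclic vector spaces given by the tensor powers of `F`. -/
def tensorPowerHom (hF : ∀ a, cyclicPerm k p A (F a) = F a) :
    Lam.proj p ⋙ cyclicObject k (FrobTwist k p A) ⟶ Lam.incl p ⋙ cyclicObject k A where
  app X := ModuleCat.ofHom (X := ⨂[k] _ : ZMod X.len, FrobTwist k p A)
    (Y := ⨂[k] _ : ZMod (p * X.len), A) (tensorPowerMap F X.len)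
  naturality X Y f := by
    induction f using Quotient.ind with | _ f
    refine ModuleCat.hom_ext (PiTensorProduct.ext (MultilinearMap.ext fun a => ?_))
    exact (congrArg _ (tensorMap_tprod k _ f a)).trans (((tensorPowerMap_tprod F _).trans
      (tensorMap_tensorPower F hF f a).symm).trans (congrArg (tensorMap k A (f.dilate p))
        (tensorPowerMap_tprod (n := X.len) F a).symm))

lemma tensorPowerHom_tprod (hF : ∀ a, cyclicPerm k p A (F a) = F a) (X : Lam p)
    (a : ZMod X.len → FrobTwist k p A) :
    ((tensorPowerHom hF).app X).hom (PiTensorProduct.tprod k a) = tensorPower F X.len a :=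
  tensorPowerMap_tprod F a

end

/-! ### Tate exactness of the rows of the cokernel of `F_#` -/

section Abstract

variable {k : Type*} [Field k] {p : ℕ} {V W : Type*} [AddCommGroup V] [Module k V] [AddCommGroup W]
  [Module k W] {s θ U : Module.End k V} {G : W →ₗ[k] V}

/-- If the complement of the fixed basis vectors is free, and `G` identifies `W` with the fixed basis vectors
up to the free part, then the cokernel of `G` has trivial Tate homology in the odd parity. -/
theorem exists_norm_sub_mem_range (hp : 0 < p) (hs : s ^ p = 1) (hU : U * s = U)
    (hθ : orbitSum p s θ = 1 - U) (hsG : ∀ w, s (G w) = G w) (hinj : ∀ w, U (G w) = 0 → w = 0)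
    (hsurj : ∀ x, ∃ w, U (G w) = U x) (x : V) (hx : x - s x ∈ LinearMap.range G) :
    ∃ y, (∑ j ∈ Finset.range p, s ^ j) y - x ∈ LinearMap.range G := by
  have hU' : ∀ y, U (s y) = U y := fun y => LinearMap.congr_fun hU y
  obtain ⟨w, hw⟩ := hx
  have hw0 : w = 0 := hinj _ (by rw [hw, map_sub, hU', sub_self])
  rw [hw0, map_zero] at hw
  obtain ⟨v, hv⟩ := hsurj x
  refine ⟨(θ * s) (x - G v), -v, ?_⟩
  have h := LinearMap.congr_fun (norm_mul_add_orbitHtpy θ hp hs) (x - G v)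
  rw [hθ] at h
  simp only [LinearMap.add_apply, Module.End.mul_apply, LinearMap.sub_apply, Module.End.one_apply,
    map_sub, hsG, hv] at h
  simp only [Module.End.mul_apply, map_sub, hsG]
  rw [← sub_eq_zero.mp hw.symm] at h ⊢
  simp only [sub_self, add_zero] at h
  rw [h, map_neg]
  abel

lemma exists_sub_sub_mem_range [CharP k p] (hs : s ^ p = 1) (hU : U * s = U)
    (hθ : orbitSum p s θ = 1 - U) (hsG : ∀ w, s (G w) = G w) (hinj : ∀ w, U (G w) = 0 → w = 0)
    (hsurj : ∀ x, ∃ w, U (G w) = U x) (x : V)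
    (hx : (∑ j ∈ Finset.range p, s ^ j) x ∈ LinearMap.range G) :
    ∃ y, (y - s y) - x ∈ LinearMap.range G := by
  have hsum : ∀ y z : V, (∀ j, (s ^ j) y = z) → (∑ j ∈ Finset.range p, s ^ j) y = 0 := fun y z h => by
    rw [LinearMap.sum_apply, Finset.sum_congr rfl fun j _ => h j, Finset.sum_const, Finset.card_range,
      ← Nat.cast_smul_eq_nsmul k, CharP.cast_eq_zero, zero_smul]
  have hUj : ∀ j y, U ((s ^ j) y) = U y := fun j y => by
    induction j with
    | zero => rfl
    | succ j ih => rw [pow_succ', Module.End.mul_apply, ← Module.End.mul_apply, hU, ih]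
  have hsGj : ∀ j w, (s ^ j) (G w) = G w := fun j w => by
    induction j with
    | zero => rfl
    | succ j ih => rw [pow_succ', Module.End.mul_apply, ih, hsG]
  have hUN : U ((∑ j ∈ Finset.range p, s ^ j) x) = 0 := by
    rw [LinearMap.sum_apply, map_sum, Finset.sum_congr rfl fun j _ => hUj j x, Finset.sum_const,
      Finset.card_range, ← Nat.cast_smul_eq_nsmul k, CharP.cast_eq_zero, zero_smul]
  obtain ⟨w, hw⟩ := hx
  rw [← hw] at hUN
  rw [hinj _ hUN, map_zero] at hw
  obtain ⟨v, hv⟩ := hsurj x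
  refine ⟨orbitHtpy p s θ (x - G v), -v, ?_⟩
  have h := LinearMap.congr_fun (mul_norm_add_orbitHtpy θ hs) (x - G v)
  rw [hθ] at h
  rw [LinearMap.add_apply, Module.End.mul_apply, map_sub (∑ j ∈ Finset.range p, s ^ j), ← hw,
    hsum _ _ fun j => hsGj j v, sub_zero, map_zero, zero_add, Module.End.mul_apply] at h
  simp only [LinearMap.sub_apply, Module.End.one_apply, map_sub U, hv, sub_self, sub_zero] at h
  rw [h, map_neg]
  abel

end Abstract

section Turn

variable (k : Type u) [Field k] (A : Type u) [Ring A] [Algebra k A] (p n : ℕ) [NeZero p]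
  [NeZero n]

/-- The generator of `ℤ/p` acting on `A^{⊗ pn}`. -/
def turnOp : Module.End k (⨂[k] _ : ZMod (p * n), A) := tensorMap k A ((PMap.turn n).dilate p)

variable {k A p n}

lemma turnOp_tprod (w : ZMod (p * n) → A) :
    turnOp k A p n (PiTensorProduct.tprod k w) =
      PiTensorProduct.tprod k fun j => w (j - (n : ZMod (p * n))) := by
  unfold turnOp
  rw [tensorMap_tprod, fibreProd_of_add _ (n : ℤ) fun x => rfl]
  simp

lemma turnOp_mul (x y : ⨂[k] _ : ZMod (p * n), A) :
    turnOp k A p n (x * y) = turnOp k A p n x * turnOp k A p n y := by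
  induction x using PiTensorProduct.induction_on with
  | smul_tprod c a =>
    induction y using PiTensorProduct.induction_on with
    | smul_tprod d b =>
      simp only [smul_mul_smul_comm, map_smul, PiTensorProduct.tprod_mul_tprod, turnOp_tprod]
      rfl
    | add x y hx hy => rw [mul_add, map_add, map_add, hx, hy, mul_add]
  | add x y hx hy => rw [add_mul, map_add, map_add, hx, hy, add_mul]

lemma turnOp_spread (J : ℤ) (x : ⨂[k] _ : ZMod p, A) :
    turnOp k A p n (tensorMap k A (PMap.spread p n J) x) =
      tensorMap k A (PMap.spread p n J) (cyclicPerm k p A x) := by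
  induction x using PiTensorProduct.induction_on with
  | smul_tprod c a =>
    rw [map_smul, map_smul, map_smul, map_smul]
    refine congrArg (c • ·) ?_
    have e : cyclicPerm k p A (PiTensorProduct.tprod k a) =
        PiTensorProduct.tprod k fun i => a (i - 1) := by
      exact (PiTensorProduct.reindex_tprod _ _).trans (congrArg (PiTensorProduct.tprod k)
        (funext fun i => congrArg a (sub_eq_add_neg i 1).symm))
    rw [e, tensorMap_tprod, tensorMap_tprod, ← fibreProd_spread_add, turnOp, tensorMap_tprod,
      ← fibreProd_comp]
    congr 2
    exact PMap.ext (funext fun z => by change J + n * z + n = J + n + n * z; ring)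
  | add x y hx hy => simp only [map_add, hx, hy]

lemma turnOp_pow_spread (J : ℤ) (j : ℕ) (x : ⨂[k] _ : ZMod p, A) :
    (turnOp k A p n ^ j) (tensorMap k A (PMap.spread p n J) x) =
      tensorMap k A (PMap.spread p n J) ((cyclicPerm k p A ^ j) x) := by
  induction j with
  | zero => rfl
  | succ j ih => rw [pow_succ', pow_succ', Module.End.mul_apply, ih, turnOp_spread, Module.End.mul_apply]

/-- The image of the norm is an ideal of the ring of invariants. -/
theorem mul_mem_range_norm {x y : ⨂[k] _ : ZMod (p * n), A} (hx : turnOp k A p n x = x)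
    (hy : y ∈ LinearMap.range (∑ j ∈ Finset.range p, turnOp k A p n ^ j)) :
    x * y ∈ LinearMap.range (∑ j ∈ Finset.range p, turnOp k A p n ^ j) ∧
      y * x ∈ LinearMap.range (∑ j ∈ Finset.range p, turnOp k A p n ^ j) := by
  obtain ⟨z, rfl⟩ := hy
  have h : ∀ j, (turnOp k A p n ^ j) (x * z) = x * (turnOp k A p n ^ j) z ∧
      (turnOp k A p n ^ j) (z * x) = (turnOp k A p n ^ j) z * x := fun j => by
    induction j with
    | zero => exact ⟨rfl, rfl⟩
    | succ j ih =>
      rw [pow_succ', Module.End.mul_apply, Module.End.mul_apply, Module.End.mul_apply, ih.1, ih.2,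
        turnOp_mul, turnOp_mul, hx]
      exact ⟨rfl, rfl⟩
  refine ⟨⟨x * z, ?_⟩, ⟨z * x, ?_⟩⟩
  · simp only [LinearMap.sum_apply, Finset.mul_sum, (h _).1]
  · simp only [LinearMap.sum_apply, Finset.sum_mul, (h _).2]

lemma turnOp_iprod_spread (c : ℤ → ⨂[k] _ : ZMod p, A) (hc : ∀ z, cyclicPerm k p A (c z) = c z)
    (x y : ℤ) : turnOp k A p n (iprod (fun z => tensorMap k A (PMap.spread p n z) (c z)) x y) =
      iprod (fun z => tensorMap k A (PMap.spread p n z) (c z)) x y := by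
  have h1 : turnOp k A p n 1 = 1 := by
    rw [PiTensorProduct.one_def, turnOp_tprod]; rfl
  refine (map_iprod (⟨⟨turnOp k A p n, h1⟩, turnOp_mul⟩ : _ →* _) _ x y).trans ?_
  refine iprod_congr fun z _ _ => ?_
  change turnOp k A p n _ = _
  rw [turnOp_spread, hc]

variable [ExpChar k p] [PerfectRing k p] {F : FrobTwist k p A →ₐ[k] ⨂[k] _ : ZMod p, A}

/-- Modulo norms, the tensor power of `F` is the tensor power of `a ↦ a ⊗ ⋯ ⊗ a`. -/
theorem tensorPower_sub_mem_range_norm (hF : IsQuasiFrobenius F) (a : ZMod n → A) :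
    tensorPower F n (fun i => toTwist k p (a i)) - PiTensorProduct.tprod k (fun i : ZMod (p * n) =>
      a (ZMod.castHom (dvd_mul_left n p) (ZMod n) i)) ∈
      LinearMap.range (∑ j ∈ Finset.range p, turnOp k A p n ^ j) := by
  have hn : (0 : ℤ) < n := by exact_mod_cast NeZero.pos n
  set u : ℤ → ⨂[k] _ : ZMod p, A := fun z => PiTensorProduct.tprod k fun _ => a z with hu
  have hcu : ∀ z, cyclicPerm k p A (u z) = u z := fun z => PiTensorProduct.reindex_tprod _ _
  have key : ∀ c : ℕ, iprod (fun z => tensorMap k A (PMap.spread p n z) (F (toTwist k p (a z)))) 0 c -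
      iprod (fun z => tensorMap k A (PMap.spread p n z) (u z)) 0 c ∈
      LinearMap.range (∑ j ∈ Finset.range p, turnOp k A p n ^ j) := by
    intro c
    induction c with
    | zero =>
      rw [Nat.cast_zero, iprod_self, iprod_self, sub_self]
      exact Submodule.zero_mem _
    | succ c ih =>
      push_cast
      rw [← iprod_mul _ (by positivity : (0 : ℤ) ≤ c) (by omega : (c : ℤ) ≤ c + 1),
        ← iprod_mul (fun z => tensorMap k A (PMap.spread p n z) (u z)) (by positivity : (0 : ℤ) ≤ c)
          (by omega : (c : ℤ) ≤ c + 1), iprod_single, iprod_single]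
      have h1 : tensorMap k A (PMap.spread p n c) (F (toTwist k p (a (c : ℤ)))) -
          tensorMap k A (PMap.spread p n c) (u c) ∈
          LinearMap.range (∑ j ∈ Finset.range p, turnOp k A p n ^ j) := by
        obtain ⟨y, hy⟩ := hF.tate_norm (a (c : ℤ))
        refine ⟨tensorMap k A (PMap.spread p n c) y, ?_⟩
        rw [← map_sub, ← hy, LinearMap.sum_apply, LinearMap.sum_apply, map_sum]
        exact Finset.sum_congr rfl fun j _ => turnOp_pow_spread _ _ _
      have h2 : ∀ x x' y y' : ⨂[k] _ : ZMod (p * n), A, x * y - x' * y' =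
          x * (y - y') + (x - x') * y' := fun x x' y y' => by noncomm_ring
      rw [h2]
      refine Submodule.add_mem _ (mul_mem_range_norm ?_ h1).1 (mul_mem_range_norm ?_ ih).2
      · exact turnOp_iprod_spread (fun z => F (toTwist k p (a z))) (fun z => hF.equivariant _) _ _
      · rw [turnOp_spread, hcu]
  have h := iprod_spread_tprod (k := k) (PMap.id n)
    (fun i : ZMod (p * n) => a (ZMod.castHom (dvd_mul_left n p) (ZMod n) i))
  rw [PMap.lower_id (NeZero.pos n), zero_add] at h
  have h' : iprod (fun z => tensorMap k A (PMap.spread p n z) (u z)) 0 n =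
      PiTensorProduct.tprod k (fun i : ZMod (p * n) =>
        a (ZMod.castHom (dvd_mul_left n p) (ZMod n) i)) := by
    refine Eq.trans ?_ (h.trans (congrArg _ (fibreProd_id _)))
    refine iprod_congr fun z h1 h2 => ?_
    change _ = tensorMap k A (PMap.spread p n (z % n)) _
    rw [Int.emod_eq_of_lt h1 h2]
    refine congrArg _ (congrArg (PiTensorProduct.tprod k) (funext fun l => congrArg a ?_))
    rw [map_intCast]
    simp
  rw [tensorPower_eq, ← h']
  exact key n

end Turn

section Words

variable {k : Type u} [Field k] {A : Type u} [Ring A] [Algebra k A] {p n : ℕ} [NeZero n]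
variable [NeZero p] [ExpChar k p] [PerfectRing k p] {F : FrobTwist k p A →ₐ[k] ⨂[k] _ : ZMod p, A}

/-- The space `A^{⊗ pn}` splits into the span of the words fixed under `ℤ/p` and a free part; modulo norms, `F_#` identifies
`(A^{(1)})^{⊗ n}` with the former. -/
theorem exists_fixed_projection (hp : p.Prime) [CharP k p] (hF : IsQuasiFrobenius F) (n : ℕ) [NeZero n] :
    ∃ U θ : Module.End k (⨂[k] _ : ZMod (p * n), A), U * turnOp k A p n = U ∧
      orbitSum p (turnOp k A p n) θ = 1 - U ∧ (∀ w, U (tensorPowerMap F n w) = 0 → w = 0) ∧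
      ∀ x, ∃ w, U (tensorPowerMap F n w) = U x := by
  classical
  have : Fact p.Prime := ⟨hp⟩
  set b := Module.Basis.ofVectorSpace k A with hb
  set B := Basis.piTensorProduct fun _ : ZMod (p * n) => b with hB
  set B' := Basis.piTensorProduct fun _ : ZMod n => b with hB'
  set g : (ZMod (p * n) → Module.Basis.ofVectorSpaceIndex k A) → _ :=
    fun w (j : ZMod (p * n)) => w (j - (n : ZMod (p * n))) with hg
  have hBt : ∀ w, B w = PiTensorProduct.tprod k fun i => b (w i) := fun w => by
    rw [hB, Basis.piTensorProduct_apply]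
  have hσ : ∀ w, turnOp k A p n (B w) = B (g w) := fun w => by
    rw [hBt, hBt, turnOp_tprod]
  have hσj : ∀ j w, (turnOp k A p n ^ j) (B w) = B (g^[j] w) := fun j w => by
    induction j with
    | zero => rfl
    | succ j ih => rw [pow_succ', Module.End.mul_apply, ih, hσ, Function.iterate_succ_apply']
  have hgj : ∀ j w, g^[j] w = fun i => w (i - (j * n : ℕ)) := fun j w => by
    induction j with
    | zero => simp
    | succ j ih =>
      rw [Function.iterate_succ_apply', ih]
      funext i
      simp only [hg]
      congr 1
      push_cast
      ring
  have hgp : g^[p] = id := funext fun w => by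
    rw [hgj]; simp
  obtain ⟨I, hI, hI'⟩ := exists_orbit_transversal hp g hgp
  set U : Module.End k (⨂[k] _ : ZMod (p * n), A) := B.constr k fun w => if g w = w then B w else 0 with hU
  set θ : Module.End k (⨂[k] _ : ZMod (p * n), A) := B.constr k fun w => if w ∈ I then B w else 0 with hθ
  have hUB : ∀ w, U (B w) = if g w = w then B w else 0 := fun w => B.constr_basis k _ w
  have hθB : ∀ w, θ (B w) = if w ∈ I then B w else 0 := fun w => B.constr_basis k _ w
  have hginj : Function.Injective g := fun v w h => by
    funext i
    have := congrFun h (i + (n : ZMod (p * n)))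
    simpa [hg] using this
  have hUσ : U * turnOp k A p n = U := B.ext fun w => by
    rw [Module.End.mul_apply, hσ, hUB, hUB]
    by_cases h : g w = w
    · rw [h, h]
    · rw [if_neg h, if_neg fun h' => h (hginj h')]
  have hθU : orbitSum p (turnOp k A p n) θ = 1 - U := B.ext fun w => by
    rw [LinearMap.sub_apply, Module.End.one_apply, hUB, orbitSum, LinearMap.sum_apply]
    have h1 : ∀ j ∈ Finset.range p, (turnOp k A p n ^ j * θ * turnOp k A p n ^ (p - j)) (B w) =
        if g^[p - j] w ∈ I then B w else 0 := fun j hj => by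
      rw [Module.End.mul_apply, Module.End.mul_apply, hσj, hθB]
      split_ifs with h
      · rw [hσj, ← Function.iterate_add_apply, Nat.add_sub_cancel' (Finset.mem_range.mp hj).le, hgp]
        rfl
      · rw [map_zero]
    rw [Finset.sum_congr rfl h1]
    by_cases h : g w = w
    · rw [if_pos h, sub_self]
      refine Finset.sum_eq_zero fun j _ => if_neg fun hj => ?_
      rw [Function.iterate_fixed h] at hj
      exact hI w hj h
    · rw [if_neg h, sub_zero]
      obtain ⟨j, ⟨hj, hjI⟩, hu⟩ := hI' w h
      rw [Finset.sum_eq_single j, if_pos hjI]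
      · intro i hi hij
        exact if_neg fun h' => hij (hu i ⟨Finset.mem_range.mp hi, h'⟩)
      · exact fun h' => absurd (Finset.mem_range.mpr hj) h'
  set d : (ZMod n → Module.Basis.ofVectorSpaceIndex k A) → ZMod (p * n) → Module.Basis.ofVectorSpaceIndex k A :=
    fun v i => v (ZMod.castHom (dvd_mul_left n p) (ZMod n) i) with hd
  have hdinj : Function.Injective d := fun v w h => funext fun i => by
    obtain ⟨i, rfl⟩ := ZMod.intCast_surjective i
    have := congrFun h (i : ZMod (p * n))
    simpa [hd] using this
  have hgd : ∀ v, g (d v) = d v := fun v => funext fun i => by simp [hg, hd]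
  have hdsurj : ∀ w, g w = w → ∃ v, d v = w := fun w h => by
    obtain ⟨v, hv⟩ := exists_of_periodic (n := n) (fun z => w (z : ZMod (p * n))) fun z => by
      conv_lhs => rw [← h]
      simp [hg]
    refine ⟨v, funext fun i => ?_⟩
    obtain ⟨i, rfl⟩ := ZMod.intCast_surjective i
    simp only [hd, map_intCast, hv]
  have hUN : ∀ x, U ((∑ j ∈ Finset.range p, turnOp k A p n ^ j) x) = 0 := fun x => by
    have hUj : ∀ j, U ((turnOp k A p n ^ j) x) = U x := fun j => by
      induction j with
      | zero => rfl
      | succ j ih => rw [pow_succ', Module.End.mul_apply, ← Module.End.mul_apply, hUσ, ih]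
    rw [LinearMap.sum_apply, map_sum, Finset.sum_congr rfl fun j _ => hUj j, Finset.sum_const,
      Finset.card_range, ← Nat.cast_smul_eq_nsmul k, CharP.cast_eq_zero, zero_smul]
  have hUG : ∀ v, U (tensorPowerMap F n (PiTensorProduct.tprod k fun i => toTwist k p (b (v i)))) =
      B (d v) := fun v => by
    obtain ⟨y, hy⟩ := tensorPower_sub_mem_range_norm hF fun i => b (v i)
    have h1 : PiTensorProduct.tprod k (fun i : ZMod (p * n) =>
        b (v (ZMod.castHom (dvd_mul_left n p) (ZMod n) i))) = B (d v) := (hBt (d v)).symm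
    rw [h1, eq_comm, sub_eq_iff_eq_add] at hy
    rw [tensorPowerMap_tprod, hy, map_add, hUN, zero_add, hUB, if_pos (hgd v)]
  have hcoord : ∀ (f : (ZMod n → Module.Basis.ofVectorSpaceIndex k A) →₀ k) v,
      B.repr (U (tensorPowerMap F n (twistTensor k p A n (B'.repr.symm f)))) (d v) = f v ^ p := by
    intro f
    induction f using Finsupp.induction_linear with
    | zero => intro v; simp [hp.ne_zero]
    | add f f' hf hf' =>
      intro v
      simp only [map_add, Finsupp.add_apply, hf, hf', add_pow_char]
    | single v₀ c =>
      intro v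
      rw [Module.Basis.repr_symm_single, twistTensor_smul, map_smul, map_smul, map_smul, hB',
        Basis.piTensorProduct_apply, twistTensor_tprod, hUG, Module.Basis.repr_self,
        Finsupp.smul_apply, Finsupp.single_apply, Finsupp.single_apply, if_congr hdinj.eq_iff rfl rfl]
      split_ifs <;> simp [hp.ne_zero]
  refine ⟨U, θ, hUσ, hθU, fun w hw => ?_, fun x => ?_⟩
  · obtain ⟨x, rfl⟩ := (twistTensor_bijective (p := p) (k := k) (A := A) n).2 w
    have : B'.repr x = 0 := Finsupp.ext fun v => by
      have h := hcoord (B'.repr x) v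
      rw [LinearEquiv.symm_apply_apply, hw, map_zero, Finsupp.zero_apply] at h
      exact pow_eq_zero_iff hp.ne_zero |>.mp h.symm
    rw [(LinearEquiv.map_eq_zero_iff _).mp this, map_zero]
  · refine Submodule.span_induction (p := fun x _ => ∃ w, U (tensorPowerMap F n w) = U x)
      ?_ ⟨0, by simp⟩ ?_ ?_ (B.mem_span x)
    · rintro _ ⟨w, rfl⟩
      rw [hUB]
      split_ifs with h
      · obtain ⟨v, rfl⟩ := hdsurj w h
        exact ⟨_, hUG v⟩
      · exact ⟨0, by simp⟩
    · rintro x y - - ⟨v, hv⟩ ⟨w, hw⟩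
      exact ⟨v + w, by simp only [map_add, hv, hw]⟩
    · rintro c x - ⟨v, hv⟩
      exact ⟨c • v, by simp only [map_smul, hv]⟩

end Words

/-! ### Periodic homology and short exact sequences -/

section ShortExact

variable {k : Type*} [Field k] {p : ℕ} {V V' V'' : ℕ → Type*} [∀ q, AddCommGroup (V q)]
  [∀ q, Module k (V q)] [∀ q, AddCommGroup (V' q)] [∀ q, Module k (V' q)] [∀ q, AddCommGroup (V'' q)]
  [∀ q, Module k (V'' q)] {b : ∀ q, V (q + 1) →ₗ[k] V q} {s : ∀ q, Module.End k (V q)}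
  {b' : ∀ q, V' (q + 1) →ₗ[k] V' q} {s' : ∀ q, Module.End k (V' q)}
  {b'' : ∀ q, V'' (q + 1) →ₗ[k] V'' q} {s'' : ∀ q, Module.End k (V'' q)}
  (f : ∀ q, V q →ₗ[k] V' q) (g : ∀ q, V' q →ₗ[k] V'' q)

/-- In a short exact sequence, acyclicity of germs passes from the subobject and the middle term to the quotient. -/
theorem germAcyclicOn_of_shortExact (hDD : ∀ n x, tateD p b' s' n (tateD p b' s' (n + 1) x) = 0)
    (hfb : ∀ q x, b' q (f (q + 1) x) = f q (b q x))
    (hfs : ∀ q x, s' q (f q x) = f q (s q x)) (hgb : ∀ q x, b'' q (g (q + 1) x) = g q (b' q x))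
    (hgs : ∀ q x, s'' q (g q x) = g q (s' q x)) (hinj : ∀ q x, f q x = 0 → x = 0)
    (hex : ∀ q x, g q x = 0 → ∃ w, f q w = x) (hgf : ∀ q w, g q (f q w) = 0)
    (hsurj : ∀ q x, ∃ w, g q w = x) (hV : GermAcyclicOn p b s fun _ => ⊤)
    (hV' : GermAcyclicOn p b' s' fun _ => ⊤) : GermAcyclicOn p b'' s'' fun _ => ⊤ := by
  intro n x _ hx
  choose x' hx' using fun q => hsurj q (x q)
  have hx'' : (fun q => g q (x' q)) = x := funext hx'
  have h : ∀ q, ∃ w, tateD p b'' s'' n x q = 0 → f q w = tateD p b' s' n x' q := fun q => by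
    by_cases h : tateD p b'' s'' n x q = 0
    · obtain ⟨w, hw⟩ := hex q (tateD p b' s' n x' q) (by rw [← tateD_map g hgb hgs, hx'', h])
      exact ⟨w, fun _ => hw⟩
    · exact ⟨0, fun h' => absurd h' h⟩
  choose w hw using h
  have hw' : ∀ᶠ q in Filter.atTop, f q (w q) = tateD p b' s' n x' q := hx.mono fun q hq => hw q hq
  have hn : n = n - 1 + 1 := by ring
  have hwD : ∀ᶠ q in Filter.atTop, tateD p b s (n - 1) w q = 0 := by
    filter_upwards [hw', (Filter.tendsto_add_atTop_nat 1).eventually hw'] with q h1 h2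
    refine hinj q _ ?_
    rw [← tateD_map f hfb hfs, tateD_congr p b' s' (y := tateD p b' s' n x') h1 h2]
    have := hDD (n - 1) x'
    rw [← hn] at this
    exact congrFun this q
  obtain ⟨y, -, hy⟩ := hV (n - 1) w (fun _ => trivial) hwD
  rw [← hn] at hy
  obtain ⟨z, -, hz⟩ := hV' n (fun q => x' q - f q (y q)) (fun _ => trivial) (by
    filter_upwards [hw', hy] with q h1 h2
    have : (fun q => x' q - f q (y q)) = x' - fun q => f q (y q) := rfl
    rw [this, map_sub, Pi.sub_apply, tateD_map f hfb hfs, h2, h1, sub_self])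
  refine ⟨fun q => g q (z q), fun _ => trivial, hz.mono fun q hq => ?_⟩
  rw [tateD_map g hgb hgs, hq, map_sub, hgf, sub_zero, hx']

end ShortExact

section Functors

variable {k : Type u} [Field k] {p : ℕ} {E E' E'' : Lam p ⥤ ModuleCat.{u} k}

lemma perMap_apply (α : E ⟶ E') (x : ∀ q : ℕ, E.obj (Lam.ob p q)) (q : ℕ) :
    perMap α x q = (α.app (Lam.ob p q)).hom (x q) := rfl

lemma perD_perMap_apply (α : E ⟶ E') (n : ℤ) (x : ∀ q : ℕ, E.obj (Lam.ob p q)) :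
    perD E' n (perMap α x) = perMap α (perD E n x) := LinearMap.congr_fun (perD_perMap α n) x

lemma perD_perD_apply [NeZero p] (n : ℤ) (x : ∀ q : ℕ, E.obj (Lam.ob p q)) :
    perD E n (perD E (n + 1) x) = 0 := LinearMap.congr_fun (perD_perD E n) x

/-- A short exact sequence of `p`-cyclic vector spaces. -/
structure IsShortExact (α : E ⟶ E') (β : E' ⟶ E'') : Prop where
  injective : ∀ X x, (α.app X).hom x = 0 → x = 0
  exact : ∀ X x, (β.app X).hom x = 0 → ∃ w, (α.app X).hom w = x
  comp_eq_zero : ∀ X w, (β.app X).hom ((α.app X).hom w) = 0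
  surjective : ∀ X x, ∃ w, (β.app X).hom w = x

variable {α : E ⟶ E'} {β : E' ⟶ E''}

lemma IsShortExact.perMap_injective (h : IsShortExact α β) {x : ∀ q : ℕ, E.obj (Lam.ob p q)}
    (hx : perMap α x = 0) : x = 0 :=
  funext fun q => h.injective _ _ (congrFun hx q)

lemma IsShortExact.exists_perMap_eq (h : IsShortExact α β) {x : ∀ q : ℕ, E'.obj (Lam.ob p q)}
    (hx : perMap β x = 0) : ∃ w, perMap α w = x := by
  choose w hw using fun q => h.exact _ _ (congrFun hx q)
  exact ⟨w, funext hw⟩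

lemma IsShortExact.perMap_surjective (h : IsShortExact α β) (x : ∀ q : ℕ, E''.obj (Lam.ob p q)) :
    ∃ w, perMap β w = x := by
  choose w hw using fun q => h.surjective _ (x q)
  exact ⟨w, funext hw⟩

lemma IsShortExact.perMap_perMap (h : IsShortExact α β) (w : ∀ q : ℕ, E.obj (Lam.ob p q)) :
    perMap β (perMap α w) = 0 :=
  funext fun q => h.comp_eq_zero _ _

variable [NeZero p]

/-- If the quotient has no periodic homology, every class lifts to the subobject. -/
theorem IsShortExact.exists_cycle (h : IsShortExact α β)
    (hE : ∀ n x, perD E'' n x = 0 → ∃ y, perD E'' (n + 1) y = x) {n : ℤ} {x}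
    (hx : perD E' n x = 0) : ∃ w y, perD E n w = 0 ∧ perMap α w = x - perD E' (n + 1) y := by
  obtain ⟨y'', hy''⟩ := hE n (perMap β x) (by rw [perD_perMap_apply, hx, map_zero])
  obtain ⟨y, rfl⟩ := h.perMap_surjective y''
  obtain ⟨w, hw⟩ := h.exists_perMap_eq (x := x - perD E' (n + 1) y) (by
    rw [map_sub, ← perD_perMap_apply, hy'', sub_self])
  refine ⟨w, y, h.perMap_injective ?_, hw⟩
  rw [← perD_perMap_apply, hw, map_sub, hx, perD_perD_apply, sub_zero]

/-- If the quotient has no periodic homology, classes of the subobject do not die. -/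
theorem IsShortExact.exists_boundary (h : IsShortExact α β)
    (hE : ∀ n x, perD E'' n x = 0 → ∃ y, perD E'' (n + 1) y = x) {n : ℤ} {w y}
    (hy : perD E' (n + 1) y = perMap α w) : ∃ z, perD E (n + 1) z = w := by
  obtain ⟨z'', hz''⟩ := hE (n + 1) (perMap β y) (by rw [perD_perMap_apply, hy, h.perMap_perMap])
  obtain ⟨z, rfl⟩ := h.perMap_surjective z''
  obtain ⟨u, hu⟩ := h.exists_perMap_eq (x := y - perD E' (n + 1 + 1) z) (by
    rw [map_sub, ← perD_perMap_apply, hz'', sub_self])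
  refine ⟨u, sub_eq_zero.mp (h.perMap_injective ?_)⟩
  rw [map_sub, ← perD_perMap_apply, hu, map_sub, perD_perD_apply, sub_zero, hy, sub_self]

omit [NeZero p]

/-- The pointwise cokernel of a morphism. -/
def cokerFunctor (α : E ⟶ E') : Lam p ⥤ ModuleCat.{u} k where
  obj X := ModuleCat.of k (E'.obj X ⧸ LinearMap.range (α.app X).hom)
  map {X Y} f := ModuleCat.ofHom (Submodule.mapQ _ _ (E'.map f).hom (by
    rintro _ ⟨x, rfl⟩
    exact ⟨(E.map f).hom x, LinearMap.congr_fun (congrArg ModuleCat.Hom.hom (α.naturality f)) x⟩))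
  map_id X := ModuleCat.hom_ext (Submodule.linearMap_qext _ (LinearMap.ext fun x =>
    congrArg (Submodule.Quotient.mk) (LinearMap.congr_fun (congrArg ModuleCat.Hom.hom (E'.map_id X)) x)))
  map_comp f g := ModuleCat.hom_ext (Submodule.linearMap_qext _ (LinearMap.ext fun x =>
    congrArg (Submodule.Quotient.mk) (LinearMap.congr_fun (congrArg ModuleCat.Hom.hom (E'.map_comp f g)) x)))

/-- The projection to the pointwise cokernel. -/
def cokerProj (α : E ⟶ E') : E' ⟶ cokerFunctor α where
  app X := ModuleCat.ofHom (Submodule.mkQ (LinearMap.range (α.app X).hom))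
  naturality _ _ _ := rfl

lemma isShortExact_coker (h : ∀ X x, (α.app X).hom x = 0 → x = 0) :
    IsShortExact α (cokerProj α) where
  injective := h
  exact X x hx := (Submodule.Quotient.mk_eq_zero _).mp hx
  comp_eq_zero X w := (Submodule.Quotient.mk_eq_zero _).mpr ⟨w, rfl⟩
  surjective X x := Submodule.mkQ_surjective _ x

/-- The terms of the cokernel of `α` have no Tate homology if `ℤ/p` acts trivially on the source and `α` identifies
it with the image of a projection `U` of the target that kills a free part. -/
theorem rowsExact_coker [CharP k p] (hp : p.Prime) (hE : ∀ q, lapOp E q = 1)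
    (h : ∀ q, ∃ U θ : Module.End k (E'.obj (Lam.ob p q)), U * lapOp E' q = U ∧
      orbitSum p (lapOp E' q) θ = 1 - U ∧ (∀ w, U ((α.app (Lam.ob p q)).hom w) = 0 → w = 0) ∧
      ∀ x, ∃ w, U ((α.app (Lam.ob p q)).hom w) = U x) :
    RowsExact p (lapOp (cokerFunctor α)) := by
  have hl : ∀ q x, lapOp (cokerFunctor α) q (((cokerProj α).app (Lam.ob p q)).hom x) =
      ((cokerProj α).app (Lam.ob p q)).hom (lapOp E' q x) := lapOp_app (cokerProj α)
  have hlj : ∀ q j x, (lapOp (cokerFunctor α) q ^ j) (((cokerProj α).app (Lam.ob p q)).hom x) =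
      ((cokerProj α).app (Lam.ob p q)).hom ((lapOp E' q ^ j) x) := fun q j x => by
    induction j with
    | zero => rfl
    | succ j ih => rw [pow_succ', Module.End.mul_apply, ih, hl, pow_succ', Module.End.mul_apply]
  have hN : ∀ q x, tateNorm p (lapOp (cokerFunctor α)) q (((cokerProj α).app (Lam.ob p q)).hom x) =
      ((cokerProj α).app (Lam.ob p q)).hom ((∑ j ∈ Finset.range p, lapOp E' q ^ j) x) :=
    fun q x => by
      rw [tateNorm, LinearMap.sum_apply, LinearMap.sum_apply, map_sum]
      exact Finset.sum_congr rfl fun j _ => hlj q j x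
  have hker : ∀ q x y, x - y ∈ LinearMap.range (α.app (Lam.ob p q)).hom ↔
      ((cokerProj α).app (Lam.ob p q)).hom x = ((cokerProj α).app (Lam.ob p q)).hom y :=
    fun q x y => (Submodule.Quotient.eq _).symm
  have hsG : ∀ q w, lapOp E' q ((α.app (Lam.ob p q)).hom w) = (α.app (Lam.ob p q)).hom w :=
    fun q w => by rw [lapOp_app, hE]; rfl
  refine ⟨fun q x hx => ?_, fun q x hx => ?_⟩ <;>
    obtain ⟨x, rfl⟩ : ∃ w, ((cokerProj α).app (Lam.ob p q)).hom w = x :=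
      Submodule.mkQ_surjective _ x <;> obtain ⟨U, θ, h1, h2, h3, h4⟩ := h q
  · rw [hl, sub_eq_zero, ← hker] at hx
    obtain ⟨y, hy⟩ := exists_norm_sub_mem_range hp.pos (lapOp_pow E' q) h1 h2 (hsG q) h3 h4 x hx
    exact ⟨((cokerProj α).app (Lam.ob p q)).hom y, (hN q y).trans ((hker _ _ _).mp hy)⟩
  · rw [hN, ← map_zero ((cokerProj α).app (Lam.ob p q)).hom, ← hker, sub_zero] at hx
    obtain ⟨y, hy⟩ := exists_sub_sub_mem_range (lapOp_pow E' q) h1 h2 (hsG q) h3 h4 x hx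
    refine ⟨((cokerProj α).app (Lam.ob p q)).hom y, ?_⟩
    rw [hl, ← map_sub]
    exact (hker _ _ _).mp hy

end Functors

section QuasiFrobenius

variable {k : Type u} [Field k] {A : Type u} [Ring A] [Algebra k A] {p : ℕ}
variable [NeZero p] [ExpChar k p] [PerfectRing k p] {F : FrobTwist k p A →ₐ[k] ⨂[k] _ : ZMod p, A}

lemma lapOp_incl (q : ℕ) : lapOp (Lam.incl p ⋙ cyclicObject k A) q = turnOp k A p (q + 1) := by
  rw [lapOp_eq]; rfl

lemma tensorPowerHom_injective (hp : p.Prime) [CharP k p] (hF : IsQuasiFrobenius F) (X : Lam p) (x)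
    (hx : ((tensorPowerHom hF.equivariant).app X).hom x = 0) : x = 0 := by
  obtain ⟨U, θ, -, -, h, -⟩ := exists_fixed_projection hp hF X.len
  exact h x ((congrArg U hx).trans (map_zero _))

lemma fixed_projection_incl (hp : p.Prime) [CharP k p] (hF : IsQuasiFrobenius F) (q : ℕ) :
    ∃ U θ : Module.End k ((Lam.incl p ⋙ cyclicObject k A).obj (Lam.ob p q)),
      U * lapOp (Lam.incl p ⋙ cyclicObject k A) q = U ∧
      orbitSum p (lapOp (Lam.incl p ⋙ cyclicObject k A) q) θ = 1 - U ∧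
      (∀ w, U (((tensorPowerHom hF.equivariant).app (Lam.ob p q)).hom w) = 0 → w = 0) ∧
      ∀ x, ∃ w, U (((tensorPowerHom hF.equivariant).app (Lam.ob p q)).hom w) = U x := by
  obtain ⟨U, θ, h1, h2, h3, h4⟩ := exists_fixed_projection hp hF (q + 1)
  exact ⟨U, θ, (congrArg (U * ·) (lapOp_incl q)).trans h1,
    (congrArg (orbitSum p · θ) (lapOp_incl q)).trans h2, h3, h4⟩

/-- The cokernel of `F_#` has no periodic cyclic homology. -/
theorem perD_exact_coker (hp : p.Prime) [CharP k p] (hF : IsQuasiFrobenius F)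
    (hA : ∃ d : ℕ, ∀ M : ModuleCat.{u} (A ⊗[k] Aᵐᵒᵖ), HasProjectiveDimensionLE M d) (n : ℤ) (x)
    (hx : perD (cokerFunctor (tensorPowerHom hF.equivariant)) n x = 0) :
    ∃ y, perD (cokerFunctor (tensorPowerHom hF.equivariant)) (n + 1) y = x := by
  have hse := isShortExact_coker (tensorPowerHom_injective hp hF)
  refine perD_exact_of_prodAcyclic _ _ (prodAcyclic_of_germ (hbb := bOp_bOp_apply _) (bOp_lapOp _)
    (lapOp_pow _) (rowsExact_coker hp (lapOp_proj _) (fixed_projection_incl hp hF)) (hgerm := ?_)) n hx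
  exact germAcyclicOn_of_shortExact (fun q => ((tensorPowerHom hF.equivariant).app (Lam.ob p q)).hom)
    (fun q => ((cokerProj (tensorPowerHom hF.equivariant)).app (Lam.ob p q)).hom)
    (fun n x => tateD_tateD x (hbb := bOp_bOp_apply _) (hbs := bOp_lapOp _) (hs := lapOp_pow _) n)
    (bOp_app _) (lapOp_app _) (bOp_app _) (lapOp_app _) (fun q => hse.injective _)
    (fun q => hse.exact _) (fun q => hse.comp_eq_zero _) (fun q => hse.surjective _)
    (germAcyclic_twist hp hA) (germAcyclic_blockObject hp dvd_rfl hA)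

end QuasiFrobenius

/-! ### A prism homotopy for maps of ordered cyclic sets -/

/-- The alternating sum in the construction of a chain homotopy from a prism: `a i j` stands for `dᵢ hⱼ`, and `c j i` for
`hⱼ dᵢ`. -/
theorem alternating_prism {V : Type*} [AddCommGroup V] {k : Type*} [Ring k] [Module k V] (N : ℕ)
    (a c : ℕ → ℕ → V) (e : ℕ → V) (h1 : ∀ i j, i < j → j ≤ N → a i j = c (j - 1) i)
    (h2 : ∀ j ≤ N, a j j = e j) (h3 : ∀ j ≤ N, a (j + 1) j = e (j + 1))
    (h4 : ∀ i j, j + 1 < i → i ≤ N + 1 → a i j = c j (i - 1)) :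
    ∑ j ∈ Finset.range (N + 1), ∑ i ∈ Finset.range (N + 2), (-1 : k) ^ (i + j) • a i j +
      ∑ j ∈ Finset.range N, ∑ i ∈ Finset.range (N + 1), (-1 : k) ^ (i + j) • c j i =
      e 0 - e (N + 1) := by
  have hj : ∀ j ∈ Finset.range (N + 1), ∑ i ∈ Finset.range (N + 2), (-1 : k) ^ (i + j) • a i j =
      (∑ i ∈ Finset.range j, (-1 : k) ^ (i + j) • c (j - 1) i) + (e j - e (j + 1)) -
        ∑ i ∈ Finset.range (N - j), (-1 : k) ^ (j + 1 + i + j) • c j (j + 1 + i) := by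
    intro j hj
    rw [Finset.mem_range] at hj
    obtain ⟨d, rfl⟩ : ∃ d, N = j + d := ⟨N - j, by omega⟩
    rw [show j + d + 2 = j + 1 + 1 + d by ring, Finset.sum_range_add, Finset.sum_range_succ,
      Finset.sum_range_succ, h2 j (by omega), h3 j (by omega), Nat.add_sub_cancel_left, sub_eq_add_neg,
      ← Finset.sum_neg_distrib]
    have e1 : (-1 : k) ^ (j + j) = 1 := by rw [← two_mul, pow_mul]; simp
    have e2 : (-1 : k) ^ (j + 1 + j) = -1 := by
      rw [show j + 1 + j = j + j + 1 by ring, pow_succ, e1, one_mul]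
    rw [e1, e2, one_smul, neg_one_smul, add_assoc _ (e j), ← sub_eq_add_neg (e j)]
    congr 1
    · congr 1
      refine Finset.sum_congr rfl fun i hi => ?_
      rw [h1 i j (Finset.mem_range.mp hi) (by omega)]
    · refine Finset.sum_congr rfl fun i hi => ?_
      have := Finset.mem_range.mp hi
      rw [h4 _ _ (by omega) (by omega), show j + 1 + 1 + i + j = (j + 1 + i + j) + 1 by ring, pow_succ,
        show j + 1 + 1 + i - 1 = j + 1 + i by omega]
      simp
  rw [Finset.sum_congr rfl hj, Finset.sum_sub_distrib, Finset.sum_add_distrib,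
    Finset.sum_range_sub', Finset.sum_range_succ' (fun j => ∑ i ∈ Finset.range j, _),
    Finset.sum_range_zero, add_zero, Finset.sum_range_succ (fun j => ∑ i ∈ Finset.range (N - j), _),
    Nat.sub_self, Finset.sum_range_zero, add_zero]
  have hc : ∀ j ∈ Finset.range N, ∑ i ∈ Finset.range (N + 1), (-1 : k) ^ (i + j) • c j i =
      (∑ i ∈ Finset.range (N - j), (-1 : k) ^ (j + 1 + i + j) • c j (j + 1 + i)) -
        ∑ i ∈ Finset.range (j + 1), (-1 : k) ^ (i + (j + 1)) • c (j + 1 - 1) i := by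
    intro j hj
    rw [Finset.mem_range] at hj
    obtain ⟨d, rfl⟩ : ∃ d, N = j + d := ⟨N - j, by omega⟩
    rw [show j + d + 1 = j + 1 + d by ring, Finset.sum_range_add, Nat.add_sub_cancel_left,
      sub_eq_add_neg, ← Finset.sum_neg_distrib, add_comm]
    congr 1
    refine Finset.sum_congr rfl fun i _ => ?_
    rw [← add_assoc, pow_succ, Nat.add_sub_cancel]
    simp
  rw [Finset.sum_congr rfl hc, Finset.sum_sub_distrib]
  abel

namespace PMap

/-- The degeneracy `[n + 1] ⟶ [n + 2]` that skips the position `j + 1`. -/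
def degen (n j : ℕ) : PMap (n + 1) (n + 2) where
  toFun x := x + (x + (n - j)) / (n + 1)
  mono x y h := by
    have := Int.ediv_le_ediv (a := x + (n - j)) (b := y + (n - j)) (c := (n : ℤ) + 1) (by positivity)
      (by linarith)
    dsimp only
    linarith
  shift x := by
    have hn : ((n : ℤ) + 1) ≠ 0 := by positivity
    rw [show x + ((n + 1 : ℕ) : ℤ) + ((n : ℤ) - j) = (x + ((n : ℤ) - j)) + 1 * (n + 1) by
      push_cast; ring, Int.add_mul_ediv_right _ _ hn]
    push_cast; ring

lemma degen_of_le {n j : ℕ} {b : ℤ} (hj : j ≤ n) (hb : 0 ≤ b) (hb' : b ≤ j) :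
    (degen n j).toFun b = b := by
  change b + (b + (n - j)) / (n + 1) = b
  rw [Int.ediv_eq_zero_of_lt (by omega) (by omega), add_zero]

lemma degen_of_gt {n j : ℕ} {b : ℤ} (hj : j ≤ n) (hb : j < b) (hb' : b ≤ n + 1) :
    (degen n j).toFun b = b + 1 := by
  change b + (b + (n - j)) / (n + 1) = b + 1
  rw [show (b + ((n : ℤ) - j)) / (n + 1) = 1 by
    rw [Int.ediv_eq_iff_of_pos (by positivity)]; constructor <;> omega]

lemma degen_comp_face_self {n j : ℕ} (hj : j ≤ n) :
    (degen n j).comp (face (n + 1) j) = PMap.id (n + 1) := by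
  refine ext_of_lt (by omega) fun b hb hb' => ?_
  push_cast at hb'
  change (face (n + 1) j).toFun ((degen n j).toFun b) = b
  rcases le_or_gt b j with h | h
  · rw [degen_of_le hj hb h, face_of_le (by omega) hb h]
  · rw [degen_of_gt hj h (by omega), face_of_gt (by omega) (by omega) (by push_cast; omega)]
    ring

lemma degen_comp_face_succ {n j : ℕ} (hj : j ≤ n) :
    (degen n j).comp (face (n + 1) (j + 1)) = PMap.id (n + 1) := by
  refine ext_of_lt (by omega) fun b hb hb' => ?_
  push_cast at hb'
  change (face (n + 1) (j + 1)).toFun ((degen n j).toFun b) = b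
  rcases le_or_gt b j with h | h
  · rw [degen_of_le hj hb h, face_of_le (by omega) hb (by push_cast; omega)]
  · rw [degen_of_gt hj h (by omega), face_of_gt (by omega) (by push_cast; omega) (by push_cast; omega)]
    ring

lemma degen_comp_face_of_lt {n i j : ℕ} (hij : i < j) (hj : j ≤ n + 1) :
    (degen (n + 1) j).comp (face (n + 2) i) = (face (n + 1) i).comp (degen n (j - 1)) := by
  refine ext_of_lt (by omega) fun b hb hb' => ?_
  push_cast at hb'
  change (face (n + 2) i).toFun ((degen (n + 1) j).toFun b) = (degen n (j - 1)).toFun ((face (n + 1) i).toFun b)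
  rcases le_or_gt b i with h | h
  · rw [degen_of_le (by omega) hb (by omega), face_of_le (by omega) hb h, face_of_le (by omega) hb h,
      degen_of_le (by omega) hb (by omega)]
  · rw [face_of_gt (n := n + 1) (by omega) h (by push_cast; omega)]
    rcases le_or_gt b j with h' | h'
    · rw [degen_of_le (by omega) hb (by omega), face_of_gt (by omega) (by omega) (by push_cast; omega),
        degen_of_le (by omega) (by omega) (by omega)]
    · rw [degen_of_gt (by omega) (by omega) (by push_cast; omega),
        face_of_gt (by omega) (by omega) (by push_cast; omega),
        degen_of_gt (by omega) (by omega) (by omega)]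
      ring

lemma degen_comp_face_of_gt {n i j : ℕ} (hij : j + 1 < i) (hi : i ≤ n + 2) :
    (degen (n + 1) j).comp (face (n + 2) i) = (face (n + 1) (i - 1)).comp (degen n j) := by
  refine ext_of_lt (by omega) fun b hb hb' => ?_
  push_cast at hb'
  change (face (n + 2) i).toFun ((degen (n + 1) j).toFun b) = (degen n j).toFun ((face (n + 1) (i - 1)).toFun b)
  rcases le_or_gt b j with h | h
  · rw [degen_of_le (by omega) hb (by omega), face_of_le (by omega) hb (by omega),
      face_of_le (by omega) hb (by omega), degen_of_le (by omega) hb (by omega)]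
  · rw [degen_of_gt (by omega) h (by push_cast; omega)]
    rcases le_or_gt b ((i - 1 : ℕ) : ℤ) with h' | h'
    · rw [face_of_le (by omega) (by omega) (by omega), face_of_le (by omega) hb h',
        degen_of_gt (by omega) h (by omega)]
    · rw [face_of_gt (by omega) (by omega) (by push_cast; omega),
        face_of_gt (n := n + 1) (by omega) h' (by push_cast; omega),
        degen_of_gt (by omega) (by omega) (by omega)]
      ring

variable {n m l : ℕ}

/-- The pointwise maximum. -/
def sup (f g : PMap n m) : PMap n m :=
  ⟨fun a => max (f.toFun a) (g.toFun a), f.mono.max g.mono, fun a => by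
    rw [f.shift, g.shift, max_add_add_right]⟩

lemma sup_comp (f g : PMap n m) (d : PMap m l) : (f.sup g).comp d = (f.comp d).sup (g.comp d) :=
  PMap.ext (funext fun _ => d.mono.map_max)

/-- The map that sends the multiples of `n` to those of `m`, and everything between `0` and `n` to `min c m`. -/
def step (n m : ℕ) [NeZero n] (c : ℕ) : PMap n m where
  toFun l := (min c m : ℕ) * -((-l) / n) + (m - (min c m : ℕ)) * (l / n)
  mono x y h := by
    have hn : (0 : ℤ) < n := by exact_mod_cast NeZero.pos n
    have h1 := Int.ediv_le_ediv hn h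
    have h2 := Int.ediv_le_ediv hn (neg_le_neg h)
    have h3 : ((min c m : ℕ) : ℤ) ≤ m := by exact_mod_cast min_le_right c m
    dsimp only
    gcongr
  shift a := by
    have hn : (n : ℤ) ≠ 0 := by exact_mod_cast NeZero.ne n
    rw [show -(a + n) = -a + (-1) * (n : ℤ) by ring, show a + (n : ℤ) = a + 1 * n by ring,
      Int.add_mul_ediv_right _ _ hn, Int.add_mul_ediv_right _ _ hn]
    ring

variable [NeZero n]

lemma step_mul (c : ℕ) (a : ℤ) : (step n m c).toFun (a * n) = a * m := by
  have hn : (n : ℤ) ≠ 0 := by exact_mod_cast NeZero.ne n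
  change (min c m : ℕ) * -((-(a * n)) / n) + (m - (min c m : ℕ)) * (a * n / n) = _
  rw [← neg_mul, Int.mul_ediv_cancel _ hn, Int.mul_ediv_cancel _ hn]
  ring

lemma step_of_pos {c : ℕ} (hc : c ≤ m) (a : ℤ) {o : ℤ} (h : 0 < o) (h' : o < n) :
    (step n m c).toFun (a * n + o) = a * m + c := by
  have hn : (n : ℤ) ≠ 0 := by exact_mod_cast NeZero.ne n
  have hn' : (0 : ℤ) < n := by omega
  change (min c m : ℕ) * -((-(a * n + o)) / n) + (m - (min c m : ℕ)) * ((a * n + o) / n) = _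
  rw [show -(a * n + o) = -o + (-a) * (n : ℤ) by ring, show a * n + o = o + a * (n : ℤ) by ring,
    Int.add_mul_ediv_right _ _ hn, Int.add_mul_ediv_right _ _ hn, Int.ediv_eq_zero_of_lt h.le h',
    show (-o) / (n : ℤ) = -1 by rw [Int.ediv_eq_iff_of_pos hn']; constructor <;> linarith,
    min_eq_left hc]
  ring

lemma eq_mul_or (n : ℕ) [NeZero n] (l : ℤ) : ∃ a o : ℤ, 0 ≤ o ∧ o < n ∧ l = a * n + o := by
  have hn : (0 : ℤ) < n := by exact_mod_cast NeZero.pos n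
  exact ⟨l / n, l % n, Int.emod_nonneg _ hn.ne', Int.emod_lt_of_pos _ hn, by
    rw [mul_comm]; exact (Int.mul_ediv_add_emod l n).symm⟩

lemma step_comp {c c' : ℕ} (hc : c ≤ m) (hc' : c' ≤ l) (d : PMap m l) (h0 : d.toFun 0 = 0)
    (h : d.toFun c = c') : (step n m c).comp d = step n l c' := by
  refine PMap.ext (funext fun x => ?_)
  obtain ⟨a, o, h1, h2, rfl⟩ := eq_mul_or n x
  change d.toFun ((step n m c).toFun _) = (step n l c').toFun _
  rcases h1.eq_or_lt with rfl | h1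
  · rw [add_zero, step_mul, step_mul, ← zero_add (a * (m : ℤ)), d.shift_mul, h0, zero_add]
  · rw [step_of_pos hc a h1 h2, step_of_pos hc' a h1 h2, add_comm, d.shift_mul, h, add_comm]

lemma sup_step_zero (f : PMap n m) (h : f.toFun 0 = 0) : f.sup (step n m 0) = f := by
  refine PMap.ext (funext fun x => max_eq_left ?_)
  obtain ⟨a, o, h1, h2, rfl⟩ := eq_mul_or n x
  have h3 := f.shift_mul 0 a
  rw [zero_add, h, zero_add] at h3
  have h4 : (step n m 0).toFun (a * n + o) = a * m := by
    rcases h1.eq_or_lt with rfl | h1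
    · rw [add_zero, step_mul]
    · rw [step_of_pos (Nat.zero_le _) a h1 h2, Nat.cast_zero, add_zero]
  rw [h4, ← h3]
  exact f.mono (by linarith)

lemma sup_step_self (f : PMap n m) (h : f.toFun 0 = 0) : f.sup (step n m m) = step n m m := by
  refine PMap.ext (funext fun x => max_eq_right ?_)
  obtain ⟨a, o, h1, h2, rfl⟩ := eq_mul_or n x
  have h3 : ∀ a : ℤ, f.toFun (a * n) = a * m := fun a => by
    have h3 := f.shift_mul 0 a
    rwa [zero_add, h, zero_add] at h3
  rcases h1.eq_or_lt with rfl | h1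
  · rw [add_zero, step_mul, h3]
  · rw [step_of_pos le_rfl a h1 h2, show a * (m : ℤ) + m = (a + 1) * m by ring, ← h3]
    exact f.mono (by linarith)

section Prism

variable {x : ℕ} [NeZero x] (r q : ℕ)

/-- The prism over `f` in the direction of the position `j` of the block number `t`. -/
def prism (t j : ℕ) (f : PMap x (r * (q + 1))) : PMap x (r * (q + 1 + 1)) :=
  (f.comp ((degen q j).dilate r)).sup (step x (r * (q + 1 + 1)) (t * (q + 2) + j + 1))

variable {r q}

lemma face_dilate_zero (q i : ℕ) (hi : i ≤ q + 1) : ((face (q + 1) i).dilate r).toFun 0 = 0 :=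
  face_of_le hi le_rfl (by positivity)

lemma face_mul_add (q i t c : ℕ) (hi : i ≤ q) (hc : c ≤ q + 1) : (face q i).toFun ((t * (q + 1) + c : ℕ) : ℤ) =
    ((t * q + if c ≤ i then c else c - 1 : ℕ) : ℤ) := by
  have e : ((t * (q + 1) + c : ℕ) : ℤ) = c + (t : ℤ) * ((q + 1 : ℕ) : ℤ) := by push_cast; ring
  rw [e, (face q i).shift_mul]
  split_ifs with h
  · rw [face_of_le hi (by positivity) (by exact_mod_cast h)]; push_cast; ring
  · rw [face_of_gt hi (by exact_mod_cast not_le.mp h) (by exact_mod_cast hc)]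
    push_cast [Nat.cast_sub (show 1 ≤ c by omega)]
    ring

lemma prism_comp_face (t i j c : ℕ) (ht : t < r) (hj : j ≤ q) (hi : i ≤ q + 1)
    (hc : c = if j + 1 ≤ i then j + 1 else j) (f : PMap x (r * (q + 1))) :
    (prism r q t j f).comp ((face (q + 1) i).dilate r) =
      (f.comp (((degen q j).comp (face (q + 1) i)).dilate r)).sup
        (step x (r * (q + 1)) (t * (q + 1) + c)) := by
  have h1 : (t + 1) * (q + 2) ≤ r * (q + 2) := Nat.mul_le_mul_right _ ht
  have h2 : (t + 1) * (q + 1) ≤ r * (q + 1) := Nat.mul_le_mul_right _ ht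
  unfold prism
  rw [sup_comp, step_comp (c' := t * (q + 1) + c) (by linarith) ?_ _ (face_dilate_zero q i hi) ?_]
  · rfl
  · have : c ≤ q + 1 := by rw [hc]; split_ifs <;> omega
    linarith
  · refine (face_mul_add (q + 1) i t (j + 1) hi (by omega)).trans ?_
    rw [hc]
    rfl

/-- The total prism, as a formal alternating sum over all positions of all blocks, is a homotopy from the identity to a constant
map. Here `e` is any additive invariant of maps, such as the generators of a free module. -/
theorem sum_prism_zero {V : Type*} [AddCommGroup V] (k : Type*) [Ring k] [Module k V]
    (e : PMap x (r * (0 + 1)) → V) (f : PMap x (r * (0 + 1))) (h : f.toFun 0 = 0) :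
    ∑ t ∈ Finset.range r, ∑ j ∈ Finset.range 1, ∑ i ∈ Finset.range 2, (-1 : k) ^ (i + j) •
      e ((prism r 0 t j f).comp ((face 1 i).dilate r)) = e f - e (step x (r * (0 + 1)) (r * (0 + 1))) := by
  have key : ∀ t ∈ Finset.range r, ∑ j ∈ Finset.range 1, ∑ i ∈ Finset.range 2, (-1 : k) ^ (i + j) •
      e ((prism r 0 t j f).comp ((face 1 i).dilate r)) =
      e (f.sup (step x (r * (0 + 1)) (t * (0 + 1)))) -
        e (f.sup (step x (r * (0 + 1)) ((t + 1) * (0 + 1)))) := fun t ht => by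
    rw [Finset.mem_range] at ht
    simp only [Finset.sum_range_succ, Finset.sum_range_zero, zero_add, add_zero, pow_zero, one_smul,
      pow_one, neg_smul, ← sub_eq_add_neg]
    rw [prism_comp_face t 0 0 0 ht le_rfl (by omega) rfl, prism_comp_face t 1 0 1 ht le_rfl (by omega) rfl,
      degen_comp_face_self le_rfl, degen_comp_face_succ le_rfl]
    simp only [zero_add, mul_one, add_zero]
    rfl
  rw [Finset.sum_congr rfl key, Finset.sum_range_sub' fun t => e (f.sup (step x (r * (0 + 1)) (t * (0 + 1)))),
    zero_mul, sup_step_zero f h, sup_step_self f h]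

lemma sum_prism_succ {V : Type*} [AddCommGroup V] (k : Type*) [Ring k] [Module k V] (q : ℕ)
    (e : PMap x (r * (q + 1 + 1)) → V) (f : PMap x (r * (q + 1 + 1))) (h : f.toFun 0 = 0) :
    (∑ t ∈ Finset.range r, ∑ j ∈ Finset.range (q + 2), ∑ i ∈ Finset.range (q + 3), (-1 : k) ^ (i + j) •
      e ((prism r (q + 1) t j f).comp ((face (q + 2) i).dilate r))) +
    (∑ t ∈ Finset.range r, ∑ j ∈ Finset.range (q + 1), ∑ i ∈ Finset.range (q + 2), (-1 : k) ^ (i + j) •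
      e (prism r q t j (f.comp ((face (q + 1) i).dilate r)))) =
      e f - e (step x (r * (q + 1 + 1)) (r * (q + 1 + 1))) := by
  have key : ∀ t ∈ Finset.range r, (∑ j ∈ Finset.range (q + 2), ∑ i ∈ Finset.range (q + 3),
      (-1 : k) ^ (i + j) • e ((prism r (q + 1) t j f).comp ((face (q + 2) i).dilate r))) +
      (∑ j ∈ Finset.range (q + 1), ∑ i ∈ Finset.range (q + 2), (-1 : k) ^ (i + j) •
        e (prism r q t j (f.comp ((face (q + 1) i).dilate r)))) =
      e (f.sup (step x (r * (q + 1 + 1)) (t * (q + 2)))) -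
        e (f.sup (step x (r * (q + 1 + 1)) ((t + 1) * (q + 2)))) := fun t ht => by
    rw [Finset.mem_range] at ht
    refine (alternating_prism (q + 1)
      (fun i j => e ((prism r (q + 1) t j f).comp ((face (q + 2) i).dilate r)))
      (fun j i => e (prism r q t j (f.comp ((face (q + 1) i).dilate r))))
      (fun j => e (f.sup (step x (r * (q + 1 + 1)) (t * (q + 2) + j)))) ?_ ?_ ?_ ?_).trans ?_
    · intro i j hij hj
      rw [prism_comp_face t i j j ht hj (by omega) (by rw [if_neg (by omega)]),
        degen_comp_face_of_lt hij hj]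
      unfold prism
      rw [show t * (q + 2) + (j - 1) + 1 = t * (q + 1 + 1) + j by
        change t * (q + 2) + (j - 1) + 1 = t * (q + 2) + j; omega]
      rfl
    · intro j hj
      rw [prism_comp_face t j j j ht hj (by omega) (by rw [if_neg (by omega)]), degen_comp_face_self hj]
      rfl
    · intro j hj
      rw [prism_comp_face t (j + 1) j (j + 1) ht hj (by omega) (by rw [if_pos le_rfl]),
        degen_comp_face_succ hj]
      rfl
    · intro i j hij hi
      rw [prism_comp_face t i j (j + 1) ht (by omega) hi (by rw [if_pos (by omega)]),
        degen_comp_face_of_gt hij hi]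
      rfl
    · rw [add_zero, show t * (q + 2) + (q + 1 + 1) = (t + 1) * (q + 2) by ring]
  rw [← Finset.sum_add_distrib, Finset.sum_congr rfl key,
    Finset.sum_range_sub' fun t => e (f.sup (step x (r * (q + 1 + 1)) (t * (q + 2)))),
    zero_mul, sup_step_zero f h]
  exact congrArg (fun g => e f - e g) (sup_step_self f h)

end Prism

end PMap

/-! ### Cyclic homology of free objects -/

/-- The translate of a map by a constant. -/
def PMap.translate {n m : ℕ} (f : PMap n m) (c : ℤ) : PMap n m :=
  ⟨fun a => f.toFun a + c, fun _ _ h => by simpa using f.mono h, fun a => by rw [f.shift]; ring⟩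

section Free

variable (k : Type u) [Field k] (X : Lam 1)

/-- The cyclic vector space freely generated by an element of level `X`. -/
def freeObj : Lam 1 ⥤ ModuleCat.{u} k where
  obj Y := ModuleCat.of k (ULift.{u} (X ⟶ Y) →₀ k)
  map f := ModuleCat.ofHom (Finsupp.lmapDomain k k fun g => ⟨g.down ≫ f⟩)
  map_id Y := ModuleCat.hom_ext (LinearMap.ext fun x => by
    change Finsupp.mapDomain (fun g : ULift (X ⟶ Y) => (⟨g.down ≫ 𝟙 Y⟩ : ULift (X ⟶ Y))) x = x
    simp only [Category.comp_id]
    exact Finsupp.mapDomain_id)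
  map_comp f g := ModuleCat.hom_ext (LinearMap.ext fun x => by
    refine Eq.trans ?_ Finsupp.mapDomain_comp
    change Finsupp.mapDomain _ x = _
    congr 1
    funext s
    simp)

/-- The basis of a free object. -/
def gen {Y : Lam 1} (g : X ⟶ Y) : (freeObj k X).obj Y :=
  (Finsupp.single ⟨g⟩ 1 : ULift.{u} (X ⟶ Y) →₀ k)

variable {k X}

/-- Linear maps out of a free object are given by their values on the basis. -/
def genLift {Y : Lam 1} {W : Type*} [AddCommGroup W] [Module k W] (e : (X ⟶ Y) → W) :
    (freeObj k X).obj Y →ₗ[k] W :=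
  (Finsupp.linearCombination k fun s => e s.down : (ULift.{u} (X ⟶ Y) →₀ k) →ₗ[k] W)

lemma genLift_gen {Y : Lam 1} {W : Type*} [AddCommGroup W] [Module k W] (e : (X ⟶ Y) → W)
    (g : X ⟶ Y) : genLift e (gen k X g) = e g := by
  refine (Finsupp.linearCombination_single k (1 : k) (⟨g⟩ : ULift.{u} (X ⟶ Y))).trans ?_
  rw [one_smul]

lemma gen_ext {Y : Lam 1} {W : Type*} [AddCommGroup W] [Module k W]
    {f g : (freeObj k X).obj Y →ₗ[k] W}
    (h : ∀ φ : PMap X.len Y.len, f (gen k X (Lam.ofMap φ)) = g (gen k X (Lam.ofMap φ))) :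
    f = g :=
  Finsupp.lhom_ext' fun s => LinearMap.ext_ring (by
    obtain ⟨φ⟩ := s
    induction φ using Quotient.ind with | _ φ
    exact h φ)

lemma map_gen {Y Z : Lam 1} (f : Y ⟶ Z) (g : X ⟶ Y) :
    ((freeObj k X).map f).hom (gen k X g) = gen k X (g ≫ f) :=
  Finsupp.mapDomain_single

/-- The morphism out of a free object with prescribed value on the universal element. -/
def freeLift {E : Lam 1 ⥤ ModuleCat.{u} k} (x : E.obj X) : freeObj k X ⟶ E where
  app Y := ModuleCat.ofHom (genLift fun g => (E.map g).hom x)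
  naturality Y Z f := ModuleCat.hom_ext (gen_ext fun φ => by
    change genLift (fun g => (E.map g).hom x) (((freeObj k X).map f).hom (gen k X (Lam.ofMap φ))) =
      (E.map f).hom (genLift (fun g => (E.map g).hom x) (gen k X (Lam.ofMap φ)))
    rw [map_gen, genLift_gen, genLift_gen, E.map_comp]
    rfl)

lemma freeLift_gen {E : Lam 1 ⥤ ModuleCat.{u} k} (x : E.obj X) {Y : Lam 1}
    (g : X ⟶ Y) : ((freeLift x).app Y).hom (gen k X g) = (E.map g).hom x :=
  genLift_gen _ g

variable (k X) in
/-- The augmentation of a free object. -/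
def freeAug (Y : Lam 1) : (freeObj k X).obj Y →ₗ[k] k := genLift fun _ => 1

lemma freeAug_gen {Y : Lam 1} (g : X ⟶ Y) : freeAug k X Y (gen k X g) = 1 := genLift_gen _ g

lemma freeAug_map {Y Z : Lam 1} (f : Y ⟶ Z) (x : (freeObj k X).obj Y) :
    freeAug k X Z (((freeObj k X).map f).hom x) = freeAug k X Y x := by
  have : freeAug k X Z ∘ₗ ((freeObj k X).map f).hom = freeAug k X Y := gen_ext fun φ => by
    rw [LinearMap.comp_apply, map_gen, freeAug_gen, freeAug_gen]
  exact LinearMap.congr_fun this x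

end Free

section Restricted

variable (k : Type u) [Field k] (X : Lam 1) (r : ℕ) [NeZero r]

/-- The restriction of a free object along `[n] ↦ [rn]`. -/
abbrev freeIncl : Lam r ⥤ ModuleCat.{u} k := Lam.incl r ⋙ freeObj k X

/-- The generators of the restriction of a free object. -/
def rgen (q : ℕ) (f : PMap X.len (r * (q + 1))) : (freeIncl k X r).obj (Lam.ob r q) :=
  gen k X (Y := (Lam.incl r).obj (Lam.ob r q)) (Quotient.mk _ f)

variable {k X r}

/-- Linear maps out of the restriction of a free object, given on generators by a formula in a representative. -/
def rgenLift {q : ℕ} {W : Type*} [AddCommGroup W] [Module k W]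
    (e : PMap X.len (r * (q + 1)) → W) (he : ∀ f f', PMap.rel 1 f f' → e f = e f') :
    (freeIncl k X r).obj (Lam.ob r q) →ₗ[k] W :=
  genLift (Y := (Lam.incl r).obj (Lam.ob r q)) fun g => Quotient.lift e he g

lemma rgenLift_rgen {q : ℕ} {W : Type*} [AddCommGroup W] [Module k W]
    (e : PMap X.len (r * (q + 1)) → W) (he) (f) :
    rgenLift (k := k) e he (rgen k X r q f) = e f := genLift_gen _ _

lemma rgen_ext {q : ℕ} {W : Type*} [AddCommGroup W] [Module k W]
    {f g : (freeIncl k X r).obj (Lam.ob r q) →ₗ[k] W}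
    (h : ∀ φ, f (rgen k X r q φ) = g (rgen k X r q φ)) : f = g :=
  gen_ext (Y := (Lam.incl r).obj (Lam.ob r q)) h

lemma rgen_rel {q : ℕ} {f f' : PMap X.len (r * (q + 1))} (h : PMap.rel 1 f f') :
    rgen k X r q f = rgen k X r q f' :=
  congrArg (gen k X (Y := (Lam.incl r).obj (Lam.ob r q))) (Quotient.sound h)

lemma map_rgen {q q' : ℕ} (φ : PMap (q + 1) (q' + 1)) (f : PMap X.len (r * (q + 1))) :
    ((freeIncl k X r).map (X := Lam.ob r q) (Y := Lam.ob r q') (Lam.ofMap φ)).hom (rgen k X r q f) =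
      rgen k X r q' (f.comp (φ.dilate r)) :=
  map_gen (Y := (Lam.incl r).obj (Lam.ob r q)) (Z := (Lam.incl r).obj (Lam.ob r q')) _ _

lemma bOp_rgen (q : ℕ) (f : PMap X.len (r * (q + 1 + 1))) :
    bOp (freeIncl k X r) q (rgen k X r (q + 1) f) = ∑ j ∈ Finset.range (q + 2),
      (-1 : k) ^ j • rgen k X r q (f.comp ((PMap.face (q + 1) j).dilate r)) := by
  rw [bOp, LinearMap.sum_apply]
  exact Finset.sum_congr rfl fun j _ => (LinearMap.smul_apply _ _ _).trans (congrArg ((-1 : k) ^ j • ·) (map_rgen (k := k) (PMap.face (q + 1) j) f))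

lemma rotOp_pow_rgen (q j : ℕ) (f : PMap X.len (r * (q + 1))) :
    (rotOp (freeIncl k X r) q ^ j) (rgen k X r q f) =
      ((-1 : k) ^ q) ^ j • rgen k X r q (f.translate j) := by
  obtain ⟨g, hg, h⟩ := rotOp_pow (freeIncl k X r) q j
  rw [h, LinearMap.smul_apply, map_rgen]
  congr 2
  exact PMap.ext (funext fun a => hg _)

variable (k X r)

/-- The projection to the span of the maps that preserve the base point. -/
def freeProj (q : ℕ) : Module.End k ((freeIncl k X r).obj (Lam.ob r q)) :=
  rgenLift (fun f => if ((f.toFun 0 : ℤ) : ZMod (r * (q + 1))) = 0 then rgen k X r q f else 0)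
    fun f f' h => by
      obtain ⟨c, hc⟩ := id h
      have h0 : ((c * ((1 * (r * (q + 1)) : ℕ) : ℤ) : ℤ) : ZMod (r * (q + 1))) = 0 := by
        rw [Int.cast_mul, Int.cast_natCast, one_mul, ZMod.natCast_self, mul_zero]
      rw [hc 0, rgen_rel h, Int.cast_add, h0, add_zero]

/-- The prism homotopy. -/
def freeHtpy (q : ℕ) : (freeIncl k X r).obj (Lam.ob r q) →ₗ[k]
    (freeIncl k X r).obj (Lam.ob r (q + 1)) :=
  rgenLift (fun f => ∑ t ∈ Finset.range r, ∑ j ∈ Finset.range (q + 1), (-1 : k) ^ j •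
    rgen k X r (q + 1) (PMap.prism r q t j (f.translate (-f.toFun 0)))) fun f f' h => by
      obtain ⟨c, hc⟩ := h
      have : f'.translate (-f'.toFun 0) = f.translate (-f.toFun 0) := PMap.ext (funext fun a => by
        change f'.toFun a + -f'.toFun 0 = f.toFun a + -f.toFun 0
        rw [hc, hc]; ring)
      rw [this]

/-- The map that sends every generator to a constant map. -/
def freeConst (q q' : ℕ) : (freeIncl k X r).obj (Lam.ob r q) →ₗ[k]
    (freeIncl k X r).obj (Lam.ob r q') :=
  rgenLift (fun _ => rgen k X r q' (PMap.step _ _ (r * (q' + 1)))) fun _ _ _ => rfl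

variable {k X r}

lemma freeProj_rgen (q : ℕ) (f) : freeProj k X r q (rgen k X r q f) =
    if ((f.toFun 0 : ℤ) : ZMod (r * (q + 1))) = 0 then rgen k X r q f else 0 :=
  rgenLift_rgen _ _ f

lemma freeHtpy_rgen (q : ℕ) (f) (hf : f.toFun 0 = 0) :
    freeHtpy k X r q (rgen k X r q f) = ∑ t ∈ Finset.range r, ∑ j ∈ Finset.range (q + 1),
      (-1 : k) ^ j • rgen k X r (q + 1) (PMap.prism r q t j f) := by
  have : f.translate (-f.toFun 0) = f := PMap.ext (funext fun a => by
    change f.toFun a + -f.toFun 0 = f.toFun a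
    rw [hf]; ring)
  refine (rgenLift_rgen _ _ f).trans ?_
  rw [this]

lemma freeConst_rgen (q q' : ℕ) (f) : freeConst k X r q q' (rgen k X r q f) =
    rgen k X r q' (PMap.step _ _ (r * (q' + 1))) := rgenLift_rgen _ _ f

/-- It suffices to check an identity on the image of `freeProj` on generators that preserve the base point. -/
theorem freeProj_ext {q : ℕ} {W : Type*} [AddCommGroup W] [Module k W]
    {f g : (freeIncl k X r).obj (Lam.ob r q) →ₗ[k] W}
    (h : ∀ φ, φ.toFun 0 = 0 → f (rgen k X r q φ) = g (rgen k X r q φ)) (x) :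
    f (freeProj k X r q x) = g (freeProj k X r q x) := by
  have : f ∘ₗ freeProj k X r q = g ∘ₗ freeProj k X r q := rgen_ext fun φ => by
    rw [LinearMap.comp_apply, LinearMap.comp_apply, freeProj_rgen]
    split_ifs with h0
    · obtain ⟨c, hc⟩ := (ZMod.intCast_zmod_eq_zero_iff_dvd _ _).mp h0
      rw [rgen_rel (f' := φ.translate (-φ.toFun 0)) ⟨-c, fun a => by
        change φ.toFun a + -φ.toFun 0 = _
        rw [hc]; push_cast; ring⟩]
      exact h _ (by change φ.toFun 0 + -φ.toFun 0 = 0; ring)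
    · rw [map_zero, map_zero]
  exact LinearMap.congr_fun this x

lemma freeProj_bOp (q : ℕ) (x) : freeProj k X r q (bOp (freeIncl k X r) q (freeProj k X r (q + 1) x)) =
    bOp (freeIncl k X r) q (freeProj k X r (q + 1) x) := by
  refine freeProj_ext (f := freeProj k X r q ∘ₗ bOp (freeIncl k X r) q) (fun φ h => ?_) x
  rw [LinearMap.comp_apply, bOp_rgen, map_sum]
  refine Finset.sum_congr rfl fun j hj => ?_
  rw [map_smul, freeProj_rgen, if_pos]
  change (((PMap.face (q + 1) j).toFun (φ.toFun 0) : ℤ) : ZMod (r * (q + 1))) = 0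
  rw [h, PMap.face_of_le (by have := Finset.mem_range.mp hj; omega) le_rfl (by positivity), Int.cast_zero]

lemma orbitSum_freeProj (q : ℕ) :
    orbitSum (r * (q + 1)) (rotOp (freeIncl k X r) q) (freeProj k X r q) = 1 := by
  refine rgen_ext fun f => ?_
  rw [orbitSum, LinearMap.sum_apply, Module.End.one_apply]
  have h : ∀ j ∈ Finset.range (r * (q + 1)), (rotOp (freeIncl k X r) q ^ j * freeProj k X r q *
      rotOp (freeIncl k X r) q ^ (r * (q + 1) - j)) (rgen k X r q f) =
      if ((f.toFun 0 : ℤ) : ZMod (r * (q + 1))) = (j : ZMod (r * (q + 1))) then rgen k X r q f else 0 := by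
    intro j hj
    have hj' := (Finset.mem_range.mp hj).le
    have h0 : (((f.translate (r * (q + 1) - j : ℕ)).toFun 0 : ℤ) : ZMod (r * (q + 1))) = 0 ↔
        ((f.toFun 0 : ℤ) : ZMod (r * (q + 1))) = (j : ZMod (r * (q + 1))) := by
      change ((f.toFun 0 + ((r * (q + 1) - j : ℕ) : ℤ) : ℤ) : ZMod (r * (q + 1))) = 0 ↔ _
      rw [Int.cast_add, Int.cast_natCast, Nat.cast_sub hj', ZMod.natCast_self, zero_sub,
        ← sub_eq_add_neg, sub_eq_zero]
    rw [Module.End.mul_apply, Module.End.mul_apply, rotOp_pow_rgen, map_smul, freeProj_rgen,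
      if_congr h0 rfl rfl]
    split_ifs
    · rw [← rotOp_pow_rgen, ← Module.End.mul_apply, ← pow_add, Nat.add_sub_cancel' hj', rotOp_pow_card]
      rfl
    · rw [smul_zero, map_zero]
  rw [Finset.sum_congr rfl h, Finset.sum_eq_single ((f.toFun 0 : ℤ) : ZMod (r * (q + 1))).val,
    if_pos (ZMod.natCast_zmod_val _).symm]
  · intro j hj hne
    refine if_neg fun h' => hne ?_
    rw [h', ZMod.val_natCast_of_lt (Finset.mem_range.mp hj)]
  · exact fun h' => absurd (Finset.mem_range.mpr (ZMod.val_lt _)) h'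

lemma freeProj_normOp (q : ℕ) (x) :
    freeProj k X r q (normOp (freeIncl k X r) q (freeProj k X r q x)) = freeProj k X r q x := by
  refine freeProj_ext (f := freeProj k X r q ∘ₗ normOp (freeIncl k X r) q) (g := LinearMap.id)
    (fun φ h => ?_) x
  rw [LinearMap.comp_apply, normOp, LinearMap.sum_apply, map_sum, Finset.sum_eq_single 0]
  · rw [pow_zero, Module.End.one_apply, freeProj_rgen, h, Int.cast_zero, if_pos rfl]; rfl
  · intro j hj hne
    rw [rotOp_pow_rgen, map_smul, freeProj_rgen, if_neg, smul_zero]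
    change ¬ ((φ.toFun 0 + (j : ℤ) : ℤ) : ZMod (r * (q + 1))) = 0
    rw [h, zero_add, Int.cast_natCast, ZMod.natCast_eq_zero_iff]
    exact fun hd => hne (Nat.eq_zero_of_dvd_of_lt hd (Finset.mem_range.mp hj))
  · exact fun h' => absurd (Finset.mem_range.mpr (NeZero.pos _)) h'

lemma freeHtpy_zero (x) : bOp (freeIncl k X r) 0 (freeHtpy k X r 0 (freeProj k X r 0 x)) =
    freeProj k X r 0 x - freeConst k X r 0 0 (freeProj k X r 0 x) := by
  refine freeProj_ext (f := bOp (freeIncl k X r) 0 ∘ₗ freeHtpy k X r 0)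
    (g := LinearMap.id - freeConst k X r 0 0) (fun φ h => ?_) x
  rw [LinearMap.comp_apply, LinearMap.sub_apply, LinearMap.id_apply, freeConst_rgen, freeHtpy_rgen _ _ h]
  refine Eq.trans ?_ (PMap.sum_prism_zero k (rgen k X r 0) φ h)
  simp only [map_sum, map_smul, bOp_rgen, Finset.smul_sum, smul_smul, ← pow_add]
  refine Finset.sum_congr rfl fun t _ => Finset.sum_congr rfl fun j _ => Finset.sum_congr rfl fun i _ => ?_
  rw [add_comm j i]

lemma freeHtpy_succ (q : ℕ) (x) :
    bOp (freeIncl k X r) (q + 1) (freeHtpy k X r (q + 1) (freeProj k X r (q + 1) x)) +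
      freeHtpy k X r q (bOp (freeIncl k X r) q (freeProj k X r (q + 1) x)) =
    freeProj k X r (q + 1) x - freeConst k X r (q + 1) (q + 1) (freeProj k X r (q + 1) x) := by
  refine freeProj_ext (f := bOp (freeIncl k X r) (q + 1) ∘ₗ freeHtpy k X r (q + 1) +
    freeHtpy k X r q ∘ₗ bOp (freeIncl k X r) q)
    (g := LinearMap.id - freeConst k X r (q + 1) (q + 1)) (fun φ h => ?_) x
  rw [LinearMap.add_apply, LinearMap.comp_apply, LinearMap.comp_apply, LinearMap.sub_apply,
    LinearMap.id_apply, freeConst_rgen, freeHtpy_rgen _ _ h, bOp_rgen]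
  refine Eq.trans ?_ (PMap.sum_prism_succ k q (rgen k X r (q + 1)) φ h)
  congr 1
  · simp only [map_sum, map_smul, bOp_rgen, Finset.smul_sum, smul_smul, ← pow_add]
    refine Finset.sum_congr rfl fun t _ => Finset.sum_congr rfl fun j _ => Finset.sum_congr rfl fun i _ => ?_
    rw [add_comm j i]
  · have h1 : ∀ j ∈ Finset.range (q + 2), freeHtpy k X r q (rgen k X r q
        (φ.comp ((PMap.face (q + 1) j).dilate r))) = ∑ t ∈ Finset.range r, ∑ l ∈ Finset.range (q + 1),
        (-1 : k) ^ l • rgen k X r (q + 1)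
          (PMap.prism r q t l (φ.comp ((PMap.face (q + 1) j).dilate r))) := fun j hj =>
      freeHtpy_rgen _ _ (by
        change (PMap.face (q + 1) j).toFun (φ.toFun 0) = 0
        rw [h, PMap.face_of_le (by have := Finset.mem_range.mp hj; omega) le_rfl (by positivity)])
    rw [map_sum, Finset.sum_congr rfl fun j hj => by rw [map_smul, h1 j hj]]
    simp only [Finset.smul_sum, smul_smul, ← pow_add]
    rw [Finset.sum_comm]
    exact Finset.sum_congr rfl fun t _ => Finset.sum_comm

lemma bOp_freeConst (q q' : ℕ) (x) : bOp (freeIncl k X r) q' (freeConst k X r q (q' + 1) x) =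
    (∑ j ∈ Finset.range (q' + 2), (-1 : k) ^ j) • freeConst k X r q q' x := by
  have : bOp (freeIncl k X r) q' ∘ₗ freeConst k X r q (q' + 1) =
      (∑ j ∈ Finset.range (q' + 2), (-1 : k) ^ j) • freeConst k X r q q' := rgen_ext fun f => by
    rw [LinearMap.comp_apply, LinearMap.smul_apply, freeConst_rgen, freeConst_rgen, bOp_rgen,
      Finset.sum_smul]
    refine Finset.sum_congr rfl fun j hj => ?_
    have hj' : j ≤ q' + 1 := by have := Finset.mem_range.mp hj; omega
    rw [PMap.step_comp le_rfl le_rfl _ (PMap.face_dilate_zero q' j hj')]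
    have := (((PMap.face (q' + 1) j).dilate r).shift 0).trans
      (congrArg (· + _) (PMap.face_dilate_zero q' j hj'))
    rwa [zero_add, zero_add] at this
  exact LinearMap.congr_fun this x

lemma freeConst_bOp (q q' : ℕ) (x) : freeConst k X r q q' (bOp (freeIncl k X r) q x) =
    (∑ j ∈ Finset.range (q + 2), (-1 : k) ^ j) • freeConst k X r (q + 1) q' x := by
  have : freeConst k X r q q' ∘ₗ bOp (freeIncl k X r) q =
      (∑ j ∈ Finset.range (q + 2), (-1 : k) ^ j) • freeConst k X r (q + 1) q' := rgen_ext fun f => by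
    rw [LinearMap.comp_apply, LinearMap.smul_apply, bOp_rgen, map_sum, freeConst_rgen, Finset.sum_smul]
    exact Finset.sum_congr rfl fun j hj => by rw [map_smul, freeConst_rgen]
  exact LinearMap.congr_fun this x

/-- The maps that preserve the base point span an acyclic complex. -/
theorem exists_bOp_of_freeProj (q : ℕ) (x)
    (hx : bOp (freeIncl k X r) q (freeProj k X r (q + 1) x) = 0) :
    ∃ y, bOp (freeIncl k X r) (q + 1) y = freeProj k X r (q + 1) x := by
  have h := freeHtpy_succ q x
  rw [hx, map_zero, add_zero] at h
  have hgeom : ∀ n : ℕ, ∑ j ∈ Finset.range n, (-1 : k) ^ j = if Even n then 0 else 1 :=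
    fun n => neg_one_geom_sum
  by_cases hq : Even q
  · refine ⟨freeHtpy k X r (q + 1) (freeProj k X r (q + 1) x) +
      freeConst k X r (q + 1) (q + 2) (freeProj k X r (q + 1) x), ?_⟩
    rw [map_add, h, bOp_freeConst, hgeom, if_neg (by rw [Nat.even_add_one, not_not, Nat.even_add]; simp [hq]), one_smul]
    abel
  · refine ⟨freeHtpy k X r (q + 1) (freeProj k X r (q + 1) x), ?_⟩
    have h0 := freeConst_bOp q (q + 1) (freeProj k X r (q + 1) x)
    rw [hx, map_zero, hgeom, if_neg (by rw [Nat.even_add]; simp [hq]), one_smul] at h0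
    rw [h, ← h0, sub_zero]

end Restricted

section HC

variable {k : Type u} [Field k] {p : ℕ} (E : Lam p ⥤ ModuleCat.{u} k)

/-- Cyclic homology vanishes in degree `n + 1`. The cyclic complex is the part of the periodic complex in columns `≥ 0`;
in degree `n`, these are the rows `≤ n`. -/
def HCAcyclic (n : ℕ) : Prop :=
  ∀ x : ∀ q : ℕ, E.obj (Lam.ob p q), (∀ q ≤ n, perD E n x q = 0) →
    ∃ y, ∀ q ≤ n + 1, perD E (n + 1) y q = x q

variable {E}

lemma perD_single_self_even {n : ℤ} {q : ℕ} (h : Even (n - q)) (w : E.obj (Lam.ob p q)) :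
    perD E n (Pi.single q w) q = w - rotOp E q w := by
  rw [perD_apply_even E h, Pi.single_eq_same, Pi.single_eq_of_ne (by omega), map_zero, zero_add]

lemma perD_single_self_odd {n : ℤ} {q : ℕ} (h : ¬ Even (n - q)) (w : E.obj (Lam.ob p q)) :
    perD E n (Pi.single q w) q = normOp E q w := by
  rw [perD_apply_odd E h, Pi.single_eq_same, Pi.single_eq_of_ne (by omega), map_zero, sub_zero]

lemma perD_apply_congr {n : ℤ} {q : ℕ} {x y : ∀ q : ℕ, E.obj (Lam.ob p q)} (h : x q = y q)
    (h' : x (q + 1) = y (q + 1)) : perD E n x q = perD E n y q := by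
  by_cases e : Even (n - q)
  · rw [perD_apply_even E e, perD_apply_even E e, h, h']
  · rw [perD_apply_odd E e, perD_apply_odd E e, h, h']

lemma perD_congr_degree {n m : ℤ} (h : Even (n - m)) : perD E n = perD E m := by
  have e : ∀ q : ℕ, Even (n - q) ↔ Even (m - q) := fun q => by
    rw [show n - (q : ℤ) = (n - m) + (m - q) by ring, Int.even_add]; simp [h]
  refine LinearMap.ext fun x => funext fun q => ?_
  by_cases e' : Even (n - q)
  · rw [perD_apply_even E e', perD_apply_even E ((e q).mp e')]
  · rw [perD_apply_odd E e', perD_apply_odd E (fun h => e' ((e q).mpr h))]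

lemma perD_apply_of_zero {n : ℤ} {q : ℕ} {x : ∀ q : ℕ, E.obj (Lam.ob p q)} (h : x q = 0)
    (h' : x (q + 1) = 0) : perD E n x q = 0 :=
  (perD_apply_congr (y := 0) h h').trans (congrFun (map_zero (perD E n)) q)

/-- If the rows are exact, a cycle of the cyclic complex that is a boundary in its top row is a boundary. -/
theorem hcAcyclic_of_rows [NeZero p]
    (h1 : ∀ q (x : E.obj (Lam.ob p q)), x - rotOp E q x = 0 → ∃ y, normOp E q y = x)
    (h2 : ∀ q (x : E.obj (Lam.ob p q)), normOp E q x = 0 → ∃ y, y - rotOp E q y = x) {n : ℕ}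
    (h : ∀ (x : E.obj (Lam.ob p n)) (x' : E.obj (Lam.ob p (n + 1))),
      bOp E n x' + (x - rotOp E n x) = 0 → ∃ y y', bOp E (n + 1) y' + (y - rotOp E (n + 1) y) = x') :
    HCAcyclic E n := by
  intro x hx
  have key : ∀ i ≤ n + 1, ∃ y, ∀ q, n + 1 - i ≤ q → q ≤ n + 1 → perD E (n + 1) y q = x q := by
    intro i
    induction i with
    | zero =>
      intro _
      have h0 := hx n le_rfl
      rw [perD_apply_even E (by simp)] at h0
      obtain ⟨y, y', hy⟩ := h _ _ h0
      refine ⟨Pi.single (n + 1) y + Pi.single (n + 2) y', fun q hq hq' => ?_⟩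
      obtain rfl : q = n + 1 := by omega
      rw [perD_apply_even E (by push_cast; simp), Pi.add_apply, Pi.add_apply, Pi.single_eq_same,
        Pi.single_eq_same, Pi.single_eq_of_ne (by omega), Pi.single_eq_of_ne (by omega), zero_add, add_zero]
      exact hy
    | succ i ih =>
      intro hi
      obtain ⟨y, hy⟩ := ih (by omega)
      obtain ⟨q, hq⟩ : ∃ q, n + 1 - (i + 1) = q := ⟨_, rfl⟩
      have hD := congrFun (perD_perD_apply (E := E) (n := n) y) q
      have hz : perD E n (x - perD E (n + 1) y) q = 0 := by
        rw [map_sub, Pi.sub_apply, hD, hx q (by omega)]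
        simp
      -- the next row up is already solved, so the error in row `q` is a cycle of the row
      have hz' : (x - perD E (n + 1) y) (q + 1) = 0 := by
        rw [Pi.sub_apply, hy (q + 1) (by omega) (by omega), sub_self]
      obtain ⟨w, hw⟩ : ∃ w, perD E (n + 1) (Pi.single q w) q = (x - perD E (n + 1) y) q := by
        by_cases e : Even ((n : ℤ) - q)
        · rw [perD_apply_even E e, hz', map_zero, zero_add] at hz
          obtain ⟨w, hw⟩ := h1 q _ hz
          exact ⟨w, (perD_single_self_odd (by rw [even_succ_sub, not_not]; exact e) w).trans hw⟩
        · rw [perD_apply_odd E e, hz', map_zero, sub_zero] at hz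
          obtain ⟨w, hw⟩ := h2 q _ hz
          exact ⟨w, (perD_single_self_even (by rw [even_succ_sub]; exact e) w).trans hw⟩
      refine ⟨y + Pi.single q w, fun l hl hl' => ?_⟩
      rw [map_add, Pi.add_apply]
      rcases eq_or_ne l q with rfl | hne
      · rw [hw, Pi.sub_apply, add_sub_cancel]
      · rw [perD_apply_of_zero (x := Pi.single q w) (Pi.single_eq_of_ne hne _) (Pi.single_eq_of_ne (by omega) _), add_zero,
          hy l (by omega) hl']
  obtain ⟨y, hy⟩ := key (n + 1) le_rfl
  exact ⟨y, fun q hq => hy q (by omega) hq⟩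

lemma exists_bOp_eq_sub_rotOp [NeZero p] (q : ℕ) {y : E.obj (Lam.ob p (q + 1))} (hy : bOp' E q y = 0) :
    ∃ z, bOp E (q + 1) z = y - rotOp E (q + 1) y := by
  refine ⟨extraOp E (q + 1) y - rotOp E (q + 2) (extraOp E (q + 1) y), ?_⟩
  have := bOp'_extraOp E q y
  rw [hy, map_zero, add_zero] at this
  rw [bOp_sub_rotOp_apply, this]

/-- If cyclic homology vanishes in two consecutive degrees, then by the exact sequence of Connes the homology of `b`
vanishes in the higher one of them, plus one. -/
theorem HCAcyclic.exists_bOp [NeZero p] {n : ℕ} (h : HCAcyclic E n) (h' : HCAcyclic E (n + 1))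
    {x : E.obj (Lam.ob p (n + 2))} (hx : bOp E (n + 1) x = 0) : ∃ y, bOp E (n + 2) y = x := by
  obtain ⟨y, hy⟩ := h' (Pi.single (n + 2) x) fun q hq => by
    rcases eq_or_ne q (n + 1) with rfl | hne
    · rw [perD_apply_even E (by simp), Pi.single_eq_same, Pi.single_eq_of_ne (by omega), hx]
      simp
    · exact perD_apply_of_zero (Pi.single_eq_of_ne (by omega) _) (Pi.single_eq_of_ne (by omega) _)
  have e0 : perD E ((n + 1 : ℕ) + 1) = perD E n := perD_congr_degree ⟨1, by push_cast; ring⟩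
  have e1 : perD E ((n : ℤ) + 1) = perD E ((n + 1 : ℕ) : ℤ) := by push_cast; rfl
  obtain ⟨z, hz⟩ := h y fun q hq => by
    rw [← e0, hy q (by omega), Pi.single_eq_of_ne (by omega)]
  have r2 := hy (n + 2) le_rfl
  have r1 := hy (n + 1) (by omega)
  rw [e0, perD_apply_even E ⟨-1, by push_cast; ring⟩, Pi.single_eq_same] at r2
  rw [e0, perD_apply_odd E (by rw [even_sub_succ, not_not, sub_self]; exact Even.zero), Pi.single_eq_of_ne (by omega)] at r1
  have rz := hz (n + 1) le_rfl
  rw [perD_apply_even E (by push_cast; simp)] at rz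
  rw [← rz, map_add, normOp_sub_rotOp_apply, add_zero, ← bOp'_normOp_apply, ← map_sub] at r1
  obtain ⟨w, hw⟩ := exists_bOp_eq_sub_rotOp (n + 1)
    (y := y (n + 2) - normOp E (n + 2) (z (n + 2))) (by rw [← neg_eq_zero, ← map_neg, neg_sub, r1])
  refine ⟨y (n + 3) + w, ?_⟩
  rw [map_add, hw, map_sub (rotOp E (n + 2)), sub_sub_sub_comm, sub_rotOp_normOp_apply, sub_zero, r2]

end HC

section Free

variable {k : Type u} [Field k] {X : Lam 1} {r : ℕ} [NeZero r]

lemma freeIncl_decomposition (q : ℕ) (x : (freeIncl k X r).obj (Lam.ob r q)) :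
    ∃ y, freeProj k X r q (normOp (freeIncl k X r) q x) + (y - rotOp (freeIncl k X r) q y) = x :=
  ⟨orbitHtpy (r * (q + 1)) (rotOp (freeIncl k X r) q) (freeProj k X r q) x,
    LinearMap.congr_fun ((mul_norm_add_orbitHtpy (θ := freeProj k X r q)
      (rotOp_pow_card (freeIncl k X r) q)).trans (orbitSum_freeProj q)) x⟩

lemma normOp_freeProj_normOp (q : ℕ) (x : (freeIncl k X r).obj (Lam.ob r q)) :
    normOp (freeIncl k X r) q (freeProj k X r q (normOp (freeIncl k X r) q x)) =
      normOp (freeIncl k X r) q x := by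
  obtain ⟨y, hy⟩ := freeIncl_decomposition q x
  have h := congrArg (normOp (freeIncl k X r) q) hy
  rwa [map_add, normOp_sub_rotOp_apply, add_zero] at h

lemma exists_normOp_freeIncl (q : ℕ) (x : (freeIncl k X r).obj (Lam.ob r q))
    (hx : x - rotOp (freeIncl k X r) q x = 0) : ∃ y, normOp (freeIncl k X r) q y = x := by
  have h := LinearMap.congr_fun ((norm_mul_add_orbitHtpy (freeProj k X r q)
    (Nat.mul_pos (NeZero.pos r) q.succ_pos) (rotOp_pow_card (freeIncl k X r) q)).trans
    (orbitSum_freeProj q)) x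
  refine ⟨freeProj k X r q (rotOp (freeIncl k X r) q x), Eq.trans ?_ h⟩
  have h0 : (1 - rotOp (freeIncl k X r) q) x = 0 := hx
  rw [LinearMap.add_apply, Module.End.mul_apply, Module.End.mul_apply, Module.End.mul_apply, h0, map_zero,
    add_zero]
  rfl

lemma hcAcyclic_freeIncl (n : ℕ) : HCAcyclic (freeIncl k X r) n := by
  refine hcAcyclic_of_rows exists_normOp_freeIncl (fun q x hx => ?_) fun x x' hx => ?_
  · obtain ⟨y, hy⟩ := freeIncl_decomposition q x
    exact ⟨y, by rw [← hy, hx, map_zero, zero_add] ⟩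
  · obtain ⟨y, hy⟩ := freeIncl_decomposition (n + 1) x'
    obtain ⟨v, hv⟩ : ∃ v, freeProj k X r (n + 1) (normOp (freeIncl k X r) (n + 1) x') = v := ⟨_, rfl⟩
    have hb : freeProj k X r n (bOp (freeIncl k X r) n v) = bOp (freeIncl k X r) n v := by
      rw [← hv, freeProj_bOp]
    have hN : normOp (freeIncl k X r) n (bOp (freeIncl k X r) n v) = 0 := by
      rw [← bOp'_normOp_apply, ← hv, normOp_freeProj_normOp, bOp'_normOp_apply,
        eq_neg_of_add_eq_zero_left hx, map_neg, normOp_sub_rotOp_apply, neg_zero]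
    have h0 : bOp (freeIncl k X r) n v = 0 := by
      rw [← hb, ← freeProj_normOp, hb, hN, map_zero]
    obtain ⟨y', hy'⟩ := exists_bOp_of_freeProj n (normOp (freeIncl k X r) (n + 1) x') (by rw [hv, h0])
    exact ⟨y, y', by rw [hy', hy]⟩

/-- The Hochschild homology of a free object vanishes in degrees `≥ 2`. -/
theorem exists_bOp_freeIncl (n : ℕ) {x} (hx : bOp (freeIncl k X r) (n + 1) x = 0) :
    ∃ y, bOp (freeIncl k X r) (n + 2) y = x :=
  (hcAcyclic_freeIncl n).exists_bOp (hcAcyclic_freeIncl (n + 1)) hx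

variable (k X r) in
/-- The augmentation of the restriction of a free object. -/
def rgenAug (q : ℕ) : (freeIncl k X r).obj (Lam.ob r q) →ₗ[k] k :=
  freeAug k X ((Lam.incl r).obj (Lam.ob r q))

lemma rgenAug_rgen (q : ℕ) (f : PMap X.len (r * (q + 1))) : rgenAug k X r q (rgen k X r q f) = 1 :=
  freeAug_gen _

variable (k X r) in
/-- The generator in level `0` given by a constant map. -/
def baseGen : (freeIncl k X r).obj (Lam.ob r 0) := rgen k X r 0 (PMap.step _ _ (r * (0 + 1)))

lemma rgenAug_baseGen : rgenAug k X r 0 (baseGen k X r) = 1 := rgenAug_rgen 0 _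

lemma freeConst_eq (x : (freeIncl k X r).obj (Lam.ob r 0)) :
    freeConst k X r 0 0 x = rgenAug k X r 0 x • baseGen k X r := by
  have : freeConst k X r 0 0 = (rgenAug k X r 0).smulRight (baseGen k X r) := rgen_ext fun f => by
    rw [LinearMap.smulRight_apply, freeConst_rgen, rgenAug_rgen, one_smul]; rfl
  exact LinearMap.congr_fun this x

lemma rgenAug_map {q q' : ℕ} (φ : PMap (q + 1) (q' + 1)) (x : (freeIncl k X r).obj (Lam.ob r q)) :
    rgenAug k X r q' (((freeIncl k X r).map (X := Lam.ob r q) (Y := Lam.ob r q') (Lam.ofMap φ)).hom x) =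
      rgenAug k X r q x :=
  freeAug_map _ x

lemma rgenAug_rotOp (q : ℕ) (x : (freeIncl k X r).obj (Lam.ob r q)) :
    rgenAug k X r q (rotOp (freeIncl k X r) q x) = (-1) ^ q * rgenAug k X r q x := by
  rw [rotOp, LinearMap.smul_apply, map_smul, smul_eq_mul]
  exact congrArg _ (rgenAug_map _ x)

lemma rgenAug_bOp (q : ℕ) (x : (freeIncl k X r).obj (Lam.ob r (q + 1))) :
    rgenAug k X r q (bOp (freeIncl k X r) q x) =
      (∑ j ∈ Finset.range (q + 2), (-1 : k) ^ j) * rgenAug k X r (q + 1) x := by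
  rw [bOp, LinearMap.sum_apply, map_sum, Finset.sum_mul]
  refine Finset.sum_congr rfl fun j _ => ?_
  rw [LinearMap.smul_apply, map_smul, smul_eq_mul]
  exact congrArg _ (rgenAug_map _ x)

/-- The Hochschild homology of a free object in degree `0` is detected by the augmentation. -/
theorem exists_bOp_freeIncl_zero {x : (freeIncl k X r).obj (Lam.ob r 0)} (hx : rgenAug k X r 0 x = 0) :
    ∃ y, bOp (freeIncl k X r) 0 y = x := by
  obtain ⟨y, hy⟩ := freeIncl_decomposition 0 x
  have h := freeHtpy_zero (normOp (freeIncl k X r) 0 x)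
  have h0 : rgenAug k X r 0 (freeProj k X r 0 (normOp (freeIncl k X r) 0 x)) = 0 := by
    have := congrArg (rgenAug k X r 0) hy
    rwa [map_add, map_sub, rgenAug_rotOp, pow_zero, one_mul, sub_self, add_zero, hx] at this
  rw [freeConst_eq, h0, zero_smul, sub_zero] at h
  refine ⟨freeHtpy k X r 0 (freeProj k X r 0 (normOp (freeIncl k X r) 0 x)) +
    (extraOp (freeIncl k X r) 0 y - rotOp (freeIncl k X r) 1 (extraOp (freeIncl k X r) 0 y)), ?_⟩
  rw [map_add, h, bOp_sub_rotOp_apply, bOp'_extraOp_zero, hy]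

variable (k X r) in
/-- The Hochschild cocycle of degree `1` of a free object, dual to the image under `B` of a generator of degree `0`: it
counts the maps `f` with `f 0 = 1`. -/
def windCocycle : (freeIncl k X r).obj (Lam.ob r 1) →ₗ[k] k :=
  rgenLift (fun f => if ((f.toFun 0 : ℤ) : ZMod (r * 2)) = 1 then 1 else 0) fun f f' h => by
    obtain ⟨c, hc⟩ := h
    have h0 : ((c * ((1 * (r * 2) : ℕ) : ℤ) : ℤ) : ZMod (r * 2)) = 0 := by
      rw [Int.cast_mul, Int.cast_natCast, one_mul, ZMod.natCast_self, mul_zero]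
    rw [hc 0]
    change _ = if ((f.toFun 0 + c * ((1 * (r * 2) : ℕ) : ℤ) : ℤ) : ZMod (r * 2)) = 1 then _ else _
    rw [Int.cast_add, h0, add_zero]

lemma windCocycle_rgen (f : PMap X.len (r * 2)) : windCocycle k X r (rgen k X r 1 f) =
    if ((f.toFun 0 : ℤ) : ZMod (r * 2)) = 1 then 1 else 0 := rgenLift_rgen _ _ f

lemma intCast_two_mul_ne_one (a : ℤ) : ((2 * a : ℤ) : ZMod (r * 2)) ≠ 1 := by
  intro h
  rw [← Int.cast_one, ZMod.intCast_eq_intCast_iff, Int.modEq_iff_dvd] at h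
  obtain ⟨c, hc⟩ := h
  push_cast at hc
  have : 1 - 2 * a = 2 * (r * c) := by rw [hc]; ring
  omega

lemma windCocycle_bOp (x : (freeIncl k X r).obj (Lam.ob r 2)) :
    windCocycle k X r (bOp (freeIncl k X r) 1 x) = 0 := by
  have : windCocycle k X r ∘ₗ bOp (freeIncl k X r) 1 = 0 := rgen_ext fun f => by
    rw [LinearMap.comp_apply, bOp_rgen, LinearMap.zero_apply, map_sum]
    simp only [map_smul, windCocycle_rgen, Finset.sum_range_succ, Finset.sum_range_zero]
    change 0 + (-1 : k) ^ 0 • (if (((PMap.face 2 0).toFun (f.toFun 0) : ℤ) : ZMod (r * 2)) = 1 then (1 : k) else 0) +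
      (-1 : k) ^ 1 • (if (((PMap.face 2 1).toFun (f.toFun 0) : ℤ) : ZMod (r * 2)) = 1 then (1 : k) else 0) +
      (-1 : k) ^ 2 • (if (((PMap.face 2 2).toFun (f.toFun 0) : ℤ) : ZMod (r * 2)) = 1 then (1 : k) else 0) = 0
    obtain ⟨a, b, h0, h3, hab⟩ := PMap.eq_mul_or 3 (f.toFun 0)
    have hf := fun i (hi : i ≤ 2) => PMap.face_apply 2 i hi a b h0 (by push_cast at h3 ⊢; omega)
    push_cast at hf hab
    rw [hab, hf 0 (by omega), hf 1 (by omega), hf 2 (by omega)]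
    have e : ∀ c : ℤ, (((a * 2 + 2 * c : ℤ)) : ZMod (r * 2)) ≠ 1 := fun c => by
      rw [show a * 2 + 2 * c = 2 * (a + c) by ring]; exact intCast_two_mul_ne_one _
    have e0 := e 0
    have e1 := e 1
    push_cast at e0 e1
    rw [add_zero] at e0
    obtain rfl | rfl | rfl : b = 0 ∨ b = 1 ∨ b = 2 := by omega
    · simp [e0]
    · simp only [Nat.cast_zero, Nat.cast_one, Nat.cast_ofNat]
      norm_num [e0]
      split_ifs <;> simp
    · norm_num [e0, e1]
      split_ifs <;> simp
  exact LinearMap.congr_fun this x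

lemma windCocycle_connesOp (x : (freeIncl k X r).obj (Lam.ob r 0)) :
    windCocycle k X r (connesOp (freeIncl k X r) 0 x) = rgenAug k X r 0 x := by
  have hr : NeZero (r * (0 + 1)) := ⟨(Nat.mul_pos (NeZero.pos r) Nat.one_pos).ne'⟩
  have : windCocycle k X r ∘ₗ connesOp (freeIncl k X r) 0 = rgenAug k X r 0 := rgen_ext fun f => by
    have hs : ∀ g : PMap X.len (r * (0 + 1)), windCocycle k X r (extraOp (freeIncl k X r) 0 (rgen k X r 0 g) -
        rotOp (freeIncl k X r) 1 (extraOp (freeIncl k X r) 0 (rgen k X r 0 g))) =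
        if ((g.toFun 0 : ℤ) : ZMod (r * (0 + 1))) = 0 then 1 else 0 := fun g => by
      have e1 : extraOp (freeIncl k X r) 0 (rgen k X r 0 g) =
          rgen k X r 1 (g.comp ((PMap.extra 0).dilate r)) := map_rgen _ g
      have e2 := rotOp_pow_rgen (k := k) 1 1 (g.comp ((PMap.extra 0).dilate r))
      rw [pow_one, pow_one, pow_one, neg_one_smul] at e2
      have e3 : (g.comp ((PMap.extra 0).dilate r)).toFun 0 = 2 * g.toFun 0 + 1 := by
        change (PMap.extra 0).toFun (g.toFun 0) = _
        have := (PMap.extra 0).shift_mul 0 (g.toFun 0)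
        rw [PMap.extra_of_lt le_rfl (by norm_num)] at this
        push_cast at this
        rw [mul_one, zero_add] at this
        rw [this]; ring
      have e4 : ((g.comp ((PMap.extra 0).dilate r)).translate (1 : ℕ)).toFun 0 = 2 * (g.toFun 0 + 1) := by
        change (g.comp ((PMap.extra 0).dilate r)).toFun 0 + (1 : ℕ) = _
        rw [e3]; push_cast; ring
      rw [e1, e2, sub_neg_eq_add, map_add, windCocycle_rgen, windCocycle_rgen, e3, e4,
        if_neg (intCast_two_mul_ne_one _), add_zero]
      refine if_congr ?_ rfl rfl
      rw [Int.cast_add, Int.cast_one, add_eq_right, ZMod.intCast_zmod_eq_zero_iff_dvd,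
        ZMod.intCast_zmod_eq_zero_iff_dvd]
      push_cast
      have hd : ∀ a : ℤ, (r : ℤ) * 2 ∣ 2 * a ↔ (r : ℤ) * 1 ∣ a := fun a => by
        rw [mul_one, mul_comm (r : ℤ) 2]
        exact mul_dvd_mul_iff_left two_ne_zero
      exact hd _
    rw [LinearMap.comp_apply, connesOp_apply, rgenAug_rgen, normOp, LinearMap.sum_apply, map_sum, map_sum,
      ← Finset.sum_sub_distrib, map_sum]
    have ht : ∀ j ∈ Finset.range (r * (0 + 1)), windCocycle k X r
        (extraOp (freeIncl k X r) 0 ((rotOp (freeIncl k X r) 0 ^ j) (rgen k X r 0 f)) -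
          rotOp (freeIncl k X r) 1 (extraOp (freeIncl k X r) 0 ((rotOp (freeIncl k X r) 0 ^ j) (rgen k X r 0 f)))) =
        if ((f.toFun 0 : ℤ) : ZMod (r * (0 + 1))) + j = 0 then 1 else 0 := fun j _ => by
      rw [rotOp_pow_rgen, pow_zero, one_pow, one_smul, hs]
      change (if ((f.toFun 0 + (j : ℤ) : ℤ) : ZMod (r * (0 + 1))) = 0 then (1 : k) else 0) = _
      rw [Int.cast_add, Int.cast_natCast]
    rw [Finset.sum_congr rfl ht, Finset.sum_eq_single (-((f.toFun 0 : ℤ) : ZMod (r * (0 + 1)))).val,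
      if_pos (by rw [ZMod.natCast_zmod_val, add_neg_cancel])]
    · intro j hj hne
      refine if_neg fun h' => hne ?_
      rw [← eq_neg_of_add_eq_zero_right h', ZMod.val_natCast_of_lt (Finset.mem_range.mp hj)]
    · exact fun h' => absurd (Finset.mem_range.mpr (ZMod.val_lt _)) h'
  exact LinearMap.congr_fun this x

/-- The Hochschild homology of a free object in degree `1` is detected by `windCocycle`. -/
theorem exists_bOp_freeIncl_one {x : (freeIncl k X r).obj (Lam.ob r 1)} (hx : bOp (freeIncl k X r) 0 x = 0) :
    ∃ y, bOp (freeIncl k X r) 1 y =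
      x - windCocycle k X r x • connesOp (freeIncl k X r) 0 (baseGen k X r) := by
  obtain ⟨y, hy⟩ := hcAcyclic_freeIncl 0 (Pi.single 1 x) fun q hq => by
    obtain rfl : q = 0 := by omega
    rw [perD_apply_even _ (by simp), Pi.single_eq_same, Pi.single_eq_of_ne (by omega), hx]
    simp
  have r1 := hy 1 le_rfl
  have r0 := hy 0 (by omega)
  rw [perD_apply_even _ (by simp), Pi.single_eq_same] at r1
  rw [perD_apply_odd _ (by simp), Pi.single_eq_of_ne (by omega)] at r0
  obtain ⟨c, hc⟩ : ∃ c, rgenAug k X r 0 (y 0) = c := ⟨_, rfl⟩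
  obtain ⟨z, hz⟩ := exists_bOp_freeIncl_zero (x := y 0 - c • baseGen k X r) (by
    rw [map_sub, map_smul, rgenAug_baseGen, hc, smul_eq_mul, mul_one, sub_self])
  obtain ⟨w, hw⟩ := exists_bOp_eq_sub_rotOp 0 (y := y 1 - normOp (freeIncl k X r) 1 z -
      c • extraOp (freeIncl k X r) 0 (normOp (freeIncl k X r) 0 (baseGen k X r))) (by
    rw [map_sub, map_sub, bOp'_normOp_apply, map_smul, bOp'_extraOp_zero, hz, map_sub, map_smul,
      ← sub_eq_zero.mp r0]
    abel)
  have hx' : x = bOp (freeIncl k X r) 1 (y 2 + w) + c • connesOp (freeIncl k X r) 0 (baseGen k X r) := by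
    have h0 := sub_rotOp_normOp_apply (freeIncl k X r) 1 z
    rw [map_add, hw, connesOp_apply, smul_sub, ← r1, map_sub, map_sub, map_smul,
      ← sub_eq_zero.mp h0]
    abel
  have hc' : windCocycle k X r x = c := by
    rw [hx', map_add, windCocycle_bOp, map_smul, windCocycle_connesOp, rgenAug_baseGen, zero_add,
      smul_eq_mul, mul_one]
  refine ⟨y 2 + w, ?_⟩
  rw [hc']
  exact (sub_eq_of_eq_add hx').symm

end Free

/-! ### Acyclic models -/

section Naturality

variable {k : Type u} [Field k] {p : ℕ} {E E' : Lam p ⥤ ModuleCat.{u} k} (α : E ⟶ E')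

lemma extraOp_app (q : ℕ) (x : E.obj (Lam.ob p q)) :
    extraOp E' q ((α.app (Lam.ob p q)).hom x) = (α.app (Lam.ob p (q + 1))).hom (extraOp E q x) :=
  LinearMap.congr_fun (congrArg ModuleCat.Hom.hom (α.naturality (X := Lam.ob p q) (Y := Lam.ob p (q + 1))
    (Lam.ofMap (PMap.extra q)))).symm x

lemma rotOp_app (q : ℕ) (x : E.obj (Lam.ob p q)) :
    rotOp E' q ((α.app (Lam.ob p q)).hom x) = (α.app (Lam.ob p q)).hom (rotOp E q x) :=
  LinearMap.congr_fun (rotOp_naturality α q) x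

lemma normOp_app (q : ℕ) (x : E.obj (Lam.ob p q)) :
    normOp E' q ((α.app (Lam.ob p q)).hom x) = (α.app (Lam.ob p q)).hom (normOp E q x) :=
  LinearMap.congr_fun (normOp_naturality α q) x

lemma connesOp_app (q : ℕ) (x : E.obj (Lam.ob p q)) :
    connesOp E' q ((α.app (Lam.ob p q)).hom x) = (α.app (Lam.ob p (q + 1))).hom (connesOp E q x) := by
  rw [connesOp_apply, connesOp_apply, normOp_app, extraOp_app, rotOp_app, map_sub]

lemma mixD_perMap (x : ∀ q : ℕ, E.obj (Lam.ob p q)) : mixD E' (perMap α x) = perMap α (mixD E x) := by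
  funext q
  rw [perMap_apply, mixD_apply, mixD_apply, map_add, perMap_apply, bOp_app]
  congr 1
  match q with
  | 0 => exact (map_zero _).symm
  | q + 1 => exact connesOp_app α q (x q)

lemma fromMixed_perMap (n : ℤ) (x : ∀ q : ℕ, E.obj (Lam.ob p q)) :
    fromMixed E' n (perMap α x) = perMap α (fromMixed E n x) := by
  funext q
  rw [perMap_apply]
  by_cases h : Even (n - q)
  · rw [fromMixed_even E' _ h, fromMixed_even E _ h, perMap_apply]
  · rw [fromMixed_odd E' _ h, fromMixed_odd E _ h]
    match q with
    | 0 => exact (map_zero _).symm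
    | q + 1 =>
      rw [shiftUp_succ, shiftUp_succ, LinearMap.comp_apply, LinearMap.comp_apply, perMap_apply, normOp_app,
        extraOp_app]

lemma toMixed_perMap (n : ℤ) (x : ∀ q : ℕ, E.obj (Lam.ob p q)) :
    toMixed E' n (perMap α x) = perMap α (toMixed E n x) := by
  funext q
  rw [perMap_apply]
  by_cases h : Even (n - q)
  · rw [toMixed_even E' _ h, toMixed_even E _ h, map_add, perMap_apply]
    congr 1
    match q with
    | 0 => exact (map_zero _).symm
    | q + 1 =>
      rw [shiftUp_succ, shiftUp_succ]
      change extraOp E' q _ - rotOp E' (q + 1) (extraOp E' q _) =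
        (α.app _).hom (extraOp E q _ - rotOp E (q + 1) (extraOp E q _))
      rw [perMap_apply, extraOp_app, rotOp_app, map_sub]
  · rw [toMixed_odd E' _ h, toMixed_odd E _ h, map_zero]

end Naturality

section Models

variable {k : Type u} [Field k]

/-- The morphism of the restrictions along `[n] ↦ [rn]` induced by a morphism of cyclic vector spaces. -/
abbrev inclMap (r : ℕ) [NeZero r] {E E' : Lam 1 ⥤ ModuleCat.{u} k} (α : E ⟶ E') :
    Lam.incl r ⋙ E ⟶ Lam.incl r ⋙ E' := Functor.whiskerLeft (Lam.incl r) α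

/-- The action of an element of a free object on a cyclic vector space. -/
def freeEval {X Y : Lam 1} (E : Lam 1 ⥤ ModuleCat.{u} k) (ω : (freeObj k X).obj Y) : E.obj X →ₗ[k] E.obj Y :=
  genLift (fun g => (E.map g).hom) ω

lemma freeEval_apply {X Y : Lam 1} {E : Lam 1 ⥤ ModuleCat.{u} k} (ω : (freeObj k X).obj Y) (v : E.obj X) :
    freeEval E ω v = ((freeLift v).app Y).hom ω := by
  have : LinearMap.applyₗ v ∘ₗ genLift (fun g : X ⟶ Y => (E.map g).hom) = ((freeLift v).app Y).hom :=
    gen_ext fun φ => by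
      rw [LinearMap.comp_apply, genLift_gen, freeLift_gen]; rfl
  exact LinearMap.congr_fun this ω

lemma freeEval_app {X Y : Lam 1} {E E' : Lam 1 ⥤ ModuleCat.{u} k} (α : E ⟶ E')
    (ω : (freeObj k X).obj Y) (v : E.obj X) :
    freeEval E' ω ((α.app X).hom v) = (α.app Y).hom (freeEval E ω v) := by
  have : genLift (fun g : X ⟶ Y => (E'.map g).hom ∘ₗ (α.app X).hom) =
      genLift (k := k) (fun g : X ⟶ Y => (α.app Y).hom ∘ₗ (E.map g).hom) := gen_ext fun φ => by
    rw [genLift_gen, genLift_gen]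
    exact congrArg ModuleCat.Hom.hom (α.naturality _).symm
  have h1 : LinearMap.lcomp k _ (α.app X).hom ∘ₗ genLift (fun g : X ⟶ Y => (E'.map g).hom) =
      genLift (fun g : X ⟶ Y => (E'.map g).hom ∘ₗ (α.app X).hom) := gen_ext fun φ => by
    rw [LinearMap.comp_apply, genLift_gen, genLift_gen]; rfl
  have h2 : LinearMap.llcomp k _ _ _ (α.app Y).hom ∘ₗ genLift (fun g : X ⟶ Y => (E.map g).hom) =
      genLift (fun g : X ⟶ Y => (α.app Y).hom ∘ₗ (E.map g).hom) := gen_ext fun φ => by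
    rw [LinearMap.comp_apply, genLift_gen, genLift_gen]; rfl
  exact LinearMap.congr_fun (LinearMap.congr_fun (h1.trans (this.trans h2.symm)) ω) v

variable (k) in
/-- The universal element of level `[r (q + 1)]`, as an element of level `q` of the restriction along `[n] ↦ [rn]`. -/
def univElt (r : ℕ) [NeZero r] (q : ℕ) :
    (freeIncl k ((Lam.incl r).obj (Lam.ob r q)) r).obj (Lam.ob r q) := gen k _ (𝟙 _)

lemma perMap_univElt {r : ℕ} [NeZero r] {q : ℕ} {E : Lam 1 ⥤ ModuleCat.{u} k}
    (v : (Lam.incl r ⋙ E).obj (Lam.ob r q)) :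
    perMap (inclMap r (freeLift (E := E) v)) (Pi.single q (univElt k r q)) = Pi.single q v := by
  funext l
  rw [perMap_apply]
  rcases eq_or_ne l q with rfl | h
  · rw [Pi.single_eq_same, Pi.single_eq_same]
    refine (freeLift_gen (E := E) v (𝟙 _)).trans ?_
    rw [E.map_id]; rfl
  · rw [Pi.single_eq_of_ne h, Pi.single_eq_of_ne h, map_zero]

/-- Linear maps, natural in the cyclic vector space `E`, from sequences in the restriction of `E` along `[n] ↦ [rn]` to
level `t` of the restriction along `[n] ↦ [sn]`, that depend only on the entries of the sequence in a finite set. -/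
structure NatRow (k : Type u) [Field k] (r s : ℕ) [NeZero r] [NeZero s] (t : ℕ) (J : Finset ℕ) where
  toFun : ∀ E : Lam 1 ⥤ ModuleCat.{u} k,
    (∀ q : ℕ, (Lam.incl r ⋙ E).obj (Lam.ob r q)) →ₗ[k] (Lam.incl s ⋙ E).obj (Lam.ob s t)
  natural : ∀ {E E' : Lam 1 ⥤ ModuleCat.{u} k} (α : E ⟶ E') (x : ∀ q : ℕ, (Lam.incl r ⋙ E).obj (Lam.ob r q)),
    toFun E' (perMap (inclMap r α) x) = ((inclMap s α).app (Lam.ob s t)).hom (toFun E x)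
  supported : ∀ (E : Lam 1 ⥤ ModuleCat.{u} k) (x : ∀ q : ℕ, (Lam.incl r ⋙ E).obj (Lam.ob r q)),
    (∀ q ∈ J, x q = 0) → toFun E x = 0

variable {r s : ℕ} [NeZero r] [NeZero s]

namespace NatRow

variable {t : ℕ} {J : Finset ℕ}

lemma congr (Z : NatRow k r s t J) {E : Lam 1 ⥤ ModuleCat.{u} k}
    {x y : ∀ q : ℕ, (Lam.incl r ⋙ E).obj (Lam.ob r q)} (h : ∀ q ∈ J, x q = y q) :
    Z.toFun E x = Z.toFun E y :=
  sub_eq_zero.mp (by rw [← map_sub]; exact Z.supported E _ fun q hq => sub_eq_zero.mpr (h q hq))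

lemma apply_single (Z : NatRow k r s t J) {E : Lam 1 ⥤ ModuleCat.{u} k} {q : ℕ}
    (v : (Lam.incl r ⋙ E).obj (Lam.ob r q)) : Z.toFun E (Pi.single q v) =
      ((inclMap s (freeLift (E := E) v)).app (Lam.ob s t)).hom
        (Z.toFun (freeObj k ((Lam.incl r).obj (Lam.ob r q))) (Pi.single q (univElt k r q))) := by
  rw [← Z.natural, perMap_univElt]

lemma apply_eq_sum (Z : NatRow k r s t J) {E : Lam 1 ⥤ ModuleCat.{u} k}
    (x : ∀ q : ℕ, (Lam.incl r ⋙ E).obj (Lam.ob r q)) :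
    Z.toFun E x = ∑ q ∈ J, Z.toFun E (Pi.single q (x q)) := by
  rw [← map_sum]
  refine Z.congr fun l hl => ?_
  rw [Finset.sum_apply, Finset.sum_eq_single l, Pi.single_eq_same]
  · exact fun j _ hj => Pi.single_eq_of_ne hj.symm _
  · exact fun h => absurd hl h

/-- A natural family of elements lifts along `b` if its values on the universal elements do. -/
theorem exists_lift (Z : NatRow k r s t J) (h : ∀ q ∈ J, ∃ y, bOp (freeIncl k ((Lam.incl r).obj (Lam.ob r q)) s) t y =
      Z.toFun (freeObj k ((Lam.incl r).obj (Lam.ob r q))) (Pi.single q (univElt k r q))) :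
    ∃ Y : NatRow k r s (t + 1) J, ∀ (E : Lam 1 ⥤ ModuleCat.{u} k) x,
      bOp (Lam.incl s ⋙ E) t (Y.toFun E x) = Z.toFun E x := by
  choose! y hy using h
  refine ⟨{
    toFun := fun E => ∑ q ∈ J, freeEval E (Y := (Lam.incl s).obj (Lam.ob s (t + 1))) (y q) ∘ₗ LinearMap.proj q
    natural := fun {E E'} α x => ?_
    supported := fun E x hx => ?_ }, fun E x => ?_⟩
  · rw [LinearMap.sum_apply, LinearMap.sum_apply, map_sum]
    exact Finset.sum_congr rfl fun q _ => freeEval_app α (y q) (x q)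
  · rw [LinearMap.sum_apply]
    refine Finset.sum_eq_zero fun q hq => ?_
    rw [LinearMap.comp_apply, LinearMap.proj_apply, hx q hq]
    exact map_zero _
  · change bOp (Lam.incl s ⋙ E) t ((∑ q ∈ J, freeEval E (Y := (Lam.incl s).obj (Lam.ob s (t + 1))) (y q) ∘ₗ
      LinearMap.proj q) x) = _
    rw [LinearMap.sum_apply, map_sum, Z.apply_eq_sum]
    refine Finset.sum_congr rfl fun q hq => ?_
    rw [apply_single, ← hy q hq, ← bOp_app]
    exact congrArg _ (freeEval_apply (E := E) (y q) (x q))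

end NatRow

/-- The map on sequences given by a family of natural maps. -/
def natApp {J : ℕ → Finset ℕ} (H : ∀ t, NatRow k r s t (J t)) (E : Lam 1 ⥤ ModuleCat.{u} k) :
    (∀ q : ℕ, (Lam.incl r ⋙ E).obj (Lam.ob r q)) →ₗ[k] (∀ q : ℕ, (Lam.incl s ⋙ E).obj (Lam.ob s q)) :=
  LinearMap.pi fun t => (H t).toFun E

lemma natApp_perMap {J : ℕ → Finset ℕ} (H : ∀ t, NatRow k r s t (J t)) {E E' : Lam 1 ⥤ ModuleCat.{u} k}
    (α : E ⟶ E') (x) : natApp H E' (perMap (inclMap r α) x) = perMap (inclMap s α) (natApp H E x) :=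
  funext fun t => (H t).natural α x

/-- The rows `q ≤ t` with `q ≡ t + e` modulo `2`. -/
def rowsUpTo (e t : ℕ) : Finset ℕ := (Finset.range (t + 1)).filter fun q => Even (q + t + e)

lemma mem_rowsUpTo {e t q : ℕ} : q ∈ rowsUpTo e t ↔ q ≤ t ∧ Even (q + t + e) := by
  rw [rowsUpTo, Finset.mem_filter, Finset.mem_range, Nat.lt_succ_iff]

lemma mixD_apply_eq_zero {p : ℕ} {E : Lam p ⥤ ModuleCat.{u} k} {x : ∀ q : ℕ, E.obj (Lam.ob p q)} {q : ℕ}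
    (h : x (q + 1) = 0) (h' : ∀ l, l + 1 = q → x l = 0) : mixD E x q = 0 := by
  rw [mixD_apply, h, map_zero, zero_add]
  match q with
  | 0 => rfl
  | q + 1 => rw [shiftUp_succ, h' q rfl, map_zero]

variable {e : ℕ}

/-- The failure of `H` to satisfy `D H + ε H D = Q`, where `D` is the differential of the mixed complex. -/
def defect (ε : k) (Q : ∀ t, NatRow k r s t (rowsUpTo e (t + 1))) (H : ∀ t, NatRow k r s t (rowsUpTo e t)) (t : ℕ) :
    NatRow k r s t (rowsUpTo e (t + 1)) where
  toFun E := LinearMap.proj t ∘ₗ (mixD (Lam.incl s ⋙ E) ∘ₗ natApp H E +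
    ε • natApp H E ∘ₗ mixD (Lam.incl r ⋙ E) - natApp Q E)
  natural {E E'} α x := by
    change (mixD _ (natApp H E' _) + ε • natApp H E' (mixD _ _) - natApp Q E' _) t =
      perMap (inclMap s α) (mixD _ (natApp H E x) + ε • natApp H E (mixD _ x) - natApp Q E x) t
    rw [natApp_perMap, natApp_perMap, mixD_perMap, mixD_perMap, natApp_perMap, map_sub, map_add, map_smul]
  supported E x hx := by
    have h1 : mixD (Lam.incl s ⋙ E) (natApp H E x) t = 0 := by
      refine mixD_apply_eq_zero ((H (t + 1)).supported E x hx) fun l hl => (H l).supported E x fun q hq => hx q ?_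
      obtain ⟨h1, h2⟩ := mem_rowsUpTo.mp hq
      refine mem_rowsUpTo.mpr ⟨by omega, ?_⟩
      rw [← hl, show q + (l + 1 + 1) + e = q + l + e + 2 by ring]
      exact h2.add even_two
    have h2 : natApp H E (mixD (Lam.incl r ⋙ E) x) t = 0 := by
      refine (H t).supported E _ fun q hq => ?_
      obtain ⟨h1, h2⟩ := mem_rowsUpTo.mp hq
      refine mixD_apply_eq_zero (hx _ (mem_rowsUpTo.mpr ⟨by omega, ?_⟩)) fun l hl =>
        hx _ (mem_rowsUpTo.mpr ⟨by omega, ?_⟩)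
      · rw [show q + 1 + (t + 1) + e = q + t + e + 2 by ring]
        exact h2.add even_two
      · rw [show l + (t + 1) + e = q + t + e by omega]
        exact h2
    change mixD (Lam.incl s ⋙ E) (natApp H E x) t + ε • natApp H E (mixD (Lam.incl r ⋙ E) x) t -
      natApp Q E x t = 0
    rw [h1, h2, show natApp Q E x t = 0 from (Q t).supported E x hx, smul_zero, add_zero, sub_zero]

variable {ε : k} {Q : ∀ t, NatRow k r s t (rowsUpTo e (t + 1))} {H H' : ∀ t, NatRow k r s t (rowsUpTo e t)}

lemma defect_apply (t : ℕ) (E : Lam 1 ⥤ ModuleCat.{u} k) (x) : (defect ε Q H t).toFun E x =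
    mixD (Lam.incl s ⋙ E) (natApp H E x) t + ε • natApp H E (mixD (Lam.incl r ⋙ E) x) t - natApp Q E x t := rfl

lemma defect_congr {t : ℕ} (h : ∀ l ≤ t + 1, H l = H' l) (E : Lam 1 ⥤ ModuleCat.{u} k) (x) :
    (defect ε Q H t).toFun E x = (defect ε Q H' t).toFun E x := by
  have h0 : ∀ y, ∀ l ≤ t + 1, natApp H E y l = natApp H' E y l := fun y l hl => by
    change (H l).toFun E y = (H' l).toFun E y
    rw [h l hl]
  rw [defect_apply, defect_apply, h0 _ t (by omega), mixD_apply, mixD_apply, h0 _ _ le_rfl]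
  congr 3
  match t with
  | 0 => rfl
  | t + 1 => rw [shiftUp_succ, shiftUp_succ, h0 _ t (by omega)]

lemma natApp_defect (E : Lam 1 ⥤ ModuleCat.{u} k) (x) : natApp (defect ε Q H) E x =
    mixD (Lam.incl s ⋙ E) (natApp H E x) + ε • natApp H E (mixD (Lam.incl r ⋙ E) x) - natApp Q E x := rfl

lemma mixD_defect
    (hQ : ∀ E x, mixD (Lam.incl s ⋙ E) (natApp Q E x) = ε • natApp Q E (mixD (Lam.incl r ⋙ E) x))
    (E : Lam 1 ⥤ ModuleCat.{u} k) (x) : mixD (Lam.incl s ⋙ E) (natApp (defect ε Q H) E x) =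
      ε • natApp (defect ε Q H) E (mixD (Lam.incl r ⋙ E) x) := by
  rw [natApp_defect, natApp_defect, map_sub, map_add, mixD_mixD, map_smul, hQ, mixD_mixD, map_zero, smul_zero,
    add_zero, zero_add, smul_sub]

lemma bOp_defect
    (hQ : ∀ E x, mixD (Lam.incl s ⋙ E) (natApp Q E x) = ε • natApp Q E (mixD (Lam.incl r ⋙ E) x)) {N : ℕ}
    (hH : ∀ t ≤ N, ∀ E x, (defect ε Q H t).toFun E x = 0) (E : Lam 1 ⥤ ModuleCat.{u} k) (x) :
    bOp (Lam.incl s ⋙ E) N ((defect ε Q H (N + 1)).toFun E x) = 0 := by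
  have h := congrFun (mixD_defect hQ (H := H) E x) N
  rw [mixD_apply, Pi.smul_apply,
    show natApp (defect ε Q H) E (mixD (Lam.incl r ⋙ E) x) N = 0 from hH N le_rfl _ _, smul_zero] at h
  have h0 : shiftUp (connesOp (Lam.incl s ⋙ E)) (natApp (defect ε Q H) E x) N = 0 := by
    match N with
    | 0 => rfl
    | N + 1 =>
      rw [shiftUp_succ, show natApp (defect ε Q H) E x N = 0 from hH N (by omega) _ _, map_zero]
  rwa [h0, add_zero] at h

/-- One more value of `H` can be corrected if the obstruction vanishes on the universal elements. -/
theorem exists_defect_step {N : ℕ} (hH : ∀ t < N, ∀ E x, (defect ε Q H t).toFun E x = 0)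
    (h : ∀ q ∈ rowsUpTo e (N + 1), ∃ y, bOp (freeIncl k ((Lam.incl r).obj (Lam.ob r q)) s) N y =
      (defect ε Q H N).toFun (freeObj k ((Lam.incl r).obj (Lam.ob r q))) (Pi.single q (univElt k r q))) :
    ∃ H' : ∀ t, NatRow k r s t (rowsUpTo e t), (∀ t ≤ N, H' t = H t) ∧
      ∀ t ≤ N, ∀ E x, (defect ε Q H' t).toFun E x = 0 := by
  obtain ⟨Y, hY⟩ := (defect ε Q H N).exists_lift h
  obtain ⟨Y', hY'⟩ : ∃ Y' : NatRow k r s (N + 1) (rowsUpTo e (N + 1)),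
      ∀ E x, Y'.toFun E x = (H (N + 1)).toFun E x - Y.toFun E x := ⟨{
    toFun := fun E => (H (N + 1)).toFun E - Y.toFun E
    natural := fun α x => by
      rw [LinearMap.sub_apply, LinearMap.sub_apply, (H (N + 1)).natural, Y.natural, map_sub]
    supported := fun E x hx => by
      rw [LinearMap.sub_apply, (H (N + 1)).supported E x hx, Y.supported E x hx, sub_zero] }, fun E x => rfl⟩
  obtain ⟨H', h', hne⟩ : ∃ H' : ∀ t, NatRow k r s t (rowsUpTo e t), H' (N + 1) = Y' ∧ ∀ t, t ≠ N + 1 → H' t = H t :=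
    ⟨Function.update H (N + 1) Y', Function.update_self _ _ _, fun t ht => Function.update_of_ne ht _ _⟩
  refine ⟨H', fun t ht => hne t (by omega), fun t ht E x => ?_⟩
  have happ : ∀ l ≤ N, ∀ y, natApp H' E y l = natApp H E y l := fun l hl y => by
    change (H' l).toFun E y = (H l).toFun E y
    rw [hne l (by omega)]
  rcases ht.lt_or_eq with ht' | rfl
  · rw [defect_congr (H' := H) fun l hl => hne l (by omega)]
    exact hH t ht' E x
  · have h0 := hY E x
    have h2 : natApp H' E x (t + 1) = natApp H E x (t + 1) - Y.toFun E x := by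
      change (H' (t + 1)).toFun E x = _
      rw [h', hY']; rfl
    rw [defect_apply, mixD_apply] at h0 ⊢
    have h3 : shiftUp (connesOp (Lam.incl s ⋙ E)) (natApp H' E x) t =
        shiftUp (connesOp (Lam.incl s ⋙ E)) (natApp H E x) t := by
      match t with
      | 0 => rfl
      | t + 1 => rw [shiftUp_succ, shiftUp_succ, happ t (by omega)]
    rw [h2, map_sub, h0, h3, happ t le_rfl]
    abel

/-- The obstructions vanish from level `2` on. -/
theorem exists_defect_eq_zero
    (hQ : ∀ E x, mixD (Lam.incl s ⋙ E) (natApp Q E x) = ε • natApp Q E (mixD (Lam.incl r ⋙ E) x))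
    (hH : ∀ t < 2, ∀ E x, (defect ε Q H t).toFun E x = 0) :
    ∃ H' : ∀ t, NatRow k r s t (rowsUpTo e t), (∀ t ≤ 2, H' t = H t) ∧
      ∀ t E x, (defect ε Q H' t).toFun E x = 0 := by
  have step : ∀ N (H : {H : ∀ t, NatRow k r s t (rowsUpTo e t) //
      ∀ t < N + 2, ∀ E x, (defect ε Q H t).toFun E x = 0}),
      ∃ H' : {H : ∀ t, NatRow k r s t (rowsUpTo e t) // ∀ t < N + 1 + 2, ∀ E x, (defect ε Q H t).toFun E x = 0},
        ∀ t ≤ N + 2, H'.1 t = H.1 t := fun N H => by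
    obtain ⟨H', h1, h2⟩ := exists_defect_step H.2 fun q _ => exists_bOp_freeIncl N
      (bOp_defect hQ (fun t ht => H.2 t (by omega)) _ _)
    exact ⟨⟨H', fun t ht => h2 t (by omega)⟩, h1⟩
  choose f hf using step
  let S : ∀ N, {H : ∀ t, NatRow k r s t (rowsUpTo e t) // ∀ t < N + 2, ∀ E x, (defect ε Q H t).toFun E x = 0} :=
    fun N => Nat.rec ⟨H, hH⟩ (fun N H => f N H) N
  have hS : ∀ N M, ∀ t ≤ N + 2, (S (N + M)).1 t = (S N).1 t := by
    intro N M t ht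
    induction M with
    | zero => rfl
    | succ M ih => exact (hf (N + M) (S (N + M)) t (by omega)).trans ih
  refine ⟨fun t => (S t).1 t, fun t ht => ?_, fun t E x => ?_⟩
  · have := hS 0 t t (by omega)
    rwa [zero_add] at this
  · rw [defect_congr (H' := (S (t + 1)).1) fun l hl => ?_]
    · exact (S (t + 1)).2 t (by omega) E x
    · obtain ⟨c, hc⟩ := Nat.exists_eq_add_of_le hl
      rw [hc, hS l c l (by omega)]

end Models

/-! ### The comparison in levels `0` and `1` -/

namespace PMap

variable {n m l : ℕ} [NeZero n]

/-- The map that sends the multiples of `n` to those of `m`, and `1` to `c` and everything between `2` and `n` to `m`. -/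
def spike (n m c : ℕ) [NeZero n] : PMap n m :=
  (step n m c).sup (((PMap.id n).translate (-1)).comp (step n m m))

lemma spike_apply (c : ℕ) (x : ℤ) :
    (spike n m c).toFun x = max ((step n m c).toFun x) ((step n m m).toFun (x - 1)) := rfl

lemma spike_comp {c c' : ℕ} (hc : c ≤ m) (hc' : c' ≤ l) (d : PMap m l) (h0 : d.toFun 0 = 0)
    (h : d.toFun c = c') : (spike n m c).comp d = spike n l c' := by
  have hm : d.toFun m = l := by
    have := d.shift 0
    rwa [zero_add, h0, zero_add] at this
  rw [spike, sup_comp, step_comp hc hc' d h0 h]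
  exact congrArg (fun f => (step n l c').sup (((PMap.id n).translate (-1)).comp f))
    (step_comp le_rfl le_rfl d h0 hm)

lemma step_of_pos_le {c : ℕ} (hc : c ≤ m) (a : ℤ) {o : ℤ} (h : 0 < o) (h' : o ≤ n) (hcn : c = m) :
    (step n m c).toFun (a * n + o) = a * m + m := by
  rcases h'.lt_or_eq with h' | h'
  · rw [step_of_pos hc a h h', hcn]
  · rw [h', show a * (n : ℤ) + n = (a + 1) * n by ring, step_mul]; ring

lemma spike_mul (hn : 1 < n) (c : ℕ) (a : ℤ) : (spike n m c).toFun (a * n) = a * m := by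
  rw [spike_apply, step_mul, show a * (n : ℤ) - 1 = (a - 1) * n + (n - 1) by ring,
    step_of_pos le_rfl _ (by omega) (by omega)]
  rw [max_eq_left (by linarith)]

lemma spike_one (hn : 1 < n) {c : ℕ} (hc : c ≤ m) (a : ℤ) :
    (spike n m c).toFun (a * n + 1) = a * m + c := by
  rw [spike_apply, step_of_pos hc a one_pos (by omega), add_sub_cancel_right, step_mul]
  exact max_eq_left (by linarith [show (0 : ℤ) ≤ c by positivity])

lemma spike_of_gt {c : ℕ} (hc : c ≤ m) (a : ℤ) {o : ℤ} (h : 1 < o) (h' : o < n) :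
    (spike n m c).toFun (a * n + o) = a * m + m := by
  rw [spike_apply, step_of_pos hc a (by omega) h', add_sub_assoc,
    step_of_pos le_rfl a (by omega) (by omega)]
  exact max_eq_right (by have : (c : ℤ) ≤ m := by exact_mod_cast hc
                         linarith)

/-- The maps `spike` interpolate between the composites with the two face maps `[2] ⟶ [1]`. -/
theorem face_comp_step (r m : ℕ) [NeZero r] [NeZero (r * (1 + 1))] [NeZero (r * (0 + 1))] (i : ℕ) (hi : i ≤ 1) :
    ((face 1 i).dilate r).comp (step (r * (0 + 1)) m m) = spike (r * (1 + 1)) m (if i = 0 then 0 else m) := by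
  have hr : 0 < r := NeZero.pos r
  refine PMap.ext (funext fun x => ?_)
  obtain ⟨a, o, h0, h1, rfl⟩ := eq_mul_or (r * (1 + 1)) x
  change (step (r * (0 + 1)) m m).toFun (((face 1 i).dilate r).toFun _) = _
  have e : ((face 1 i).dilate r).toFun (a * (r * (1 + 1) : ℕ) + o) =
      a * (r * (0 + 1) : ℕ) + (face 1 i).toFun o := 
    (congrArg _ (add_comm _ _)).trans ((((face 1 i).dilate r).shift_mul o a).trans (add_comm _ _))
  obtain ⟨u, v, hv0, hv1, rfl⟩ := eq_mul_or 2 o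
  have hf := face_apply 1 i hi u v hv0 (by push_cast at hv1 ⊢; omega)
  push_cast at hf h1 hv1
  norm_num only [mul_one] at hf
  have hn : 1 < r * (1 + 1) := by omega
  have hi' : (if i = 0 then 0 else m) ≤ m := by split_ifs <;> omega
  have hu : 0 ≤ u := by omega
  simp only [Nat.cast_ofNat] at e ⊢
  rw [e, hf]
  obtain rfl | rfl : v = 0 ∨ v = 1 := by omega
  · rw [if_pos (by positivity)]
    rcases hu.lt_or_eq with hu | rfl
    · rw [spike_of_gt hi' a (by omega) (by push_cast; omega), add_zero,
        step_of_pos_le le_rfl a hu (by push_cast; omega) rfl]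
    · simp only [zero_mul, add_zero]
      rw [spike_mul hn, step_mul]
  · rcases hu.lt_or_eq with hu | rfl
    · rw [spike_of_gt hi' a (by omega) (by push_cast; omega),
        step_of_pos_le le_rfl a (by split_ifs <;> omega) (by push_cast; split_ifs <;> omega) rfl]
    · rw [zero_mul, zero_add (1 : ℤ), spike_one hn hi']
      rcases Nat.le_one_iff_eq_zero_or_eq_one.mp hi with rfl | rfl
      · rw [if_neg (by norm_num)]
        rw [sub_self, add_zero, step_mul]
        simp
      · rw [if_pos (by norm_num), step_of_pos_le le_rfl a (by omega) (by push_cast; omega) rfl]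
        simp

end PMap

section Mixed

variable {k : Type u} [Field k] {r s l : ℕ} [NeZero r] [NeZero s] [NeZero l]

/-- The action of a map `[r (q + 1)] ⟶ [s (t + 1)]` on a cyclic vector space. -/
def actOp (E : Lam 1 ⥤ ModuleCat.{u} k) {q t : ℕ} (f : PMap (r * (q + 1)) (s * (t + 1))) :
    (Lam.incl r ⋙ E).obj (Lam.ob r q) →ₗ[k] (Lam.incl s ⋙ E).obj (Lam.ob s t) :=
  (E.map (X := (Lam.incl r).obj (Lam.ob r q)) (Y := (Lam.incl s).obj (Lam.ob s t)) (Quotient.mk _ f)).hom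

lemma actOp_actOp (E : Lam 1 ⥤ ModuleCat.{u} k) {q t d : ℕ} (f : PMap (r * (q + 1)) (s * (t + 1)))
    (g : PMap (s * (t + 1)) (l * (d + 1))) (v) : actOp E g (actOp E f v) = actOp E (f.comp g) v :=
  (LinearMap.congr_fun (congrArg ModuleCat.Hom.hom (E.map_comp (X := (Lam.incl r).obj (Lam.ob r q))
    (Y := (Lam.incl s).obj (Lam.ob s t)) (Z := (Lam.incl l).obj (Lam.ob l d)) (Quotient.mk _ f)
    (Quotient.mk _ g))) v).symm

lemma actOp_app {E E' : Lam 1 ⥤ ModuleCat.{u} k} (α : E ⟶ E') {q t : ℕ}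
    (f : PMap (r * (q + 1)) (s * (t + 1))) (v) :
    actOp E' f (((inclMap r α).app (Lam.ob r q)).hom v) = ((inclMap s α).app (Lam.ob s t)).hom (actOp E f v) :=
  LinearMap.congr_fun (congrArg ModuleCat.Hom.hom (α.naturality (X := (Lam.incl r).obj (Lam.ob r q))
    (Y := (Lam.incl s).obj (Lam.ob s t)) (Quotient.mk _ f))).symm v

lemma actOp_rgen {X : Lam 1} {q t : ℕ} (f : PMap (r * (q + 1)) (s * (t + 1))) (g : PMap X.len (r * (q + 1))) :
    actOp (freeObj k X) f (rgen k X r q g) = rgen k X s t (g.comp f) :=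
  map_gen (Y := (Lam.incl r).obj (Lam.ob r q)) (Z := (Lam.incl s).obj (Lam.ob s t)) _ _

lemma bOp_incl_zero (E : Lam 1 ⥤ ModuleCat.{u} k) (v : (Lam.incl r ⋙ E).obj (Lam.ob r 1)) :
    bOp (Lam.incl r ⋙ E) 0 v = actOp E ((PMap.face 1 0).dilate r) v - actOp E ((PMap.face 1 1).dilate r) v := by
  rw [bOp, Finset.sum_range_succ, Finset.sum_range_succ, Finset.sum_range_zero]
  change 0 + (-1 : k) ^ 0 • actOp E ((PMap.face 1 0).dilate r) v +
    (-1 : k) ^ 1 • actOp E ((PMap.face 1 1).dilate r) v = _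
  generalize actOp E ((PMap.face 1 0).dilate r) v = a
  generalize actOp E ((PMap.face 1 1).dilate r) v = b
  simp [sub_eq_add_neg]

/-- The value of the comparison in level `0`. -/
def levelZero (r s : ℕ) [NeZero r] [NeZero s] (E : Lam 1 ⥤ ModuleCat.{u} k) :
    (Lam.incl r ⋙ E).obj (Lam.ob r 0) →ₗ[k] (Lam.incl s ⋙ E).obj (Lam.ob s 0) :=
  actOp E (PMap.step (r * (0 + 1)) (s * (0 + 1)) (s * (0 + 1)))

/-- The value of the comparison in level `1`. -/
def levelOne (r s : ℕ) [NeZero r] [NeZero s] (E : Lam 1 ⥤ ModuleCat.{u} k) :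
    (Lam.incl r ⋙ E).obj (Lam.ob r 1) →ₗ[k] (Lam.incl s ⋙ E).obj (Lam.ob s 1) :=
  ∑ j ∈ Finset.range s, actOp E (PMap.spike (r * (1 + 1)) (s * (1 + 1)) (2 * j + 1))

lemma levelZero_app {E E' : Lam 1 ⥤ ModuleCat.{u} k} (α : E ⟶ E') (v) :
    levelZero r s E' (((inclMap r α).app (Lam.ob r 0)).hom v) =
      ((inclMap s α).app (Lam.ob s 0)).hom (levelZero r s E v) := actOp_app α _ v

lemma levelOne_app {E E' : Lam 1 ⥤ ModuleCat.{u} k} (α : E ⟶ E') (v) :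
    levelOne r s E' (((inclMap r α).app (Lam.ob r 1)).hom v) =
      ((inclMap s α).app (Lam.ob s 1)).hom (levelOne r s E v) := by
  rw [levelOne, levelOne, LinearMap.sum_apply, LinearMap.sum_apply, map_sum]
  exact Finset.sum_congr rfl fun j _ => actOp_app α _ v

lemma bOp_levelOne (E : Lam 1 ⥤ ModuleCat.{u} k) (v : (Lam.incl r ⋙ E).obj (Lam.ob r 1)) :
    bOp (Lam.incl s ⋙ E) 0 (levelOne r s E v) = levelZero r s E (bOp (Lam.incl r ⋙ E) 0 v) := by
  have hL : ∀ j ∈ Finset.range s, bOp (Lam.incl s ⋙ E) 0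
      (actOp E (PMap.spike (r * (1 + 1)) (s * (1 + 1)) (2 * j + 1)) v) =
      actOp E (PMap.spike (r * (1 + 1)) (s * (0 + 1)) j) v -
      actOp E (PMap.spike (r * (1 + 1)) (s * (0 + 1)) (j + 1)) v := fun j hj => by
    have hj' := Finset.mem_range.mp hj
    have hf := fun i (hi : i ≤ 1) => PMap.face_mul_add 1 i j 1 hi (by norm_num)
    rw [bOp_incl_zero, actOp_actOp, actOp_actOp]
    congr 3
    · refine PMap.spike_comp (by omega) (by omega) _ (PMap.face_dilate_zero 0 0 (by omega)) ?_
      have := hf 0 (by omega)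
      rw [if_neg (by omega)] at this
      rw [show 2 * j + 1 = j * (1 + 1) + 1 by ring]
      exact this.trans (by push_cast; ring)
    · refine PMap.spike_comp (by omega) (by omega) _ (PMap.face_dilate_zero 0 1 (by omega)) ?_
      have := hf 1 le_rfl
      rw [if_pos (by omega)] at this
      rw [show 2 * j + 1 = j * (1 + 1) + 1 by ring]
      exact this.trans (by push_cast; ring)
  rw [levelOne, LinearMap.sum_apply, map_sum, Finset.sum_congr rfl hL, Finset.sum_range_sub', bOp_incl_zero, map_sub,
    levelZero, actOp_actOp, actOp_actOp, PMap.face_comp_step r _ 0 (by omega), PMap.face_comp_step r _ 1 le_rfl,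
    if_pos rfl, if_neg one_ne_zero]
  congr 3
  rw [zero_add, mul_one]

lemma rgenAug_levelZero {X : Lam 1} (x : (freeIncl k X r).obj (Lam.ob r 0)) :
    rgenAug k X s 0 (levelZero r s (freeObj k X) x) = rgenAug k X r 0 x := by
  have : rgenAug k X s 0 ∘ₗ levelZero r s (freeObj k X) = rgenAug k X r 0 := rgen_ext fun g => by
    rw [LinearMap.comp_apply, levelZero, actOp_rgen, rgenAug_rgen, rgenAug_rgen]
  exact LinearMap.congr_fun this x

/-- The value in level `1` preserves winding numbers, which makes it compatible with Connes' operator up to boundaries. -/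
theorem windCocycle_levelOne {X : Lam 1} (x : (freeIncl k X r).obj (Lam.ob r 1)) :
    windCocycle k X s (levelOne r s (freeObj k X) x) = windCocycle k X r x := by
  have : windCocycle k X s ∘ₗ levelOne r s (freeObj k X) = windCocycle k X r := rgen_ext fun g => by
    rw [LinearMap.comp_apply, levelOne, LinearMap.sum_apply, map_sum]
    simp only [actOp_rgen, windCocycle_rgen]
    change (∑ j ∈ Finset.range s, if ((((PMap.spike (r * (1 + 1)) (s * (1 + 1)) (2 * j + 1)).toFun (g.toFun 0)) : ℤ) :
      ZMod (s * 2)) = 1 then (1 : k) else 0) = _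
    obtain ⟨a, o, h0, h1, hg⟩ := PMap.eq_mul_or (r * (1 + 1)) (g.toFun 0)
    have hn : 1 < r * (1 + 1) := by have := NeZero.pos r; omega
    have hg' : ((g.toFun 0 : ℤ) : ZMod (r * 2)) = (o : ZMod (r * 2)) := by
      rw [hg, Int.cast_add, Int.cast_mul, Int.cast_natCast, show r * (1 + 1) = r * 2 by ring, ZMod.natCast_self,
        mul_zero, zero_add]
    have hs : ∀ c : ℤ, ((a * (s * (1 + 1) : ℕ) + c : ℤ) : ZMod (s * 2)) = c := fun c => by
      rw [Int.cast_add, Int.cast_mul, Int.cast_natCast, show s * (1 + 1) = s * 2 by ring, ZMod.natCast_self,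
        mul_zero, zero_add]
    have hnot : ∀ (m : ℕ) [NeZero m] (c : ℤ), 0 ≤ c → c < m * 2 → (c : ZMod (m * 2)) = 1 → c = 1 := by
      intro m _ c hc hc' h
      rw [← Int.cast_one, ZMod.intCast_eq_intCast_iff] at h
      have hm := NeZero.pos m
      have h : c % ((m * 2 : ℕ) : ℤ) = 1 % ((m * 2 : ℕ) : ℤ) := h
      rw [Int.emod_eq_of_lt hc (by push_cast; exact hc'), Int.emod_eq_of_lt (by norm_num) (by push_cast; omega)] at h
      exact h
    rw [hg', hg]
    rcases (show o = 0 ∨ o = 1 ∨ 1 < o by omega) with rfl | rfl | ho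
    · rw [if_neg (fun h => by have := hnot r 0 le_rfl (by omega) h; omega)]
      refine Finset.sum_eq_zero fun j _ => if_neg fun h => ?_
      rw [add_zero, PMap.spike_mul hn, ← add_zero (a * _), hs] at h
      have := hnot s 0 le_rfl (by have := NeZero.pos s; omega) h
      omega
    · rw [Int.cast_one, if_pos rfl, Finset.sum_eq_single 0]
      · rw [if_pos]
        rw [PMap.spike_one hn (by have := NeZero.pos s; omega), hs]
        simp
      · intro j hj hne
        refine if_neg fun h => ?_
        have hj' := Finset.mem_range.mp hj
        rw [PMap.spike_one hn (by omega), hs] at h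
        have := hnot s _ (by positivity) (by push_cast; omega) h
        push_cast at this
        omega
      · exact fun h => absurd (Finset.mem_range.mpr (NeZero.pos s)) h
    · rw [if_neg (fun h => by have := hnot r o h0 (by push_cast at h1; omega) h; omega)]
      refine Finset.sum_eq_zero fun j hj => if_neg fun h => ?_
      have hj' := Finset.mem_range.mp hj
      rw [PMap.spike_of_gt (by omega) a ho h1, hs] at h
      refine intCast_two_mul_ne_one (r := s) s ?_
      rw [← h]; push_cast; ring_nf
  exact LinearMap.congr_fun this x

end Mixed

section Models

variable {k : Type u} [Field k] {r s : ℕ} [NeZero r] [NeZero s]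

instance (t : ℕ) (J : Finset ℕ) : Zero (NatRow k r s t J) where
  zero :=
    { toFun := fun _ => 0
      natural := fun _ _ => (map_zero _).symm
      supported := fun _ _ _ => rfl }

/-- The values of the comparison in levels `0` and `1`, continued by zero. -/
def initialRows (k : Type u) [Field k] (r s : ℕ) [NeZero r] [NeZero s] : ∀ t, NatRow k r s t (rowsUpTo 0 t)
  | 0 =>
    { toFun := fun E => levelZero r s E ∘ₗ LinearMap.proj 0
      natural := fun α x => levelZero_app α (x 0)
      supported := fun E x hx => by
        rw [LinearMap.comp_apply, LinearMap.proj_apply, hx 0 (mem_rowsUpTo.mpr ⟨le_rfl, Even.zero⟩), map_zero] }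
  | 1 =>
    { toFun := fun E => levelOne r s E ∘ₗ LinearMap.proj 1
      natural := fun α x => levelOne_app α (x 1)
      supported := fun E x hx => by
        rw [LinearMap.comp_apply, LinearMap.proj_apply, hx 1 (mem_rowsUpTo.mpr ⟨le_rfl, even_two⟩), map_zero] }
  | _ + 2 => 0

/-- There is a natural morphism of mixed complexes from the one of the restriction along `[n] ↦ [rn]` to the one of the
restriction along `[n] ↦ [sn]` that induces the identity on cyclic homology of degree `0`. -/
theorem exists_mixedMap : ∃ R : ∀ t, NatRow k r s t (rowsUpTo 0 t),
    (∀ E x, mixD (Lam.incl s ⋙ E) (natApp R E x) = natApp R E (mixD (Lam.incl r ⋙ E) x)) ∧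
      ∀ E x, natApp R E x 0 = levelZero r s E (x 0) := by
  let Q : ∀ t, NatRow k r s t (rowsUpTo 0 (t + 1)) := fun _ => 0
  have hQ : ∀ E x, mixD (Lam.incl s ⋙ E) (natApp Q E x) = (-1 : k) • natApp Q E (mixD (Lam.incl r ⋙ E) x) :=
    fun E x => (map_zero (mixD (Lam.incl s ⋙ E))).trans (smul_zero _).symm
  have hd : ∀ (H : ∀ t, NatRow k r s t (rowsUpTo 0 t)) t E x, (defect (-1 : k) Q H t).toFun E x =
      mixD (Lam.incl s ⋙ E) (natApp H E x) t - natApp H E (mixD (Lam.incl r ⋙ E) x) t := fun H t E x => by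
    rw [defect_apply, neg_one_smul, ← sub_eq_add_neg]
    exact sub_zero _
  have h0 : ∀ t < 1, ∀ E x, (defect (-1 : k) Q (initialRows k r s) t).toFun E x = 0 := fun t ht E x => by
    obtain rfl : t = 0 := by omega
    rw [hd, mixD_apply, shiftUp_zero, add_zero]
    refine sub_eq_zero.mpr ((bOp_levelOne E (x 1)).trans (congrArg (levelZero r s E)
      (show _ = mixD (Lam.incl r ⋙ E) x 0 from ?_)))
    rw [mixD_apply, shiftUp_zero, add_zero]
  obtain ⟨H, h1, h2⟩ := exists_defect_step h0 fun q _ => by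
    obtain ⟨x, hx⟩ : ∃ x : ∀ l : ℕ, (freeIncl k ((Lam.incl r).obj (Lam.ob r q)) r).obj (Lam.ob r l),
      Pi.single q (univElt k r q) = x := ⟨_, rfl⟩
    rw [hx]
    have hw : windCocycle k _ s ((defect (-1) Q (initialRows k r s) 1).toFun _ x) = 0 := by
      have e1 : windCocycle k _ s (connesOp _ 0 (levelZero r s _ (x 0))) = rgenAug k _ r 0 (x 0) := by
        rw [windCocycle_connesOp, rgenAug_levelZero]
      have e2 : windCocycle k _ s (levelOne r s _ (mixD (Lam.incl r ⋙ _) x 1)) = rgenAug k _ r 0 (x 0) := by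
        rw [windCocycle_levelOne, mixD_apply, map_add, windCocycle_bOp, shiftUp_succ, windCocycle_connesOp, zero_add]
      rw [hd, mixD_apply]
      change windCocycle k _ s (bOp _ 1 0 + connesOp _ 0 (levelZero r s _ (x 0)) -
        levelOne r s _ (mixD _ x 1)) = 0
      rw [map_sub, map_add, e1, e2, map_zero, map_zero]
      ring
    obtain ⟨y, hy⟩ : ∃ y, bOp (freeIncl k ((Lam.incl r).obj (Lam.ob r q)) s) 1 y =
        (defect (-1) Q (initialRows k r s) 1).toFun _ x - windCocycle k _ s
          ((defect (-1) Q (initialRows k r s) 1).toFun _ x) • connesOp _ 0 (baseGen k _ s) :=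
      exists_bOp_freeIncl_one (bOp_defect hQ (fun t ht => h0 t (by omega)) _ x)
    exact ⟨y, by rw [hy, hw, zero_smul, sub_zero]⟩
  obtain ⟨R, h3, h4⟩ := exists_defect_eq_zero hQ (fun t ht => h2 t (by omega))
  refine ⟨R, fun E x => funext fun t => ?_, fun E x => ?_⟩
  · exact sub_eq_zero.mp ((hd R t E x).symm.trans (h4 t E x))
  · change (R 0).toFun E x = _
    rw [h3 0 (by omega), h1 0 (by omega)]
    rfl

lemma rgenAug_univElt (q : ℕ) : rgenAug k _ r q (univElt k r q) = 1 :=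
  freeAug_gen (X := (Lam.incl r).obj (Lam.ob r q)) (𝟙 _)

lemma rgenAug_inclMap_freeLift {X Y : Lam 1} (v : (freeObj k X).obj Y) {t : ℕ}
    (x : (freeIncl k Y s).obj (Lam.ob s t)) :
    rgenAug k X s t (((inclMap s (freeLift v)).app (Lam.ob s t)).hom x) = freeAug k X Y v * rgenAug k Y s t x := by
  have : rgenAug k X s t ∘ₗ ((inclMap s (freeLift v)).app (Lam.ob s t)).hom =
      freeAug k X Y v • rgenAug k Y s t := rgen_ext fun f => by
    rw [LinearMap.comp_apply, LinearMap.smul_apply, rgenAug_rgen, smul_eq_mul, mul_one]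
    exact (congrArg _ (freeLift_gen v _)).trans (freeAug_map _ v)
  exact LinearMap.congr_fun this x

/-- A natural morphism of mixed complexes is determined up to a natural homotopy by its effect on cyclic homology of
degree `0`. -/
theorem exists_mixedHtpy {R R' : ∀ t, NatRow k r s t (rowsUpTo 0 t)}
    (hR : ∀ E x, mixD (Lam.incl s ⋙ E) (natApp R E x) = natApp R E (mixD (Lam.incl r ⋙ E) x))
    (hR' : ∀ E x, mixD (Lam.incl s ⋙ E) (natApp R' E x) = natApp R' E (mixD (Lam.incl r ⋙ E) x))
    (h0 : ∀ X x, rgenAug k X s 0 (natApp R (freeObj k X) x 0) = rgenAug k X s 0 (natApp R' (freeObj k X) x 0)) :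
    ∃ H : ∀ t, NatRow k r s t (rowsUpTo 1 t), ∀ E x, mixD (Lam.incl s ⋙ E) (natApp H E x) +
      natApp H E (mixD (Lam.incl r ⋙ E) x) = natApp R E x - natApp R' E x := by
  let Q : ∀ t, NatRow k r s t (rowsUpTo 1 (t + 1)) := fun t =>
    { toFun := fun E => (R t).toFun E - (R' t).toFun E
      natural := fun α x => by
        rw [LinearMap.sub_apply, LinearMap.sub_apply, (R t).natural, (R' t).natural, map_sub]
      supported := fun E x hx => by
        have hx' : ∀ q ∈ rowsUpTo 0 t, x q = 0 := fun q hq => hx q (by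
          obtain ⟨h1, h2⟩ := mem_rowsUpTo.mp hq
          refine mem_rowsUpTo.mpr ⟨by omega, ?_⟩
          rw [show q + (t + 1) + 1 = q + t + 0 + 2 by ring]
          exact h2.add even_two)
        rw [LinearMap.sub_apply, (R t).supported E x hx', (R' t).supported E x hx', sub_zero] }
  have hQa : ∀ E x, natApp Q E x = natApp R E x - natApp R' E x := fun E x => rfl
  have hQ : ∀ E x, mixD (Lam.incl s ⋙ E) (natApp Q E x) = (1 : k) • natApp Q E (mixD (Lam.incl r ⋙ E) x) :=
    fun E x => by rw [hQa, hQa, map_sub, hR, hR', one_smul]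
  obtain ⟨H, -, hH⟩ := exists_defect_step (ε := (1 : k)) (Q := Q) (N := 0) (H := fun _ => 0)
    (fun t ht => absurd ht (by omega)) fun q _ => by
      refine exists_bOp_freeIncl_zero ?_
      rw [defect_apply, map_sub, hQa, Pi.sub_apply, map_sub, h0, sub_self, sub_zero, map_add, map_smul]
      have e1 : ∀ E x, natApp (J := rowsUpTo 1) (fun t => (0 : NatRow k r s t (rowsUpTo 1 t))) E x = 0 :=
        fun E x => rfl
      rw [e1, e1, map_zero]
      simp
  obtain ⟨H, -, hH⟩ := exists_defect_step (N := 1) (fun t ht => hH t (by omega)) fun q hq => by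
    obtain rfl : q = 1 := by
      obtain ⟨h1, h2⟩ := mem_rowsUpTo.mp hq
      interval_cases q
      · exact absurd h2 (by decide)
      · rfl
      · exact absurd h2 (by decide)
    obtain ⟨y, hy⟩ : ∃ y, bOp (freeIncl k ((Lam.incl r).obj (Lam.ob r 1)) s) 1 y =
        (defect 1 Q H 1).toFun _ (Pi.single 1 (univElt k r 1)) - windCocycle k _ s
          ((defect 1 Q H 1).toFun _ (Pi.single 1 (univElt k r 1))) • connesOp _ 0 (baseGen k _ s) :=
      exists_bOp_freeIncl_one (bOp_defect hQ hH _ (Pi.single 1 (univElt k r 1)))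
    obtain ⟨w, hw⟩ : ∃ w, windCocycle k _ s ((defect 1 Q H 1).toFun _ (Pi.single 1 (univElt k r 1))) = w := ⟨_, rfl⟩
    rw [hw] at hy
    -- the obstruction is multiplied by the alternating sum of three ones along `b` from level `2` to level `1`
    have hw0 : w = 0 := by
      obtain ⟨x, hx⟩ : ∃ x : ∀ l : ℕ, (freeIncl k ((Lam.incl r).obj (Lam.ob r 2)) r).obj (Lam.ob r l),
        Pi.single 2 (univElt k r 2) = x := ⟨_, rfl⟩
      have hx2 : x 2 = univElt k r 2 := by rw [← hx, Pi.single_eq_same]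
      have h1 := congrFun (mixD_defect hQ (H := H) _ x) 1
      rw [mixD_apply, shiftUp_succ, one_smul,
        show natApp (defect 1 Q H) _ x 0 = 0 from hH 0 le_rfl _ _, map_zero, add_zero] at h1
      have h2 := congrArg (windCocycle k _ s) h1
      rw [windCocycle_bOp] at h2
      have h3 : natApp (defect 1 Q H) _ (mixD _ x) 1 = (defect 1 Q H 1).toFun _
          (Pi.single 1 (bOp (freeIncl k ((Lam.incl r).obj (Lam.ob r 2)) r) 1 (univElt k r 2))) := by
        refine (defect 1 Q H 1).congr fun l hl => ?_
        obtain rfl : l = 1 := by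
          obtain ⟨h1, h2⟩ := mem_rowsUpTo.mp hl
          interval_cases l
          · exact absurd h2 (by decide)
          · rfl
          · exact absurd h2 (by decide)
        rw [Pi.single_eq_same, mixD_apply, hx2, shiftUp_succ, ← hx, Pi.single_eq_of_ne (by norm_num), map_zero,
          add_zero]
      rw [h3, NatRow.apply_single, ← sub_add_cancel ((defect 1 Q H 1).toFun _ (Pi.single 1 (univElt k r 1)))
        (w • connesOp _ 0 (baseGen k _ s)), ← hy, map_add, ← bOp_app, map_add, windCocycle_bOp, zero_add, map_smul,
        map_smul, ← connesOp_app, windCocycle_connesOp, rgenAug_inclMap_freeLift, rgenAug_baseGen, mul_one] at h2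
      have h4 := rgenAug_bOp (k := k) 1 (univElt k r 2)
      rw [rgenAug_univElt, Finset.sum_range_succ, Finset.sum_range_succ, Finset.sum_range_succ,
        Finset.sum_range_zero] at h4
      norm_num at h4
      rw [show freeAug k _ _ _ = (1 : k) from h4, smul_eq_mul, mul_one] at h2
      exact h2.symm
    exact ⟨y, by rw [hy, hw0, zero_smul, sub_zero]⟩
  obtain ⟨H, -, hH⟩ := exists_defect_eq_zero hQ (fun t ht => hH t (by omega))
  refine ⟨H, fun E x => funext fun t => ?_⟩
  have := hH t E x
  rw [defect_apply, one_smul, hQa] at this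
  exact sub_eq_zero.mp this

end Models

/-! ### Comparison maps -/

section Parity

variable {k : Type u} [Field k] {p : ℕ} {E : Lam p ⥤ ModuleCat.{u} k} {n m : ℤ}

lemma even_sub_iff_of_even (h : Even (n - m)) (q : ℕ) : Even (n - q) ↔ Even (m - q) := by
  rw [show n - (q : ℤ) = (n - m) + (m - q) by ring, Int.even_add]; simp [h]

lemma fromMixed_congr_degree (h : Even (n - m)) : fromMixed E n = fromMixed E m := by
  refine LinearMap.ext fun x => funext fun q => ?_
  by_cases e : Even (n - q)
  · rw [fromMixed_even E _ e, fromMixed_even E _ ((even_sub_iff_of_even h q).mp e)]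
  · rw [fromMixed_odd E _ e, fromMixed_odd E _ (fun h' => e ((even_sub_iff_of_even h q).mpr h'))]

lemma toMixed_congr_degree (h : Even (n - m)) : toMixed E n = toMixed E m := by
  refine LinearMap.ext fun x => funext fun q => ?_
  by_cases e : Even (n - q)
  · rw [toMixed_even E _ e, toMixed_even E _ ((even_sub_iff_of_even h q).mp e)]
  · rw [toMixed_odd E _ e, toMixed_odd E _ (fun h' => e ((even_sub_iff_of_even h q).mpr h'))]

lemma fromMixed_congr {x y : ∀ q : ℕ, E.obj (Lam.ob p q)} (h : ∀ q : ℕ, Even (n - q) → x q = y q) :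
    fromMixed E n x = fromMixed E n y := by
  funext q
  by_cases e : Even (n - q)
  · rw [fromMixed_even E _ e, fromMixed_even E _ e, h q e]
  · rw [fromMixed_odd E _ e, fromMixed_odd E _ e]
    match q with
    | 0 => rfl
    | q + 1 => rw [shiftUp_succ, shiftUp_succ, h q (not_not.mp fun h' => e (even_sub_succ.mpr h'))]

lemma fromMixed_apply_eq_zero {x : ∀ q : ℕ, E.obj (Lam.ob p q)} {t : ℕ} (h : ∀ q ≤ t, x q = 0) :
    fromMixed E n x t = 0 := by
  by_cases e : Even (n - t)
  · rw [fromMixed_even E _ e, h t le_rfl]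
  · rw [fromMixed_odd E _ e]
    match t with
    | 0 => rfl
    | t + 1 => rw [shiftUp_succ, h t (by omega), map_zero]

lemma toMixed_apply_eq_zero {x : ∀ q : ℕ, E.obj (Lam.ob p q)} {t : ℕ} (h : ∀ q ≤ t, x q = 0) :
    toMixed E n x t = 0 := by
  by_cases e : Even (n - t)
  · rw [toMixed_even E _ e, h t le_rfl, zero_add]
    match t with
    | 0 => rfl
    | t + 1 => rw [shiftUp_succ, h t (by omega), map_zero]
  · rw [toMixed_odd E _ e]

end Parity

section Periodic

/-- Chain maps, natural in the cyclic vector space `E`, from the periodic complex of the restriction of `E` along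
`[n] ↦ [rn]` to the one of the restriction along `[n] ↦ [sn]`. They are compatible with periodicity and with the part in
negative columns, and on cyclic homology of degree `0` they are compatible with the maps to the colimit of `E`; this is
expressed on free objects, where the colimit is given by the augmentation. -/
structure NatPer (k : Type u) [Field k] (r s : ℕ) [NeZero r] [NeZero s] where
  toFun : ∀ (E : Lam 1 ⥤ ModuleCat.{u} k) (_ : ℤ),
    (∀ q : ℕ, (Lam.incl r ⋙ E).obj (Lam.ob r q)) →ₗ[k] (∀ q : ℕ, (Lam.incl s ⋙ E).obj (Lam.ob s q))
  natural : ∀ {E E' : Lam 1 ⥤ ModuleCat.{u} k} (α : E ⟶ E') (n : ℤ) (x : ∀ q : ℕ, (Lam.incl r ⋙ E).obj (Lam.ob r q)),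
    toFun E' n (perMap (inclMap r α) x) = perMap (inclMap s α) (toFun E n x)
  comm : ∀ (E : Lam 1 ⥤ ModuleCat.{u} k) (n : ℤ) (x : ∀ q : ℕ, (Lam.incl r ⋙ E).obj (Lam.ob r q)),
    perD (Lam.incl s ⋙ E) n (toFun E (n + 1) x) = toFun E n (perD (Lam.incl r ⋙ E) n x)
  periodic : ∀ (E : Lam 1 ⥤ ModuleCat.{u} k) (n : ℤ), toFun E (n - 2) = toFun E n
  filtered : ∀ (E : Lam 1 ⥤ ModuleCat.{u} k) (n : ℤ) (x : ∀ q : ℕ, (Lam.incl r ⋙ E).obj (Lam.ob r q)),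
    (∀ q : ℕ, (q : ℤ) ≤ n → x q = 0) → ∀ q : ℕ, (q : ℤ) ≤ n → toFun E n x q = 0
  augmented : ∀ (X : Lam 1) (x : (freeIncl k X r).obj (Lam.ob r 0)),
    rgenAug k X s 0 (toFun (freeObj k X) 0 (Pi.single 0 x) 0) = rgenAug k X r 0 x

variable {k : Type u} [Field k] {r s l : ℕ} [NeZero r] [NeZero s] [NeZero l]

namespace NatPer

lemma congr_degree (c : NatPer k r s) (E : Lam 1 ⥤ ModuleCat.{u} k) {n m : ℤ} (h : Even (n - m)) :
    c.toFun E n = c.toFun E m := by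
  obtain ⟨d, hd⟩ := h
  obtain rfl : n = m + 2 * d := by omega
  clear hd
  induction d using Int.induction_on with
  | zero => simp
  | succ d ih => rw [← ih, ← c.periodic E]; congr 2; ring
  | pred d ih => 
    rw [← ih, ← c.periodic E (m + 2 * -(d : ℤ)), show m + 2 * (-(d : ℤ) - 1) = m + 2 * -(d : ℤ) - 2 by ring]

lemma augmented_apply (c : NatPer k r s) {X : Lam 1} (x : ∀ q : ℕ, (freeIncl k X r).obj (Lam.ob r q)) :
    rgenAug k X s 0 (c.toFun (freeObj k X) 0 x 0) = rgenAug k X r 0 (x 0) := by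
  rw [← c.augmented X (x 0), ← sub_eq_zero, ← map_sub, ← Pi.sub_apply, ← map_sub]
  rw [c.filtered _ 0 _ (fun q hq => ?_) 0 le_rfl, map_zero]
  obtain rfl : q = 0 := by omega
  rw [Pi.sub_apply, Pi.single_eq_same, sub_self]

/-- The identity. -/
protected def id (k : Type u) [Field k] (r : ℕ) [NeZero r] : NatPer k r r where
  toFun _ _ := LinearMap.id
  natural _ _ _ := rfl
  comm _ _ _ := rfl
  periodic _ _ := rfl
  filtered _ _ _ h := h
  augmented X x := by rw [LinearMap.id_apply, Pi.single_eq_same]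

/-- The composite, first `c`, then `d`. -/
protected def comp (c : NatPer k r s) (d : NatPer k s l) : NatPer k r l where
  toFun E n := d.toFun E n ∘ₗ c.toFun E n
  natural α n x := by
    rw [LinearMap.comp_apply, c.natural, d.natural]; rfl
  comm E n x := by
    rw [LinearMap.comp_apply, d.comm, c.comm]; rfl
  periodic E n := by rw [c.periodic, d.periodic]
  filtered E n x h := d.filtered E n _ (c.filtered E n x h)
  augmented X x := by rw [LinearMap.comp_apply, d.augmented_apply, c.augmented]

/-- The natural morphism of mixed complexes induced by a natural morphism of periodic complexes. -/
def toMixedMap (c : NatPer k r s) (t : ℕ) : NatRow k r s t (rowsUpTo 0 t) where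
  toFun E := LinearMap.proj t ∘ₗ toMixed (Lam.incl s ⋙ E) t ∘ₗ c.toFun E t ∘ₗ fromMixed (Lam.incl r ⋙ E) t
  natural {E E'} α x := by
    change toMixed (Lam.incl s ⋙ E') t (c.toFun E' t (fromMixed (Lam.incl r ⋙ E') t _)) t =
      perMap (inclMap s α) (toMixed (Lam.incl s ⋙ E) t (c.toFun E t (fromMixed (Lam.incl r ⋙ E) t x))) t
    rw [fromMixed_perMap, c.natural, toMixed_perMap]
  supported E x hx := by
    refine toMixed_apply_eq_zero fun q hq => ?_
    have h0 : fromMixed (Lam.incl r ⋙ E) t x =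
        fromMixed (Lam.incl r ⋙ E) t (fun l => if l ≤ t then 0 else x l) := fromMixed_congr fun l hl => by
      split_ifs with h
      · refine hx l (mem_rowsUpTo.mpr ⟨h, ?_⟩)
        have := hl.add (even_two_mul (l : ℤ))
        rw [show (t : ℤ) - l + 2 * l = ((l + t + 0 : ℕ) : ℤ) by push_cast; ring] at this
        exact_mod_cast this
      · rfl
    change c.toFun E t (fromMixed (Lam.incl r ⋙ E) t x) q = 0
    rw [h0]
    exact c.filtered E t _ (fun l hl => fromMixed_apply_eq_zero fun l' hl' => if_pos (by omega)) q (by omega)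

lemma natApp_toMixedMap (c : NatPer k r s) {E : Lam 1 ⥤ ModuleCat.{u} k} (x) {n : ℤ} {t : ℕ} (h : Even (n - t)) :
    natApp c.toMixedMap E x t =
      toMixed (Lam.incl s ⋙ E) n (c.toFun E n (fromMixed (Lam.incl r ⋙ E) n x)) t := by
  rw [toMixed_congr_degree h, c.congr_degree E h, fromMixed_congr_degree h]
  rfl

lemma mixD_toMixedMap (c : NatPer k r s) (E : Lam 1 ⥤ ModuleCat.{u} k) (x) :
    mixD (Lam.incl s ⋙ E) (natApp c.toMixedMap E x) = natApp c.toMixedMap E (mixD (Lam.incl r ⋙ E) x) := by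
  funext t
  have h : mixD (Lam.incl s ⋙ E) (natApp c.toMixedMap E x) t = mixD (Lam.incl s ⋙ E)
      (toMixed (Lam.incl s ⋙ E) (t + 1) (c.toFun E (t + 1) (fromMixed (Lam.incl r ⋙ E) (t + 1) x))) t := by
    rw [mixD_apply, mixD_apply, natApp_toMixedMap c x (n := t + 1) (by simp)]
    congr 1
    match t with
    | 0 => rfl
    | t + 1 =>
      rw [shiftUp_succ, shiftUp_succ, natApp_toMixedMap c x (n := (t + 1 : ℕ) + 1) ⟨1, by push_cast; ring⟩]
  rw [h, mixD_toMixed, c.comm, perD_fromMixed, natApp_toMixedMap c _ (n := t) (by simp)]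

lemma toMixed_comp_fromMixed (c : NatPer k r s) {E : Lam 1 ⥤ ModuleCat.{u} k} (n : ℤ) (x) :
    fromMixed (Lam.incl s ⋙ E) n (toMixed (Lam.incl s ⋙ E) n (c.toFun E n (fromMixed (Lam.incl r ⋙ E) n x))) =
      fromMixed (Lam.incl s ⋙ E) n (natApp c.toMixedMap E x) :=
  fromMixed_congr fun _ hq => (natApp_toMixedMap c x hq).symm

/-- On cycles, a natural morphism of periodic complexes is homologous to one through the mixed complexes. -/
theorem exists_homologous_mixed (c : NatPer k r s) {E : Lam 1 ⥤ ModuleCat.{u} k} {n : ℤ} {x}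
    (hx : perD (Lam.incl r ⋙ E) n x = 0) : ∃ y, perD (Lam.incl s ⋙ E) (n + 1) y = c.toFun E (n + 1) x -
      fromMixed (Lam.incl s ⋙ E) (n + 1) (natApp c.toMixedMap E (toMixed (Lam.incl r ⋙ E) (n + 1) x)) := by
  obtain ⟨z, hz⟩ : ∃ z, toMixed (Lam.incl r ⋙ E) (n + 1) x = z := ⟨_, rfl⟩
  have h1 := fromMixed_toMixed (Lam.incl r ⋙ E) x n
  rw [hx, map_zero, add_zero, hz] at h1
  have hz0 : perD (Lam.incl r ⋙ E) n (fromMixed (Lam.incl r ⋙ E) (n + 1) z) = 0 := by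
    rw [perD_fromMixed, ← hz, mixD_toMixed, hx, map_zero, map_zero]
  have h2 := fromMixed_toMixed (Lam.incl s ⋙ E) (c.toFun E (n + 1) (fromMixed (Lam.incl r ⋙ E) (n + 1) z)) n
  rw [c.comm, hz0, map_zero, map_zero, add_zero, toMixed_comp_fromMixed] at h2
  refine ⟨mixHtpy (Lam.incl s ⋙ E) (n + 1) (c.toFun E (n + 1) (fromMixed (Lam.incl r ⋙ E) (n + 1) z)) +
    c.toFun E (n + 1 + 1) (mixHtpy (Lam.incl r ⋙ E) (n + 1) x), ?_⟩
  have h3 := congrArg (c.toFun E (n + 1)) h1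
  rw [map_add] at h3
  rw [map_add, c.comm, hz, h3, eq_sub_of_add_eq' h2.symm]
  abel

/-- Two natural morphisms of periodic complexes agree on homology. -/
theorem exists_homologous (c c' : NatPer k r s) {E : Lam 1 ⥤ ModuleCat.{u} k} {n : ℤ} {x}
    (hx : perD (Lam.incl r ⋙ E) n x = 0) :
    ∃ y, perD (Lam.incl s ⋙ E) (n + 1) y = c.toFun E (n + 1) x - c'.toFun E (n + 1) x := by
  have haug : ∀ (c : NatPer k r s) X x, rgenAug k X s 0 (natApp c.toMixedMap (freeObj k X) x 0) =
      rgenAug k X r 0 (x 0) := fun c X x => by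
    rw [natApp_toMixedMap c x (n := 0) (by simp), toMixed_even _ _ (by simp), shiftUp_zero, add_zero,
      c.augmented_apply, fromMixed_even _ _ (by simp)]
  obtain ⟨H, hH⟩ := exists_mixedHtpy c.mixD_toMixedMap c'.mixD_toMixedMap
    (fun X x => (haug c X x).trans (haug c' X x).symm)
  obtain ⟨y, hy⟩ := c.exists_homologous_mixed hx
  obtain ⟨y', hy'⟩ := c'.exists_homologous_mixed hx
  have h := hH E (toMixed (Lam.incl r ⋙ E) (n + 1) x)
  rw [mixD_toMixed, hx, map_zero, map_zero, add_zero] at h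
  refine ⟨y - y' + fromMixed (Lam.incl s ⋙ E) (n + 1 + 1)
    (natApp H E (toMixed (Lam.incl r ⋙ E) (n + 1) x)), ?_⟩
  rw [map_add, map_sub, hy, hy', perD_fromMixed, h, map_sub]
  abel

end NatPer

/-- The natural map of mixed complexes, conjugated by the homotopy equivalence with the periodic complexes. -/
theorem exists_natPer (k : Type u) [Field k] (r s : ℕ) [NeZero r] [NeZero s] : Nonempty (NatPer k r s) := by
  obtain ⟨R, h1, h2⟩ := exists_mixedMap (k := k) (r := r) (s := s)
  exact ⟨{
    toFun := fun E n => fromMixed (Lam.incl s ⋙ E) n ∘ₗ natApp R E ∘ₗ toMixed (Lam.incl r ⋙ E) n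
    natural := fun {E E'} α n x => by
      rw [LinearMap.comp_apply, LinearMap.comp_apply, toMixed_perMap, natApp_perMap, fromMixed_perMap]
      rfl
    comm := fun E n x => by
      rw [LinearMap.comp_apply, LinearMap.comp_apply, perD_fromMixed, h1, mixD_toMixed]
      rfl
    periodic := fun E n => by
      rw [fromMixed_congr_degree (m := n) ⟨-1, by ring⟩, toMixed_congr_degree (m := n) ⟨-1, by ring⟩]
    filtered := fun E n x hx q hq => by
      refine fromMixed_apply_eq_zero fun t ht => (R t).supported E _ fun l hl => ?_
      have := (mem_rowsUpTo.mp hl).1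
      exact toMixed_apply_eq_zero fun m hm => hx m (by omega)
    augmented := fun X x => by
      rw [LinearMap.comp_apply, LinearMap.comp_apply, fromMixed_even _ _ (by simp), h2, rgenAug_levelZero,
        toMixed_even _ _ (by simp), shiftUp_zero, add_zero, Pi.single_eq_same] }⟩

end Periodic

section Comparisons

variable {k : Type u} [Field k]

lemma perMap_inclOne_hom_inv (E : Lam 1 ⥤ ModuleCat.{u} k) (x : ∀ q : ℕ, E.obj (Lam.ob 1 q)) :
    perMap (inclOne E).hom (perMap (inclOne E).inv x) = x :=
  funext fun q => congrArg (fun f => f.hom (x q)) ((inclOne E).inv_hom_id_app (Lam.ob 1 q))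

lemma perMap_inclOne_naturality {E E' : Lam 1 ⥤ ModuleCat.{u} k} (α : E ⟶ E') (x) :
    perMap (inclOne E').hom (perMap (inclMap 1 α) x) = perMap α (perMap (inclOne E).hom x) :=
  funext fun q => congrArg (fun f => f.hom (x q)) (α.naturality (inclOneIso.hom.app (Lam.ob 1 q))).symm

lemma perMap_inclOne_inv_naturality {E E' : Lam 1 ⥤ ModuleCat.{u} k} (α : E ⟶ E') (x) :
    perMap (inclMap 1 α) (perMap (inclOne E).inv x) = perMap (inclOne E').inv (perMap α x) :=
  funext fun q => congrArg (fun f => f.hom (x q)) (α.naturality (inclOneIso.inv.app (Lam.ob 1 q)))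

variable {p : ℕ} [NeZero p]

/-- A chain map with components in the degrees, natural in the cyclic vector space, is a natural transformation of
periodic complexes. -/
def perNat (f : ∀ (E : Lam 1 ⥤ ModuleCat.{u} k) (_ : ℤ),
      (∀ q : ℕ, (Lam.incl p ⋙ E).obj (Lam.ob p q)) →ₗ[k] (∀ q : ℕ, E.obj (Lam.ob 1 q)))
    (hc : ∀ E n x, perD E n (f E (n + 1) x) = f E n (perD (Lam.incl p ⋙ E) n x))
    (hn : ∀ {E E' : Lam 1 ⥤ ModuleCat.{u} k} (α : E ⟶ E') (n : ℤ) x,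
      f E' n (perMap (inclMap p α) x) = perMap α (f E n x)) :
    (Functor.whiskeringLeft (Lam p) (Lam 1) (ModuleCat.{u} k)).obj (Lam.incl p) ⋙
      perFunctor k p ⟶ perFunctor k 1 where
  app E := ChainComplex.ofHom (X := perComplex (Lam.incl p ⋙ E)) (Y := perComplex E)
    (fun n => ModuleCat.ofHom (f E n)) fun n => by
      rw [perComplex_d, perComplex_d]
      exact ModuleCat.hom_ext (LinearMap.ext (hc E n))
  naturality E E' α := by
    refine HomologicalComplex.hom_ext _ _ fun n => ModuleCat.hom_ext (LinearMap.ext fun x => ?_)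
    exact hn α n x

/-- The comparison map given by a natural morphism of periodic complexes. -/
def NatPer.toComparison (c : NatPer k p 1) : Comparison k p where
  toNat := perNat (fun E n => perMap (inclOne E).hom ∘ₗ c.toFun E n)
    (fun E n x => by
      rw [LinearMap.comp_apply, perD_perMap_apply, c.comm]; rfl)
    (fun α n x => by
      rw [LinearMap.comp_apply, c.natural, perMap_inclOne_naturality]; rfl)
  periodic E n := congrArg (perMap (inclOne E).hom ∘ₗ ·) (c.periodic E n)
  filtered E n x h q hq :=
    (congrArg ((inclOne E).hom.app (Lam.ob 1 q)).hom (c.filtered E n x h q hq)).trans (map_zero _)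
  augmented E x g := by
    set v := c.toFun (freeObj k _) 0 (Pi.single 0 (univElt k p 0)) 0
    set w := ((inclOne (freeObj k ((Lam.incl p).obj (Lam.ob p 0)))).inv.app (Lam.ob 1 0)).hom (gen k _ g)
    have hw : rgenAug k _ 1 0 w = 1 := (freeAug_map _ _).trans (freeAug_gen g)
    obtain ⟨y, hy⟩ := exists_bOp_freeIncl_zero (x := v - w) (by
      rw [map_sub, hw, c.augmented, rgenAug_univElt, sub_self])
    have h1 : c.toFun E 0 (Pi.single 0 x) 0 = ((inclMap 1 (freeLift (E := E) x)).app (Lam.ob 1 0)).hom v := by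
      rw [← perMap_univElt, c.natural]; rfl
    have h2 : ((inclOne E).hom.app (Lam.ob 1 0)).hom (((inclMap 1 (freeLift (E := E) x)).app (Lam.ob 1 0)).hom w) =
        (E.map g).hom x := by
      have h := congrFun (perMap_inclOne_naturality (freeLift (E := E) x) (Pi.single 0 w)) 0
      rw [perMap_apply, perMap_apply, perMap_apply, perMap_apply, Pi.single_eq_same] at h
      refine h.trans ((congrArg _ ?_).trans (freeLift_gen (E := E) x g))
      exact congrArg (fun f => f.hom (gen k _ g)) ((inclOne (freeObj k _)).inv_hom_id_app (Lam.ob 1 0))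
    refine ⟨((inclOne E).hom.app (Lam.ob 1 1)).hom (((inclMap 1 (freeLift (E := E) x)).app (Lam.ob 1 1)).hom y), ?_⟩
    have h3 := bOp_app (inclMap 1 (freeLift (E := E) x)) 0 y
    rw [hy, map_sub, ← h1] at h3
    have h4 := bOp_app (inclOne E).hom 0 (((inclMap 1 (freeLift (E := E) x)).app (Lam.ob 1 1)).hom y)
    refine h4.trans ((congrArg _ h3).trans ((map_sub _ _ _).trans ?_))
    exact congrArg (_ - ·) h2

/-- The natural morphism of periodic complexes given by a comparison map. -/
def Comparison.toNatPer (c : Comparison k p) : NatPer k p 1 where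
  toFun E n := perMap (inclOne E).inv ∘ₗ perComponent c.toNat E n
  natural {E E'} α n x := by
    refine Eq.trans ?_ (perMap_inclOne_inv_naturality α _).symm
    refine congrArg (perMap (inclOne E').inv) ?_
    exact congrArg (fun f => (f.f n).hom x) (c.toNat.naturality α)
  comm E n x := by
    rw [LinearMap.comp_apply, perD_perMap_apply]
    refine congrArg (perMap (inclOne E).inv) ?_
    have h := (c.toNat.app E).comm (n + 1) n
    rw [show ((perFunctor k 1).obj E).d (n + 1) n = ModuleCat.ofHom (perD E n) from perComplex_d E n,
      show (((Functor.whiskeringLeft (Lam p) (Lam 1) (ModuleCat.{u} k)).obj (Lam.incl p) ⋙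
        perFunctor k p).obj E).d (n + 1) n = ModuleCat.ofHom (perD (Lam.incl p ⋙ E) n) from perComplex_d _ n] at h
    exact congrArg (fun f => f.hom x) h
  periodic E n := congrArg (perMap (inclOne E).inv ∘ₗ ·) (c.periodic E n)
  filtered E n x h q hq :=
    (congrArg ((inclOne E).inv.app (Lam.ob 1 q)).hom (c.filtered E n x h q hq)).trans (map_zero _)
  augmented X x := by
    obtain ⟨y, hy⟩ := c.augmented (freeObj k X) x (Lam.ofMap (PMap.step _ _ 1))
    have h : perComponent c.toNat (freeObj k X) 0 (Pi.single 0 x) 0 = _ + _ := (sub_eq_iff_eq_add.mp hy.symm)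
    have h0 := rgenAug_bOp (r := 1) 0 (((inclOne (freeObj k X)).inv.app (Lam.ob 1 1)).hom y)
    rw [bOp_app (inclOne (freeObj k X)).inv 0 y] at h0
    rw [LinearMap.comp_apply, perMap_apply, h, map_add, map_add, h0, Finset.sum_range_succ, Finset.sum_range_one,
      pow_zero, pow_one, add_neg_cancel, zero_mul, zero_add]
    exact (freeAug_map _ _).trans (freeAug_map _ _)

lemma Comparison.perMap_toNatPer (c : Comparison k p) (E : Lam 1 ⥤ ModuleCat.{u} k) (n : ℤ) (x) :
    perMap (inclOne E).hom (c.toNatPer.toFun E n x) = perComponent c.toNat E n x :=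
  perMap_inclOne_hom_inv E _

lemma exists_comparison (k : Type u) [Field k] (p : ℕ) [NeZero p] : Nonempty (Comparison k p) :=
  (exists_natPer k p 1).map NatPer.toComparison

/-- Two comparison maps agree on periodic cyclic homology. -/
theorem Comparison.exists_homologous (c c' : Comparison k p) {E : Lam 1 ⥤ ModuleCat.{u} k} {n : ℤ} {x}
    (hx : perD (Lam.incl p ⋙ E) n x = 0) : ∃ y, perD E (n + 1) y =
      perComponent c.toNat E (n + 1) x - perComponent c'.toNat E (n + 1) x := by
  obtain ⟨y, hy⟩ := c.toNatPer.exists_homologous c'.toNatPer hx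
  refine ⟨perMap (inclOne E).hom y, ?_⟩
  rw [perD_perMap_apply, hy, map_sub, c.perMap_toNatPer, c'.perMap_toNatPer]

/-- Comparison maps are surjective on periodic cyclic homology. -/
theorem Comparison.exists_cycle (c : Comparison k p) {E : Lam 1 ⥤ ModuleCat.{u} k} {n : ℤ} {x}
    (hx : perD E n x = 0) : ∃ w y, perD (Lam.incl p ⋙ E) n w = 0 ∧
      perD E (n + 1) y = perComponent c.toNat E (n + 1) w - x := by
  obtain ⟨d⟩ := exists_natPer k 1 p
  have hx' : perD (Lam.incl 1 ⋙ E) n (perMap (inclOne E).inv x) = 0 := by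
    rw [perD_perMap_apply, hx, map_zero]
  obtain ⟨y, hy⟩ := (d.comp c.toNatPer).exists_homologous (NatPer.id k 1) hx'
  refine ⟨d.toFun E (n + 1) (perMap (inclOne E).inv x), perMap (inclOne E).hom y, ?_, ?_⟩
  · rw [d.comm, hx', map_zero]
  · rw [perD_perMap_apply, hy, map_sub, ← c.perMap_toNatPer]
    exact congrArg (_ - ·) (perMap_inclOne_hom_inv E x)

/-- Comparison maps are injective on periodic cyclic homology. -/
theorem Comparison.exists_boundary (c : Comparison k p) {E : Lam 1 ⥤ ModuleCat.{u} k} {n : ℤ} {x y}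
    (hx : perD (Lam.incl p ⋙ E) n x = 0) (hy : perD E (n + 1) y = perComponent c.toNat E (n + 1) x) :
    ∃ z, perD (Lam.incl p ⋙ E) (n + 1) z = x := by
  obtain ⟨d⟩ := exists_natPer k 1 p
  obtain ⟨z, hz⟩ := (c.toNatPer.comp d).exists_homologous (NatPer.id k p) hx
  refine ⟨d.toFun E (n + 1 + 1) (perMap (inclOne E).inv y) - z, ?_⟩
  have h : c.toNatPer.toFun E (n + 1) x = perMap (inclOne E).inv (perComponent c.toNat E (n + 1) x) := rfl
  rw [map_sub, hz, d.comm, perD_perMap_apply, hy, ← h]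
  exact sub_sub_cancel _ _

end Comparisons

/-! ### Homology classes -/

section Classes

variable {k : Type u} [Field k] {ι : Type*} {c : ComplexShape ι}
  (K : HomologicalComplex (ModuleCat.{u} k) c)

lemma iCycles_injective (i : ι) : Function.Injective (K.iCycles i).hom :=
  (ModuleCat.mono_iff_injective _).mp inferInstance

lemma homologyπ_surjective (i : ι) : Function.Surjective (K.homologyπ i).hom :=
  (ModuleCat.epi_iff_surjective _).mp inferInstance

lemma exists_iCycles {i j : ι} (hj : c.next i = j) {x : K.X i} (hx : (K.d i j).hom x = 0) :
    ∃ w, (K.iCycles i).hom w = x :=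
  ⟨K.cyclesMk (C := ModuleCat.{u} k) x j hj hx, K.i_cyclesMk (C := ModuleCat.{u} k) x j hj hx⟩

lemma d_iCycles (i j : ι) (w : K.cycles i) : (K.d i j).hom ((K.iCycles i).hom w) = 0 :=
  congrArg (fun f => f.hom w) (K.iCycles_d i j)

lemma homologyπ_eq_zero_iff {i j : ι} (hi : c.prev j = i) (w : K.cycles j) :
    (K.homologyπ j).hom w = 0 ↔ ∃ y, (K.d i j).hom y = (K.iCycles j).hom w := by
  have h : (ShortComplex.mk (K.toCycles i j) (K.homologyπ j) (by simp)).Exact :=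
    ShortComplex.exact_of_g_is_cokernel _ (K.homologyIsCokernel i j hi)
  have h2 : ∀ y, (K.iCycles j).hom ((K.toCycles i j).hom y) = (K.d i j).hom y := fun y =>
    congrArg (fun f => f.hom y) (K.toCycles_i i j)
  constructor
  · intro hw
    obtain ⟨y, hy⟩ := (ShortComplex.moduleCat_exact_iff _).mp h w hw
    exact ⟨y, by rw [← h2, ← hy]⟩
  · rintro ⟨y, hy⟩
    obtain rfl : (K.toCycles i j).hom y = w := iCycles_injective K j ((h2 y).trans hy)
    exact congrArg (fun f => f.hom y) (K.toCycles_comp_homologyπ i j)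

end Classes

section PeriodicClasses

variable {k : Type u} [Field k] {p : ℕ} [NeZero p] (E : Lam p ⥤ ModuleCat.{u} k)

lemma exists_cycles_perComplex {n : ℤ} {x : ∀ q : ℕ, E.obj (Lam.ob p q)} (hx : perD E n x = 0) :
    ∃ w, ((perComplex E).iCycles (n + 1)).hom w = x :=
  exists_iCycles (perComplex E) (j := n) (by simp) ((congrArg (fun f => f.hom x) (perComplex_d E n)).trans hx)

lemma perD_iCycles {n : ℤ} (w : (perComplex E).cycles (n + 1)) :
    perD E n (((perComplex E).iCycles (n + 1)).hom w) = 0 := by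
  have h := d_iCycles (perComplex E) (n + 1) n w
  rwa [perComplex_d] at h

lemma homologyπ_perComplex_eq_zero_iff {n : ℤ} (w : (perComplex E).cycles n) :
    ((perComplex E).homologyπ n).hom w = 0 ↔ ∃ y, perD E n y = ((perComplex E).iCycles n).hom w := by
  refine (homologyπ_eq_zero_iff (perComplex E) (i := n + 1) (by simp) w).trans ?_
  rw [perComplex_d]
  exact Iff.rfl

lemma stdComplex_d (q : ℕ) : (stdComplex E).d (q + 1) q = ModuleCat.ofHom (bOp E q) := by
  simp [stdComplex]

lemma exists_cycles_stdComplex {q : ℕ} {x : E.obj (Lam.ob p q)}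
    (hx : ∀ (r : ℕ) (h : q = r + 1), bOp E r (h ▸ x) = 0) : ∃ w, ((stdComplex E).iCycles q).hom w = x := by
  match q with
  | 0 =>
    refine exists_iCycles (stdComplex E) (j := 0) (by simp) ?_
    rw [(stdComplex E).shape 0 0 (by simp)]; rfl
  | q + 1 =>
    exact exists_iCycles (stdComplex E) (j := q) (by simp)
      ((congrArg (fun f => f.hom x) (stdComplex_d E q)).trans (hx q rfl))

lemma bOp_iCycles {q : ℕ} (w : (stdComplex E).cycles (q + 1)) :
    bOp E q (((stdComplex E).iCycles (q + 1)).hom w) = 0 := by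
  have h := d_iCycles (stdComplex E) (q + 1) q w
  rwa [stdComplex_d] at h

lemma homologyπ_stdComplex_eq_zero_iff {q : ℕ} (w : (stdComplex E).cycles q) :
    ((stdComplex E).homologyπ q).hom w = 0 ↔ ∃ y, bOp E q y = ((stdComplex E).iCycles q).hom w := by
  refine (homologyπ_eq_zero_iff (stdComplex E) (i := q + 1) (by simp) w).trans ?_
  rw [stdComplex_d]
  exact Iff.rfl

end PeriodicClasses

/-! ### The mixed complex of the twist and the Laurent chains -/

section Degenerate

variable {k : Type u} [Field k] {p : ℕ} {T : Lam p ⥤ ModuleCat.{u} k}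

lemma normOp_proj [CharP k p] [ExpChar k p] [PerfectRing k p] (E : Lam 1 ⥤ ModuleCat.{u} k) (q : ℕ) :
    normOp (Lam.proj p ⋙ E) q = 0 := by
  rw [normOp_eq_tateNorm_mul, tateNorm_eq_zero (lapOp_proj E), zero_mul]

lemma mixD_of_normOp (hT : ∀ q, normOp T q = 0) (x : ∀ q : ℕ, T.obj (Lam.ob p q)) (q : ℕ) :
    mixD T x q = bOp T q (x (q + 1)) := by
  rw [mixD_apply]
  match q with
  | 0 => rw [shiftUp_zero, add_zero]
  | q + 1 => rw [shiftUp_succ, connesOp_apply, hT, LinearMap.zero_apply, map_zero, map_zero, sub_zero, add_zero]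

lemma fromMixed_of_normOp (hT : ∀ q, normOp T q = 0) {n : ℤ} {q : ℕ} (h : ¬ Even (n - q))
    (x : ∀ q : ℕ, T.obj (Lam.ob p q)) : fromMixed T n x q = 0 := by
  rw [fromMixed_odd T _ h]
  match q with
  | 0 => rw [shiftUp_zero]
  | q + 1 => rw [shiftUp_succ, LinearMap.comp_apply, hT, LinearMap.zero_apply, map_zero]

lemma toMixed_fromMixed_of_normOp (hT : ∀ q, normOp T q = 0) {n : ℤ} {q : ℕ} (h : Even (n - q))
    (x : ∀ q : ℕ, T.obj (Lam.ob p q)) : toMixed T n (fromMixed T n x) q = x q := by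
  rw [toMixed_even T _ h, fromMixed_even T _ h]
  match q with
  | 0 => rw [shiftUp_zero, add_zero]
  | q + 1 =>
    rw [shiftUp_succ, fromMixed_of_normOp hT (even_sub_succ.mp h), map_zero, add_zero]

end Degenerate

section Laurent

variable {k : Type u} [Field k] {p : ℕ} [NeZero p] [ExpChar k p] [PerfectRing k p]
  {A : Type u} [Ring A] [Algebra k A]
  (G : Lam.proj p ⋙ cyclicObject k (FrobTwist k p A) ⟶ Lam.incl p ⋙ cyclicObject k A)

variable [CharP k p]

/-- Laurent chains are the image of chains of the mixed complex of the twist. -/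
theorem laurentChain_eq (n : ℤ) (z : ∀ q : ℕ, (cyclicObject k A).obj (Lam.ob 1 q)) :
    laurentChain G n (fun q => z q) = perMap G (fromMixed _ n (fun q => twistEquiv q (z q))) := by
  funext q
  rw [perMap_apply]
  by_cases h : Even (n - q)
  · rw [fromMixed_even _ _ h]
    exact dif_pos h
  · rw [fromMixed_of_normOp (normOp_proj _) h, map_zero]
    exact dif_neg h

lemma perD_laurentChain {n : ℤ} {z : ∀ q : ℕ, (cyclicObject k A).obj (Lam.ob 1 q)}
    (hz : ∀ q : ℕ, Even (n - q) → bOp (cyclicObject k A) q (z (q + 1)) = 0) :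
    perD (Lam.incl p ⋙ cyclicObject k A) n (laurentChain G (n + 1) (fun q => z q)) = 0 := by
  rw [laurentChain_eq, perD_perMap_apply, perD_fromMixed, fromMixed_congr (y := 0), map_zero, map_zero]
  intro q hq
  rw [mixD_of_normOp (normOp_proj _), bOp_twistEquiv, hz q hq, map_zero, Pi.zero_apply]

lemma exists_perD_laurentChain {n : ℤ} {z : ∀ q : ℕ, (cyclicObject k A).obj (Lam.ob 1 q)}
    (hz : ∀ q : ℕ, Even (n - q) → ∃ y, bOp (cyclicObject k A) q y = z q) :
    ∃ y, perD (Lam.incl p ⋙ cyclicObject k A) n y = laurentChain G n (fun q => z q) := by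
  choose! y hy using hz
  let y' : ∀ q : ℕ, (cyclicObject k A).obj (Lam.ob 1 q) := fun q => match q with
    | 0 => 0
    | q + 1 => y q
  refine ⟨laurentChain G (n + 1) (fun q => y' q), ?_⟩
  rw [laurentChain_eq, laurentChain_eq, perD_perMap_apply, perD_fromMixed]
  refine congrArg (perMap G) (fromMixed_congr fun q hq => ?_)
  rw [mixD_of_normOp (normOp_proj _), bOp_twistEquiv]
  exact congrArg (twistEquiv q) (hy q hq)

variable {G} {E'' : Lam p ⥤ ModuleCat.{u} k} {β : Lam.incl p ⋙ cyclicObject k A ⟶ E''}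

/-- If the cokernel of `G` has no periodic homology, every class is the one of a Laurent chain. -/
theorem IsShortExact.exists_laurentChain (h : IsShortExact G β)
    (hE : ∀ n x, perD E'' n x = 0 → ∃ y, perD E'' (n + 1) y = x) {n : ℤ} {x}
    (hx : perD (Lam.incl p ⋙ cyclicObject k A) n x = 0) :
    ∃ (z : ∀ q : ℕ, (cyclicObject k A).obj (Lam.ob 1 q)) (y : _), (∀ q, bOp (cyclicObject k A) q (z (q + 1)) = 0) ∧
      perD (Lam.incl p ⋙ cyclicObject k A) (n + 1) y = x - perMap G (fromMixed _ (n + 1) fun q => twistEquiv q (z q)) := by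
  obtain ⟨w, y, hw, hy⟩ := h.exists_cycle hE hx
  obtain ⟨z, hz⟩ : ∃ z : ∀ q : ℕ, (cyclicObject k A).obj (Lam.ob 1 q), (fun q => twistEquiv (p := p) q (z q)) = toMixed _ (n + 1) w :=
    ⟨fun q => (twistEquiv q).symm (toMixed _ (n + 1) w q), funext fun q => (twistEquiv q).apply_symm_apply _⟩
  have h1 := fromMixed_toMixed _ w n
  rw [hw, map_zero, add_zero] at h1
  refine ⟨z, y + perMap G (mixHtpy _ (n + 1) w), fun q => ?_, ?_⟩
  · refine (twistEquiv (p := p) q).injective ?_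
    rw [← bOp_twistEquiv, map_zero]
    refine (mixD_of_normOp (normOp_proj _) (fun q => twistEquiv q (z q)) q).symm.trans ?_
    rw [hz, mixD_toMixed, hw, map_zero, Pi.zero_apply]
  · rw [hz, map_add, perD_perMap_apply, ← sub_eq_of_eq_add' h1, map_sub, hy]
    abel

/-- If the cokernel of `G` has no periodic homology, a Laurent chain is a boundary only if its entries are. -/
theorem IsShortExact.exists_bOp_of_laurentChain (h : IsShortExact G β)
    (hE : ∀ n x, perD E'' n x = 0 → ∃ y, perD E'' (n + 1) y = x) {n : ℤ}
    {z : ∀ q : ℕ, (cyclicObject k A).obj (Lam.ob 1 q)} {y}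
    (hy : perD (Lam.incl p ⋙ cyclicObject k A) (n + 1) y = laurentChain G (n + 1) (fun q => z q)) {q : ℕ}
    (hq : Even (n + 1 - q)) : ∃ u, bOp (cyclicObject k A) q u = z q := by
  rw [laurentChain_eq] at hy
  obtain ⟨v, hv⟩ := h.exists_boundary hE hy
  obtain ⟨u, hu⟩ : ∃ u : ∀ q : ℕ, (cyclicObject k A).obj (Lam.ob 1 q), (fun q => twistEquiv (p := p) q (u q)) = toMixed _ (n + 1 + 1) v :=
    ⟨fun q => (twistEquiv q).symm (toMixed _ (n + 1 + 1) v q), funext fun q => (twistEquiv q).apply_symm_apply _⟩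
  refine ⟨u (q + 1), (twistEquiv (p := p) q).injective ?_⟩
  rw [← bOp_twistEquiv]
  refine (mixD_of_normOp (normOp_proj _) (fun q => twistEquiv q (u q)) q).symm.trans ?_
  rw [hu, mixD_toMixed, hv, toMixed_fromMixed_of_normOp (normOp_proj _) hq]

end Laurent

/-! ### The isomorphism -/

section ComparisonClasses

variable {k : Type u} [Field k] {p : ℕ} [NeZero p] (c c' : Comparison k p) {E : Lam 1 ⥤ ModuleCat.{u} k} {n : ℤ}

lemma homologyπ_perComplex_eq_iff (E : Lam p ⥤ ModuleCat.{u} k) (w w' : (perComplex E).cycles n) :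
    ((perComplex E).homologyπ n).hom w = ((perComplex E).homologyπ n).hom w' ↔
      ∃ y : ∀ q : ℕ, E.obj (Lam.ob p q), perD E n y =
        ((perComplex E).iCycles n).hom w - ((perComplex E).iCycles n).hom w' := by
  rw [← sub_eq_zero, ← map_sub, homologyπ_perComplex_eq_zero_iff, map_sub]

/-- The map induced by a comparison map on periodic cyclic homology. -/
def Comparison.onHomology (E : Lam 1 ⥤ ModuleCat.{u} k) (n : ℤ) :
    (perComplex (Lam.incl p ⋙ E)).homology n →ₗ[k] (perComplex E).homology n :=
  (HomologicalComplex.homologyMap (c.toNat.app E) n).hom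

lemma Comparison.exists_onHomology (w : (perComplex (Lam.incl p ⋙ E)).cycles n) :
    ∃ w' : (perComplex E).cycles n,
      c.onHomology E n (((perComplex (Lam.incl p ⋙ E)).homologyπ n).hom w) = ((perComplex E).homologyπ n).hom w' ∧
      ((perComplex E).iCycles n).hom w' =
        perComponent c.toNat E n (((perComplex (Lam.incl p ⋙ E)).iCycles n).hom w) :=
  ⟨(HomologicalComplex.cyclesMap (c.toNat.app E) n).hom w,
    congrArg (fun f => f.hom w) (HomologicalComplex.homologyπ_naturality (c.toNat.app E) n),
    congrArg (fun f => f.hom w) (HomologicalComplex.cyclesMap_i (c.toNat.app E) n)⟩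

/-- All comparison maps induce the same map on periodic cyclic homology. -/
theorem Comparison.onHomology_eq : c.onHomology E n = c'.onHomology E n := by
  obtain ⟨n, rfl⟩ : ∃ m, n = m + 1 := ⟨n - 1, by ring⟩
  refine LinearMap.ext fun h => ?_
  obtain ⟨w, rfl⟩ := homologyπ_surjective _ _ h
  obtain ⟨v, hv, hv'⟩ := c.exists_onHomology w
  obtain ⟨v', hv₁, hv₂⟩ := c'.exists_onHomology w
  obtain ⟨y, hy⟩ := c.exists_homologous c' (perD_iCycles (Lam.incl p ⋙ E) w)
  exact hv.trans (Eq.trans ((homologyπ_perComplex_eq_iff E v v').mpr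
    ⟨y, by rw [hv', hv₂]; exact hy⟩) hv₁.symm)

lemma Comparison.onHomology_injective : Function.Injective (c.onHomology E n) := by
  obtain ⟨n, rfl⟩ : ∃ m, n = m + 1 := ⟨n - 1, by ring⟩
  refine (injective_iff_map_eq_zero _).mpr fun h hh => ?_
  obtain ⟨w, rfl⟩ := homologyπ_surjective _ _ h
  obtain ⟨v, hv, hv'⟩ := c.exists_onHomology w
  obtain ⟨y, hy⟩ := (homologyπ_perComplex_eq_zero_iff E v).mp (hv.symm.trans hh)
  exact (homologyπ_perComplex_eq_zero_iff _ w).mpr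
    (c.exists_boundary (perD_iCycles (Lam.incl p ⋙ E) w) (hy.trans hv'))

lemma Comparison.onHomology_surjective : Function.Surjective (c.onHomology E n) := by
  obtain ⟨n, rfl⟩ : ∃ m, n = m + 1 := ⟨n - 1, by ring⟩
  intro h
  obtain ⟨v, rfl⟩ := homologyπ_surjective _ _ h
  obtain ⟨x, y, hx, hy⟩ := c.exists_cycle (perD_iCycles E v)
  obtain ⟨w, rfl⟩ := exists_cycles_perComplex _ hx
  obtain ⟨v', hv, hv'⟩ := c.exists_onHomology w
  refine ⟨((perComplex (Lam.incl p ⋙ E)).homologyπ (n + 1)).hom w,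
    hv.trans ((homologyπ_perComplex_eq_iff E v' v).mpr ⟨y, ?_⟩)⟩
  rw [hv']
  exact hy

end ComparisonClasses

/-- Two surjections with the same kernel have isomorphic targets. -/
theorem exists_addEquiv_of_ker_eq {M N P : Type*} [AddCommGroup M] [AddCommGroup N] [AddCommGroup P] {f : M →+ N}
    {g : M →+ P} (hf : Function.Surjective f) (hg : Function.Surjective g) (h : f.ker = g.ker) :
    ∃ φ : N ≃+ P, ∀ x, φ (f x) = g x := by
  refine ⟨(QuotientAddGroup.quotientKerEquivOfSurjective f hf).symm.trans
    ((QuotientAddGroup.quotientAddEquivOfEq h).trans (QuotientAddGroup.quotientKerEquivOfSurjective g hg)), fun x => ?_⟩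
  have h1 : (QuotientAddGroup.quotientKerEquivOfSurjective f hf).symm (f x) = x :=
    (AddEquiv.symm_apply_eq _).mpr rfl
  rw [AddEquiv.trans_apply, AddEquiv.trans_apply, h1]
  rfl

section Isomorphism

variable {k : Type u} [Field k] {p : ℕ} [NeZero p] [ExpChar k p] [PerfectRing k p]
  {A : Type u} [Ring A] [Algebra k A]
  {G : Lam.proj p ⋙ cyclicObject k (FrobTwist k p A) ⟶ Lam.incl p ⋙ cyclicObject k A} {n : ℤ}

/-- Families of Hochschild cycles of the degrees that occur in a Laurent series of degree `n`. -/
abbrev HochschildCycles (k : Type u) [Field k] (A : Type u) [Ring A] [Algebra k A] (n : ℤ) : Type u :=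
  ∀ q : {q : ℕ // Even (n - q)}, (hochschildComplex k A).cycles q

lemma HochschildCycles.exists_extension (z : HochschildCycles k A n) :
    ∃ x : ∀ q : ℕ, (cyclicObject k A).obj (Lam.ob 1 q),
      ∀ q : {q : ℕ // Even (n - q)}, ((hochschildComplex k A).iCycles q).hom (z q) = x q := by
  have h : ∀ q : ℕ, ∃ x : (cyclicObject k A).obj (Lam.ob 1 q), ∀ h : Even (n - q),
      ((hochschildComplex k A).iCycles q).hom (z ⟨q, h⟩) = x := fun q => by
    by_cases h : Even (n - q)
    · exact ⟨((hochschildComplex k A).iCycles q).hom (z ⟨q, h⟩), fun _ => rfl⟩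
    · exact ⟨0, fun h' => absurd h' h⟩
  choose x hx using h
  exact ⟨x, fun q => hx q q.2⟩

variable (G) in
/-- The chain of the periodic complex given by a family of Hochschild cycles. -/
abbrev cycleChain (z : HochschildCycles k A n) : (perComplex (Lam.incl p ⋙ cyclicObject k A)).X n :=
  laurentChain G n fun q => ((hochschildComplex k A).iCycles q).hom (z q)

lemma cycleChain_add (z z' : HochschildCycles k A n) : cycleChain G (z + z') = cycleChain G z + cycleChain G z' := by
  refine funext fun q : ℕ => ?_
  change cycleChain G (z + z') q = cycleChain G z q + cycleChain G z' q
  unfold cycleChain laurentChain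
  split_ifs with h
  · exact (congrArg (fun x => (G.app (Lam.ob p q)).hom (twistTensor k p A (q + 1) x)) (map_add _ _ _)).trans
      ((congrArg (G.app (Lam.ob p q)).hom (map_add (twistTensor k p A (q + 1)) _ _)).trans (map_add _ _ _))
  · rw [add_zero]

lemma cycleChain_smul (a : k) (z : HochschildCycles k A n) : cycleChain G (a • z) = a ^ p • cycleChain G z := by
  refine funext fun q : ℕ => ?_
  change cycleChain G (a • z) q = a ^ p • cycleChain G z q
  unfold cycleChain laurentChain
  split_ifs with h
  · exact (congrArg (fun x => (G.app (Lam.ob p q)).hom (twistTensor k p A (q + 1) x)) (map_smul _ _ _)).trans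
      ((congrArg (G.app (Lam.ob p q)).hom (twistTensor_smul k p A (q + 1) _ _)).trans (map_smul _ _ _))
  · rw [smul_zero]

variable [CharP k p]

lemma exists_iCycles_cycleChain (z : HochschildCycles k A n) :
    ∃ w, ((perComplex (Lam.incl p ⋙ cyclicObject k A)).iCycles n).hom w = cycleChain G z := by
  obtain ⟨n, rfl⟩ : ∃ m, n = m + 1 := ⟨n - 1, by ring⟩
  obtain ⟨x, hx⟩ := z.exists_extension
  rw [cycleChain, funext hx]
  refine exists_cycles_perComplex _ (perD_laurentChain G fun q hq => ?_)
  exact (congrArg _ (hx ⟨q + 1, even_succ_sub_succ.mpr hq⟩)).symm.trans (bOp_iCycles (cyclicObject k A) _)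

variable {E'' : Lam p ⥤ ModuleCat.{u} k} {β : Lam.incl p ⋙ cyclicObject k A ⟶ E''}

lemma IsShortExact.exists_perD_cycleChain_iff (h : IsShortExact G β)
    (hE : ∀ n x, perD E'' n x = 0 → ∃ y, perD E'' (n + 1) y = x) (z : HochschildCycles k A n) :
    (∃ y, perD (Lam.incl p ⋙ cyclicObject k A) n y = cycleChain G z) ↔
      ∀ q : {q : ℕ // Even (n - q)}, ((hochschildComplex k A).homologyπ q).hom (z q) = 0 := by
  obtain ⟨n, rfl⟩ : ∃ m, n = m + 1 := ⟨n - 1, by ring⟩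
  obtain ⟨x, hx⟩ := z.exists_extension
  rw [cycleChain, funext hx]
  constructor
  · rintro ⟨y, hy⟩ q
    obtain ⟨u, hu⟩ := h.exists_bOp_of_laurentChain hE hy q.2
    exact (homologyπ_stdComplex_eq_zero_iff _ _).mpr ⟨u, hu.trans (hx q).symm⟩
  · intro hz
    refine exists_perD_laurentChain G fun q hq => ?_
    obtain ⟨u, hu⟩ := (homologyπ_stdComplex_eq_zero_iff _ _).mp (hz ⟨q, hq⟩)
    exact ⟨u, hu.trans (hx ⟨q, hq⟩)⟩

lemma IsShortExact.exists_cycleChain (h : IsShortExact G β)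
    (hE : ∀ n x, perD E'' n x = 0 → ∃ y, perD E'' (n + 1) y = x)
    (w : (perComplex (Lam.incl p ⋙ cyclicObject k A)).cycles n) :
    ∃ (z : HochschildCycles k A n) (y : _), perD (Lam.incl p ⋙ cyclicObject k A) n y =
      (((perComplex (Lam.incl p ⋙ cyclicObject k A)).iCycles n).hom w - cycleChain G z :
        (perComplex (Lam.incl p ⋙ cyclicObject k A)).X n) := by
  obtain ⟨n, rfl⟩ : ∃ m, n = m + 1 := ⟨n - 1, by ring⟩
  obtain ⟨x, y, hx, hy⟩ := h.exists_laurentChain hE (perD_iCycles _ w)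
  have hx' : ∀ q, ∃ z, ((hochschildComplex k A).iCycles q).hom z = x q := fun q =>
    exists_cycles_stdComplex (cyclicObject k A) fun r hr => by subst hr; exact hx r
  choose z hz using hx'
  refine ⟨fun q => z q, y, hy.trans ?_⟩
  rw [cycleChain, funext fun q : {q : ℕ // Even (n + 1 - q)} => hz q, laurentChain_eq]
  rfl

/-- A morphism `G` of `p`-cyclic vector spaces with periodically acyclic cokernel gives the isomorphism. -/
theorem IsShortExact.exists_laurentIso (h : IsShortExact G β)
    (hE : ∀ n x, perD E'' n x = 0 → ∃ y, perD E'' (n + 1) y = x) (c : Comparison k p) (n : ℤ) :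
    ∃ φ : HHLaurent k A n ≃+ HP k A n, (∀ (a : k) (h : HHLaurent k A n), φ (a • h) = a ^ p • φ h) ∧
      ∀ z : HochschildCycles k A n, ∃ w,
        ((perComplex (Lam.incl p ⋙ cyclicObject k A)).iCycles n).hom w = cycleChain G z ∧
        φ (fun q => ((hochschildComplex k A).homologyπ q).hom (z q)) = c.onHomology (cyclicObject k A) n
          (((perComplex (Lam.incl p ⋙ cyclicObject k A)).homologyπ n).hom w) := by
  choose w hw using fun z : HochschildCycles k A n => exists_iCycles_cycleChain (G := G) z
  have hinj := iCycles_injective (perComplex (Lam.incl p ⋙ cyclicObject k A)) n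
  have hadd : ∀ z z', w (z + z') = w z + w z' := fun z z' => hinj (by
    rw [map_add, hw, hw, hw, cycleChain_add])
  have hsmul : ∀ (a : k) z, w (a • z) = a ^ p • w z := fun a z => hinj (by
    rw [map_smul, hw, hw, cycleChain_smul])
  -- Both homology groups are quotients of the group of families of Hochschild cycles, by the same subgroup.
  let π : HochschildCycles k A n →+ HHLaurent k A n :=
    AddMonoidHom.mk' (fun z q => ((hochschildComplex k A).homologyπ q).hom (z q))
      fun z z' => funext fun q => map_add _ _ _
  let ψ : HochschildCycles k A n →+ HP k A n := AddMonoidHom.mk' (fun z => c.onHomology (cyclicObject k A) n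
    (((perComplex (Lam.incl p ⋙ cyclicObject k A)).homologyπ n).hom (w z)))
      fun z z' => by rw [hadd, map_add, map_add]
  have hπ : Function.Surjective π := fun h => by
    choose z hz using fun q => homologyπ_surjective (hochschildComplex k A) _ (h q)
    exact ⟨z, funext hz⟩
  have hψ : Function.Surjective ψ := fun x => by
    obtain ⟨x, rfl⟩ := c.onHomology_surjective x
    obtain ⟨v, rfl⟩ := homologyπ_surjective _ _ x
    obtain ⟨z, y, hy⟩ := h.exists_cycleChain hE v
    refine ⟨z, congrArg (c.onHomology (cyclicObject k A) n) ?_⟩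
    exact ((homologyπ_perComplex_eq_iff _ v (w z)).mpr ⟨y, by rw [hw]; exact hy⟩).symm
  have hker : π.ker = ψ.ker := AddSubgroup.ext fun z => by
    rw [AddMonoidHom.mem_ker, AddMonoidHom.mem_ker]
    refine funext_iff.trans ((h.exists_perD_cycleChain_iff hE z).symm.trans ?_)
    rw [← hw z, ← homologyπ_perComplex_eq_zero_iff]
    exact (map_eq_zero_iff _ c.onHomology_injective).symm
  obtain ⟨φ, hφ⟩ := exists_addEquiv_of_ker_eq hπ hψ hker
  refine ⟨φ, fun a x => ?_, fun z => ⟨w z, hw z, hφ z⟩⟩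
  obtain ⟨z, rfl⟩ := hπ x
  have h1 : a • π z = π (a • z) := funext fun q => (map_smul ((hochschildComplex k A).homologyπ q).hom a (z q)).symm
  rw [h1, hφ, hφ]
  change c.onHomology _ n (((perComplex _).homologyπ n).hom (w (a • z))) = _
  rw [hsmul, map_smul, map_smul]
  rfl

end Isomorphism

end CyclicHomology

open CyclicHomology

theorem mainTheorem5 {k : Type u} [Field k] (p : ℕ) [Fact p.Prime] [CharP k p] [PerfectRing k p]
    (A : Type u) [Ring A] [Algebra k A]
    (F : FrobTwist k p A →ₐ[k] ⨂[k] _ : ZMod p, A) (hF : IsQuasiFrobenius F)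
    (hA : ∃ d : ℕ, ∀ M : ModuleCat.{u} (A ⊗[k] Aᵐᵒᵖ), HasProjectiveDimensionLE M d) :
    Nonempty (Comparison k p) ∧
    ∃ G : Lam.proj p ⋙ cyclicObject k (FrobTwist k p A) ⟶ Lam.incl p ⋙ cyclicObject k A,
      (∀ (X : Lam p) (a : ZMod X.len → FrobTwist k p A),
        (G.app X).hom (PiTensorProduct.tprod k a) = tensorPower F X.len a) ∧
      ∃ φ : ∀ n : ℤ, HHLaurent k A n ≃+ HP k A n,
        (∀ (n : ℤ) (c : k) (h : HHLaurent k A n), φ n (c • h) = c ^ p • φ n h) ∧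
        ∀ (c : Comparison k p) (n : ℤ)
          (z : ∀ q : {q : ℕ // Even (n - q)}, (hochschildComplex k A).cycles q),
          ∃ w : (perComplex (Lam.incl p ⋙ cyclicObject k A)).cycles n,
            ((perComplex (Lam.incl p ⋙ cyclicObject k A)).iCycles n).hom w =
              laurentChain G n (fun q => ((hochschildComplex k A).iCycles q).hom (z q)) ∧
            φ n (fun q => ((hochschildComplex k A).homologyπ q).hom (z q)) =
              (HomologicalComplex.homologyMap (c.toNat.app (cyclicObject k A)) n).hom
                (((perComplex (Lam.incl p ⋙ cyclicObject k A)).homologyπ n).hom w) := by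
  have hp : p.Prime := Fact.out
  have h := isShortExact_coker (tensorPowerHom_injective hp hF)
  obtain ⟨c₀⟩ := exists_comparison k p
  choose φ h1 h2 using h.exists_laurentIso (perD_exact_coker hp hF hA) c₀
  refine ⟨⟨c₀⟩, tensorPowerHom hF.equivariant, tensorPowerHom_tprod hF.equivariant, φ, h1, fun c n z => ?_⟩
  obtain ⟨w, hw, hw'⟩ := h2 n z
  exact ⟨w, hw, hw'.trans (LinearMap.congr_fun (c₀.onHomology_eq c) _)⟩
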